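/- Work over $\mathbb C$. A rational integral curve $C\subset\mathbb P^3$ (an integral closed curve of geometric genus $0$) is called canonically embedded if $C$ is Gorenstein, its canonical sheaf $\omega_C$ satisfies $\omega_C\cong\mathcal O_{\mathbb P^3}(1)|_C$, and the inclusion $C\hookrightarrow\mathbb P^3$ is the canonical map, i.e. the map given by a basis of $H^0(C,\omega_C)$; in particular $C$ has arithmetic genus $4$. For a finite set $Y\subset\mathbb P^3$ and a quadric surface $X\subset\mathbb P^3$ containing $Y$, let $R_{Y,X}$ be the space (with the Zariski topology induced from the Hilbert scheme of $\mathbb P^3$) of all canonically embedded rational integral curves of arithmetic genus $4$ in $\mathbb P^3$ that contain $Y$ and are contained in $X$. **Proposition.** Let $H$ be a plane in $\mathbb P^3$, and let $Y=\{y_1,\dots,y_6\}$ be a set of six distinct points of $H$ that is general among those contained in a conic in $H$; that is, $(y_1,\dots,y_6)$ lies in a suitable dense Zariski-open subset, depending only on $H$, of the space of all sextuples of distinct points of $H$ lying on a conic in $H$. Then for every smooth quadric surface $X\subset\mathbb P^3$ containing $Y$, the space $R_{Y,X}$ has dimension $5$, and it has exactly one irreducible component of dimension $5$. -/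

import Mathlib

open MvPolynomial
open scoped Topology

noncomputable section

/-- The homogeneous coordinate ring `ℂ[x₀, x₁, x₂, x₃]` of `ℙ³`. -/
abbrev CoordRing : Type := MvPolynomial (Fin 4) ℂ

/-- The (closed) points of `ℙ³` over `ℂ`. -/
abbrev P3 : Type := Projectivization ℂ (Fin 4 → ℂ)

/-- The form `f` vanishes at the point `p`; for homogeneous `f` (and for the conjunction of these
conditions over a homogeneous ideal) the chosen representative of `p` is irrelevant. -/
def VanishesAt (f : CoordRing) (p : P3) : Prop := eval p.rep f = 0

/-! ### Zariski topologies -/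

/-- The Zariski topology on (the points of) a finite-dimensional complex vector space: the sets
`{x | P(φ₁ x, …, φₘ x) ≠ 0}`, for linear functionals `φᵢ` and a polynomial `P`, form a basis. -/
@[reducible] def zariskiTopology (V : Type*) [AddCommGroup V] [Module ℂ V] : TopologicalSpace V :=
  TopologicalSpace.generateFrom
    {U | ∃ P : MvPolynomial (Module.Dual ℂ V) ℂ, U = {x : V | eval (fun φ => φ x) P ≠ 0}}

/-- The Zariski topology on the set `(ℙ³)ⁿ` of `n`-tuples of points, as the quotient of the
Zariski-open set of `n`-tuples of nonzero vectors of `ℂ⁴`. -/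
@[reducible] def zariskiTuples (n : ℕ) : TopologicalSpace (Fin n → P3) :=
  TopologicalSpace.coinduced
    (fun (v : {v : Fin n → Fin 4 → ℂ // ∀ i, v i ≠ 0}) (i : Fin n) =>
      Projectivization.mk ℂ (v.1 i) (v.2 i))
    (TopologicalSpace.induced Subtype.val (zariskiTopology (Fin n → Fin 4 → ℂ)))

/-- The Zariski topology on the set of all subspaces of a finite-dimensional complex vector space
`V`, i.e. on the disjoint union of the Grassmannians `Gr(r, V)`: a set of subspaces is open if and
only if, for every `r`, the set of linearly independent `r`-tuples (`r`-frames) whose span belongs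
to it is Zariski open in the space of all `r`-frames in `V`. -/
@[reducible] def grassmannTopology (V : Type*) [AddCommGroup V] [Module ℂ V] :
    TopologicalSpace (Submodule ℂ V) :=
  ⨆ r : ℕ, TopologicalSpace.coinduced
    (fun v : {v : Fin r → V // LinearIndependent ℂ v} => Submodule.span ℂ (Set.range v.1))
    (TopologicalSpace.induced Subtype.val (zariskiTopology (Fin r → V)))

/-! ### Integral curves in `ℙ³` -/

/-- An integral (closed) curve in `ℙ³`, given by its homogeneous prime ideal. The homogeneous
coordinate ring of a curve has Krull dimension `2`. -/
structure IntegralCurve where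
  ideal : Ideal CoordRing
  isPrime : ideal.IsPrime
  isHomogeneous : ∀ f ∈ ideal, ∀ d : ℕ, homogeneousComponent d f ∈ ideal
  dim_eq : ringKrullDim (CoordRing ⧸ ideal) = 2

namespace IntegralCurve

instance (C : IntegralCurve) : C.ideal.IsPrime := C.isPrime

/-- The homogeneous coordinate ring `A` of the curve. -/
abbrev Ring (C : IntegralCurve) : Type := CoordRing ⧸ C.ideal

/-- The image in `A` of a polynomial in the homogeneous coordinates. -/
abbrev toRing (C : IntegralCurve) : CoordRing →+* C.Ring := Ideal.Quotient.mk C.ideal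

/-- The point `p` lies on the curve. -/
def Contains (C : IntegralCurve) (p : P3) : Prop := ∀ f ∈ C.ideal, VanishesAt f p

/-- The space `I_d` of forms of degree `d` vanishing on the curve, inside the space of all forms
of degree `d`. -/
def forms (C : IntegralCurve) (d : ℕ) : Submodule ℂ (homogeneousSubmodule (Fin 4) ℂ d) :=
  (C.ideal.restrictScalars ℂ).comap (homogeneousSubmodule (Fin 4) ℂ d).subtype

/-- The topology on spaces of curves: the coarsest one for which all the maps
`C ↦ I_d ∈ Gr(·, ℂ[x₀, …, x₃]_d)` are continuous, that is, the subspace topology from the product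
of these Grassmannians. On a set of curves with one and the same Hilbert function (all the
canonically embedded curves of genus `4` have the same one) this is the topology induced by the
Zariski topology of the Hilbert scheme of `ℙ³`. -/
instance : TopologicalSpace IntegralCurve :=
  ⨅ d : ℕ, TopologicalSpace.induced (fun C => C.forms d)
    (grassmannTopology (homogeneousSubmodule (Fin 4) ℂ d))

/-- The function field of the curve, generated over `ℂ` by the ratios `xᵢ / xⱼ` of the homogeneous
coordinates (a ratio with `xⱼ = 0` on the curve is read as `0`). -/
def functionField (C : IntegralCurve) : IntermediateField ℂ (FractionRing C.Ring) :=
  IntermediateField.adjoin ℂ {z | ∃ i j : Fin 4,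
    z = algebraMap C.Ring (FractionRing C.Ring) (C.toRing (X i)) /
      algebraMap C.Ring (FractionRing C.Ring) (C.toRing (X j))}

/-- A rational integral curve: its geometric genus is `0`, that is, it is birational to `ℙ¹`, that
is, its function field is isomorphic to `ℂ(t)`. -/
def IsRational (C : IntegralCurve) : Prop :=
  Nonempty (C.functionField ≃ₐ[ℂ] RatFunc ℂ)

/-- `u, v` are linear forms without a common zero on the curve, so that they define a finite
morphism `π = [u : v] : C → ℙ¹`. -/
structure IsProjection (C : IntegralCurve) (u v : CoordRing) : Prop where
  left : u.IsHomogeneous 1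
  right : v.IsHomogeneous 1
  no_zero : ∀ p : P3, C.Contains p → ¬ (VanishesAt u p ∧ VanishesAt v p)

/-- Global sections of twists of the canonical (dualizing) sheaf `ω_C`.

The canonical sheaf of a projective curve `C` with a finite morphism `π : C → ℙ¹` is
`ω_C = π^! ω_{ℙ¹}`, the coherent `O_C`-module with `π_* ω_C = Hom(π_* O_C, ω_{ℙ¹})`, where
`ω_{ℙ¹} = O(-2)`. Let `π = [u : v]`, let `R = ℂ[s, t]` be the homogeneous coordinate ring of `ℙ¹`
and let `A` be that of `C`, an `R`-algebra by `s ↦ u`, `t ↦ v`. Then `H⁰(C, ω_C(n))` is the space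
of graded `R`-linear maps `A → R(n - 2)`, i.e. of those `R`-linear `φ : A → R` that map `A_m` into
`R_{m+n-2}` for all `m` (into `0` if `m + n - 2 < 0`). Multiplication by `a ∈ A_k`, from
`H⁰(C, ω_C(n))` to `H⁰(C, ω_C(n+k))`, is `φ ↦ φ(a · -)`. -/
def dualizingSections (C : IntegralCurve) (u v : CoordRing) (n : ℤ) :
    Submodule ℂ (C.Ring →ₗ[ℂ] MvPolynomial (Fin 2) ℂ) where
  carrier := {φ |
    (∀ (r : MvPolynomial (Fin 2) ℂ) (a : C.Ring),
      φ (C.toRing (aeval ![u, v] r) * a) = r * φ a) ∧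
    (∀ (m : ℕ) (f : CoordRing), f.IsHomogeneous m →
      ∀ e ∈ (φ (C.toRing f)).support, (e.degree : ℤ) = m + n - 2)}
  zero_mem' := by
    constructor <;> intros <;> simp_all
  add_mem' := by
    rintro φ ψ ⟨h1, h2⟩ ⟨h3, h4⟩
    refine ⟨fun r a => ?_, fun m f hf e he => ?_⟩
    · simp only [LinearMap.add_apply, h1, h3, mul_add]
    · classical
      rcases Finset.mem_union.1 (MvPolynomial.support_add he) with h | h
      · exact h2 m f hf e h
      · exact h4 m f hf e h
  smul_mem' := by
    rintro c φ ⟨h1, h2⟩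
    refine ⟨fun r a => ?_, fun m f hf e he => ?_⟩
    · simp only [LinearMap.smul_apply, h1, mul_smul_comm]
    · exact h2 m f hf e (MvPolynomial.support_smul he)

/-- The curve is canonically embedded in `ℙ³`: its canonical sheaf `ω_C` is invertible (`C` is
Gorenstein), it is isomorphic to `O(1)|_C`, and the inclusion `C ⊆ ℙ³` is the canonical map.
Explicitly, there is a basis `s₀, …, s₃` of `H⁰(C, ω_C)` with `[s₀ : s₁ : s₂ : s₃] =
[x₀ : x₁ : x₂ : x₃]` on `C`, i.e. `xⱼ sₖ = xₖ sⱼ` in `H⁰(C, ω_C(1))`, such that `sⱼ` generates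
`ω_C` over the affine open set `xⱼ ≠ 0`: every section `φ / xⱼⁿ` of `ω_C` there, where
`φ ∈ H⁰(C, ω_C(n))`, is a multiple `(a / xⱼᴺ⁺ⁿ) sⱼ`. In particular `C` has arithmetic genus
`dim H¹(C, O_C) = dim H⁰(C, ω_C) = 4`. (The sheaf `ω_C` does not depend on the projection used to
describe it, and projections exist.) -/
def IsCanonicallyEmbedded (C : IntegralCurve) : Prop :=
  ∃ u v : CoordRing, C.IsProjection u v ∧
    ∃ s : Module.Basis (Fin 4) ℂ (C.dualizingSections u v 0),
      (∀ (j k : Fin 4) (a : C.Ring),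
        (s k).1 (C.toRing (X j) * a) = (s j).1 (C.toRing (X k) * a)) ∧
      (∀ (j : Fin 4) (n : ℤ), ∀ φ ∈ C.dualizingSections u v n,
        ∃ (N : ℕ) (b : C.Ring), ∀ a : C.Ring,
          φ (C.toRing (X j) ^ N * a) = (s j).1 (b * a))

end IntegralCurve

/-! ### The data of the theorem -/

/-- `q` is the equation of a smooth quadric surface in `ℙ³`. -/
structure IsSmoothQuadric (q : CoordRing) : Prop where
  isHomogeneous : q.IsHomogeneous 2
  smooth : ∀ p : P3, VanishesAt q p → ∃ i : Fin 4, ¬ VanishesAt (pderiv i q) p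

/-- The space of (ordered) sextuples of distinct points of the plane `H` (a `3`-dimensional
subspace of `ℂ⁴`) that lie on a conic of `H`, i.e. at which some quadratic form that is not
identically zero on `H` vanishes. -/
def sextuplesOnConic (H : Submodule ℂ (Fin 4 → ℂ)) : Set (Fin 6 → P3) :=
  {y | Function.Injective y ∧ (∀ i, (y i).submodule ≤ H) ∧
    ∃ g : CoordRing, g.IsHomogeneous 2 ∧ (∃ w ∈ H, eval w g ≠ 0) ∧ ∀ i, VanishesAt g (y i)}

/-- The space `R_{Y,X}` of rational integral curves of genus `4`, canonically embedded in `ℙ³`,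
that contain the points `Y = {y₁, …, y₆}` and lie on the quadric `X = {q = 0}`. -/
def curvesThrough (y : Fin 6 → P3) (q : CoordRing) : Set IntegralCurve :=
  {C | C.IsCanonicallyEmbedded ∧ C.IsRational ∧ (∀ i, C.Contains (y i)) ∧ q ∈ C.ideal}

end

open MvPolynomial
open scoped Topology

noncomputable section

open Function (Injective)
open Finset (sum_congr mul_sum univ mem_univ sum_add_distrib)
open IntermediateField (adjoin subset_adjoin adjoin_le_iff)
open LinearMap (range proj)
open Finsupp (single)
open Module (finrank Dual)
open Lagrange (nodal)
open Ideal (span subset_span)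
open AlgEquiv (apply_symm_apply)
open scoped Polynomial
open Polynomial (derivative coeff_eq_zero_of_natDegree_lt coeff_mul_add_eq_of_natDegree_le)

local notation "𝓡" => MvPolynomial (Fin 2) ℂ
local notation "𝓢" => homogeneousSubmodule (Fin 4) ℂ
local notation "𝐂" => Polynomial.C
local notation "𝐗" => Polynomial.X

/-! The general position used is that no three of the six points are collinear. For such Y the space
of curves is irreducible of dimension 5, hence it is its own only component.

Normal form. Six points of H, no three on a line, force the conic H ∩ X to be smooth. In suitable
coordinates X is the Segre quadric with points (p, q) of ℙ¹ × ℙ¹, the conic is the diagonal, and Y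
consists of (∞, ∞) and five points (ηᵢ, ηᵢ) (`IsGeneral.exists_coordinates`). Such sextuples are
dense: a conic with three collinear points among the six is contained in a pair of lines, and the
points can be moved to smooth conics xy = s²z² (`sextuplesOnConic_subset_closure`).

From curves to pairs of functions. The dualizing module of a canonical curve has one generator φ. A
Koszul complex over ℂ[s, t] together with duality gives h⁰(ω²) ≤ 9 and h⁰(ω³) ≤ 15, so any sixteen
cubic forms are dependent on the curve (`IsCanonicalGenerator.exists_cubic`). In particular the
functions pⁱqʲ with i, j ≤ 3 are dependent; since ℂ(p, q) = ℂ(t), both p and q have degree at most 3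
in t. The parameter can be chosen so that t = ∞ lies over (∞, ∞), and some tᵢ lies over (ηᵢ, ηᵢ).
Write p = P₁/P₀ and q = Q₁/Q₀. Lagrange interpolation at the tᵢ replaces these polynomials by
residues rᵢ, sᵢ (`exists_isNodalPair`), and the bounds on the degrees say that r and s are
orthogonal to 1, η and t. Orthogonality to 1 and η makes r and s values of quadratic polynomials at
the ηᵢ, multiplied by the weights 1/Y'(ηᵢ), where Y = ∏ (y - ηᵢ). Orthogonality to r and s then
determines t, up to an affine change, as a multiple of the cross product of the two coefficient
vectors plus a multiple of η (`IsNodalPair.exists_param`). This is a polynomial parametrization by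
eight parameters `e`; rescaling r, s and t leaves the five of `CurveParam.slice`.

From pairs to curves. Conversely, data satisfying the open condition `CurveParam.disc` ≠ 0 define a
rational curve, cut out on X by a cubic, the Bézout resultant. After a change of coordinates on both
factors of ℙ¹ × ℙ¹ the coordinate ring is free over ℂ[X₁, X₂] on `cubicBasis`, and the coefficient
of X₀³ generates the dual module; this is ω = O(1)
(`IntegralCurve.isCanonicallyEmbedded_of_isNormalCubic`).

Dimension. The cubic equation, normalized modulo the quadric, induces the topology of the space of
curves (`exists_coordinates`). So the space is, up to density, the image of a rational family in
five parameters: it is irreducible, and a comparison of transcendence degrees bounds its dimension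
by 5. For the lower bound the parameters are released one at a time. The slopes of the curve at the
points (ηᵢ, ηᵢ) are functions of the normalized cubic. When the parameter u₀ tends to 0, both p and
q degenerate to t, the slopes acquire a common denominator tending to 0, and their numerators
become, up to constants, the values at ηᵢ of the monic polynomial with roots u₁, …, u₄. Such values
satisfy no homogeneous relation, so each new parameter provides one more algebraically independent
slope (`CurveParam.krullDim_segreCurves`). -/

/-! ### Polynomials all of whose monomials have a given integral degree -/

/-- All monomials of `p` have degree `k`; for negative `k` this means `p = 0`. -/
def HasDegree {σ : Type*} (p : MvPolynomial σ ℂ) (k : ℤ) : Prop :=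
  ∀ e ∈ p.support, (e.degree : ℤ) = k

namespace HasDegree

variable {σ : Type*} {p q : MvPolynomial σ ℂ} {k : ℤ}

lemma zero : HasDegree (0 : MvPolynomial σ ℂ) k := by intro e he; simp at he

lemma iff_coeff : HasDegree p k ↔ ∀ e, coeff e p ≠ 0 → (e.degree : ℤ) = k := by
  simp [HasDegree, mem_support_iff]

lemma add (hp : HasDegree p k) (hq : HasDegree q k) : HasDegree (p + q) k := by
  rw [iff_coeff] at *
  intro e he
  by_cases h : coeff e p = 0
  · exact hq e (by simpa [coeff_add, h] using he)
  · exact hp e h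

lemma smul (c : ℂ) (hp : HasDegree p k) : HasDegree (c • p) k := by
  rw [iff_coeff] at *
  intro e he
  exact hp e (by rw [coeff_smul] at he; exact fun h => he (by simp [h]))

lemma X_mul (i : σ) (hp : HasDegree p k) : HasDegree (X i * p) (k + 1) := by
  classical
  intro e he
  rw [support_X_mul] at he
  obtain ⟨d, hd, rfl⟩ := Finset.mem_map.1 he
  have := hp d hd
  simp [addLeftEmbedding] at *
  omega

lemma of_X_mul (i : σ) (hp : HasDegree (X i * p) (k + 1)) : HasDegree p k := by
  classical
  intro e he
  have := hp (single i 1 + e) (by rw [support_X_mul]; exact Finset.mem_map.2 ⟨e, he, rfl⟩)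
  simp at this
  omega

lemma eq_zero_of_neg (hp : HasDegree p k) (hk : k < 0) : p = 0 := by
  rw [iff_coeff] at hp
  ext e
  by_contra h
  have := hp e (by simpa using h)
  omega

lemma eq_C (hp : HasDegree p 0) : p = C (coeff 0 p) := by
  classical
  rw [iff_coeff] at hp
  ext e
  rw [coeff_C]
  split_ifs with h
  · rw [h]
  · by_contra h'
    have := hp e h'
    have h3 : e.degree = 0 := by omega
    exact h (((Finsupp.degree_eq_zero_iff e).1 h3).symm)

lemma of_isHomogeneous {n : ℕ} (hp : p.IsHomogeneous n) : HasDegree p n := by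
  rw [iff_coeff]
  intro e he
  have := hp he
  have h2 := DFunLike.congr_fun (Finsupp.degree_eq_weight_one (R := ℕ) (σ := σ)) e
  rw [Pi.one_def] at this
  rw [h2]
  exact_mod_cast this

lemma isHomogeneous {n : ℕ} (hp : HasDegree p n) : p.IsHomogeneous n := by
  rw [iff_coeff] at hp
  intro e he
  have := hp e he
  have h2 := DFunLike.congr_fun (Finsupp.degree_eq_weight_one (R := ℕ) (σ := σ)) e
  rw [Pi.one_def, ← h2]
  exact_mod_cast this

end HasDegree

lemma aeval_mul_of_isHomogeneous {σ K : Type*} [CommRing K] [Algebra ℂ K] {f : MvPolynomial σ ℂ}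
    {d : ℕ} (hf : f.IsHomogeneous d) (c : K) (x : σ → K) :
    aeval (fun i => c * x i) f = c ^ d * aeval x f := by
  rw [aeval_def, aeval_def, eval₂_eq, eval₂_eq, mul_sum]
  refine sum_congr rfl fun e he => ?_
  have : d = ∑ i ∈ e.support, e i := by
    rw [← Finsupp.degree_apply, Finsupp.degree_eq_weight_one]
    exact (hf (mem_support_iff.1 he)).symm
  simp_rw [mul_pow, Finset.prod_mul_distrib, Finset.prod_pow_eq_pow_sum, ← this]
  ring

lemma monomial_coeff (f : CoordRing) (e : Fin 4 →₀ ℕ) :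
    monomial e (coeff e f) = coeff e f • (monomial e 1 : CoordRing) := by
  rw [smul_monomial, smul_eq_mul, mul_one]

lemma eval_smul_of_isHomogeneous {σ : Type*} {f : MvPolynomial σ ℂ}
    {d : ℕ} (hf : f.IsHomogeneous d) (c : ℂ) (x : σ → ℂ) :
    eval (c • x) f = c ^ d * eval x f := by
  exact aeval_mul_of_isHomogeneous hf c x

/-- A linear map all of whose values are divisible by a nonzero `p` can be divided by `p`. -/
lemma exists_smul_eq_of_dvd {V σ : Type*} [AddCommGroup V] [Module ℂ V] (p : MvPolynomial σ ℂ)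
    (hp : p ≠ 0) (f : V →ₗ[ℂ] MvPolynomial σ ℂ) (h : ∀ v, p ∣ f v) :
    ∃ g : V →ₗ[ℂ] MvPolynomial σ ℂ, f = p • g := by
  choose g hg using h
  refine ⟨⟨⟨g, fun x y => ?_⟩, fun c x => ?_⟩, ?_⟩
  · apply mul_left_cancel₀ hp
    rw [mul_add, ← hg, ← hg, ← hg, map_add]
  · apply mul_left_cancel₀ hp
    simp only [RingHom.id_apply]
    rw [mul_smul_comm, ← hg, ← hg, map_smul]
  · ext1 v
    simp [hg v]

/-! ### Finiteness of the coordinate ring over a projection to the line -/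

namespace IntegralCurve

variable (C : IntegralCurve)

/-- The image of `ℂ[s, t]` in the homogeneous coordinate ring under `s ↦ u`, `t ↦ v`. -/
abbrev proj (u v : CoordRing) : 𝓡 →+* C.Ring :=
  C.toRing.comp (aeval ![u, v] : 𝓡 →ₐ[ℂ] CoordRing).toRingHom

lemma toRing_surjective : Function.Surjective C.toRing := Ideal.Quotient.mk_surjective

lemma toRing_eq_zero {f : CoordRing} : C.toRing f = 0 ↔ f ∈ C.ideal :=
  Ideal.Quotient.eq_zero_iff_mem

/-- Independence of the representative: the homogeneous components of an element of the ideal lie in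
the ideal, and each of them scales by a power. -/
lemma contains_mk {w : Fin 4 → ℂ} (hw : w ≠ 0) :
    C.Contains (Projectivization.mk ℂ w hw) ↔ ∀ f ∈ C.ideal, eval w f = 0 := by
  obtain ⟨a, ha⟩ := Projectivization.exists_smul_eq_mk_rep ℂ w hw
  have key : ∀ (c : ℂ) (x : Fin 4 → ℂ), (∀ f ∈ C.ideal, eval x f = 0) →
      ∀ f ∈ C.ideal, eval (c • x) f = 0 := by
    intro c x h f hf
    rw [← sum_homogeneousComponent f, map_sum]
    refine Finset.sum_eq_zero fun d _ => ?_
    have h1 := h _ (C.isHomogeneous f hf d)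
    rw [eval_smul_of_isHomogeneous (homogeneousComponent_isHomogeneous d f), h1, mul_zero]
  unfold Contains VanishesAt
  rw [← ha]
  constructor
  · intro h
    have := key (a⁻¹ : ℂˣ) _ h
    simpa [Units.smul_def, smul_smul] using this
  · intro h
    exact key a _ h

lemma IsProjection.eq_zero_of_eval {C : IntegralCurve} {u v : CoordRing} (h : C.IsProjection u v)
    {w : Fin 4 → ℂ} (hI : ∀ f ∈ C.ideal, eval w f = 0) (hu : eval w u = 0) (hv : eval w v = 0) :
    w = 0 := by
  by_contra hw
  obtain ⟨a, ha⟩ := Projectivization.exists_smul_eq_mk_rep ℂ w hw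
  refine h.no_zero (Projectivization.mk ℂ w hw) ((C.contains_mk hw).2 hI) ⟨?_, ?_⟩
  · rw [VanishesAt, ← ha, Units.smul_def, eval_smul_of_isHomogeneous h.left, hu, mul_zero]
  · rw [VanishesAt, ← ha, Units.smul_def, eval_smul_of_isHomogeneous h.right, hv, mul_zero]

/-- A power of every coordinate is a combination of `u` and `v` modulo the ideal of the curve. -/
lemma IsProjection.exists_pow {C : IntegralCurve} {u v : CoordRing} (h : C.IsProjection u v) :
    ∃ N : ℕ, ∀ i : Fin 4, ∃ a b : CoordRing, a.IsHomogeneous N ∧ b.IsHomogeneous N ∧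
      C.toRing (X i) ^ (N + 1) = C.toRing u * C.toRing a + C.toRing v * C.toRing b := by
  -- Nullstellensatz: the cone over the curve meets u = v = 0 only in the origin.
  have h1 : ∀ i : Fin 4, (X i : CoordRing) ∈ (C.ideal ⊔ span {u, v}).radical := by
    intro i
    rw [← vanishingIdeal_zeroLocus_eq_radical (K := ℂ) (k := ℂ), mem_vanishingIdeal_iff]
    intro w hw
    rw [mem_zeroLocus_iff] at hw
    have : w = 0 := by
      refine h.eq_zero_of_eval (fun f hf => ?_) ?_ ?_
      · simpa using hw f (Ideal.mem_sup_left hf)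
      · simpa using hw u (Ideal.mem_sup_right (subset_span (by simp)))
      · simpa using hw v (Ideal.mem_sup_right (subset_span (by simp)))
    simp [this]
  choose n hn using h1
  refine ⟨∑ i, n i, fun i => ?_⟩
  set N := ∑ i, n i with hN
  have h2 : (X i : CoordRing) ^ (N + 1) ∈ C.ideal ⊔ span {u, v} :=
    Ideal.pow_mem_of_pow_mem _ (hn i)
      ((Finset.single_le_sum (f := n) (fun _ _ => Nat.zero_le _) (mem_univ i)).trans
        (Nat.le_succ _))
  obtain ⟨f, hf, g, hg, hfg⟩ := Submodule.mem_sup.1 h2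
  obtain ⟨a, b, hab⟩ := Ideal.mem_span_pair.1 hg
  -- Taking components of degree N + 1 makes the coefficients of u and v homogeneous of degree N.
  have hcomp : ∀ w : CoordRing, w.IsHomogeneous 1 → ∀ a : CoordRing,
      homogeneousComponent (N + 1) (a * w) = homogeneousComponent N a * w := by
    intro w hw a
    conv_lhs => rw [← sum_homogeneousComponent a, Finset.sum_mul, map_sum]
    have : ∀ d, homogeneousComponent (N + 1) (homogeneousComponent d a * w) =
        if d = N then homogeneousComponent N a * w else 0 := by
      intro d
      rw [homogeneousComponent_of_mem (show _ ∈ 𝓢 (d + 1) from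
          (homogeneousComponent_isHomogeneous d a).mul hw)]
      by_cases hd : d = N
      · simp [hd]
      · simp [hd, Ne.symm hd]
    simp_rw [this]
    rw [Finset.sum_ite_eq' (Finset.range (a.totalDegree + 1)) N]
    split_ifs with hNa
    · rfl
    · rw [homogeneousComponent_eq_zero N a (by simpa using hNa), zero_mul]
  refine ⟨homogeneousComponent N a, homogeneousComponent N b,
    homogeneousComponent_isHomogeneous _ _, homogeneousComponent_isHomogeneous _ _, ?_⟩
  rw [← map_pow, ← map_mul, ← map_mul, ← map_add, ← sub_eq_zero, ← map_sub, toRing_eq_zero]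
  have h3 := congrArg (homogeneousComponent (N + 1)) hfg
  rw [← hab, map_add, map_add, hcomp u h.left, hcomp v h.right,
    homogeneousComponent_eq_self (isHomogeneous_X_pow i (N + 1))] at h3
  rw [← h3]
  ring_nf
  exact C.isHomogeneous f hf _

set_option maxHeartbeats 1000000 in
/-- The homogeneous coordinate ring is integral over `ℂ[u, v]`. -/
lemma IsProjection.isIntegral {C : IntegralCurve} {u v : CoordRing} (h : C.IsProjection u v) :
    (C.proj u v).IsIntegral := by
  obtain ⟨N, hN⟩ := h.exists_pow
  let _ : Algebra 𝓡 C.Ring := (C.proj u v).toAlgebra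
  have hX0 : ∀ a : C.Ring, (X 0 : 𝓡) • a = C.toRing u * a := by
    intro a
    rw [Algebra.smul_def, RingHom.algebraMap_toAlgebra]
    simp
  have hX1 : ∀ a : C.Ring, (X 1 : 𝓡) • a = C.toRing v * a := by
    intro a
    rw [Algebra.smul_def, RingHom.algebraMap_toAlgebra]
    simp
  have hC : ∀ (c : ℂ) (f : CoordRing), (MvPolynomial.C c : 𝓡) • C.toRing f = C.toRing (c • f) := by
    intro c f
    rw [Algebra.smul_def, RingHom.algebraMap_toAlgebra, smul_eq_C_mul]
    simp only [RingHom.comp_apply, map_mul]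
    congr 2
    exact (aeval ![u, v]).commutes c
  set G : Set C.Ring := (fun e : Fin 4 →₀ ℕ => C.toRing (monomial e 1)) ''
    {e | e.degree ≤ 4 * N} with hG
  have hfin : G.Finite := by
    refine Set.Finite.image _ ?_
    refine Set.Finite.subset (s := {e : Fin 4 →₀ ℕ | ∀ i, e i ≤ 4 * N}) ?_ ?_
    · have : {e : Fin 4 →₀ ℕ | ∀ i, e i ≤ 4 * N} =
          Set.Iic (Finsupp.equivFunOnFinite.symm fun _ => 4 * N) := by
        ext e; simp [Finsupp.le_def]
      rw [this]
      exact Set.finite_Iic _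
    · intro e he i
      exact (Finsupp.le_degree i e).trans he
  have hsum : ∀ f : CoordRing, (∀ e ∈ f.support, C.toRing (monomial e 1) ∈ Submodule.span 𝓡 G) →
      C.toRing f ∈ Submodule.span 𝓡 G := by
    intro f hf
    rw [f.as_sum, map_sum]
    refine Submodule.sum_mem _ fun e he => ?_
    rw [monomial_coeff, ← hC]
    exact Submodule.smul_mem _ _ (hf e he)
  -- A monomial of degree above 4N contains some X i ^ (N + 1). Replacing this power by u a + v b
  -- leaves monomials of degree one less, with coefficients from ℂ[s, t].
  have key : ∀ d : ℕ, ∀ e : Fin 4 →₀ ℕ, e.degree = d →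
      C.toRing (monomial e 1) ∈ Submodule.span 𝓡 G := by
    intro d
    induction d using Nat.strong_induction_on with
    | _ d ih =>
      intro e he
      by_cases hd : d ≤ 4 * N
      · exact Submodule.subset_span ⟨e, by simpa [he] using hd, rfl⟩
      obtain ⟨i, hi⟩ : ∃ i, N + 1 ≤ e i := by
        by_contra! hcon
        have h1 : e.degree = ∑ i : Fin 4, e i := by rw [Finsupp.degree_eq_sum]
        have h2 : ∑ i : Fin 4, e i ≤ ∑ _i : Fin 4, N :=
          Finset.sum_le_sum fun i _ => Nat.lt_succ_iff.1 (hcon i)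
        simp at h2
        omega
      obtain ⟨e', rfl⟩ : ∃ e', e = single i (N + 1) + e' :=
        ⟨e - single i (N + 1), (add_tsub_cancel_of_le (Finsupp.single_le_iff.2 hi)).symm⟩
      obtain ⟨a, b, ha, hb, hab⟩ := hN i
      have hdeg : e'.degree + (N + 1) = d := by rw [← he]; simp [add_comm]
      have hm : C.toRing (monomial (single i (N + 1) + e') 1) =
          (X 0 : 𝓡) • C.toRing (a * monomial e' 1) +
          (X 1 : 𝓡) • C.toRing (b * monomial e' 1) := by
        rw [monomial_single_add, map_mul, map_pow, hab, hX0, hX1, map_mul, map_mul]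
        ring
      have hrec : ∀ a : CoordRing, a.IsHomogeneous N → C.toRing (a * monomial e' 1) ∈
          Submodule.span 𝓡 G := by
        intro a ha
        refine hsum _ fun e₁ he₁ => ih (d - 1) (by omega) e₁ ?_
        have := HasDegree.of_isHomogeneous (ha.mul (isHomogeneous_monomial (1 : ℂ) (rfl : e'.degree = _)))
          e₁ he₁
        omega
      rw [hm]
      exact Submodule.add_mem _ (Submodule.smul_mem _ _ (hrec a ha))
        (Submodule.smul_mem _ _ (hrec b hb))
  have hfg : Module.Finite 𝓡 C.Ring := by
    refine ⟨⟨hfin.toFinset, ?_⟩⟩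
    rw [Set.Finite.coe_toFinset, eq_top_iff]
    rintro a -
    obtain ⟨f, rfl⟩ := C.toRing_surjective a
    exact hsum f fun e _ => key _ e rfl
  exact fun a => Algebra.IsIntegral.isIntegral (R := 𝓡) a

end IntegralCurve

lemma exists_eq_sum_X {f : CoordRing} (hf : f.IsHomogeneous 1) :
    ∃ c : Fin 4 → ℂ, f = ∑ k, c k • X k := by
  have : f ∈ 𝓢 1 := hf
  rw [homogeneousSubmodule_one_eq_span_X] at this
  obtain ⟨c, hc⟩ := (Submodule.mem_span_range_iff_exists_fun ℂ).1 this
  exact ⟨c, hc.symm⟩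

lemma isHomogeneous_sum_X (c : Fin 4 → ℂ) : (∑ k, c k • X k : CoordRing).IsHomogeneous 1 :=
  IsHomogeneous.sum _ _ _ fun k _ => by rw [smul_eq_C_mul]; exact isHomogeneous_C_mul_X (c k) k

/-- If `X₀ p = - X₁ q` in `ℂ[X₀, X₁]` then `X₁` divides `p`. -/
lemma X_one_dvd_of_add_eq_zero {p q : 𝓡} (h : X 0 * p + X 1 * q = 0) : X 1 ∣ p := by
  have h1 : (X 1 : 𝓡) ∣ X 0 * p := ⟨-q, by linear_combination h⟩
  rcases (X_prime (R := ℂ) (i := (1 : Fin 2))).dvd_or_dvd h1 with h2 | h2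
  · simp [X_dvd_X] at h2
  · exact h2

/-! ### Graded linear forms on a quotient of the coordinate ring -/

section Sections

variable {A : Type} [CommRing A] [Algebra ℂ A]

/-- `φ` is `ℂ[s, t]`-linear, where `s` and `t` act as `u` and `v` on the source. -/
def IsProjLinear (π : CoordRing →ₐ[ℂ] A) (u v : CoordRing) (φ : A →ₗ[ℂ] 𝓡) : Prop :=
  ∀ (r : 𝓡) (a : A), φ (π (aeval ![u, v] r) * a) = r * φ a

/-- `φ` is `ℂ[s, t]`-linear and homogeneous of degree `n - 2`. -/
structure IsSection (π : CoordRing →ₐ[ℂ] A) (u v : CoordRing) (n : ℤ)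
    (φ : A →ₗ[ℂ] 𝓡) : Prop where
  linear : IsProjLinear π u v φ
  hasDegree : ∀ (m : ℕ) (f : CoordRing), f.IsHomogeneous m → HasDegree (φ (π f)) (m + n - 2)

/-- The product of a linear form on the ring and an element of the ring. -/
def ringSmul (a : A) (φ : A →ₗ[ℂ] 𝓡) : A →ₗ[ℂ] 𝓡 :=
  φ ∘ₗ LinearMap.mulLeft ℂ a

@[simp] lemma ringSmul_apply (a b : A) (φ : A →ₗ[ℂ] 𝓡) : ringSmul a φ b = φ (a * b) := rfl

lemma ringSmul_add (a b : A) (φ : A →ₗ[ℂ] 𝓡) :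
    ringSmul (a + b) φ = ringSmul a φ + ringSmul b φ := by
  ext1 x; simp [add_mul]

lemma ringSmul_smul (c : ℂ) (a : A) (φ : A →ₗ[ℂ] 𝓡) : ringSmul (c • a) φ = c • ringSmul a φ := by
  ext1 x; simp

lemma ringSmul_mul (a b : A) (φ : A →ₗ[ℂ] 𝓡) : ringSmul (a * b) φ = ringSmul a (ringSmul b φ) := by
  ext1 x; simp only [ringSmul_apply]; congr 1; ring

lemma ringSmul_sum {ι : Type*} (t : Finset ι) (a : ι → A) (φ : A →ₗ[ℂ] 𝓡) :
    ringSmul (∑ i ∈ t, a i) φ = ∑ i ∈ t, ringSmul (a i) φ := by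
  ext1 x; simp [Finset.sum_mul]

variable {π : CoordRing →ₐ[ℂ] A} {u v : CoordRing} {n : ℤ} {φ ψ : A →ₗ[ℂ] 𝓡}

lemma IsSection.add (hφ : IsSection π u v n φ) (hψ : IsSection π u v n ψ) :
    IsSection π u v n (φ + ψ) where
  linear r a := by simp only [LinearMap.add_apply, hφ.linear r a, hψ.linear r a]; ring
  hasDegree m f hf := (hφ.hasDegree m f hf).add (hψ.hasDegree m f hf)

lemma IsSection.smul (c : ℂ) (hφ : IsSection π u v n φ) : IsSection π u v n (c • φ) where
  linear r a := by simp only [LinearMap.smul_apply, hφ.linear r a, mul_smul_comm]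
  hasDegree m f hf := (hφ.hasDegree m f hf).smul c

variable (π u v n) in
/-- The space of graded linear forms of degree `n - 2`. -/
def sections : Submodule ℂ (A →ₗ[ℂ] 𝓡) where
  carrier := {φ | IsSection π u v n φ}
  zero_mem' := ⟨fun r a => by simp, fun m f _ => HasDegree.zero⟩
  add_mem' := IsSection.add
  smul_mem' := fun c _ => IsSection.smul c

lemma mem_sections : φ ∈ sections π u v n ↔ IsSection π u v n φ := Iff.rfl

lemma IsProjLinear.apply_vecCons (hφ : IsProjLinear π u v φ) (i : Fin 2) (a : A) :
    φ (π (![u, v] i) * a) = X i * φ a := by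
  have := hφ (X i) a
  rwa [aeval_X] at this

lemma IsProjLinear.ringSmul_vecCons (hφ : IsProjLinear π u v φ) (i : Fin 2) :
    ringSmul (π (![u, v] i)) φ = (X i : 𝓡) • φ :=
  LinearMap.ext fun a => hφ.apply_vecCons i a

lemma IsProjLinear.X_pow_smul (hφ : IsProjLinear π u v φ) (i : Fin 2) (N : ℕ) :
    ringSmul (π (![u, v] i) ^ N) φ = (X i ^ N : 𝓡) • φ := by
  ext1 a
  have := hφ (X i ^ N) a
  rw [map_pow, map_pow, aeval_X] at this
  exact this

lemma IsSection.X_smul (i : Fin 2) (hφ : IsSection π u v n φ) :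
    IsSection π u v (n + 1) ((X i : 𝓡) • φ) where
  linear r a := by
    simp only [LinearMap.smul_apply, smul_eq_mul, hφ.linear r a]
    ring
  hasDegree m f hf := by
    have := (hφ.hasDegree m f hf).X_mul i
    rw [LinearMap.smul_apply, smul_eq_mul]
    convert this using 1
    ring

lemma IsSection.of_X_smul (i : Fin 2)
    (hφ : IsSection π u v (n + 1) ((X i : 𝓡) • φ)) : IsSection π u v n φ where
  linear r a := by
    have := hφ.linear r a
    simp only [LinearMap.smul_apply, smul_eq_mul] at this
    apply mul_left_cancel₀ (X_ne_zero i : (X i : 𝓡) ≠ 0)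
    rw [this]; ring
  hasDegree m f hf := by
    have := hφ.hasDegree m f hf
    rw [LinearMap.smul_apply, smul_eq_mul] at this
    refine HasDegree.of_X_mul i ?_
    convert this using 1
    ring

lemma IsSection.X_pow_smul (i : Fin 2) (N : ℕ) (hφ : IsSection π u v n φ) :
    IsSection π u v (n + N) ((X i ^ N : 𝓡) • φ) := by
  induction N with
  | zero => simpa using hφ
  | succ N ih =>
    have := ih.X_smul i
    rw [smul_smul, ← pow_succ'] at this
    convert this using 1
    push_cast; ring

lemma IsProjLinear.ringSmul (hφ : IsProjLinear π u v φ) (a : A) :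
    IsProjLinear π u v (ringSmul a φ) := by
  intro r b
  rw [ringSmul_apply, ringSmul_apply, ← hφ]
  congr 1; ring

lemma IsSection.ringSmul (hφ : IsSection π u v n φ) {d : ℕ} {f : CoordRing}
    (hf : f.IsHomogeneous d) : IsSection π u v (n + d) (ringSmul (π f) φ) where
  linear := hφ.linear.ringSmul _
  hasDegree m g hg := by
    have := hφ.hasDegree _ _ (hf.mul hg)
    rw [ringSmul_apply, ← map_mul]
    convert this using 1
    push_cast; ring

/-- A homogeneous generator of the dualizing module, from a canonical basis of sections. -/
lemma exists_generator (hπ : Function.Surjective π) (hu : u.IsHomogeneous 1)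
    (s : Fin 4 → A →ₗ[ℂ] 𝓡) (hs : ∀ k, IsSection π u v 0 (s k))
    (h1 : ∀ (j k : Fin 4) (a : A), s k (π (X j) * a) = s j (π (X k) * a)) :
    ∃ φ, IsSection π u v (-1) φ ∧ ∀ k, ringSmul (π (X k)) φ = s k := by
  obtain ⟨c, hc⟩ := exists_eq_sum_X hu
  -- With u = ∑ cₖ Xₖ the generator has to satisfy u φ = ∑ cₖ sₖ, and u acts on the values as X 0.
  -- So φ is the sum `su` divided by X 0.
  set su : A →ₗ[ℂ] 𝓡 := ∑ k, c k • s k with hsu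
  have hmem : IsSection π u v 0 su := mem_sections.1 <|
    Submodule.sum_mem _ fun k _ => Submodule.smul_mem _ _ (hs k)
  have key : ∀ k a, su (π (X k) * a) = X 0 * s k a := by
    intro k a
    have h2 := (hs k).linear.apply_vecCons 0 a
    rw [← h2, hsu]
    simp only [Matrix.cons_val_zero]
    rw [hc, map_sum, Finset.sum_mul, map_sum, LinearMap.sum_apply]
    refine sum_congr rfl fun j _ => ?_
    rw [LinearMap.smul_apply, map_smul, smul_mul_assoc, map_smul, h1]
  -- Multiples of a coordinate are covered by `key`; on constants `su` vanishes, its value having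
  -- degree -2.
  have hdvd : ∀ a, (X 0 : 𝓡) ∣ su a := by
    intro a
    obtain ⟨f, rfl⟩ := hπ a
    induction f using MvPolynomial.induction_on with
    | C c =>
      have := hmem.hasDegree 0 (MvPolynomial.C c) (isHomogeneous_C _ _)
      rw [HasDegree.eq_zero_of_neg this (by norm_num)]
      exact dvd_zero _
    | add p q hp hq => rw [map_add, map_add]; exact dvd_add hp hq
    | mul_X p k _ =>
      rw [mul_comm, map_mul, key]
      exact dvd_mul_right _ _
  obtain ⟨φ, hφ⟩ := exists_smul_eq_of_dvd (X 0) (X_ne_zero 0) su hdvd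
  refine ⟨φ, IsSection.of_X_smul 0 (by simpa [← hφ] using hmem), fun k => ?_⟩
  ext1 a
  apply mul_left_cancel₀ (X_ne_zero 0 : (X 0 : 𝓡) ≠ 0)
  rw [← key, hφ]; rfl

/-- `φ` generates the dualizing module like a canonical basis of sections does. -/
structure IsCanonicalGenerator (π : CoordRing →ₐ[ℂ] A) (u v : CoordRing)
    (φ : A →ₗ[ℂ] 𝓡) : Prop where
  surj : Function.Surjective π
  left : u.IsHomogeneous 1
  right : v.IsHomogeneous 1
  isHomogeneous : ∀ f, π f = 0 → ∀ d : ℕ, π (homogeneousComponent d f) = 0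
  torsion : ∀ ψ, IsProjLinear π u v ψ → ∀ a, a ≠ 0 → ringSmul a ψ = 0 → ψ = 0
  mem : IsSection π u v (-1) φ
  exists_linear : ∀ ψ, IsSection π u v 0 ψ → ∃ c : Fin 4 → ℂ, ψ = ringSmul (π (∑ k, c k • X k)) φ
  independent : ∀ c : Fin 4 → ℂ, ringSmul (π (∑ k, c k • X k)) φ = 0 → c = 0
  exists_pow : ∀ (j : Fin 4) (n : ℤ) ψ, IsSection π u v n ψ → ∃ (N : ℕ) (b : A),
    ringSmul (π (X j) ^ N) ψ = ringSmul b φ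

namespace IsCanonicalGenerator

variable {φ : A →ₗ[ℂ] 𝓡} (h : IsCanonicalGenerator π u v φ)
include h

lemma ne_zero : φ ≠ 0 := by
  rintro rfl
  have := congrFun (h.independent 1 (by ext1 x; simp)) 0
  simp at this

lemma linear_ne_zero {c : Fin 4 → ℂ} (hc : c ≠ 0) : π (∑ k, c k • X k) ≠ 0 := by
  intro h0
  exact hc (h.independent c (by rw [h0]; ext1 x; simp))

/-- The sections of degree `-3` are the multiples of the generator. -/
lemma exists_smul {ψ : A →ₗ[ℂ] 𝓡} (hψ : IsSection π u v (-1) ψ) : ∃ c : ℂ, ψ = c • φ := by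
  have h1 : ∀ j : Fin 4, ∃ c : Fin 4 → ℂ,
      ringSmul (π (X j)) ψ = ringSmul (π (∑ k, c k • X k)) φ := fun j =>
    h.exists_linear _ (by simpa using hψ.ringSmul (isHomogeneous_X ℂ j))
  choose T hT using h1
  -- Multiplication by coordinates compares ψ with φ through the matrix T. If x is an eigenvector
  -- with eigenvalue c, the linear form with coefficients x annihilates ψ - c φ, and
  -- torsion-freeness applies.
  let E : Module.End ℂ (Fin 4 → ℂ) := (Matrix.of T).vecMulLinear
  obtain ⟨c, hc⟩ := Module.End.exists_eigenvalue E
  obtain ⟨x, hx⟩ := hc.exists_hasEigenvector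
  refine ⟨c, ?_⟩
  rw [← sub_eq_zero]
  refine h.torsion _ (mem_sections.1 (Submodule.sub_mem (sections π u v (-1)) hψ
    (Submodule.smul_mem _ c h.mem))).linear (π (∑ k, x k • X k)) (h.linear_ne_zero hx.2) ?_
  have h2 : ringSmul (π (∑ k, x k • X k)) ψ = ringSmul (π (∑ k, (E x) k • X k)) φ := by
    simp only [map_sum, map_smul, ringSmul_sum, ringSmul_smul, hT]
    simp only [E, Matrix.vecMulLinear_apply, Matrix.vecMul, dotProduct, Matrix.of_apply,
      Finset.sum_smul, Finset.smul_sum, smul_smul]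
    rw [Finset.sum_comm]
  have h3 : ringSmul (π (∑ k, x k • X k)) (ψ - c • φ) =
      ringSmul (π (∑ k, x k • X k)) ψ - c • ringSmul (π (∑ k, x k • X k)) φ := by
    ext1 a; simp
  rw [h3, h2, hx.apply_eq_smul]
  simp only [Pi.smul_apply, map_sum, map_smul, ringSmul_sum, ringSmul_smul, Finset.smul_sum,
    smul_smul, smul_eq_mul, sub_self]

/-- After multiplication with a power of `u`, each section becomes a homogeneous multiple of the
generator. -/
lemma exists_X_pow_smul {n : ℤ} (hn : -1 ≤ n) {ψ : A →ₗ[ℂ] 𝓡}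
    (hψ : IsSection π u v n ψ) : ∃ (N d : ℕ) (f : CoordRing), (d : ℤ) = n + N + 1 ∧
      f.IsHomogeneous d ∧ (X 0 ^ N : 𝓡) • ψ = ringSmul (π f) φ := by
  obtain ⟨c, hc⟩ := exists_eq_sum_X h.left
  -- The elements carrying ψ into the multiples of φ form an ideal. It contains a power of every
  -- coordinate, hence a power of u.
  let I : Ideal A :=
    { carrier := {a | ∃ b, ringSmul a ψ = ringSmul b φ}
      zero_mem' := ⟨0, by ext1 x; simp⟩
      add_mem' := by
        rintro a a' ⟨b, hb⟩ ⟨b', hb'⟩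
        exact ⟨b + b', by rw [ringSmul_add, ringSmul_add, hb, hb']⟩
      smul_mem' := by
        rintro a a' ⟨b, hb⟩
        exact ⟨a * b, by rw [smul_eq_mul, ringSmul_mul, ringSmul_mul, hb]⟩ }
  have hu : π u ∈ I.radical := by
    rw [hc, map_sum]
    refine Ideal.sum_mem _ fun k _ => ?_
    obtain ⟨N, b, hb⟩ := h.exists_pow k n ψ hψ
    rw [map_smul, Algebra.smul_def]
    exact Ideal.mul_mem_left _ _ ⟨N, b, hb⟩
  obtain ⟨N, b, hb⟩ := hu
  obtain ⟨g, rfl⟩ := h.surj b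
  obtain ⟨d, hd⟩ : ∃ d : ℕ, (d : ℤ) = n + N + 1 :=
    ⟨(n + N + 1).toNat, Int.toNat_of_nonneg (by omega)⟩
  have h1 : (X 0 ^ N : 𝓡) • ψ = ringSmul (π g) φ := by rw [← hb, ← hψ.linear.X_pow_smul 0 N]; rfl
  refine ⟨N, d, homogeneousComponent d g, hd, homogeneousComponent_isHomogeneous _ _, ?_⟩
  -- Comparison of degrees: on a form of degree m, only the component of g of degree d contributes
  -- to the degree of the left-hand side.
  ext1 a
  obtain ⟨f, rfl⟩ := h.surj a
  rw [← sum_homogeneousComponent f, map_sum, map_sum, map_sum]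
  refine sum_congr rfl fun m _ => ?_
  set fm := homogeneousComponent m f
  have hfm : fm.IsHomogeneous m := homogeneousComponent_isHomogeneous _ _
  have h2 := (hψ.X_pow_smul 0 N).hasDegree m fm hfm
  have h3 : ((X 0 ^ N : 𝓡) • ψ) (π fm) =
      ∑ e ∈ Finset.range (g.totalDegree + 1), φ (π (homogeneousComponent e g) * π fm) := by
    rw [h1, ringSmul_apply]
    conv_lhs => rw [← sum_homogeneousComponent g]
    rw [map_sum, Finset.sum_mul, map_sum]
  have h4 : ∀ e : ℕ, HasDegree (φ (π (homogeneousComponent e g) * π fm)) (e + m - 3) := by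
    intro e
    have := h.mem.hasDegree _ _ ((homogeneousComponent_isHomogeneous e g).mul hfm)
    rw [map_mul] at this
    convert this using 1
    push_cast; ring
  rw [ringSmul_apply]
  ext x
  by_cases hx : (x.degree : ℤ) = d + m - 3
  · rw [h3, coeff_sum, Finset.sum_eq_single d]
    · intro e _ hed
      by_contra hne
      have := HasDegree.iff_coeff.1 (h4 e) x hne
      omega
    · intro hd'
      rw [homogeneousComponent_eq_zero d g (by simpa using hd')]
      simp
  · have h5 : coeff x (φ (π (homogeneousComponent d g) * π fm)) = 0 := by
      by_contra hne
      exact hx (HasDegree.iff_coeff.1 (h4 d) x hne)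
    rw [h5]
    by_contra hne
    have := HasDegree.iff_coeff.1 h2 x hne
    omega

end IsCanonicalGenerator
end Sections

/-! ### Duality for graded linear forms, and the cubics through a canonical curve -/

section Duality

variable {A : Type} [CommRing A] [Algebra ℂ A] {π : CoordRing →ₐ[ℂ] A} {u v : CoordRing} {n : ℤ}

/-- The multiples by `X₀` and `X₁` of the sections of degree `n`. -/
def multiples (π : CoordRing →ₐ[ℂ] A) (u v : CoordRing) (n : ℤ) :
    (sections π u v n × sections π u v n) →ₗ[ℂ] (A →ₗ[ℂ] 𝓡) :=
  LinearMap.coprod ((LinearMap.lsmul 𝓡 (A →ₗ[ℂ] 𝓡)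
      (X 0)).restrictScalars ℂ ∘ₗ (sections π u v n).subtype)
    ((LinearMap.lsmul 𝓡 (A →ₗ[ℂ] 𝓡) (X 1)).restrictScalars ℂ ∘ₗ (sections π u v n).subtype)

lemma multiples_apply (x : sections π u v n × sections π u v n) :
    multiples π u v n x = (X 0 : 𝓡) • x.1.1 + (X 1 : 𝓡) • x.2.1 := rfl

/-- Exactness of the Koszul complex: X 0 and X 1 are coprime, so the first entry of a syzygy is
divisible by X 1, and dividing preserves linearity and grading. -/
lemma exists_of_multiples_eq_zero {n : ℤ} {x : sections π u v (n + 1) × sections π u v (n + 1)}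
    (hx : multiples π u v (n + 1) x = 0) : ∃ ψ, IsSection π u v n ψ ∧
      x.1.1 = (X 1 : 𝓡) • ψ ∧ x.2.1 = -((X 0 : 𝓡) • ψ) := by
  rw [multiples_apply] at hx
  obtain ⟨ψ, hψ⟩ := exists_smul_eq_of_dvd (X 1) (X_ne_zero 1) x.1.1 (fun a =>
    X_one_dvd_of_add_eq_zero (q := x.2.1 a) (by simpa using LinearMap.congr_fun hx a))
  refine ⟨ψ, IsSection.of_X_smul 1 (by rw [← hψ]; exact x.1.2), hψ, ?_⟩
  ext1 a
  have := LinearMap.congr_fun hx a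
  rw [hψ] at this
  simp only [LinearMap.add_apply, LinearMap.smul_apply, smul_eq_mul, LinearMap.zero_apply] at this
  apply mul_left_cancel₀ (X_ne_zero 1 : (X 1 : 𝓡) ≠ 0)
  simp only [LinearMap.neg_apply, LinearMap.smul_apply, smul_eq_mul]
  linear_combination this

/-- A map defined on the image of T is extended by a projection onto this image. The second
conclusion keeps the values among those of S, so that degree conditions are inherited. -/
lemma exists_extension {V W X : Type*} [AddCommGroup V] [Module ℂ V] [AddCommGroup W] [Module ℂ W]
    [AddCommGroup X] [Module ℂ X] (T : X →ₗ[ℂ] V) (S : X →ₗ[ℂ] W) (h : ∀ x, T x = 0 → S x = 0) :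
    ∃ g : V →ₗ[ℂ] W, (∀ x, g (T x) = S x) ∧ ∀ v, ∃ x, g v = S x := by
  obtain ⟨pr, hpr⟩ := LinearMap.exists_leftInverse_of_injective
    (Submodule.subtype (range T)) (Submodule.ker_subtype (range T))
  obtain ⟨σ, hσ⟩ := LinearMap.exists_rightInverse_of_surjective T.rangeRestrict
    (LinearMap.range_rangeRestrict T)
  refine ⟨S ∘ₗ σ ∘ₗ pr, fun x => ?_, fun v => ⟨σ (pr v), rfl⟩⟩
  have h1 : pr (T x) = T.rangeRestrict x := LinearMap.congr_fun hpr (T.rangeRestrict x)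
  have h2 : T.rangeRestrict (σ (T.rangeRestrict x)) = T.rangeRestrict x :=
    LinearMap.congr_fun hσ _
  rw [LinearMap.comp_apply, LinearMap.comp_apply, h1, ← sub_eq_zero, ← map_sub]
  refine h _ ?_
  rw [map_sub, sub_eq_zero]
  exact congrArg Subtype.val h2

/-- One degree of an inductive construction. Linearity over ℂ[s, t] prescribes the value at X₀ψ₀ +
X₁ψ₁; it is well defined because all relations are Koszul relations, on which the compatibility of f
and g gives zero. -/
lemma exists_next_functional (n k : ℤ) (f g : (A →ₗ[ℂ] 𝓡) →ₗ[ℂ] 𝓡)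
    (hfg : ∀ ψ, IsSection π u v n ψ → ∀ i : Fin 2, g ((X i : 𝓡) • ψ) = X i * f ψ)
    (hg : ∀ ψ, HasDegree (g ψ) k) :
    ∃ h : (A →ₗ[ℂ] 𝓡) →ₗ[ℂ] 𝓡, (∀ ψ, IsSection π u v (n + 1) ψ → ∀ i : Fin 2,
        h ((X i : 𝓡) • ψ) = X i * g ψ) ∧ ∀ ψ, HasDegree (h ψ) (k + 1) := by
  let mulX (i : Fin 2) : 𝓡 →ₗ[ℂ] 𝓡 :=
    LinearMap.mulLeft ℂ (X i)
  let S : (sections π u v (n + 1) × sections π u v (n + 1)) →ₗ[ℂ] 𝓡 :=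
    LinearMap.coprod (mulX 0 ∘ₗ g ∘ₗ (sections π u v (n + 1)).subtype)
      (mulX 1 ∘ₗ g ∘ₗ (sections π u v (n + 1)).subtype)
  have hS : ∀ x, S x = X 0 * g x.1.1 + X 1 * g x.2.1 := fun x => rfl
  obtain ⟨h, h1, h2⟩ := exists_extension (V := A →ₗ[ℂ] 𝓡)
    (X := sections π u v (n + 1) × sections π u v (n + 1)) (multiples π u v (n + 1)) S (by
      intro x hx
      obtain ⟨ψ, hψ, h1, h2⟩ := exists_of_multiples_eq_zero hx
      have h3 : -((X 0 : 𝓡) • ψ) = (-1 : ℂ) • ((X 0 : 𝓡) • ψ) := by ext1 a; simp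
      rw [hS, h1, h2, h3, hfg ψ hψ, g.map_smul, hfg ψ hψ, neg_one_smul]
      ring)
  refine ⟨h, fun ψ hψ i => ?_, fun ψ => ?_⟩
  · fin_cases i
    · have := h1 (⟨ψ, hψ⟩, 0)
      rw [hS (⟨ψ, hψ⟩, 0), multiples_apply] at this
      simpa using this
    · have := h1 (0, ⟨ψ, hψ⟩)
      rw [hS (0, ⟨ψ, hψ⟩), multiples_apply] at this
      simpa using this
  · obtain ⟨x, hx⟩ := h2 ψ
    rw [hx, hS]
    exact ((hg x.1.1).X_mul 0).add ((hg x.2.1).X_mul 1)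

/-- A functional separating m from X₀ψ₀ + X₁ψ₁ is propagated to all higher degrees. The index n
refers to sections of twist k - 1 + n: `Λ 0` is zero just below the twist of m, and `Λ 1` is the
separating functional. -/
lemma exists_functional (k : ℤ) {m : A →ₗ[ℂ] 𝓡} (hm : ∀ x, multiples π u v (k - 1) x ≠ m) :
    ∃ Λ : ℕ → (A →ₗ[ℂ] 𝓡) →ₗ[ℂ] 𝓡, Λ 0 = 0 ∧ Λ 1 m = 1 ∧ (∀ n ψ, HasDegree (Λ n ψ) (n - 1)) ∧
      ∀ (n : ℕ) ψ, IsSection π u v (k - 1 + n) ψ → ∀ i : Fin 2,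
        Λ (n + 1) ((X i : 𝓡) • ψ) = X i * Λ n ψ := by
  have hm' : m ∉ range (multiples π u v (k - 1)) := by rintro ⟨x, hx⟩; exact hm x hx
  obtain ⟨ℓ, hℓ1, hℓ2⟩ := Submodule.exists_le_ker_of_notMem hm'
  -- Two consecutive functionals are carried along, since the next one is well defined only by their
  -- compatibility.
  let St (n : ℕ) : Type := {p : ((A →ₗ[ℂ] 𝓡) →ₗ[ℂ] 𝓡) ×
    ((A →ₗ[ℂ] 𝓡) →ₗ[ℂ] 𝓡) // (∀ ψ, IsSection π u v (k - 1 + n) ψ → ∀ i : Fin 2,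
        p.2 ((X i : 𝓡) • ψ) = X i * p.1 ψ) ∧
      (∀ ψ, HasDegree (p.1 ψ) (n - 1)) ∧ ∀ ψ, HasDegree (p.2 ψ) n}
  let base : St 0 := ⟨(0, (Algebra.linearMap ℂ 𝓡) ∘ₗ ((ℓ m)⁻¹ • ℓ)), by
    refine ⟨fun ψ hψ i => ?_, fun ψ => HasDegree.zero, fun ψ => ?_⟩
    · have : ℓ ((X i : 𝓡) • ψ) = 0 := by
        refine LinearMap.mem_ker.1 (hℓ2 ?_)
        simp only [CharP.cast_eq_zero, add_zero] at hψ
        fin_cases i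
        · exact ⟨(⟨ψ, hψ⟩, 0), by simp [multiples_apply]⟩
        · exact ⟨(0, ⟨ψ, hψ⟩), by simp [multiples_apply]⟩
      simp [this]
    · exact HasDegree.of_isHomogeneous (isHomogeneous_C _ _)⟩
  let step (n : ℕ) (p : St n) : St (n + 1) :=
    ⟨(p.1.2, (exists_next_functional _ _ p.1.1 p.1.2 p.2.1 p.2.2.2).choose), by
      have := (exists_next_functional _ _ p.1.1 p.1.2 p.2.1 p.2.2.2).choose_spec
      refine ⟨fun ψ hψ => this.1 ψ (by push_cast at hψ; rwa [add_assoc]), fun ψ => ?_, fun ψ => ?_⟩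
      · simpa using p.2.2.2 ψ
      · simpa using this.2 ψ⟩
  let seq (n : ℕ) : St n := Nat.rec base step n
  refine ⟨fun n => (seq n).1.1, rfl, ?_, fun n => (seq n).2.2.1, fun n => (seq n).2.1⟩
  change (Algebra.linearMap ℂ 𝓡) ((ℓ m)⁻¹ • ℓ m) = 1
  rw [smul_eq_mul, inv_mul_cancel₀ hℓ1]
  simp

namespace IsCanonicalGenerator

variable {φ : A →ₗ[ℂ] 𝓡} (h : IsCanonicalGenerator π u v φ)
include h

/-- A substitute for Serre duality: a section m that is not generated from lower twist yields, by
evaluating the functionals at f φ, a linear form on the ring itself. This is a section of twist 1 -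
k that does not annihilate the elements f representing m. -/
lemma exists_dual (k : ℕ) {m : A →ₗ[ℂ] 𝓡} (hmk : IsSection π u v k m)
    (hm : ∀ x, multiples π u v ((k : ℤ) - 1) x ≠ m) :
    ∃ ψ, IsSection π u v (1 - k) ψ ∧ ∀ (N d : ℕ) (f : CoordRing), d = k + N + 1 →
      f.IsHomogeneous d → (X 0 ^ N : 𝓡) • m = ringSmul (π f) φ →
      ψ (π f) = X 0 ^ N := by
  obtain ⟨Λ, hΛ0, hΛ1, hdeg, hmul⟩ := exists_functional (k : ℤ) hm
  -- Truncated subtraction is intended: forms of degree below k get index 0, where the functional is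
  -- zero.
  let g : CoordRing →ₗ[ℂ] 𝓡 := (basisMonomials (Fin 4) ℂ).constr ℂ
    (fun e => Λ (e.degree - k) (ringSmul (π (monomial e 1)) φ))
  have hg : ∀ (d : ℕ) (f : CoordRing), f.IsHomogeneous d → g f = Λ (d - k) (ringSmul (π f) φ) := by
    intro d f hf
    conv_lhs => rw [f.as_sum]
    conv_rhs => rw [f.as_sum]
    rw [map_sum, map_sum, ringSmul_sum, map_sum]
    refine sum_congr rfl fun e he => ?_
    have hde : e.degree = d := by exact_mod_cast HasDegree.of_isHomogeneous hf e he
    rw [monomial_coeff, map_smul, map_smul, ringSmul_smul, map_smul]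
    congr 1
    have := (basisMonomials (Fin 4) ℂ).constr_basis ℂ
      (fun e => Λ (e.degree - k) (ringSmul (π (monomial e 1)) φ)) e
    rw [coe_basisMonomials] at this
    rw [this, hde]
  have hker : ∀ f, π f = 0 → g f = 0 := by
    intro f hf
    rw [← sum_homogeneousComponent f, map_sum]
    refine Finset.sum_eq_zero fun d _ => ?_
    rw [hg d _ (homogeneousComponent_isHomogeneous _ _), h.isHomogeneous f hf d]
    have : ringSmul (0 : A) φ = 0 := by ext1 x; simp
    rw [this, map_zero]
  obtain ⟨σ, hσ⟩ := LinearMap.exists_rightInverse_of_surjective π.toLinearMap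
    (LinearMap.range_eq_top.2 h.surj)
  have hσ' : ∀ a, π (σ a) = a := fun a => LinearMap.congr_fun hσ a
  let ψ : A →ₗ[ℂ] 𝓡 := g ∘ₗ σ
  have hψ : ∀ f, ψ (π f) = g f := by
    intro f
    change g (σ (π f)) = g f
    rw [← sub_eq_zero, ← map_sub]
    exact hker _ (by rw [map_sub, hσ', sub_self])
  have hsec : ∀ (d : ℕ) (f : CoordRing), f.IsHomogeneous d →
      IsSection π u v (d - 1) (ringSmul (π f) φ) := by
    intro d f hf
    have := h.mem.ringSmul hf
    rwa [neg_add_eq_sub] at this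
  have hvec : ∀ i : Fin 2, (![u, v] i).IsHomogeneous 1 := by
    intro i; fin_cases i
    · exact h.left
    · exact h.right
  have hX : ∀ (i : Fin 2) (f : CoordRing), g (![u, v] i * f) = X i * g f := by
    intro i f
    conv_lhs => rw [← sum_homogeneousComponent f]
    conv_rhs => rw [← sum_homogeneousComponent f]
    rw [mul_sum, map_sum, map_sum, mul_sum]
    refine sum_congr rfl fun d _ => ?_
    have hf := homogeneousComponent_isHomogeneous d f
    set fd := homogeneousComponent d f
    rw [hg _ _ ((hvec i).mul hf), hg _ _ hf, map_mul, ringSmul_mul,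
      (hsec d fd hf).linear.ringSmul_vecCons]
    by_cases hdk : k ≤ d
    · rw [show 1 + d - k = (d - k) + 1 by omega]
      refine hmul (d - k) _ ?_ i
      convert hsec d fd hf using 1
      omega
    · rw [show 1 + d - k = 0 by omega, show d - k = 0 by omega, hΛ0]
      simp
  refine ⟨ψ, ⟨fun r a => ?_, fun d f hf => ?_⟩, fun N d f hd hf hfm => ?_⟩
  · obtain ⟨f, rfl⟩ := h.surj a
    rw [← map_mul, hψ, hψ]
    induction r using MvPolynomial.induction_on generalizing f with
    | C c => rw [algHom_C, ← smul_eq_C_mul, ← Algebra.smul_def, map_smul]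
    | add p q hp hq => rw [map_add, add_mul, map_add, hp, hq, add_mul]
    | mul_X p i hp =>
      have h1 : aeval ![u, v] (p * X i) = aeval ![u, v] p * ![u, v] i := by rw [map_mul, aeval_X]
      rw [h1, mul_assoc, hp, hX, mul_assoc]
  · rw [hψ, hg d f hf]
    by_cases hdk : k ≤ d
    · convert hdeg (d - k) (ringSmul (π f) φ) using 1
      push_cast [hdk]
      ring
    · rw [show d - k = 0 by omega, hΛ0]
      exact HasDegree.zero
  · rw [hψ, hg d f hf, ← hfm, hd, show k + N + 1 - k = N + 1 by omega]
    clear hfm hd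
    have hmm : ∀ N : ℕ, Λ (N + 1) ((X 0 ^ N : 𝓡) • m) = X 0 ^ N := by
      intro N
      induction N with
      | zero => simpa using hΛ1
      | succ N ih =>
        rw [pow_succ', ← smul_smul, hmul (N + 1) _ (by
          have := hmk.X_pow_smul 0 N
          convert this using 1
          push_cast; ring) 0, ih]
    exact hmm N

/-- Otherwise the dual section has twist 0, so it is ℓ φ with ℓ linear. Its value at f is then X₀ᴺ
m(ℓ) = 0 instead of X₀ᴺ. -/
lemma exists_multiples_one {m : A →ₗ[ℂ] 𝓡} (hm : IsSection π u v 1 m)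
    (h0 : ∀ k, m (π (X k)) = 0) : ∃ x, multiples π u v 0 x = m := by
  by_contra! hcon
  obtain ⟨ψ, hψ, hψ2⟩ := h.exists_dual 1 (m := m) (by exact_mod_cast hm) (by simpa using hcon)
  obtain ⟨N, d, f, hd, hf, hfm⟩ := h.exists_X_pow_smul (by norm_num) hm
  have h1 := hψ2 N d f (by omega) hf hfm
  obtain ⟨c, hc⟩ := h.exists_linear ψ (by simpa using hψ)
  rw [hc, ringSmul_apply, mul_comm, ← ringSmul_apply, ← hfm, LinearMap.smul_apply] at h1
  simp only [map_sum, map_smul, h0, smul_zero, Finset.sum_const_zero] at h1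
  exact pow_ne_zero N (X_ne_zero 0) h1.symm

/-- Otherwise the dual section has twist -1, so it is c φ. Its value at f is then c X₀ᴺ m(1) = 0
instead of X₀ᴺ. -/
lemma exists_multiples_two {m : A →ₗ[ℂ] 𝓡} (hm : IsSection π u v 2 m)
    (h0 : m 1 = 0) : ∃ x, multiples π u v 1 x = m := by
  by_contra! hcon
  obtain ⟨ψ, hψ, hψ2⟩ := h.exists_dual 2 (m := m) (by exact_mod_cast hm) (by simpa using hcon)
  obtain ⟨N, d, f, hd, hf, hfm⟩ := h.exists_X_pow_smul (by norm_num) hm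
  have h1 := hψ2 N d f (by omega) hf hfm
  obtain ⟨c, hc⟩ := h.exists_smul (ψ := ψ) (by simpa using hψ)
  rw [hc, LinearMap.smul_apply, ← mul_one (π f), ← ringSmul_apply, ← hfm,
    LinearMap.smul_apply] at h1
  simp only [h0, smul_zero] at h1
  exact pow_ne_zero N (X_ne_zero 0) h1.symm

end IsCanonicalGenerator

/-- The space of graded linear forms of degree `n - 2`, as a type. -/
def Sec (π : CoordRing →ₐ[ℂ] A) (u v : CoordRing) (n : ℤ) : Type := sections π u v n

namespace Sec

instance : AddCommGroup (Sec π u v n) := inferInstanceAs (AddCommGroup (sections π u v n))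

instance : Module ℂ (Sec π u v n) := inferInstanceAs (Module ℂ (sections π u v n))

/-- The underlying linear form. -/
def val (ψ : Sec π u v n) : A →ₗ[ℂ] 𝓡 := Subtype.val ψ

lemma isSection (ψ : Sec π u v n) : IsSection π u v n ψ.val := Subtype.prop ψ

/-- A section from a linear form. -/
def mk (ψ : A →ₗ[ℂ] 𝓡) (h : IsSection π u v n ψ) : Sec π u v n :=
  (⟨ψ, h⟩ : sections π u v n)

lemma ext {ψ ψ' : Sec π u v n} (h : ψ.val = ψ'.val) : ψ = ψ' := Subtype.ext h

@[simp] lemma val_add (ψ ψ' : Sec π u v n) : (ψ + ψ').val = ψ.val + ψ'.val := rfl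

@[simp] lemma val_smul (c : ℂ) (ψ : Sec π u v n) : (c • ψ).val = c • ψ.val := rfl

lemma val_sum {ι : Type*} (t : Finset ι) (f : ι → Sec π u v n) :
    (∑ i ∈ t, f i).val = ∑ i ∈ t, (f i).val :=
  map_sum ({ toFun := val, map_zero' := rfl, map_add' := fun _ _ => rfl } : Sec π u v n →+ _) f t

end Sec

/-- Multiplication of sections by `X₀` or `X₁`. -/
def sectionsMulX (π : CoordRing →ₐ[ℂ] A) (u v : CoordRing) (i : Fin 2) {n m : ℤ} (hnm : n + 1 = m) :
    Sec π u v n →ₗ[ℂ] Sec π u v m where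
  toFun ψ := Sec.mk ((X i : 𝓡) • ψ.val) (hnm ▸ IsSection.X_smul i ψ.isSection)
  map_add' _ _ := Sec.ext (smul_add _ _ _)
  map_smul' _ _ := Sec.ext (smul_comm _ _ _)

lemma sectionsMulX_comm {n m k : ℤ} (hnm : n + 1 = m) (hmk : m + 1 = k)
    (ψ : Sec π u v n) : sectionsMulX π u v 0 hmk (sectionsMulX π u v 1 hnm ψ) =
      sectionsMulX π u v 1 hmk (sectionsMulX π u v 0 hnm ψ) :=
  Sec.ext (smul_comm _ _ _)

lemma sectionsMulX_injective {n m : ℤ} (hnm : n + 1 = m) (i : Fin 2) :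
    Injective (sectionsMulX π u v i hnm) := by
  intro ψ ψ' hψ
  refine Sec.ext (LinearMap.ext fun a => ?_)
  exact mul_left_cancel₀ (X_ne_zero i) (LinearMap.congr_fun (congrArg Sec.val hψ) a)

/-- A dimension estimate from a Koszul complex `Y → X × X → Z → W`. -/
lemma finite_and_finrank_add_le {W X Y Z : Type*} [AddCommGroup W] [Module ℂ W] [AddCommGroup X]
    [Module ℂ X] [AddCommGroup Y] [Module ℂ Y] [AddCommGroup Z] [Module ℂ Z] [Module.Finite ℂ W]
    [Module.Finite ℂ X] (f : Z →ₗ[ℂ] W) (a₀ a₁ : X →ₗ[ℂ] Z) (b₀ b₁ : Y →ₗ[ℂ] X)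
    (hb : Injective b₁) (hab : ∀ y, a₀ (b₁ y) = a₁ (b₀ y))
    (hf : ∀ z, f z = 0 → ∃ x y, a₀ x + a₁ y = z) :
    Module.Finite ℂ Z ∧ finrank ℂ Z + finrank ℂ Y ≤ finrank ℂ (range f) + 2 * finrank ℂ X := by
  set g := LinearMap.coprod a₀ a₁
  have hle : LinearMap.ker f ≤ range g := by
    intro z hz
    obtain ⟨x, y, h⟩ := hf z hz
    exact ⟨(x, y), by simpa [g] using h⟩
  have hk : Module.Finite ℂ (LinearMap.ker f) :=
    Submodule.finiteDimensional_of_le (S₂ := range g) hle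
  have hZ : Module.Finite ℂ Z := by
    refine ⟨Submodule.fg_of_fg_map_of_fg_inf_ker f ?_ ?_⟩
    · exact IsNoetherian.noetherian _
    · rw [top_inf_eq]
      exact Module.Finite.iff_fg.1 hk
  refine ⟨hZ, ?_⟩
  have h1 := LinearMap.finrank_range_add_finrank_ker f
  have h2 := Submodule.finrank_mono hle
  have h3 := LinearMap.finrank_range_add_finrank_ker g
  rw [Module.finrank_prod] at h3
  -- The Koszul syzygies embed Y in the kernel of g, so the range of g has dimension at most 2 dim X
  -- - dim Y.
  let K : Y →ₗ[ℂ] LinearMap.ker g := (LinearMap.prod b₁ (-b₀)).codRestrict _ fun y => by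
    rw [LinearMap.mem_ker]
    simp [g, hab]
  have hK : Injective K := fun y y' h => hb (congrArg (fun x => x.1.1) h)
  have h4 := LinearMap.finrank_le_finrank_of_injective hK
  omega

/-- The dimension estimate for the sections of consecutive degrees. -/
lemma finrank_sections_add_le {n m k : ℤ} (hnm : n + 1 = m) (hmk : m + 1 = k) {W : Type*}
    [AddCommGroup W] [Module ℂ W] [Module.Finite ℂ W] [Module.Finite ℂ (Sec π u v m)]
    (f : Sec π u v k →ₗ[ℂ] W) (hf : ∀ z, f z = 0 → ∃ x, multiples π u v m x = z.val) :
    Module.Finite ℂ (Sec π u v k) ∧ finrank ℂ (Sec π u v k) + finrank ℂ (Sec π u v n) ≤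
      finrank ℂ (range f) + 2 * finrank ℂ (Sec π u v m) := by
  have h1 : ∀ z, f z = 0 → ∃ x y, sectionsMulX π u v 0 hmk x + sectionsMulX π u v 1 hmk y = z := by
    intro z hz
    obtain ⟨x, hx⟩ := hf z hz
    exact ⟨Sec.mk x.1.1 x.1.2, Sec.mk x.2.1 x.2.2, Sec.ext hx⟩
  exact finite_and_finrank_add_le (X := Sec π u v m) (Y := Sec π u v n)
    (Z := Sec π u v k) f (sectionsMulX π u v 0 hmk) (sectionsMulX π u v 1 hmk)
    (sectionsMulX π u v 0 hnm) (sectionsMulX π u v 1 hnm) (sectionsMulX_injective hnm 1)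
    (sectionsMulX_comm hnm hmk) h1

/-- The values of the sections of degree `-1` on the coordinates. -/
def valuesOne (π : CoordRing →ₐ[ℂ] A) (u v : CoordRing) : Sec π u v 1 →ₗ[ℂ] (Fin 4 → ℂ) where
  toFun m k := coeff 0 (m.val (π (X k)))
  map_add' m m' := funext fun k => by simp
  map_smul' c m := funext fun k => by simp

namespace IsCanonicalGenerator

variable {φ : A →ₗ[ℂ] 𝓡} (h : IsCanonicalGenerator π u v φ)
include h

lemma finrank_zero : Module.Finite ℂ (Sec π u v 0) ∧ finrank ℂ (Sec π u v 0) = 4 := by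
  let f : (Fin 4 → ℂ) →ₗ[ℂ] Sec π u v 0 :=
    { toFun := fun c => Sec.mk (ringSmul (π (∑ k, c k • X k)) φ) (by
        have := h.mem.ringSmul (isHomogeneous_sum_X c)
        norm_num at this
        simpa using this)
      map_add' := fun c c' => Sec.ext (by
        simp only [Pi.add_apply, add_smul, sum_add_distrib, map_add, ringSmul_add]
        rfl)
      map_smul' := fun a c => Sec.ext (by
        simp only [Pi.smul_apply, smul_eq_mul, ← smul_smul, ← Finset.smul_sum, map_smul,
          ringSmul_smul]
        rfl) }
  have hf : Function.Bijective f := by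
    constructor
    · rw [injective_iff_map_eq_zero]
      intro c hc
      exact h.independent c (congrArg Sec.val hc)
    · intro ψ
      obtain ⟨c, hc⟩ := h.exists_linear ψ.val ψ.isSection
      exact ⟨c, Sec.ext hc.symm⟩
  let e := LinearEquiv.ofBijective f hf
  exact ⟨Module.Finite.equiv e, by rw [← e.finrank_eq]; simp⟩

lemma finrank_neg_one : 1 ≤ finrank ℂ (Sec π u v (-1)) := by
  obtain ⟨hfin0, hrank0⟩ := h.finrank_zero
  have := Module.Finite.of_injective (M := Sec π u v (-1)) (N := Sec π u v 0)
    (sectionsMulX π u v 0 (by norm_num)) (sectionsMulX_injective _ _)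
  rw [Nat.one_le_iff_ne_zero, ← Nat.pos_iff_ne_zero, Module.finrank_pos_iff_exists_ne_zero]
  exact ⟨Sec.mk φ h.mem, fun h0 => h.ne_zero (congrArg Sec.val h0)⟩

/-- A relation between u and v would give a nonzero linear form of ℂ[s, t] annihilating φ, whose
values lie in a domain. -/
lemma linearIndependent_left_right {M : Fin 2 → Fin 4 → ℂ}
    (hM : ∀ i, ![u, v] i = ∑ k, M i k • X k) : LinearIndependent ℂ M := by
  rw [Fintype.linearIndependent_iff]
  intro a ha
  by_contra! hne
  have h1 : π (∑ i, a i • ![u, v] i) = 0 := by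
    have : (∑ i, a i • ![u, v] i) = ∑ k, (∑ i, a i • M i) k • X k := by
      simp only [hM, Finset.smul_sum, smul_smul, Finset.sum_apply, Pi.smul_apply, smul_eq_mul,
        Finset.sum_smul]
      rw [Finset.sum_comm]
    rw [this, ha]
    simp
  have h2 : ∀ b, (∑ i, a i • X i : 𝓡) * φ b = 0 := by
    intro b
    rw [← h.mem.linear, map_sum]
    simp only [map_smul, aeval_X]
    rw [h1, zero_mul, map_zero]
  have h3 : (∑ i, a i • X i : 𝓡) ≠ 0 := by
    intro h0
    obtain ⟨i, hi⟩ := hne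
    have := congrArg (coeff (single i 1)) h0
    simp only [Fin.sum_univ_two, coeff_add, coeff_smul, coeff_X, coeff_zero] at this
    fin_cases i <;> simp [Finsupp.single_left_inj] at this hi <;> exact hi this
  exact h.ne_zero (LinearMap.ext fun b => (mul_eq_zero.1 (h2 b)).resolve_left h3)

/-- A section of twist 1 vanishes on constants by degree, hence on u and v. The values at the
coordinates thus satisfy two independent linear equations. -/
lemma finrank_range_valuesOne : finrank ℂ (range (valuesOne π u v)) ≤ 2 := by
  obtain ⟨cu, hcu⟩ := exists_eq_sum_X h.left
  obtain ⟨cv, hcv⟩ := exists_eq_sum_X h.right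
  let M : Matrix (Fin 2) (Fin 4) ℂ := Matrix.of ![cu, cv]
  have hM : ∀ i, ![u, v] i = ∑ k, M i k • X k := by
    intro i; fin_cases i
    · exact hcu
    · exact hcv
  have hvan : ∀ (m : Sec π u v 1) (i : Fin 2), m.val (π (![u, v] i)) = 0 := by
    intro m i
    have h1 := m.isSection.linear.apply_vecCons i 1
    have h2 := m.isSection.hasDegree 0 1 (isHomogeneous_one _ _)
    rw [map_one] at h2
    rwa [mul_one, h2.eq_zero_of_neg (by norm_num), mul_zero] at h1
  have hrange : range (valuesOne π u v) ≤ LinearMap.ker M.mulVecLin := by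
    rintro _ ⟨m, rfl⟩
    rw [LinearMap.mem_ker]
    ext i
    have := congrArg (coeff 0) (hvan m i)
    rw [hM, map_sum, map_sum, coeff_sum] at this
    simp only [map_smul, coeff_smul] at this
    simpa [Matrix.mulVec, dotProduct, valuesOne] using this
  have h4 := Submodule.finrank_mono hrange
  have h5 := LinearMap.finrank_range_add_finrank_ker M.mulVecLin
  have h6 : M.rank = 2 := by
    have := (h.linearIndependent_left_right (M := M) hM).rank_matrix
    simpa using this
  rw [Matrix.rank] at h6
  rw [h6, Module.finrank_fin_fun] at h5
  omega

/-- The bound h⁰(ω²) ≤ 9 is 2 + 2·4 - 1: two new generators, the multiples of the four sections of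
ω, one syzygy. -/
lemma finrank_one : Module.Finite ℂ (Sec π u v 1) ∧ finrank ℂ (Sec π u v 1) ≤ 9 := by
  obtain ⟨hfin0, hrank0⟩ := h.finrank_zero
  have h1 := h.finrank_neg_one
  have h2 := h.finrank_range_valuesOne
  obtain ⟨h3, h4⟩ := finrank_sections_add_le (n := -1) (m := 0) (k := 1) (by norm_num)
    (by norm_num) (valuesOne π u v) (fun m hm => h.exists_multiples_one m.isSection fun k => by
      have h5 := m.isSection.hasDegree 1 (X k) (isHomogeneous_X ℂ k)
      norm_num at h5
      rw [h5.eq_C]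
      have := congrFun hm k
      simpa [valuesOne] using this)
  exact ⟨h3, by omega⟩

/-- The bound h⁰(ω³) ≤ 15 is 1 + 2·9 - 4: one new generator, the multiples from twist 1, four
syzygies. -/
lemma finrank_two : Module.Finite ℂ (Sec π u v 2) ∧ finrank ℂ (Sec π u v 2) ≤ 15 := by
  obtain ⟨hfin0, hrank0⟩ := h.finrank_zero
  obtain ⟨hfin1, hrank1⟩ := h.finrank_one
  let f : Sec π u v 2 →ₗ[ℂ] ℂ :=
    { toFun := fun m => coeff 0 (m.val 1)
      map_add' := fun m m' => by simp
      map_smul' := fun c m => by simp }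
  obtain ⟨h3, h4⟩ := finrank_sections_add_le (n := 0) (m := 1) (k := 2) (by norm_num)
    (by norm_num) f (fun m hm => h.exists_multiples_two m.isSection (by
      have h5 := m.isSection.hasDegree 0 1 (isHomogeneous_one _ _)
      norm_num at h5
      rw [h5.eq_C, show coeff 0 (m.val 1) = 0 from hm, C_0]))
  have h1 : finrank ℂ (range f) ≤ 1 := by simpa using Submodule.finrank_le (range f)
  exact ⟨h3, by omega⟩

/-- Any sixteen cubic forms have a nontrivial linear combination vanishing on the curve. -/
lemma exists_cubic (m : Fin 16 → CoordRing) (hm : ∀ i, (m i).IsHomogeneous 3) :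
    ∃ c : Fin 16 → ℂ, c ≠ 0 ∧ π (∑ i, c i • m i) = 0 := by
  obtain ⟨hfin, hrank⟩ := h.finrank_two
  let f : (Fin 16 → ℂ) →ₗ[ℂ] Sec π u v 2 :=
    Fintype.linearCombination ℂ fun i => Sec.mk (ringSmul (π (m i)) φ) (by
      have := h.mem.ringSmul (hm i)
      norm_num at this
      exact this)
  have hf : ¬ Injective f := by
    intro hinj
    have := LinearMap.finrank_le_finrank_of_injective hinj
    rw [Module.finrank_fin_fun] at this
    omega
  rw [injective_iff_map_eq_zero] at hf
  push Not at hf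
  obtain ⟨c, hc, hc0⟩ := hf
  refine ⟨c, hc0, ?_⟩
  by_contra hne
  refine h.ne_zero (h.torsion φ h.mem.linear _ hne ?_)
  have := congrArg Sec.val hc
  rw [Fintype.linearCombination_apply, Sec.val_sum] at this
  simp only [map_sum, map_smul, ringSmul_sum, ringSmul_smul]
  exact this

end IsCanonicalGenerator

end Duality

/-! ### The generator attached to a canonically embedded curve -/

lemma basis_combinations {M : Type*} [AddCommGroup M] [Module ℂ M] {S : Submodule ℂ M}
    (s : Module.Basis (Fin 4) ℂ S) :
    (∀ x ∈ S, ∃ c : Fin 4 → ℂ, x = ∑ k, c k • (s k).1) ∧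
      ∀ c : Fin 4 → ℂ, ∑ k, c k • (s k).1 = 0 → c = 0 := by
  refine ⟨fun x hx => ⟨s.repr ⟨x, hx⟩, ?_⟩, fun c hc => ?_⟩
  · have := congrArg Subtype.val (s.sum_repr ⟨x, hx⟩)
    rw [Submodule.coe_sum] at this
    exact this.symm
  · refine funext (Fintype.linearIndependent_iff.1 s.linearIndependent c (Subtype.ext ?_))
    rw [Submodule.coe_sum]
    exact hc

namespace IntegralCurve

variable (C : IntegralCurve)

/-- The quotient map to the homogeneous coordinate ring, as a homomorphism of algebras. -/
abbrev toRingₐ : CoordRing →ₐ[ℂ] C.Ring := Ideal.Quotient.mkₐ ℂ C.ideal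

lemma mem_dualizingSections {u v : CoordRing} {n : ℤ} {φ : C.Ring →ₗ[ℂ] 𝓡} :
    φ ∈ C.dualizingSections u v n ↔ IsSection C.toRingₐ u v n φ :=
  ⟨fun h => ⟨h.1, h.2⟩, fun h => ⟨h.1, h.2⟩⟩

/-- Since a ≠ 0 is integral over ℂ[s, t], some nonzero r in ℂ[s, t] maps to a multiple of a, or to
zero if the projection is not injective. Then r annihilates ψ, whose values lie in a domain. -/
lemma IsProjection.eq_zero_of_ringSmul {C : IntegralCurve} {u v : CoordRing}
    (h : C.IsProjection u v) {ψ : C.Ring →ₗ[ℂ] 𝓡}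
    (hψ : IsProjLinear C.toRingₐ u v ψ) {a : C.Ring} (ha : a ≠ 0) (h0 : ringSmul a ψ = 0) :
    ψ = 0 := by
  obtain ⟨p, hp, hpa⟩ := h.isIntegral a
  have hI : (Ideal.comap (C.proj u v) (span {a})) ≠ ⊥ ∨ ∃ r : 𝓡, r ≠ 0 ∧ C.proj u v r = 0 := by
    by_cases hinj : Injective (C.proj u v)
    · left
      let _ : Algebra 𝓡 C.Ring := (C.proj u v).toAlgebra
      exact Ideal.comap_ne_bot_of_integral_mem ha (Ideal.mem_span_singleton_self a)
        (show IsIntegral 𝓡 a from ⟨p, hp, hpa⟩)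
    · right
      rw [injective_iff_map_eq_zero] at hinj
      push Not at hinj
      obtain ⟨r, h1, h2⟩ := hinj
      exact ⟨r, h2, h1⟩
  have key : ∃ r : 𝓡, r ≠ 0 ∧ ∃ b, C.proj u v r = a * b := by
    rcases hI with h1 | ⟨r, h1, h2⟩
    · obtain ⟨r, h2, h3⟩ := Submodule.exists_mem_ne_zero_of_ne_bot h1
      obtain ⟨b, hb⟩ := Ideal.mem_span_singleton.1 (Ideal.mem_comap.1 h2)
      exact ⟨r, h3, b, hb⟩
    · exact ⟨r, h1, 0, by rw [h2, mul_zero]⟩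
  obtain ⟨r, hr, b, hb⟩ := key
  ext1 c
  have h1 := hψ r c
  have h2 : C.toRingₐ (aeval ![u, v] r) = a * b := hb
  rw [h2, mul_assoc, ← ringSmul_apply a, h0] at h1
  exact (mul_eq_zero.1 h1.symm).resolve_left hr

lemma IsCanonicallyEmbedded.exists_isCanonicalGenerator {C : IntegralCurve}
    (h : C.IsCanonicallyEmbedded) : ∃ u v φ, IsCanonicalGenerator C.toRingₐ u v φ := by
  obtain ⟨u, v, hproj, s, h1, h2⟩ := h
  have hs : ∀ k, IsSection C.toRingₐ u v 0 (s k).1 := fun k =>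
    C.mem_dualizingSections.1 (s k).2
  obtain ⟨φ, hφ, hφs⟩ := exists_generator (π := C.toRingₐ) C.toRing_surjective hproj.left
    (fun k => (s k).1) hs h1
  obtain ⟨hb1, hb2⟩ := basis_combinations (M := C.Ring →ₗ[ℂ] 𝓡) s
  have hlin : ∀ c : Fin 4 → ℂ, ringSmul (C.toRingₐ (∑ k, c k • X k)) φ = ∑ k, c k • (s k).1 := by
    intro c
    rw [map_sum, ringSmul_sum]
    refine sum_congr rfl fun k _ => ?_
    rw [map_smul, ringSmul_smul, hφs]
  refine ⟨u, v, φ, C.toRing_surjective, hproj.left, hproj.right, ?_, ?_, hφ, ?_, ?_, ?_⟩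
  · intro f hf d
    exact C.toRing_eq_zero.2 (C.isHomogeneous f (C.toRing_eq_zero.1 hf) d)
  · exact fun ψ hψ a ha h0 => hproj.eq_zero_of_ringSmul hψ ha h0
  · intro ψ hψ
    obtain ⟨c, hc⟩ := hb1 ψ (C.mem_dualizingSections.2 hψ)
    exact ⟨c, by rw [hlin, ← hc]⟩
  · intro c hc
    rw [hlin] at hc
    exact hb2 c hc
  · intro j n ψ hψ
    obtain ⟨N, b, hb⟩ := h2 j n ψ (C.mem_dualizingSections.2 hψ)
    -- The section `s j` is X j times the generator, whence the additional factor.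
    refine ⟨N, C.toRing (X j) * b, ?_⟩
    ext1 a
    rw [ringSmul_apply, ringSmul_apply]
    refine (hb a).trans ?_
    rw [← hφs]
    simp only [ringSmul_apply, mul_assoc]
    rfl

lemma IsCanonicallyEmbedded.linear_notMem {C : IntegralCurve} (h : C.IsCanonicallyEmbedded)
    {f : CoordRing} (hf : f.IsHomogeneous 1) (hf0 : f ∈ C.ideal) : f = 0 := by
  obtain ⟨u, v, φ, hφ⟩ := h.exists_isCanonicalGenerator
  obtain ⟨c, rfl⟩ := exists_eq_sum_X hf
  by_contra hne
  refine hφ.linear_ne_zero (c := c) ?_ (C.toRing_eq_zero.2 hf0)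
  rintro rfl
  simp at hne

lemma IsCanonicallyEmbedded.exists_cubic {C : IntegralCurve} (h : C.IsCanonicallyEmbedded)
    (m : Fin 16 → CoordRing) (hm : ∀ i, (m i).IsHomogeneous 3) :
    ∃ c : Fin 16 → ℂ, c ≠ 0 ∧ ∑ i, c i • m i ∈ C.ideal := by
  obtain ⟨u, v, φ, hφ⟩ := h.exists_isCanonicalGenerator
  obtain ⟨c, hc, h0⟩ := hφ.exists_cubic m hm
  exact ⟨c, hc, C.toRing_eq_zero.1 h0⟩

end IntegralCurve

/-! ### Cubic sections of a quadric -/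

lemma HasDegree.mul {σ : Type*} {p q : MvPolynomial σ ℂ} {k l : ℤ} (hp : HasDegree p k)
    (hq : HasDegree q l) : HasDegree (p * q) (k + l) := by
  classical
  intro e he
  obtain ⟨a, ha, b, hb, rfl⟩ := Finset.mem_add.1 (support_mul p q he)
  rw [map_add, Nat.cast_add, hp a ha, hq b hb]

lemma HasDegree.one {σ : Type*} : HasDegree (1 : MvPolynomial σ ℂ) 0 :=
  HasDegree.of_isHomogeneous (isHomogeneous_one σ ℂ)

lemma HasDegree.X {σ : Type*} (i : σ) : HasDegree (X i : MvPolynomial σ ℂ) 1 :=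
  HasDegree.of_isHomogeneous (isHomogeneous_X ℂ i)

/-- The equation of the Segre quadric. -/
def segre : CoordRing := X 0 * X 3 - X 1 * X 2

/-- A form in the two middle coordinates. -/
abbrev bin : 𝓡 →ₐ[ℂ] CoordRing := aeval ![X 1, X 2]

/-- A basis of the coordinate ring of a cubic section of the quadric over `ℂ[X₁, X₂]`. -/
def cubicBasis : Fin 6 → CoordRing := ![1, X 0, X 0 ^ 2, X 0 ^ 3, X 3, X 3 ^ 2]

/-- The degrees of the members of `cubicBasis`. -/
def cubicBasisDegree : Fin 6 → ℤ := ![0, 1, 2, 3, 1, 2]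

/-- Combinations of the members of `cubicBasis`. -/
def cubicComb (r : Fin 6 → 𝓡) : CoordRing := ∑ k, bin (r k) * cubicBasis k

/-- The combination has the degree `d`. -/
def CombDegree (r : Fin 6 → 𝓡) (d : ℤ) : Prop :=
  ∀ k, HasDegree (r k) (d - cubicBasisDegree k)

lemma cubicComb_add (r s : Fin 6 → 𝓡) : cubicComb (r + s) = cubicComb r + cubicComb s := by
  simp [cubicComb, add_mul, sum_add_distrib]

lemma cubicComb_smul (c : ℂ) (r : Fin 6 → 𝓡) : cubicComb (c • r) = c • cubicComb r := by
  simp [cubicComb, Finset.smul_sum]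

lemma cubicComb_mul (p : 𝓡) (r : Fin 6 → 𝓡) :
    cubicComb (fun k => p * r k) = bin p * cubicComb r := by
  simp [cubicComb, mul_sum, mul_assoc]

lemma cubicComb_single (k : Fin 6) (p : 𝓡) : cubicComb (Pi.single k p) = bin p * cubicBasis k := by
  rw [cubicComb, Finset.sum_eq_single k]
  · simp
  · intro l _ hl; simp [hl]
  · simp

lemma cubicComb_zero : cubicComb 0 = 0 := by simp [cubicComb]

lemma combDegree_zero (d : ℤ) : CombDegree 0 d := fun _ => HasDegree.zero

lemma CombDegree.add {r s : Fin 6 → 𝓡} {d : ℤ} (hr : CombDegree r d)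
    (hs : CombDegree s d) : CombDegree (r + s) d := fun k => (hr k).add (hs k)

lemma CombDegree.smul {r : Fin 6 → 𝓡} {d : ℤ} (c : ℂ) (hr : CombDegree r d) :
    CombDegree (c • r) d := fun k => (hr k).smul c

lemma CombDegree.mul {r : Fin 6 → 𝓡} {d l : ℤ} {p : 𝓡}
    (hp : HasDegree p l) (hr : CombDegree r d) : CombDegree (fun k => p * r k) (d + l) := fun k => by
  have := hp.mul (hr k)
  rwa [show l + (d - cubicBasisDegree k) = d + l - cubicBasisDegree k by ring] at this

lemma CombDegree.single {k : Fin 6} {d : ℤ} {p : 𝓡}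
    (hp : HasDegree p (d - cubicBasisDegree k)) : CombDegree (Pi.single k p) d := fun l => by
  by_cases h : l = k
  · subst h; simpa using hp
  · simpa [h] using HasDegree.zero

/-- `f` is congruent modulo `J` to a combination of degree `d` with coefficients from `P`. -/
def CombMod (J : Ideal CoordRing) (d : ℤ) (f : CoordRing) : Prop :=
  ∃ r, CombDegree r d ∧ f - cubicComb r ∈ J

namespace CombMod

variable {J : Ideal CoordRing} {d l : ℤ} {f g : CoordRing}

lemma of_mem (hf : f ∈ J) : CombMod J d f := ⟨0, combDegree_zero d, by simpa [cubicComb_zero]⟩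

lemma add (hf : CombMod J d f) (hg : CombMod J d g) : CombMod J d (f + g) := by
  obtain ⟨r, hr, hr'⟩ := hf
  obtain ⟨s, hs, hs'⟩ := hg
  refine ⟨r + s, hr.add hs, ?_⟩
  rw [cubicComb_add, add_sub_add_comm]
  exact J.add_mem hr' hs'

lemma smul (c : ℂ) (hf : CombMod J d f) : CombMod J d (c • f) := by
  obtain ⟨r, hr, hr'⟩ := hf
  refine ⟨c • r, hr.smul c, ?_⟩
  rw [cubicComb_smul, ← smul_sub, smul_eq_C_mul]
  exact J.mul_mem_left _ hr'

lemma sum {ι : Type*} (t : Finset ι) {f : ι → CoordRing} (hf : ∀ i ∈ t, CombMod J d (f i)) :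
    CombMod J d (∑ i ∈ t, f i) :=
  Finset.sum_induction _ (CombMod J d) (fun _ _ => add) (of_mem J.zero_mem) hf

lemma bin_mul {p : 𝓡} (hp : HasDegree p l) (hf : CombMod J d f) :
    CombMod J (d + l) (bin p * f) := by
  obtain ⟨r, hr, hr'⟩ := hf
  refine ⟨_, hr.mul hp, ?_⟩
  rw [cubicComb_mul, ← mul_sub]
  exact J.mul_mem_left _ hr'

lemma basis (k : Fin 6) : CombMod J (cubicBasisDegree k) (cubicBasis k) :=
  ⟨Pi.single k 1, CombDegree.single (by simpa using HasDegree.one), by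
    rw [cubicComb_single, map_one, one_mul, sub_self]; exact J.zero_mem⟩

lemma of_eq (hf : CombMod J d f) (hd : d = l) (hg : f = g) : CombMod J l g := by
  subst hd hg; exact hf

lemma congr (hf : CombMod J d f) (h : g - f ∈ J) : CombMod J d g := by
  have := hf.add (of_mem h)
  rwa [add_sub_cancel] at this

end CombMod

/-- Modulo the quadric the product X₀X₃ is X₁X₂, so the smaller of the two outer exponents can be
removed. What remains is at most a square of an outer coordinate, the two pure cubes being excluded.
-/
lemma monomial_three {e : Fin 4 →₀ ℕ} (he : e.degree = 3) (h0 : e ≠ single 0 3)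
    (h3 : e ≠ single 3 3) : ∃ r, r 3 = 0 ∧ CombDegree r 3 ∧
      monomial e 1 - cubicComb r ∈ span {segre} := by
  have hsum : e 0 + e 1 + e 2 + e 3 = 3 := by
    have h := Finsupp.degree_eq_sum e
    rw [Fin.sum_univ_four] at h
    omega
  have hm : (monomial e 1 : CoordRing) = X 0 ^ e 0 * X 1 ^ e 1 * X 2 ^ e 2 * X 3 ^ e 3 := by
    rw [monomial_eq, C_1, one_mul, Finsupp.prod_fintype _ _ (by simp), Fin.prod_univ_four]
  have hn0 : e 0 ≠ 3 := by
    intro h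
    apply h0
    ext i; fin_cases i <;> simp <;> omega
  have hn3 : e 3 ≠ 3 := by
    intro h
    apply h3
    ext i; fin_cases i <;> simp <;> omega
  have hpow : ∀ n : ℕ, segre ∣ (X 0 * X 3) ^ n - (X 1 * X 2) ^ n := fun n =>
    sub_dvd_pow_sub_pow _ _ n
  have hd : ∀ a b : ℕ, HasDegree (X 0 ^ a * X 1 ^ b : 𝓡) (a + b) := by
    intro a b
    have := HasDegree.of_isHomogeneous ((isHomogeneous_X_pow (R := ℂ) (0 : Fin 2) a).mul
      (isHomogeneous_X_pow (1 : Fin 2) b))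
    exact_mod_cast this
  have key : ∀ (k : Fin 6) (n : ℕ), k ≠ 3 → (n : ℤ) + n + e 1 + e 2 + cubicBasisDegree k = 3 →
      (monomial e 1 : CoordRing) = (X 0 * X 3) ^ n * X 1 ^ e 1 * X 2 ^ e 2 * cubicBasis k →
      ∃ r, r 3 = 0 ∧ CombDegree r 3 ∧ monomial e 1 - cubicComb r ∈ span {segre} := by
    intro k n hk hdeg hmon
    refine ⟨Pi.single k (X 0 ^ (n + e 1) * X 1 ^ (n + e 2)), by simp [hk.symm],
      CombDegree.single ?_, ?_⟩
    · convert hd (n + e 1) (n + e 2) using 1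
      push_cast; linarith
    · rw [cubicComb_single, hmon, Ideal.mem_span_singleton]
      obtain ⟨c, hc⟩ := hpow n
      refine ⟨c * X 1 ^ e 1 * X 2 ^ e 2 * cubicBasis k, ?_⟩
      have : bin (X 0 ^ (n + e 1) * X 1 ^ (n + e 2)) =
          (X 1 : CoordRing) ^ (n + e 1) * X 2 ^ (n + e 2) := by simp [bin]
      rw [this]
      have hc' : (X 0 * X 3 : CoordRing) ^ n = (X 1 * X 2) ^ n + segre * c := by rw [← hc]; ring
      rw [hc']
      ring
  rcases le_total (e 0) (e 3) with hle | hle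
  · obtain ⟨i, hi⟩ : ∃ i, e 3 = e 0 + i := ⟨e 3 - e 0, by omega⟩
    have hi2 : i < 3 := by omega
    rw [hi] at hm hsum
    interval_cases i <;> [apply key 0 (e 0) (by decide); apply key 4 (e 0) (by decide);
      apply key 5 (e 0) (by decide)] <;>
      first | (simp [cubicBasisDegree]; omega) | (rw [hm]; simp [cubicBasis]; ring)
  · obtain ⟨i, hi⟩ : ∃ i, e 0 = e 3 + i := ⟨e 0 - e 3, by omega⟩
    have hi2 : i < 3 := by omega
    rw [hi] at hm hsum
    interval_cases i <;> [apply key 0 (e 3) (by decide); apply key 1 (e 3) (by decide);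
      apply key 2 (e 3) (by decide)] <;>
      first | (simp [cubicBasisDegree]; omega) | (rw [hm]; simp [cubicBasis]; ring)

/-- The pure cubes of X₀ and X₃ are kept apart: their coefficients decide whether the cubic section
is free over ℂ[X₁, X₂] on `cubicBasis`. -/
lemma cubic_normal_form {F : CoordRing} (hF : F.IsHomogeneous 3) : ∃ r, r 3 = 0 ∧ CombDegree r 3 ∧
    F - (coeff (single 0 3) F • X 0 ^ 3 + coeff (single 3 3) F • X 3 ^ 3 +
      cubicComb r) ∈ span {segre} := by
  classical
  set e0 : Fin 4 →₀ ℕ := single 0 3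
  set e3 : Fin 4 →₀ ℕ := single 3 3
  have hne : e0 ≠ e3 := by
    intro h
    have := DFunLike.congr_fun h 0
    simp [e0, e3] at this
  have hX : ∀ i : Fin 4, (X i ^ 3 : CoordRing) = monomial (single i 3) 1 := fun i => by
    rw [X_pow_eq_monomial]
  have h1 : ∀ e : Fin 4 →₀ ℕ, ∃ r, e ∈ F.support → e ≠ e0 → e ≠ e3 →
      r 3 = 0 ∧ CombDegree r 3 ∧ monomial e 1 - cubicComb r ∈ span {segre} := by
    intro e
    by_cases h : e ∈ F.support ∧ e ≠ e0 ∧ e ≠ e3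
    · obtain ⟨r, hr⟩ := monomial_three (e := e)
        (by exact_mod_cast HasDegree.of_isHomogeneous hF e h.1) h.2.1 h.2.2
      exact ⟨r, fun _ _ _ => hr⟩
    · exact ⟨0, fun a b c => absurd ⟨a, b, c⟩ h⟩
  choose r hr using h1
  set T := (F.support.erase e0).erase e3
  have hT : ∀ e ∈ T, r e 3 = 0 ∧ CombDegree (r e) 3 ∧
      monomial e 1 - cubicComb (r e) ∈ span {segre} := by
    intro e he
    simp only [T, Finset.mem_erase] at he
    exact hr e he.2.2 he.2.1 he.1
  have hF2 : F = coeff e0 F • X 0 ^ 3 + coeff e3 F • X 3 ^ 3 +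
      ∑ e ∈ T, coeff e F • (monomial e 1 : CoordRing) := by
    have h2 : ∑ e ∈ T, coeff e F • (monomial e 1 : CoordRing) =
        ∑ e ∈ F.support, coeff e F • (monomial e 1 : CoordRing) -
          coeff e0 F • (monomial e0 1 : CoordRing) - coeff e3 F • (monomial e3 1 : CoordRing) := by
      have herase : ∀ (T : Finset (Fin 4 →₀ ℕ)) (e : Fin 4 →₀ ℕ), (e ∉ T → coeff e F = 0) →
          ∑ x ∈ T.erase e, coeff x F • (monomial x 1 : CoordRing) =
          ∑ x ∈ T, coeff x F • (monomial x 1 : CoordRing) - coeff e F • monomial e 1 := by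
        intro T e he
        by_cases heT : e ∈ T
        · rw [← Finset.sum_erase_add _ _ heT]; ring
        · rw [Finset.erase_eq_of_notMem heT, he heT, zero_smul, sub_zero]
      rw [herase _ _ (fun h => by
        by_contra h'
        exact h (Finset.mem_erase.2 ⟨hne.symm, mem_support_iff.2 h'⟩)), herase _ _ (fun h => by
        by_contra h'
        exact h (mem_support_iff.2 h'))]
    rw [h2, hX, hX]
    conv_lhs => rw [F.as_sum]
    simp only [monomial_coeff]
    ring
  refine ⟨∑ e ∈ T, coeff e F • r e, ?_, ?_, ?_⟩
  · rw [Finset.sum_apply]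
    exact Finset.sum_eq_zero fun e he => by simp [(hT e he).1]
  · exact Finset.sum_induction _ (CombDegree · 3) (fun _ _ => CombDegree.add) (combDegree_zero 3)
      fun e he => (hT e he).2.1.smul _
  · have h3 : cubicComb (∑ e ∈ T, coeff e F • r e) = ∑ e ∈ T, coeff e F • cubicComb (r e) := by
      simp_rw [← cubicComb_smul]
      exact map_sum ({ toFun := cubicComb, map_zero' := cubicComb_zero, map_add' := cubicComb_add } :
        (Fin 6 → 𝓡) →+ CoordRing) _ _
    rw [h3]
    nth_rw 1 [hF2]
    rw [add_sub_add_left_eq_sub, ← Finset.sum_sub_distrib]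
    refine Ideal.sum_mem _ fun e he => ?_
    rw [← smul_sub, smul_eq_C_mul]
    exact Ideal.mul_mem_left _ _ (hT e he).2.2

/-- Every form is congruent to a combination of `cubicBasis` modulo the quadric and a cubic in
which the cubes of the outer coordinates occur. -/
lemma combMod_of_isHomogeneous {F : CoordRing} (hF : F.IsHomogeneous 3)
    (h0 : coeff (single 0 3) F ≠ 0) (h3 : coeff (single 3 3) F ≠ 0)
    {d : ℕ} {f : CoordRing} (hf : f.IsHomogeneous d) : CombMod (span {segre, F}) d f := by
  set J := span {segre, F} with hJ
  have hqJ : segre ∈ J := subset_span (by simp)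
  have hFJ : F ∈ J := subset_span (by simp)
  obtain ⟨ρ, hρ3, hρ, hρF⟩ := cubic_normal_form hF
  set α := coeff (single 0 3) F
  set β := coeff (single 3 3) F
  have hle : span {segre} ≤ J := Ideal.span_mono (by simp)
  have hrel : α • X 0 ^ 3 + β • X 3 ^ 3 + cubicComb ρ ∈ J := by
    have := J.sub_mem hFJ (hle hρF)
    rwa [sub_sub_cancel] at this
  have hu : HasDegree (X 0 * X 1 : 𝓡) 2 := by simpa using (HasDegree.X 0).mul (HasDegree.X 1)
  have hbu : bin (X 0 * X 1) = (X 1 * X 2 : CoordRing) := by simp [bin]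
  have hX03 : ∀ (k : Fin 6) {x : CoordRing} {l : ℤ}, cubicBasisDegree k + 2 = l →
      x = X 0 * X 3 * cubicBasis k → CombMod J l x := by
    rintro k x l rfl rfl
    refine ((CombMod.basis k).bin_mul hu).congr ?_
    rw [hbu, ← sub_mul]
    exact J.mul_mem_right _ hqJ
  have hbasis : ∀ (k : Fin 6) {x : CoordRing} {l : ℤ}, cubicBasisDegree k = l →
      cubicBasis k = x → CombMod J l x := fun k _ _ => (CombMod.basis k).of_eq
  -- products with the outer coordinates
  have hA : ∀ k : Fin 6, k ≠ 3 → CombMod J (cubicBasisDegree k + 1) (X 0 * cubicBasis k) := by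
    intro k hk
    fin_cases k <;> [apply hbasis 1 rfl; apply hbasis 2 rfl; apply hbasis 3 rfl; exact absurd rfl hk;
      apply hX03 0 rfl; apply hX03 4 rfl] <;> simp [cubicBasis] <;> ring
  have hA' : ∀ r, r 3 = 0 → CombDegree r 3 → CombMod J 4 (X 0 * cubicComb r) := by
    intro r hr3 hr
    rw [cubicComb, mul_sum]
    refine CombMod.sum _ fun k _ => ?_
    by_cases hk : k = 3
    · subst hk
      rw [hr3, map_zero, zero_mul, mul_zero]
      exact CombMod.of_mem J.zero_mem
    · have := (hA k hk).bin_mul (hr k)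
      convert this using 1
      · ring
      · ring
  -- X₀⁴ is the only product with X₀ that leaves the basis. The cubic multiplied by X₀ expresses it
  -- through X₀X₃³, which the quadric reduces, and through products already treated.
  have hX04 : CombMod J 4 (X 0 * cubicBasis 3) := by
    have h1 : CombMod J 4 (X 0 * X 3 ^ 3) := hX03 5 rfl (by simp [cubicBasis]; ring)
    have h2 := ((h1.smul β).add (hA' ρ hρ3 hρ)).smul (-α⁻¹)
    refine h2.congr ?_
    have h3 := J.mul_mem_left (C α⁻¹ * X 0) hrel
    convert h3 using 1
    have h4 : (C α⁻¹ * C α : CoordRing) = 1 := by rw [← C_mul, inv_mul_cancel₀ h0, C_1]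
    simp only [cubicBasis, smul_eq_C_mul, C_neg, Matrix.cons_val]
    linear_combination (-X 0 ^ 4) * h4
  have hAall : ∀ k, CombMod J (cubicBasisDegree k + 1) (X 0 * cubicBasis k) := by
    intro k
    by_cases hk : k = 3
    · subst hk
      exact hX04
    · exact hA k hk
  -- Likewise the cubic expresses X₃³ through X₀³ and the other basis elements.
  have hX33 : CombMod J 3 (X 3 ^ 3) := by
    have h1 : CombMod J 3 (cubicComb ρ) := ⟨ρ, hρ, by simp⟩
    have h2 := (((CombMod.basis (J := J) 3).smul α).add h1).smul (-β⁻¹)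
    refine h2.congr ?_
    have h3' := J.mul_mem_left (C β⁻¹) hrel
    convert h3' using 1
    have h4 : (C β⁻¹ * C β : CoordRing) = 1 := by rw [← C_mul, inv_mul_cancel₀ h3, C_1]
    simp only [cubicBasis, smul_eq_C_mul, C_neg, Matrix.cons_val]
    linear_combination (-X 3 ^ 3) * h4
  have hB : ∀ k, CombMod J (cubicBasisDegree k + 1) (X 3 * cubicBasis k) := by
    intro k
    fin_cases k <;> [apply hbasis 4 rfl; apply hX03 0 rfl; apply hX03 1 rfl; apply hX03 2 rfl;
      apply hbasis 5 rfl; apply hX33.of_eq rfl] <;> simp [cubicBasis] <;> ring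
  have hmulX : ∀ (i : Fin 4) {l : ℤ} {g : CoordRing}, CombMod J l g →
      CombMod J (l + 1) (X i * g) := by
    intro i l g hg
    have hout : ∀ x : CoordRing, (∀ k, CombMod J (cubicBasisDegree k + 1) (x * cubicBasis k)) →
        CombMod J (l + 1) (x * g) := by
      intro x hx
      obtain ⟨r, hr, hr'⟩ := hg
      have h1 : CombMod J (l + 1) (x * cubicComb r) := by
        rw [cubicComb, mul_sum]
        refine CombMod.sum _ fun k _ => ?_
        have := (hx k).bin_mul (hr k)
        convert this using 1 <;> ring
      refine h1.congr ?_
      rw [← mul_sub]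
      exact J.mul_mem_left _ hr'
    fin_cases i
    · exact hout _ hAall
    · have := hg.bin_mul (HasDegree.X (0 : Fin 2))
      simpa [bin] using this
    · have := hg.bin_mul (HasDegree.X (1 : Fin 2))
      simpa [bin] using this
    · exact hout _ hB
  have hmon : ∀ (n : ℕ) (e : Fin 4 →₀ ℕ), e.degree = n → CombMod J n (monomial e 1) := by
    intro n
    induction n with
    | zero =>
      intro e he
      rw [(Finsupp.degree_eq_zero_iff e).1 he]
      simpa [cubicBasis, cubicBasisDegree] using CombMod.basis (J := J) 0
    | succ n ih =>
      intro e he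
      obtain ⟨i, hi⟩ : ∃ i, 1 ≤ e i := by
        by_contra! hcon
        have : e = 0 := by ext i; have := hcon i; simp; omega
        rw [this] at he
        simp at he
      obtain ⟨e', rfl⟩ : ∃ e', e = single i 1 + e' :=
        ⟨e - single i 1, (add_tsub_cancel_of_le (Finsupp.single_le_iff.2 hi)).symm⟩
      rw [monomial_single_add, pow_one]
      have := hmulX i (ih e' (by simp at he; omega))
      exact_mod_cast this
  rw [f.as_sum]
  refine CombMod.sum _ fun e he => ?_
  rw [monomial_coeff]
  exact (hmon d e (by exact_mod_cast HasDegree.of_isHomogeneous hf e he)).smul _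

/-! ### Duality for cubic sections of the quadric -/

lemma segre_mul_sub_mem (F g : CoordRing) : X 0 * X 3 * g - X 1 * X 2 * g ∈ span {segre, F} := by
  rw [← sub_mul]
  exact Ideal.mul_mem_right _ _ (subset_span (by simp [segre]))

/-- The quadric and the cubic `F` vanish under `π`, the cubes of the outer coordinates occur in `F`,
and `cubicBasis` is independent over the forms in the two middle coordinates. -/
structure IsNormalCubic {A : Type} [CommRing A] [Algebra ℂ A] (π : CoordRing →ₐ[ℂ] A)
    (F : CoordRing) : Prop where
  surj : Function.Surjective π
  segre_eq : π segre = 0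
  isHomogeneous : F.IsHomogeneous 3
  eq_zero : π F = 0
  coeff_zero : coeff (single 0 3) F ≠ 0
  coeff_three : coeff (single 3 3) F ≠ 0
  indep : ∀ r, π (cubicComb r) = 0 → r = 0

namespace IsNormalCubic

variable {A : Type} [CommRing A] [Algebra ℂ A] {π : CoordRing →ₐ[ℂ] A} {F : CoordRing}
  (h : IsNormalCubic π F)
include h

lemma span_le {f : CoordRing} (hf : f ∈ span {segre, F}) : π f = 0 := by
  have : span {segre, F} ≤ RingHom.ker π := by
    rw [Ideal.span_le]
    rintro x (rfl | rfl)
    · exact h.segre_eq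
    · exact h.eq_zero
  exact this hf

lemma exists_comb_of_isHomogeneous {f : CoordRing} {d : ℕ} (hf : f.IsHomogeneous d) :
    ∃ r, CombDegree r d ∧ f - cubicComb r ∈ span {segre, F} :=
  combMod_of_isHomogeneous h.isHomogeneous h.coeff_zero h.coeff_three hf

lemma exists_comb (f : CoordRing) : ∃ r, f - cubicComb r ∈ span {segre, F} := by
  induction f using MvPolynomial.induction_on' with
  | monomial e a =>
    obtain ⟨r, -, hr⟩ := h.exists_comb_of_isHomogeneous (isHomogeneous_monomial a (rfl : e.degree = _))
    exact ⟨r, hr⟩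
  | add p q hp hq =>
    obtain ⟨r, hr⟩ := hp
    obtain ⟨s, hs⟩ := hq
    refine ⟨r + s, ?_⟩
    rw [cubicComb_add, add_sub_add_comm]
    exact Ideal.add_mem _ hr hs

lemma comb_injective {r s : Fin 6 → 𝓡} (hrs : π (cubicComb r) = π (cubicComb s)) : r = s := by
  rw [← sub_eq_zero]
  refine h.indep _ ?_
  have : r - s = r + (-1 : ℂ) • s := by ext1 k; simp [sub_eq_add_neg]
  rw [this, cubicComb_add, cubicComb_smul, map_add, map_smul, hrs]
  simp

/-- The ideal is generated by the quadric and the cubic. -/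
lemma eq_zero_iff {f : CoordRing} : π f = 0 ↔ f ∈ span {segre, F} := by
  refine ⟨fun hf => ?_, h.span_le⟩
  obtain ⟨r, hr⟩ := h.exists_comb f
  have h1 := h.span_le hr
  rw [map_sub, hf, zero_sub, neg_eq_zero] at h1
  rwa [h.indep r h1, cubicComb_zero, sub_zero] at hr

lemma exists_coords (a : A) : ∃ r, π (cubicComb r) = a := by
  obtain ⟨f, rfl⟩ := h.surj a
  obtain ⟨r, hr⟩ := h.exists_comb f
  refine ⟨r, ?_⟩
  have := h.span_le hr
  rw [map_sub, sub_eq_zero] at this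
  exact this.symm

/-- The coordinate of the cube of the first coordinate. -/
def coordForm : A →ₗ[ℂ] 𝓡 where
  toFun a := (h.exists_coords a).choose 3
  map_add' a b := by
    rw [← Pi.add_apply]
    refine congrFun (h.comb_injective ?_) 3
    rw [cubicComb_add, map_add, (h.exists_coords a).choose_spec, (h.exists_coords b).choose_spec,
      (h.exists_coords (a + b)).choose_spec]
  map_smul' c a := by
    rw [RingHom.id_apply, ← Pi.smul_apply]
    refine congrFun (h.comb_injective ?_) 3
    rw [cubicComb_smul, map_smul, (h.exists_coords a).choose_spec,
      (h.exists_coords (c • a)).choose_spec]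

lemma coordForm_comb (r : Fin 6 → 𝓡) : h.coordForm (π (cubicComb r)) = r 3 :=
  congrFun (h.comb_injective (h.exists_coords (π (cubicComb r))).choose_spec) 3

lemma coordForm_cube : h.coordForm (π (X 0 ^ 3)) = 1 := by
  have := h.coordForm_comb (Pi.single 3 1)
  rw [cubicComb_single, map_one, one_mul, Pi.single_eq_same] at this
  exact this

lemma coordForm_bin_mul {r : 𝓡} {k : Fin 6} (hk : k ≠ 3) {f : CoordRing}
    (hf : f - bin r * cubicBasis k ∈ span {segre, F}) : h.coordForm (π f) = 0 := by
  have := h.span_le hf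
  rw [map_sub, sub_eq_zero, ← cubicComb_single] at this
  rw [this, coordForm_comb]
  simp [hk.symm]

/-- X₀³ is the basis element of highest degree, so reading off its coefficient lowers degrees by 3,
the shift of a section of twist -1. It is the prospective generator of the dualizing module. -/
lemma coordForm_isSection : IsSection π (X 1) (X 2) (-1) h.coordForm where
  linear r a := by
    obtain ⟨s, rfl⟩ := h.exists_coords a
    rw [← map_mul, ← cubicComb_mul, coordForm_comb, coordForm_comb]
  hasDegree m f hf := by
    obtain ⟨r, hr, hfr⟩ := h.exists_comb_of_isHomogeneous hf
    have h1 := h.span_le hfr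
    rw [map_sub, sub_eq_zero] at h1
    rw [h1, coordForm_comb]
    have := hr 3
    rwa [show cubicBasisDegree 3 = 3 from rfl, show (m : ℤ) - 3 = m + -1 - 2 by ring] at this

lemma ext_of_linear {ψ χ : A →ₗ[ℂ] 𝓡} (hψ : IsProjLinear π (X 1) (X 2) ψ)
    (hχ : IsProjLinear π (X 1) (X 2) χ)
    (hk : ∀ k, ψ (π (cubicBasis k)) = χ (π (cubicBasis k))) : ψ = χ := by
  ext1 a
  obtain ⟨r, rfl⟩ := h.exists_coords a
  rw [cubicComb, map_sum, map_sum, map_sum]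
  refine sum_congr rfl fun k _ => ?_
  rw [map_mul, hψ, hχ, hk]

/-- By the cubic, α X₀³ + β X₃³ is congruent to terms without X₀³, so γ = -α/β. It is nonzero
because both cubes occur, which makes X₃ and X₃² dual to each other. -/
lemma coordForm_X_three_pow : ∃ γ : ℂ, γ ≠ 0 ∧ h.coordForm (π (X 3 ^ 3)) = C γ := by
  obtain ⟨ρ, hρ3, -, hρ⟩ := cubic_normal_form h.isHomogeneous
  set α := coeff (single 0 3) F
  set β := coeff (single 3 3) F
  have hβ : β ≠ 0 := h.coeff_three
  have h1 : π F - (α • π (X 0 ^ 3) + β • π (X 3 ^ 3) + π (cubicComb ρ)) = 0 := by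
    rw [← map_smul, ← map_smul, ← map_add, ← map_add, ← map_sub]
    exact h.span_le (Ideal.span_mono (by simp) hρ)
  rw [h.eq_zero, zero_sub, neg_eq_zero] at h1
  have h2 := congrArg h.coordForm h1
  rw [map_add, map_add, map_smul, map_smul, h.coordForm_cube, h.coordForm_comb, hρ3, map_zero, add_zero] at h2
  refine ⟨-(α / β), neg_ne_zero.2 (div_ne_zero h.coeff_zero hβ), ?_⟩
  have h4 : (C β : 𝓡) ≠ 0 := by simpa using hβ
  apply mul_left_cancel₀ h4
  rw [smul_eq_C_mul, smul_eq_C_mul, mul_one] at h2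
  rw [← C_mul, show β * -(α / β) = -α by field_simp, C_neg]
  linear_combination h2

set_option maxHeartbeats 2000000 in
/-- Each graded linear form is a multiple of `coordForm`. -/
lemma exists_ringSmul {ψ : A →ₗ[ℂ] 𝓡} (hψ : IsProjLinear π (X 1) (X 2) ψ) :
    ∃ b, ψ = ringSmul b h.coordForm ∧ (IsSection π (X 1) (X 2) 0 ψ →
      ∃ c : Fin 4 → ℂ, b = π (∑ k, c k • X k)) := by
  obtain ⟨γ, hγ, hγ3⟩ := h.coordForm_X_three_pow
  set φ := h.coordForm with hφ
  set g : ℕ → 𝓡 := fun n => φ (π (X 0 ^ n)) with hg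
  set z : Fin 6 → 𝓡 := fun k => ψ (π (cubicBasis k)) with hz
  -- The pairing φ(ab) is perfect: 1, X₀, X₀², X₀³ pair antitriangularly with ones on the
  -- antidiagonal, X₃ and X₃² pair to γ, and mixed products give zero. The coefficients of the
  -- multiplier are obtained from the values of ψ by back substitution.
  set c3 := z 0
  set c2 := z 1 - c3 * g 4
  set c1 := z 2 - c2 * g 4 - c3 * g 5
  set c0 := z 3 - c1 * g 4 - c2 * g 5 - c3 * g 6
  set c5 := C γ⁻¹ * z 4
  set c4 := C γ⁻¹ * (z 5 - c5 * φ (π (X 3 ^ 4)))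
  set c : Fin 6 → 𝓡 := ![c0, c1, c2, c3, c4, c5] with hc
  have hC : (C γ⁻¹ * C γ : 𝓡) = 1 := by rw [← C_mul, inv_mul_cancel₀ hγ, C_1]
  have hlin := h.coordForm_isSection.linear
  have hcomb : ∀ r f, φ (π (cubicComb r) * π f) = ∑ k, r k * φ (π (cubicBasis k * f)) := by
    intro r f
    rw [cubicComb, map_sum, Finset.sum_mul, map_sum]
    refine sum_congr rfl fun k _ => ?_
    rw [map_mul π, mul_assoc, hlin, map_mul π]
  have e0 : φ (π 1) = 0 := h.coordForm_bin_mul (r := 1) (k := 0) (by decide)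
    (by simp [cubicBasis])
  have e1 : φ (π (X 0)) = 0 := h.coordForm_bin_mul (r := 1) (k := 1) (by decide)
    (by simp [cubicBasis])
  have e2 : φ (π (X 0 ^ 2)) = 0 := h.coordForm_bin_mul (r := 1) (k := 2) (by decide)
    (by simp [cubicBasis])
  have e3 : φ (π (X 0 ^ 3)) = 1 := h.coordForm_cube
  have e4 : φ (π (X 3)) = 0 := h.coordForm_bin_mul (r := 1) (k := 4) (by decide)
    (by simp [cubicBasis])
  have e5 : φ (π (X 3 ^ 2)) = 0 := h.coordForm_bin_mul (r := 1) (k := 5) (by decide)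
    (by simp [cubicBasis])
  have emul : ∀ f, φ (π (X 0 * X 3 * f)) = X 0 * X 1 * φ (π f) := by
    intro f
    have h1 := h.span_le (segre_mul_sub_mem F f)
    rw [map_sub, sub_eq_zero] at h1
    rw [h1, ← hlin, ← map_mul π]
    simp [hφ]
  have key : ψ = ringSmul (π (cubicComb c)) φ := by
    refine h.ext_of_linear hψ (hlin.ringSmul _) fun k => ?_
    rw [ringSmul_apply, hcomb, Fin.sum_univ_six]
    have hzk : ψ (π (cubicBasis k)) = z k := rfl
    rw [hzk]
    have m14 : φ (π (X 0 * X 3)) = 0 := by have := emul 1; rwa [e0, mul_zero, mul_one] at this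
    have m24 : φ (π (X 0 ^ 2 * X 3)) = 0 := by
      have := emul (X 0); rw [e1, mul_zero] at this; rw [← this]; congr 2; ring
    have m34 : φ (π (X 0 ^ 3 * X 3)) = 0 := by
      have := emul (X 0 ^ 2); rw [e2, mul_zero] at this; rw [← this]; congr 2; ring
    have m15 : φ (π (X 0 * X 3 ^ 2)) = 0 := by
      have := emul (X 3); rw [e4, mul_zero] at this; rw [← this]; congr 2; ring
    have m25 : φ (π (X 0 ^ 2 * X 3 ^ 2)) = 0 := by
      have := emul (X 0 * X 3); rw [m14, mul_zero] at this; rw [← this]; congr 2; ring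
    have m35 : φ (π (X 0 ^ 3 * X 3 ^ 2)) = 0 := by
      have := emul (X 0 ^ 2 * X 3); rw [m24, mul_zero] at this; rw [← this]; congr 2; ring
    have p : ∀ n : ℕ, φ (π (X 0 ^ n)) = g n := fun _ => rfl
    have hk : ∀ i j : ℕ, φ (π (X 0 ^ i * X 0 ^ j)) = g (i + j) := fun i j => by rw [← pow_add]
    fin_cases k
    · change z 0 = c0 * φ (π (1 * 1)) + c1 * φ (π (X 0 * 1)) + c2 * φ (π (X 0 ^ 2 * 1)) +
        c3 * φ (π (X 0 ^ 3 * 1)) + c4 * φ (π (X 3 * 1)) + c5 * φ (π (X 3 ^ 2 * 1))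
      simp only [mul_one, e0, e1, e2, e3, e4, e5]
      simp [c3]
    · change z 1 = c0 * φ (π (1 * X 0)) + c1 * φ (π (X 0 * X 0)) + c2 * φ (π (X 0 ^ 2 * X 0)) +
        c3 * φ (π (X 0 ^ 3 * X 0)) + c4 * φ (π (X 3 * X 0)) + c5 * φ (π (X 3 ^ 2 * X 0))
      rw [mul_comm (X 3) (X 0), mul_comm (X 3 ^ 2) (X 0), m14, m15, one_mul, e1, ← sq, e2,
        ← pow_succ, e3, ← pow_succ, p]
      simp only [c2]; ring
    · change z 2 = c0 * φ (π (1 * X 0 ^ 2)) + c1 * φ (π (X 0 * X 0 ^ 2)) +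
        c2 * φ (π (X 0 ^ 2 * X 0 ^ 2)) + c3 * φ (π (X 0 ^ 3 * X 0 ^ 2)) +
        c4 * φ (π (X 3 * X 0 ^ 2)) + c5 * φ (π (X 3 ^ 2 * X 0 ^ 2))
      rw [mul_comm (X 3) (X 0 ^ 2), mul_comm (X 3 ^ 2) (X 0 ^ 2), m24, m25, one_mul, e2, hk, hk,
        ← pow_succ', e3]
      simp only [c1]; ring
    · change z 3 = c0 * φ (π (1 * X 0 ^ 3)) + c1 * φ (π (X 0 * X 0 ^ 3)) +
        c2 * φ (π (X 0 ^ 2 * X 0 ^ 3)) + c3 * φ (π (X 0 ^ 3 * X 0 ^ 3)) +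
        c4 * φ (π (X 3 * X 0 ^ 3)) + c5 * φ (π (X 3 ^ 2 * X 0 ^ 3))
      rw [mul_comm (X 3) (X 0 ^ 3), mul_comm (X 3 ^ 2) (X 0 ^ 3), m34, m35, one_mul, e3, hk, hk,
        ← pow_succ', p]
      simp only [c0]; ring
    · change z 4 = c0 * φ (π (1 * X 3)) + c1 * φ (π (X 0 * X 3)) +
        c2 * φ (π (X 0 ^ 2 * X 3)) + c3 * φ (π (X 0 ^ 3 * X 3)) +
        c4 * φ (π (X 3 * X 3)) + c5 * φ (π (X 3 ^ 2 * X 3))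
      rw [one_mul, e4, m14, m24, m34, ← sq, e5, ← pow_succ, hγ3]
      simp only [c5]
      linear_combination (-z 4) * hC
    · change z 5 = c0 * φ (π (1 * X 3 ^ 2)) + c1 * φ (π (X 0 * X 3 ^ 2)) +
        c2 * φ (π (X 0 ^ 2 * X 3 ^ 2)) + c3 * φ (π (X 0 ^ 3 * X 3 ^ 2)) +
        c4 * φ (π (X 3 * X 3 ^ 2)) + c5 * φ (π (X 3 ^ 2 * X 3 ^ 2))
      rw [one_mul, e5, m15, m25, m35, ← pow_succ', hγ3, ← pow_add]
      simp only [c4]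
      linear_combination (-(z 5 - c5 * φ (π (X 3 ^ 4)))) * hC
  refine ⟨_, key, fun hsec => ?_⟩
  -- the degrees of the coefficients
  have hdegk : ∀ (k : Fin 6) (d : ℕ), (cubicBasis k).IsHomogeneous d → HasDegree (z k) (d - 2) := by
    intro k d hd
    have := hsec.hasDegree d _ hd
    rwa [add_zero] at this
  have hX : ∀ (i : Fin 4) (n : ℕ), (X i ^ n : CoordRing).IsHomogeneous n := fun i n =>
    isHomogeneous_X_pow i n
  -- For a section of twist 0, the coefficients in negative degree vanish. The constants c1, c4 and
  -- the linear form c0 remain, and these assemble to a linear form in the four coordinates.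
  have z0 : c3 = 0 := (hdegk 0 0 (isHomogeneous_one _ _)).eq_zero_of_neg (by norm_num)
  have z1 : z 1 = 0 := (hdegk 1 1 (isHomogeneous_X ℂ 0)).eq_zero_of_neg (by norm_num)
  have z4 : z 4 = 0 := (hdegk 4 1 (isHomogeneous_X ℂ 3)).eq_zero_of_neg (by norm_num)
  have z2 : c2 = 0 := by simp [c2, z0, z1]
  have z5 : c5 = 0 := by simp [c5, z4]
  have hg4 : HasDegree (g 4) 1 := by
    have := h.coordForm_isSection.hasDegree 4 _ (hX 0 4)
    rwa [show ((4 : ℕ) : ℤ) + -1 - 2 = 1 by norm_num] at this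
  have d1 : HasDegree c1 0 := by
    have := hdegk 2 2 (hX 0 2)
    simpa [c1, z0, z2] using this
  have d4 : HasDegree c4 0 := by
    have := hdegk 5 2 (hX 3 2)
    rw [Nat.cast_ofNat, sub_self] at this
    have h1 := this.smul γ⁻¹
    rw [smul_eq_C_mul] at h1
    simpa [c4, z5] using h1
  have d0 : HasDegree c0 1 := by
    have h1 := hdegk 3 3 (hX 0 3)
    have h2 := (d1.mul hg4).smul (-1)
    norm_num at h1 h2
    have h3 := h1.add h2
    simpa [c0, z0, z2, sub_eq_add_neg] using h3
  have d0' : c0 ∈ homogeneousSubmodule (Fin 2) ℂ 1 := HasDegree.isHomogeneous (n := 1) (by exact_mod_cast d0)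
  rw [homogeneousSubmodule_one_eq_span_X] at d0'
  obtain ⟨a, ha⟩ := (Submodule.mem_span_range_iff_exists_fun ℂ).1 d0'
  refine ⟨![coeff 0 c1, a 0, a 1, coeff 0 c4], ?_⟩
  congr 1
  have hb : bin c0 = a 0 • X 1 + a 1 • X 2 := by
    rw [← ha, Fin.sum_univ_two, map_add, map_smul, map_smul]
    simp
  have hb1 : bin c1 = C (coeff 0 c1) := by
    conv_lhs => rw [d1.eq_C]
    exact algHom_C _ _
  have hb4 : bin c4 = C (coeff 0 c4) := by
    conv_lhs => rw [d4.eq_C]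
    exact algHom_C _ _
  rw [cubicComb, Fin.sum_univ_six, Fin.sum_univ_four]
  change bin c0 * 1 + bin c1 * X 0 + bin c2 * X 0 ^ 2 + bin c3 * X 0 ^ 3 + bin c4 * X 3 +
    bin c5 * X 3 ^ 2 = coeff 0 c1 • X 0 + a 0 • X 1 + a 1 • X 2 + coeff 0 c4 • X 3
  rw [hb, hb1, hb4, z2, z0, z5, smul_eq_C_mul, smul_eq_C_mul, smul_eq_C_mul, smul_eq_C_mul]
  simp only [map_zero]
  ring

/-- The multiples of `coordForm` by linear forms are independent. -/
lemma linear_independent {c : Fin 4 → ℂ} (hc : π (∑ k, c k • X k) = 0) : c = 0 := by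
  have h1 : (∑ k, c k • X k : CoordRing) =
      cubicComb ![c 1 • X 0 + c 2 • X 1, C (c 0), 0, 0, C (c 3), 0] := by
    rw [cubicComb, Fin.sum_univ_six, Fin.sum_univ_four]
    change _ = bin (c 1 • X 0 + c 2 • X 1) * 1 + bin (C (c 0)) * X 0 + bin 0 * X 0 ^ 2 +
      bin 0 * X 0 ^ 3 + bin (C (c 3)) * X 3 + bin 0 * X 3 ^ 2
    have hC : ∀ a : ℂ, bin (C a) = C a := fun a => algHom_C _ _
    have h0 : bin (c 1 • X 0 + c 2 • X 1) = c 1 • X 1 + c 2 • X 2 := by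
      rw [map_add, map_smul, map_smul, aeval_X, aeval_X]
      rfl
    rw [h0, hC, hC, map_zero, smul_eq_C_mul, smul_eq_C_mul, smul_eq_C_mul, smul_eq_C_mul]
    ring
  rw [h1] at hc
  have h2 := h.indep _ hc
  have h3 : c 1 • X 0 + c 2 • X 1 = (0 : 𝓡) := congrFun h2 0
  have h4 : (C (c 0) : 𝓡) = 0 := congrFun h2 1
  have h5 : (C (c 3) : 𝓡) = 0 := congrFun h2 4
  have h6 := congrArg (eval ![1, 0]) h3
  have h7 := congrArg (eval ![0, 1]) h3
  simp [smul_eq_C_mul] at h4 h5 h6 h7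
  ext k
  fin_cases k
  · exact h4
  · exact h6
  · exact h7
  · exact h5

end IsNormalCubic

/-- Incomparability of primes in an integral extension bounds the dimension above; lying over for
the bottom of a chain and going up for the rest bound it below. -/
lemma ringKrullDim_eq_of_isIntegral {R S : Type*} [CommRing R] [CommRing S] [IsDomain S]
    [Algebra R S] [Algebra.IsIntegral R S] (hinj : Injective (algebraMap R S)) :
    ringKrullDim S = ringKrullDim R := by
  apply le_antisymm
  · refine Order.krullDim_le_of_strictMono (PrimeSpectrum.comap (algebraMap R S)) ?_
    intro P Q hPQ
    exact Ideal.IsIntegral.comap_lt_comap (I := P.asIdeal) (J := Q.asIdeal) hPQ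
  · refine iSup_le fun l => ?_
    obtain ⟨Q, -, hQ, hQl⟩ := Ideal.exists_ideal_over_prime_of_isIntegral
      (RelSeries.head l).asIdeal (⊥ : Ideal S)
      (by rw [← RingHom.ker_eq_comap_bot, (RingHom.injective_iff_ker_eq_bot _).1 hinj]; exact bot_le)
    have : Q.LiesOver (RelSeries.head l).asIdeal := ⟨hQl.symm⟩
    obtain ⟨L, hL, -⟩ := Ideal.exists_ltSeries_of_hasGoingUp l Q
    rw [← hL]
    exact Order.LTSeries.length_le_krullDim L

/-- A linear change of coordinates. -/
def PreservesDegree (Φ : CoordRing ≃ₐ[ℂ] CoordRing) : Prop :=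
  ∀ (d : ℕ) (f : CoordRing), (Φ f).IsHomogeneous d ↔ f.IsHomogeneous d

namespace IsNormalCubic

variable {A : Type} [CommRing A] [Algebra ℂ A] {π : CoordRing →ₐ[ℂ] A} {F : CoordRing}

lemma ringKrullDim_eq [IsDomain A] (h : IsNormalCubic π F) : ringKrullDim A = 2 := by
  let _ : Algebra 𝓡 A := (π.comp bin).toRingHom.toAlgebra
  have hsmul : ∀ (r : 𝓡) (a : A), r • a = π (bin r) * a := fun r a => by rw [Algebra.smul_def]; rfl
  have hfin : Module.Finite 𝓡 A := by
    refine Module.Finite.of_surjective (Fintype.linearCombination 𝓡 fun k => π (cubicBasis k)) ?_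
    intro a
    obtain ⟨r, rfl⟩ := h.exists_coords a
    refine ⟨r, ?_⟩
    rw [Fintype.linearCombination_apply, cubicComb, map_sum]
    exact sum_congr rfl fun k _ => by rw [hsmul, map_mul]
  have hinj : Injective (algebraMap 𝓡 A) := by
    rw [injective_iff_map_eq_zero]
    intro r hr
    have h1 : π (cubicComb (Pi.single 0 r)) = 0 := by
      rw [cubicComb_single, map_mul, show π (bin r) = 0 from hr, zero_mul]
    simpa using congrFun (h.indep _ h1) 0
  rw [ringKrullDim_eq_of_isIntegral hinj, MvPolynomial.ringKrullDim_of_isNoetherianRing,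
    ringKrullDim_eq_zero_of_field]
  simp

end IsNormalCubic

lemma exists_basis_of_combinations {M : Type*} [AddCommGroup M] [Module ℂ M] {S : Submodule ℂ M}
    {s : Fin 4 → M} (hs : ∀ k, s k ∈ S) (h1 : ∀ c : Fin 4 → ℂ, ∑ k, c k • s k = 0 → c = 0)
    (h2 : ∀ x ∈ S, ∃ c : Fin 4 → ℂ, x = ∑ k, c k • s k) :
    ∃ b : Module.Basis (Fin 4) ℂ S, ∀ k, (b k).1 = s k := by
  let s' : Fin 4 → S := fun k => ⟨s k, hs k⟩
  have hcoe : ∀ c : Fin 4 → ℂ, (∑ k, c k • s' k).1 = ∑ k, c k • s k := fun c => by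
    rw [Submodule.coe_sum]; rfl
  have hli : LinearIndependent ℂ s' := by
    rw [Fintype.linearIndependent_iff]
    intro c hc
    exact congrFun (h1 c (by rw [← hcoe, hc]; rfl))
  refine ⟨Module.Basis.mk hli ?_, fun k => by rw [Module.Basis.mk_apply]⟩
  rintro ⟨x, hx⟩ -
  obtain ⟨c, hc⟩ := h2 x hx
  have h3 : (⟨x, hx⟩ : S) = ∑ k, c k • s' k := Subtype.ext (by rw [hcoe]; exact hc)
  rw [h3]
  exact Submodule.sum_mem _ fun k _ => Submodule.smul_mem _ _ (Submodule.subset_span ⟨k, rfl⟩)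

/-! ### Canonical embedding of cubic sections of the quadric -/

namespace IntegralCurve

/-- A curve with the coordinate ring of a normal cubic is canonically embedded. -/
theorem isCanonicallyEmbedded_of_isNormalCubic (C : IntegralCurve) {Φ : CoordRing ≃ₐ[ℂ] CoordRing}
    (hΦ : PreservesDegree Φ) {F : CoordRing}
    (h : IsNormalCubic (C.toRingₐ.comp Φ.toAlgHom) F) : C.IsCanonicallyEmbedded := by
  set π : CoordRing →ₐ[ℂ] C.Ring := C.toRingₐ.comp Φ.toAlgHom with hπ
  have hπΦ : ∀ f, π (Φ.symm f) = C.toRing f := fun f => by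
    change C.toRing (Φ (Φ.symm f)) = _
    rw [apply_symm_apply]
  have hhom : ∀ (d : ℕ) (f : CoordRing), f.IsHomogeneous d → (Φ.symm f).IsHomogeneous d := by
    intro d f hf
    rw [← hΦ, apply_symm_apply]
    exact hf
  have hlin : ∀ r, π (bin r) = C.toRing (aeval ![Φ (X 1), Φ (X 2)] r) := by
    intro r
    have : (Φ : CoordRing →ₐ[ℂ] CoordRing).comp bin = aeval ![Φ (X 1), Φ (X 2)] := by
      refine algHom_ext fun i => ?_
      fin_cases i <;> simp [bin]
    rw [← this]
    rfl
  have hlinear : ∀ ψ, IsProjLinear π (X 1) (X 2) ψ ↔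
      IsProjLinear C.toRingₐ (Φ (X 1)) (Φ (X 2)) ψ := by
    intro ψ
    refine forall_congr' fun r => forall_congr' fun a => ?_
    rw [hlin]
    rfl
  have hsection : ∀ n ψ, IsSection π (X 1) (X 2) n ψ ↔
      IsSection C.toRingₐ (Φ (X 1)) (Φ (X 2)) n ψ := by
    intro n ψ
    constructor
    · rintro ⟨h1, h2⟩
      refine ⟨(hlinear ψ).1 h1, fun m f hf => ?_⟩
      have := h2 m _ (hhom m f hf)
      rwa [hπΦ] at this
    · rintro ⟨h1, h2⟩
      exact ⟨(hlinear ψ).2 h1, fun m f hf => h2 m (Φ f) ((hΦ m f).2 hf)⟩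
  -- At a common zero of X₁ and X₂ the quadric gives X₀X₃ = 0 and the cubic gives α X₀³ + β X₃³ = 0,
  -- so all coordinates vanish.
  have hproj : C.IsProjection (Φ (X 1)) (Φ (X 2)) := by
    refine ⟨(hΦ 1 _).2 (isHomogeneous_X ℂ 1), (hΦ 1 _).2 (isHomogeneous_X ℂ 2), ?_⟩
    rintro p hp ⟨h1, h2⟩
    set ev : CoordRing →ₐ[ℂ] ℂ := (aeval p.rep).comp Φ.toAlgHom with hev
    have hevap : ∀ f, ev f = eval p.rep (Φ f) := fun f => rfl
    have hker : ∀ f, π f = 0 → ev f = 0 := fun f hf => hp _ (C.toRing_eq_zero.1 hf)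
    have e1 : ev (X 1) = 0 := h1
    have e2 : ev (X 2) = 0 := h2
    have es := hker _ h.segre_eq
    simp only [segre, map_sub, map_mul, e1, e2, mul_zero, sub_zero, mul_eq_zero] at es
    obtain ⟨ρ, hρ3, hρd, hρ⟩ := cubic_normal_form h.isHomogeneous
    have eF : coeff (single 0 3) F * ev (X 0) ^ 3 + coeff (single 3 3) F * ev (X 3) ^ 3 = 0 := by
      have h3 := hker _ h.eq_zero
      have h4 := hker _ (h.span_le (Ideal.span_mono (t := {segre, F}) (by simp) hρ))
      have h5 : ev (cubicComb ρ) = 0 := by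
        rw [cubicComb, map_sum]
        refine Finset.sum_eq_zero fun k _ => ?_
        by_cases hk : k = 3
        · rw [hk, hρ3, map_zero, zero_mul, map_zero]
        · have h6 : ev (bin (ρ k)) = eval ![0, 0] (ρ k) := by
            have : ev.comp bin = aeval ![0, 0] := by
              refine algHom_ext fun i => ?_
              fin_cases i
              · simpa [bin] using e1
              · simpa [bin] using e2
            exact DFunLike.congr_fun this (ρ k)
          have h7 : coeff 0 (ρ k) = 0 := by
            by_contra hne
            have h8 := HasDegree.iff_coeff.1 (hρd k) 0 hne
            fin_cases k <;> simp [cubicBasisDegree] at h8 hk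
          have h9 : eval ![0, 0] (ρ k) = coeff 0 (ρ k) := by
            rw [show (![0, 0] : Fin 2 → ℂ) = 0 by ext i; fin_cases i <;> rfl]
            rw [eval_zero, constantCoeff_eq]
          rw [map_mul, h6, h9, h7, zero_mul]
      rw [map_sub, map_add, map_add, h3, h5, map_smul, map_smul, map_pow, map_pow] at h4
      simp only [smul_eq_mul] at h4
      linear_combination -h4
    have hz : ∀ k, ev (X k) = 0 := by
      intro k
      rcases es with h0 | h0
      · have h3 : ev (X 3) = 0 := by simpa [h0, h.coeff_three] using eF
        fin_cases k
        exacts [h0, e1, e2, h3]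
      · have h3 : ev (X 0) = 0 := by simpa [h0, h.coeff_zero] using eF
        fin_cases k
        exacts [h3, e1, e2, h0]
    apply p.rep_nonzero
    ext i
    obtain ⟨c, hc⟩ := exists_eq_sum_X (hhom 1 _ (isHomogeneous_X ℂ i))
    have h3 : p.rep i = ev (Φ.symm (X i)) := by rw [hevap, apply_symm_apply, eval_X]
    rw [h3, hc, map_sum]
    exact Finset.sum_eq_zero fun k _ => by rw [map_smul, hz, smul_zero]
  set φ := h.coordForm with hφ
  have hφs : IsSection C.toRingₐ (Φ (X 1)) (Φ (X 2)) (-1) φ := (hsection _ _).1 h.coordForm_isSection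
  have hφ0 : φ ≠ 0 := by
    intro h0
    have := h.coordForm_cube
    rw [← hφ, h0] at this
    simp at this
  have hs : ∀ k, IsSection C.toRingₐ (Φ (X 1)) (Φ (X 2)) 0 (ringSmul (C.toRing (X k)) φ) := fun k => by
    simpa using hφs.ringSmul (isHomogeneous_X ℂ k)
  have hsum : ∀ c : Fin 4 → ℂ, ∑ k, c k • ringSmul (C.toRing (X k)) φ =
      ringSmul (C.toRing (∑ k, c k • X k)) φ := by
    intro c
    rw [map_sum, ringSmul_sum]
    exact sum_congr rfl fun k _ => (ringSmul_smul _ _ _).symm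
  obtain ⟨s, hsφ⟩ := exists_basis_of_combinations (M := C.Ring →ₗ[ℂ] 𝓡)
    (S := C.dualizingSections (Φ (X 1)) (Φ (X 2)) 0) (s := fun k => ringSmul (C.toRing (X k)) φ)
    (fun k => C.mem_dualizingSections.2 (hs k)) (by
      intro c hc
      rw [hsum] at hc
      have h2 : C.toRing (∑ k, c k • X k) = 0 := by
        by_contra hne
        exact hφ0 (hproj.eq_zero_of_ringSmul hφs.linear hne hc)
      rw [← hπΦ] at h2
      obtain ⟨c', hc'⟩ := exists_eq_sum_X (hhom 1 _ (isHomogeneous_sum_X c))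
      rw [hc'] at h2
      have h3 := h.linear_independent h2
      rw [h3] at hc'
      have h4 : (∑ k, c k • X k : CoordRing) = 0 := by
        apply Φ.symm.injective
        rw [hc', map_zero]
        simp
      ext k
      have := congrArg (coeff (single k 1)) h4
      simpa [coeff_sum, coeff_X, Finsupp.single_left_inj] using this) (by
      intro ψ hψ
      have h1 := (hsection 0 ψ).2 (C.mem_dualizingSections.1 hψ)
      obtain ⟨b, hb, hb'⟩ := h.exists_ringSmul h1.linear
      obtain ⟨c, rfl⟩ := hb' h1
      obtain ⟨c', hc'⟩ := exists_eq_sum_X ((hΦ 1 _).2 (isHomogeneous_sum_X c))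
      refine ⟨c', ?_⟩
      rw [hsum, ← hc']
      exact hb)
  refine ⟨Φ (X 1), Φ (X 2), hproj, s, fun j k a => ?_, fun j n ψ hψ => ?_⟩
  · rw [hsφ, hsφ]
    change φ (C.toRing (X k) * (C.toRing (X j) * a)) = φ (C.toRing (X j) * (C.toRing (X k) * a))
    rw [mul_left_comm]
  · obtain ⟨b, hb, -⟩ := h.exists_ringSmul ((hlinear ψ).2 (C.mem_dualizingSections.1 hψ).linear)
    refine ⟨1, b, fun a => ?_⟩
    rw [hsφ, hb, pow_one]
    change φ (b * (C.toRing (X j) * a)) = φ (C.toRing (X j) * (b * a))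
    rw [mul_left_comm]

end IntegralCurve

/-! ### Rational functions -/

/-- The field of rational functions of one variable. -/
abbrev RatField : Type := RatFunc ℂ

/-- A polynomial as a rational function. -/
abbrev toRat : ℂ[X] →+* RatField := algebraMap ℂ[X] (RatFunc ℂ)

lemma toRat_injective : Injective toRat := RatFunc.algebraMap_injective ℂ

lemma toRat_ne_zero {p : ℂ[X]} (hp : p ≠ 0) : toRat p ≠ 0 := by
  rwa [Ne, map_eq_zero_iff _ toRat_injective]

lemma toRat_C (c : ℂ) : toRat (𝐂 c) = algebraMap ℂ RatField c := by rw [RatFunc.algebraMap_C]; rfl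

/-- A coprime numerator and denominator agree with the reduced ones up to units, so they have the
same degrees. -/
lemma finrank_adjoin_div {N D : ℂ[X]} (h : IsCoprime N D) (hN : N ≠ 0) (hD : D ≠ 0) :
    finrank (adjoin ℂ {toRat N / toRat D}) RatField = max N.natDegree D.natDegree := by
  rw [RatFunc.finrank_eq_max_natDegree]
  set w := toRat N / toRat D with hw
  have hw0 : w ≠ 0 := div_ne_zero (toRat_ne_zero hN) (toRat_ne_zero hD)
  have h1 : w.num ∣ N := RatFunc.num_div_dvd N hD
  have h2 : w.denom ∣ D := RatFunc.denom_div_dvd N D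
  have h3 : w.num * D = N * w.denom := by rw [RatFunc.num_mul_eq_mul_denom_iff hD]
  have h4 : N ∣ w.num := h.dvd_of_dvd_mul_right ⟨_, h3⟩
  have h5 : D ∣ w.denom := h.symm.dvd_of_dvd_mul_left ⟨w.num, by rw [← h3, mul_comm]⟩
  have h6 : w.num.natDegree = N.natDegree := le_antisymm (Polynomial.natDegree_le_of_dvd h1 hN)
    (Polynomial.natDegree_le_of_dvd h4 (RatFunc.num_ne_zero hw0))
  have h7 : w.denom.natDegree = D.natDegree := le_antisymm (Polynomial.natDegree_le_of_dvd h2 hD)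
    (Polynomial.natDegree_le_of_dvd h5 w.denom_ne_zero)
  rw [h6, h7]

lemma isCoprime_of_no_common_root {p q : ℂ[X]} (h : ∀ x, p.eval x = 0 → q.eval x ≠ 0) :
    IsCoprime p q := by
  rw [Polynomial.isCoprime_iff_aeval_ne_zero_of_isAlgClosed ℂ ℂ]
  intro x
  by_cases hx : p.eval x = 0
  · right; simpa [Polynomial.coe_aeval_eq_eval] using h x hx
  · left; simpa [Polynomial.coe_aeval_eq_eval] using hx

lemma eval_ne_zero_of_isCoprime {p q : ℂ[X]} (h : IsCoprime p q) {x : ℂ}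
    (hx : p.eval x = 0) : q.eval x ≠ 0 := by
  obtain ⟨a, b, hab⟩ := h
  intro hq
  have := congrArg (Polynomial.eval x) hab
  simp [hx, hq] at this

/-- Powers of a generator are independent up to the degree of the extension. -/
lemma eq_zero_of_aeval_generator {L : Type*} [Field L] [Algebra ℂ L] (K : IntermediateField ℂ L)
    {a : L} (hK : adjoin K {a} = ⊤) {n : ℕ} (hn : finrank K L = n)
    (hn0 : 0 < n) {p : Polynomial K} (hp : p.natDegree < n) (hpa : Polynomial.aeval a p = 0) :
    p = 0 := by
  have : FiniteDimensional K L := Module.finite_of_finrank_pos (by omega)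
  have hint : IsIntegral K a := Algebra.IsIntegral.isIntegral a
  have h1 := IntermediateField.adjoin.finrank hint
  rw [hK, IntermediateField.finrank_top', hn] at h1
  by_contra hne
  have := Polynomial.natDegree_le_of_dvd (minpoly.dvd K a hpa) hne
  omega

/-! ### Linear changes of coordinates -/

/-- The change of coordinates with the matrix `M`, whose inverse is `N`. -/
def changeCoords (M N : Matrix (Fin 4) (Fin 4) ℂ) (h : M * N = 1) : CoordRing ≃ₐ[ℂ] CoordRing :=
  AlgEquiv.ofAlgHom (aeval fun k => ∑ j, M k j • X j) (aeval fun k => ∑ j, N k j • X j) (by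
      refine algHom_ext fun k => ?_
      have h' : N * M = 1 := mul_eq_one_comm.1 h
      simp only [AlgHom.comp_apply, aeval_X, map_sum, map_smul, Finset.smul_sum, smul_smul,
        AlgHom.id_apply]
      rw [Finset.sum_comm]
      have h2 : ∀ i, ∑ j, (N k j * M j i) • (X i : CoordRing) = (1 : Matrix _ _ ℂ) k i • X i := by
        intro i
        rw [← Finset.sum_smul, ← h', Matrix.mul_apply]
      simp only [h2, Matrix.one_apply, ite_smul, one_smul, zero_smul, Finset.sum_ite_eq,
        mem_univ, if_true])
    (by
      refine algHom_ext fun k => ?_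
      simp only [AlgHom.comp_apply, aeval_X, map_sum, map_smul, Finset.smul_sum, smul_smul,
        AlgHom.id_apply]
      rw [Finset.sum_comm]
      have h2 : ∀ i, ∑ j, (M k j * N j i) • (X i : CoordRing) = (1 : Matrix _ _ ℂ) k i • X i := by
        intro i
        rw [← Finset.sum_smul, ← h, Matrix.mul_apply]
      simp only [h2, Matrix.one_apply, ite_smul, one_smul, zero_smul, Finset.sum_ite_eq,
        mem_univ, if_true])

section changeCoords

variable (M N : Matrix (Fin 4) (Fin 4) ℂ) (h : M * N = 1)

lemma changeCoords_X (k : Fin 4) : changeCoords M N h (X k) = ∑ j, M k j • X j := by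
  change aeval _ (X k) = _
  rw [aeval_X]

lemma changeCoords_symm_X (k : Fin 4) : (changeCoords M N h).symm (X k) = ∑ j, N k j • X j := by
  change aeval _ (X k) = _
  rw [aeval_X]

lemma changeCoords_preservesDegree : PreservesDegree (changeCoords M N h) := by
  have key : ∀ (T : Matrix (Fin 4) (Fin 4) ℂ) (d : ℕ) (f : CoordRing), f.IsHomogeneous d →
      (aeval (fun k => ∑ j, T k j • X j) f : CoordRing).IsHomogeneous d := by
    intro T d f hf
    have := hf.aeval (fun k => ∑ j, T k j • X j : Fin 4 → CoordRing) (n := 1)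
      (fun k => isHomogeneous_sum_X (T k))
    rwa [one_mul] at this
  intro d f
  refine ⟨fun hf => ?_, fun hf => key M d f hf⟩
  have := key N d _ hf
  have h2 : (changeCoords M N h).symm (changeCoords M N h f) = f := AlgEquiv.symm_apply_apply _ _
  rwa [← h2]

end changeCoords

lemma PreservesDegree.trans {Φ Ψ : CoordRing ≃ₐ[ℂ] CoordRing} (hΦ : PreservesDegree Φ)
    (hΨ : PreservesDegree Ψ) : PreservesDegree (Φ.trans Ψ) := fun d f => by
  rw [AlgEquiv.trans_apply, hΨ, hΦ]

lemma PreservesDegree.symm {Φ : CoordRing ≃ₐ[ℂ] CoordRing} (hΦ : PreservesDegree Φ) :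
    PreservesDegree Φ.symm := fun d f => by
  rw [← hΦ, apply_symm_apply]

lemma PreservesDegree.homogeneousComponent {Φ : CoordRing ≃ₐ[ℂ] CoordRing} (hΦ : PreservesDegree Φ)
    (d : ℕ) (f : CoordRing) :
    MvPolynomial.homogeneousComponent d (Φ f) = Φ (MvPolynomial.homogeneousComponent d f) := by
  conv_lhs => rw [← sum_homogeneousComponent f, map_sum, map_sum]
  have h : ∀ i, MvPolynomial.homogeneousComponent d (Φ (MvPolynomial.homogeneousComponent i f)) =
      if i = d then Φ (MvPolynomial.homogeneousComponent d f) else 0 := by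
    intro i
    rw [homogeneousComponent_of_mem (show _ ∈ 𝓢 i from
      (hΦ i _).2 (homogeneousComponent_isHomogeneous i f))]
    by_cases hi : i = d
    · simp [hi]
    · simp [hi, Ne.symm hi]
  simp_rw [h]
  rw [Finset.sum_ite_eq' (Finset.range (f.totalDegree + 1)) d]
  split_ifs with hd
  · rfl
  · rw [homogeneousComponent_eq_zero d f (by simpa using hd), map_zero]

/-! ### The cone over a point with coordinates in a field extension -/

section Cone

variable {L : Type} [Field L] [Algebra ℂ L]

/-- Evaluation at the generic point of the line through `ζ`. -/
def coneHom (ζ : Fin 4 → L) : CoordRing →ₐ[ℂ] Polynomial L :=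
  aeval fun k => 𝐂 (ζ k) * 𝐗

lemma coneHom_of_isHomogeneous (ζ : Fin 4 → L) {d : ℕ} {f : CoordRing} (hf : f.IsHomogeneous d) :
    coneHom ζ f = 𝐂 (aeval ζ f) * 𝐗 ^ d := by
  have h1 : coneHom ζ f = aeval (fun k => 𝐗 * 𝐂 (ζ k)) f := by
    rw [coneHom]; congr 2; ext1 k; rw [mul_comm]
  have h2 : aeval (fun k => 𝐂 (ζ k)) f = 𝐂 (aeval ζ f) := by
    have := MvPolynomial.aeval_algebraMap_apply (A := L) (B := Polynomial L) ζ f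
    exact this
  rw [h1, aeval_mul_of_isHomogeneous hf, h2, mul_comm]

lemma coeff_coneHom (ζ : Fin 4 → L) (f : CoordRing) (d : ℕ) :
    (coneHom ζ f).coeff d = aeval ζ (homogeneousComponent d f) := by
  conv_lhs => rw [← sum_homogeneousComponent f, map_sum, Polynomial.finsetSum_coeff]
  have h : ∀ i, (coneHom ζ (homogeneousComponent i f)).coeff d =
      if d = i then aeval ζ (homogeneousComponent d f) else 0 := by
    intro i
    rw [coneHom_of_isHomogeneous ζ (homogeneousComponent_isHomogeneous i f),
      Polynomial.coeff_C_mul_X_pow]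
    split_ifs with hi
    · rw [hi]
    · rfl
  simp_rw [h]
  rw [Finset.sum_ite_eq (Finset.range (f.totalDegree + 1)) d]
  split_ifs with hd
  · rfl
  · rw [homogeneousComponent_eq_zero d f (by simpa using hd), map_zero]

/-- The variable of the polynomial ring over L records degrees, so the kernel of `coneHom` is the
homogeneous ideal of the point ζ; it is prime as the kernel of a map to a domain. -/
lemma coneHom_eq_zero (ζ : Fin 4 → L) {f : CoordRing} :
    coneHom ζ f = 0 ↔ ∀ d, aeval ζ (homogeneousComponent d f) = 0 := by
  rw [Polynomial.ext_iff]
  simp_rw [coeff_coneHom, Polynomial.coeff_zero]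

end Cone

/-! ### Independence of the basis of a cubic section -/

/-- The degrees of the members of `cubicBasis`, as natural numbers. -/
def cubicBasisNatDegree : Fin 6 → ℕ := ![0, 1, 2, 3, 1, 2]

lemma cubicBasisDegree_eq (k : Fin 6) : cubicBasisDegree k = cubicBasisNatDegree k := by
  fin_cases k <;> rfl

lemma cubicBasis_isHomogeneous (k : Fin 6) :
    (cubicBasis k).IsHomogeneous (cubicBasisNatDegree k) := by
  fin_cases k
  · exact isHomogeneous_one _ _
  · exact isHomogeneous_X ℂ 0
  · exact isHomogeneous_X_pow 0 2
  · exact isHomogeneous_X_pow 0 3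
  · exact isHomogeneous_X ℂ 3
  · exact isHomogeneous_X_pow 3 2

lemma bin_isHomogeneous {p : 𝓡} {d : ℕ} (hp : p.IsHomogeneous d) : (bin p).IsHomogeneous d := by
  have := hp.aeval (![X 1, X 2] : Fin 2 → CoordRing) (n := 1) (fun i => by
    fin_cases i
    · exact isHomogeneous_X ℂ 1
    · exact isHomogeneous_X ℂ 2)
  rwa [one_mul] at this

lemma CombDegree.isHomogeneous {r : Fin 6 → 𝓡} {n : ℕ} (hr : CombDegree r n) :
    (cubicComb r).IsHomogeneous n := by
  refine IsHomogeneous.sum _ _ _ fun k _ => ?_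
  by_cases h0 : r k = 0
  · rw [h0, map_zero, zero_mul]
    exact isHomogeneous_zero _ _ _
  · have h1 := hr k
    rw [cubicBasisDegree_eq] at h1
    obtain ⟨e, he⟩ := support_nonempty.2 h0
    have h2 := h1 e he
    obtain ⟨m, hm⟩ : ∃ m, n = m + cubicBasisNatDegree k := ⟨n - cubicBasisNatDegree k, by omega⟩
    rw [hm, Nat.cast_add, add_sub_cancel_right] at h1
    rw [hm]
    exact (bin_isHomogeneous h1.isHomogeneous).mul (cubicBasis_isHomogeneous k)

/-- The part of degree `n` of a combination. -/
def combComponent (r : Fin 6 → 𝓡) (n : ℕ) : Fin 6 → 𝓡 :=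
  fun k => if cubicBasisNatDegree k ≤ n then homogeneousComponent (n - cubicBasisNatDegree k) (r k)
    else 0

lemma combComponent_degree (r : Fin 6 → 𝓡) (n : ℕ) : CombDegree (combComponent r n) n := by
  intro k
  rw [combComponent]
  split_ifs with h
  · have := HasDegree.of_isHomogeneous
      (homogeneousComponent_isHomogeneous (n - cubicBasisNatDegree k) (r k))
    rwa [Nat.cast_sub h, ← cubicBasisDegree_eq] at this
  · exact HasDegree.zero

lemma homogeneousComponent_cubicComb (r : Fin 6 → 𝓡) (n : ℕ) :
    homogeneousComponent n (cubicComb r) = cubicComb (combComponent r n) := by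
  rw [cubicComb, cubicComb, map_sum]
  refine sum_congr rfl fun k _ => ?_
  conv_lhs => rw [← sum_homogeneousComponent (r k), map_sum, Finset.sum_mul, map_sum]
  have h : ∀ i, homogeneousComponent n (bin (homogeneousComponent i (r k)) * cubicBasis k) =
      if n = i + cubicBasisNatDegree k then bin (homogeneousComponent i (r k)) * cubicBasis k
      else 0 := by
    intro i
    rw [homogeneousComponent_of_mem (show _ ∈ 𝓢 _ from
      (bin_isHomogeneous (homogeneousComponent_isHomogeneous i (r k))).mul
        (cubicBasis_isHomogeneous k))]
  simp_rw [h]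
  rw [combComponent]
  split_ifs with hk
  · obtain ⟨m, hm⟩ : ∃ m, n = m + cubicBasisNatDegree k := ⟨n - cubicBasisNatDegree k, by omega⟩
    subst hm
    simp only [add_left_inj, add_tsub_cancel_right]
    rw [Finset.sum_ite_eq (Finset.range ((r k).totalDegree + 1)) m]
    split_ifs with hd
    · rfl
    · rw [homogeneousComponent_eq_zero m (r k) (by simpa using hd), map_zero, zero_mul]
  · rw [map_zero, zero_mul]
    exact Finset.sum_eq_zero fun i _ => if_neg (by omega)

/-- Setting the second variable to 1 loses nothing on forms of fixed degree, where the first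
exponent determines the second. -/
lemma eq_zero_of_aeval_transcendental {L : Type*} [Field L] [Algebra ℂ L] {w : L}
    (hw : Transcendental ℂ w) {p : 𝓡} {k : ℤ} (hp : HasDegree p k)
    (h : aeval ![w, 1] p = 0) : p = 0 := by
  set T : 𝓡 →ₐ[ℂ] ℂ[X] := aeval ![𝐗, 1] with hT
  have h1 : T p = 0 := by
    refine (transcendental_iff.1 hw) _ ?_
    rw [← h]
    have : (Polynomial.aeval w).comp T = aeval ![w, 1] := by
      refine algHom_ext fun i => ?_
      fin_cases i <;> simp [hT]
    rw [← this]; rfl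
  ext e
  rw [coeff_zero]
  by_contra hne
  have hTm : ∀ e' : Fin 2 →₀ ℕ, ∀ c, T (monomial e' c) = Polynomial.monomial (e' 0) c := by
    intro e' c
    rw [hT, aeval_monomial, Finsupp.prod_fintype _ _ (by simp), Fin.prod_univ_two]
    simp [Polynomial.C_mul_X_pow_eq_monomial]
  have h2 := congrArg (Polynomial.coeff · (e 0)) h1
  simp only [Polynomial.coeff_zero] at h2
  rw [p.as_sum, map_sum, Polynomial.finsetSum_coeff, Finset.sum_eq_single e] at h2
  · rw [hTm, Polynomial.coeff_monomial, if_pos rfl] at h2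
    exact hne h2
  · intro e' he' hne'
    rw [hTm, Polynomial.coeff_monomial, if_neg]
    intro h0
    apply hne'
    have d1 := hp e' he'
    have d2 := HasDegree.iff_coeff.1 hp e hne
    rw [Finsupp.degree_eq_sum, Fin.sum_univ_two] at d1 d2
    ext i
    fin_cases i
    · exact h0
    · simp only [Fin.isValue, Fin.mk_one]
      push_cast at d1 d2
      rw [h0] at d1
      omega
  · intro he
    rw [notMem_support_iff.1 he]
    simp

/-- The basis is independent if the ratio `w` of the middle coordinates has degree six. -/
lemma cubicComb_injective_of_finrank {L : Type} [Field L] [Algebra ℂ L] {A₀ A₁ B₀ B₁ : L}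
    (hA₀ : A₀ ≠ 0) (hA₁ : A₁ ≠ 0) (hB₀ : B₀ ≠ 0) (hB₁ : B₁ ≠ 0) {w a : L}
    (hw : w = A₀ * B₁ / (A₁ * B₀)) (ha : a = A₀ / A₁) (htr : Transcendental ℂ w)
    (hrank : finrank (adjoin ℂ {w}) L = 6)
    (hgen : adjoin (adjoin ℂ {w}) {a} = ⊤)
    {r : Fin 6 → 𝓡}
    (hr : coneHom ![A₀ * B₀, A₀ * B₁, A₁ * B₀, A₁ * B₁] (cubicComb r) = 0) : r = 0 := by
  set K := adjoin ℂ {w} with hK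
  have ha0 : a ≠ 0 := by rw [ha]; exact div_ne_zero hA₀ hA₁
  have hw0 : w ≠ 0 := by rw [hw]; exact div_ne_zero (mul_ne_zero hA₀ hB₁) (mul_ne_zero hA₁ hB₀)
  let w' : K := ⟨w, IntermediateField.mem_adjoin_simple_self ℂ w⟩
  have hw'0 : w' ≠ 0 := fun h => hw0 (congrArg Subtype.val h)
  -- Up to a scalar the point is (a, w, 1, w/a), so forms in the middle coordinates take values in K
  -- = ℂ(w).
  have hpt : ![A₀ * B₀, A₀ * B₁, A₁ * B₀, A₁ * B₁] =
      fun i => (A₁ * B₀) * (![a, w, 1, w / a] : Fin 4 → L) i := by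
    ext i
    fin_cases i <;> simp [hw, ha] <;> field_simp
  have key : ∀ (r : Fin 6 → 𝓡) (n : ℕ), CombDegree r n →
      aeval ![A₀ * B₀, A₀ * B₁, A₁ * B₀, A₁ * B₁] (cubicComb r) = 0 → r = 0 := by
    intro r n hr h0
    rw [hpt, aeval_mul_of_isHomogeneous hr.isHomogeneous] at h0
    have h1 := (mul_eq_zero.1 h0).resolve_left (pow_ne_zero _ (mul_ne_zero hA₁ hB₀))
    set γ : Fin 6 → K := fun k => aeval ![w', 1] (r k) with hγ
    have hγL : ∀ k, (γ k : L) = aeval ![w, 1] (r k) := by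
      intro k
      have : (K.val).comp (aeval ![w', 1] : 𝓡 →ₐ[ℂ] K) = aeval ![w, 1] := by
        refine algHom_ext fun i => ?_
        fin_cases i <;> simp [w']
      rw [← this]; rfl
    have hbin : ∀ p, aeval (![a, w, 1, w / a] : Fin 4 → L) (bin p) = aeval ![w, 1] p := by
      intro p
      have : (aeval (![a, w, 1, w / a] : Fin 4 → L)).comp bin = aeval ![w, 1] := by
        refine algHom_ext fun i => ?_
        fin_cases i <;> simp [bin]
      rw [← this]; rfl
    have h2 : (γ 0 : L) + γ 1 * a + γ 2 * a ^ 2 + γ 3 * a ^ 3 + γ 4 * (w / a) +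
        γ 5 * (w / a) ^ 2 = 0 := by
      rw [← h1, cubicComb, map_sum, Fin.sum_univ_six]
      simp only [map_mul, hbin, ← hγL]
      simp [cubicBasis]
    obtain ⟨δ, hδ⟩ : ∃ δ, δ = γ 5 * w' ^ 2 := ⟨_, rfl⟩
    -- The combination multiplied by a² is a polynomial of degree at most 5 in a over K, whereas a
    -- generates an extension of degree 6. The six coefficients are those of the combination up to
    -- powers of w.
    let P : Polynomial K := 𝐂 δ + 𝐂 (γ 4 * w') * 𝐗 + 𝐂 (γ 0) * 𝐗 ^ 2 + 𝐂 (γ 1) * 𝐗 ^ 3 +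
      𝐂 (γ 2) * 𝐗 ^ 4 + 𝐂 (γ 3) * 𝐗 ^ 5
    have hPdeg : P.natDegree < 6 := by
      have : P.natDegree ≤ 5 := by
        simp only [P]
        compute_degree
      omega
    have hw'L : algebraMap K L w' = w := rfl
    have hPa : Polynomial.aeval a P = 0 := by
      simp only [P, hδ, map_add, map_mul, Polynomial.aeval_C, Polynomial.aeval_X, map_pow, hw'L]
      change (γ 5 : L) * w ^ 2 + γ 4 * w * a + γ 0 * a ^ 2 + γ 1 * a ^ 3 + γ 2 * a ^ 4 +
        γ 3 * a ^ 5 = 0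
      have h3 := congrArg (· * a ^ 2) h2
      simp only [zero_mul] at h3
      rw [← h3]
      field_simp
      ring
    have hP := eq_zero_of_aeval_generator K hgen hrank (by norm_num) hPdeg hPa
    have hcoef : ∀ i, P.coeff i = 0 := fun i => by rw [hP, Polynomial.coeff_zero]
    have c0 := hcoef 0
    have c1 := hcoef 1
    have c2 := hcoef 2
    have c3 := hcoef 3
    have c4 := hcoef 4
    have c5 := hcoef 5
    simp [P, Polynomial.coeff_X, Polynomial.coeff_C] at c0 c1 c2 c3 c4 c5
    have hγ0 : ∀ k, γ k = 0 := by
      intro k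
      fin_cases k
      · exact c2
      · exact c3
      · exact c4
      · exact c5
      · exact c1.resolve_right hw'0
      · rw [hδ] at c0
        exact (mul_eq_zero.1 c0).resolve_right (pow_ne_zero 2 hw'0)
    ext1 k
    refine eq_zero_of_aeval_transcendental htr (hr k) ?_
    rw [← hγL, hγ0]; rfl
  ext1 k
  rw [← sum_homogeneousComponent (r k), Pi.zero_apply]
  refine Finset.sum_eq_zero fun m _ => ?_
  have h1 := key _ _ (combComponent_degree r (m + cubicBasisNatDegree k)) (by
    rw [← homogeneousComponent_cubicComb]
    exact (coneHom_eq_zero _).1 hr _)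
  have h2 := congrFun h1 k
  simpa [combComponent] using h2

/-! ### Rational curves on the quadric given by a pair of rational functions -/

/-- The point of the Segre quadric with the two parameters `p` and `q`. -/
def segrePoint {L : Type*} [CommRing L] (p q : L) : Fin 4 → L := ![1, q, p, p * q]

/-- The rational functions `P₁ / P₀` and `Q₁ / Q₀` have a triple pole at infinity and together
generate the field of rational functions. -/
structure IsCubicPair (P₀ P₁ Q₀ Q₁ : ℂ[X]) : Prop where
  coprime_left : IsCoprime P₀ P₁
  coprime_right : IsCoprime Q₀ Q₁
  natDegree_left : P₁.natDegree = 3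
  natDegree_right : Q₁.natDegree = 3
  natDegree_left_le : P₀.natDegree ≤ 2
  natDegree_right_le : Q₀.natDegree ≤ 2
  adjoin_eq_top : adjoin ℂ {toRat P₁ / toRat P₀, toRat Q₁ / toRat Q₀} = ⊤

namespace IntegralCurve

/-- A curve whose cone has a generic point with coordinates generating a rational function field is
rational. -/
lemma isRational_of_coneHom (C : IntegralCurve) {Φ : CoordRing ≃ₐ[ℂ] CoordRing}
    (hΦ : PreservesDegree Φ) {ζ : Fin 4 → RatField}
    (h : ∀ f, f ∈ C.ideal ↔ coneHom ζ (Φ.symm f) = 0) (hζ0 : ζ 0 = 1)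
    (hζ : adjoin ℂ (Set.range ζ) = ⊤) : C.IsRational := by
  let Fr := FractionRing (Polynomial RatField)
  let ι : C.Ring →ₐ[ℂ] Polynomial RatField := Ideal.Quotient.liftₐ C.ideal
    ((coneHom ζ).comp Φ.symm.toAlgHom) (fun f hf => (h f).1 hf)
  have hι : ∀ f, ι (C.toRing f) = coneHom ζ (Φ.symm f) := fun f => rfl
  have hinj : Injective ι := by
    rw [injective_iff_map_eq_zero]
    intro a ha
    obtain ⟨f, rfl⟩ := C.toRing_surjective a
    exact C.toRing_eq_zero.2 ((h f).2 ha)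
  let j : Polynomial RatField →ₐ[ℂ] Fr := IsScalarTower.toAlgHom ℂ _ _
  have hj : Injective j := IsFractionRing.injective (Polynomial RatField) Fr
  have hji : Injective (j.comp ι) := hj.comp hinj
  let κ : FractionRing C.Ring →ₐ[ℂ] Fr := IsFractionRing.liftAlgHom hji
  have hκ : ∀ a : C.Ring, κ (algebraMap C.Ring (FractionRing C.Ring) a) = j (ι a) := fun a =>
    IsFractionRing.lift_algebraMap hji a
  let c : RatField →ₐ[ℂ] Fr := j.comp (IsScalarTower.toAlgHom ℂ RatField (Polynomial RatField))
  set g : Fin 4 → RatField := fun i => aeval ζ (Φ.symm (X i)) with hg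
  have hX : ∀ i, κ (algebraMap C.Ring (FractionRing C.Ring) (C.toRing (X i))) = c (g i) * j 𝐗 := by
    intro i
    rw [hκ, hι, coneHom_of_isHomogeneous ζ ((hΦ.symm 1 _).2 (isHomogeneous_X ℂ i)), pow_one,
      map_mul]
    rfl
  have hjX : j 𝐗 ≠ 0 := by
    rw [Ne, map_eq_zero_iff j hj]
    exact Polynomial.X_ne_zero
  have hratio : ∀ i k, κ (algebraMap C.Ring (FractionRing C.Ring) (C.toRing (X i)) /
      algebraMap C.Ring (FractionRing C.Ring) (C.toRing (X k))) = c (g i / g k) := by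
    intro i k
    rw [map_div₀, hX, hX, mul_div_mul_right _ _ hjX, map_div₀]
  set G : Set RatField := {z | ∃ i k : Fin 4, z = g i / g k} with hG
  -- The ratios of the gᵢ generate the field of the ratios of the ζₖ, since the two systems of
  -- coordinates are linear combinations of each other; and ζ₀ = 1.
  have hGtop : adjoin ℂ G = ⊤ := by
    have hζg : ∀ k, ∃ b : Fin 4 → ℂ, ζ k = ∑ i, b i • g i := by
      intro k
      obtain ⟨b, hb⟩ := exists_eq_sum_X ((hΦ 1 _).2 (isHomogeneous_X ℂ k))
      refine ⟨b, ?_⟩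
      have h1 : aeval ζ (Φ.symm (Φ (X k))) = ζ k := by rw [AlgEquiv.symm_apply_apply, aeval_X]
      rw [← h1, hb, map_sum, map_sum]
      exact sum_congr rfl fun i _ => by rw [map_smul, map_smul]
    obtain ⟨l, hl⟩ : ∃ l, g l ≠ 0 := by
      by_contra! hcon
      obtain ⟨b, hb⟩ := hζg 0
      rw [hζ0] at hb
      simp [hcon] at hb
    have hmem : ∀ k, ζ k / g l ∈ adjoin ℂ G := by
      intro k
      obtain ⟨b, hb⟩ := hζg k
      rw [hb, Finset.sum_div]
      refine sum_mem fun i _ => ?_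
      rw [smul_div_assoc]
      exact IntermediateField.smul_mem _ (subset_adjoin ℂ G ⟨i, l, rfl⟩)
    rw [eq_top_iff, ← hζ, adjoin_le_iff]
    rintro _ ⟨k, rfl⟩
    have h1 := div_mem (hmem k) (hmem 0)
    rw [hζ0] at h1
    have h2 : ζ k / g l / (1 / g l) = ζ k := by field_simp
    rwa [h2] at h1
  have hmap : C.functionField.map κ = (⊤ : IntermediateField ℂ RatField).map c := by
    rw [functionField, IntermediateField.adjoin_map, ← hGtop, IntermediateField.adjoin_map]
    congr 1
    ext z
    constructor
    · rintro ⟨_, ⟨i, k, rfl⟩, rfl⟩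
      exact ⟨_, ⟨i, k, rfl⟩, (hratio i k).symm⟩
    · rintro ⟨_, ⟨i, k, rfl⟩, rfl⟩
      exact ⟨_, ⟨i, k, rfl⟩, hratio i k⟩
  refine ⟨(IntermediateField.equivMap C.functionField κ).trans
    ((IntermediateField.equivOfEq hmap).trans ?_)⟩
  exact ((IntermediateField.equivMap (⊤ : IntermediateField ℂ RatField) c).symm.trans
    IntermediateField.topEquiv)

end IntegralCurve

section Moebius

variable (α α' β β' : ℂ)

/-- The matrix of the change of coordinates of the quadric induced by a change of the coordinates on
both factors. -/
def moebiusMatrix : Matrix (Fin 4) (Fin 4) ℂ :=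
  !![α * β, -α, -β, 1; α * β', -α, -β', 1; α' * β, -α', -β, 1; α' * β', -α', -β', 1]

/-- The inverse of `moebiusMatrix`. -/
def moebiusInverse : Matrix (Fin 4) (Fin 4) ℂ :=
  ((α' - α) * (β' - β))⁻¹ • !![1, -1, -1, 1; β', -β, -β', β; α', -α', -α, α;
    α' * β', -(α' * β), -(α * β'), α * β]

lemma moebius_mul_inverse (hα : α ≠ α') (hβ : β ≠ β') :
    moebiusMatrix α α' β β' * moebiusInverse α α' β β' = 1 := by
  have h1 : α' - α ≠ 0 := sub_ne_zero.2 hα.symm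
  have h2 : β' - β ≠ 0 := sub_ne_zero.2 hβ.symm
  ext i j
  fin_cases i <;> fin_cases j <;>
    simp [moebiusMatrix, moebiusInverse, Matrix.mul_apply, Fin.sum_univ_four] <;> field_simp <;> ring

end Moebius

lemma eval_single_eq_coeff {F : CoordRing} (hF : F.IsHomogeneous 3) (i : Fin 4) :
    eval (Pi.single i 1) F = coeff (single i 3) F := by
  rw [eval_eq, Finset.sum_eq_single (single i 3)]
  · rw [Finset.prod_eq_one, mul_one]
    intro j hj
    rw [Finsupp.support_single_ne_zero _ (by norm_num), Finset.mem_singleton] at hj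
    subst hj
    simp
  · intro e he hne
    obtain ⟨j, hj, hji⟩ : ∃ j ∈ e.support, j ≠ i := by
      by_contra! hcon
      apply hne
      have h1 : e = single i (e i) := by
        ext j
        by_cases hj : j = i
        · subst hj; simp
        · have : e j = 0 := by
            by_contra h0
            exact hj (hcon j (Finsupp.mem_support_iff.2 h0))
          simp [this, Finsupp.single_apply, Ne.symm hj]
      have h2 : e.degree = 3 := by exact_mod_cast HasDegree.of_isHomogeneous hF e he
      rw [h1, Finsupp.degree_single] at h2
      rw [h1, h2]
    rw [Finset.prod_eq_zero hj, mul_zero]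
    rw [Pi.single_eq_of_ne hji, zero_pow (Finsupp.mem_support_iff.1 hj)]
  · intro h
    rw [notMem_support_iff.1 h, zero_mul]

/-- A cubic that does not vanish on the quadric is nonzero at two points in general position. -/
lemma exists_two_points {F : CoordRing} {y : ℂ} (hy : eval (segrePoint y y) F ≠ 0) :
    ∃ α α' β β' : ℂ, α ≠ α' ∧ β ≠ β' ∧ eval (segrePoint α β) F ≠ 0 ∧
      eval (segrePoint α' β') F ≠ 0 := by
  set G : 𝓡 := aeval (segrePoint (X 0) (X 1)) F with hG
  have hGe : ∀ a : Fin 2 → ℂ, eval a G = eval (segrePoint (a 0) (a 1)) F := by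
    intro a
    have : (aeval a : 𝓡 →ₐ[ℂ] ℂ).comp (aeval (segrePoint (X 0) (X 1))) =
        aeval (segrePoint (a 0) (a 1)) := by
      refine algHom_ext fun i => ?_
      fin_cases i <;> simp [segrePoint]
    exact DFunLike.congr_fun this F
  -- The linear factors force the second point to differ from (y, y) in both parameters.
  have hne : G * ((X 0 - C y) * (X 1 - C y)) ≠ 0 := by
    refine mul_ne_zero ?_ (mul_ne_zero ?_ ?_)
    · intro h0
      have := hGe ![y, y]
      rw [h0, map_zero] at this
      exact hy this.symm
    · intro h0
      have := congrArg (eval ![y + 1, 0]) h0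
      simp at this
    · intro h0
      have := congrArg (eval ![0, y + 1]) h0
      simp at this
  obtain ⟨a, ha⟩ : ∃ a, eval a (G * ((X 0 - C y) * (X 1 - C y))) ≠ 0 := by
    by_contra! hcon
    exact hne (MvPolynomial.funext fun a => by rw [hcon a, map_zero])
  simp only [map_mul, map_sub, eval_X, eval_C, hGe] at ha
  refine ⟨y, a 0, y, a 1, ?_, ?_, hy, left_ne_zero_of_mul ha⟩
  · rintro h; simp [← h] at ha
  · rintro h; simp [← h] at ha

lemma aeval_polynomial_eq_eval (z : Fin 4 → ℂ[X]) (F : CoordRing) (x : ℂ) :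
    (aeval z F : ℂ[X]).eval x = eval (fun i => (z i).eval x) F := by
  have : (Polynomial.aeval x : ℂ[X] →ₐ[ℂ] ℂ).comp (aeval z) = aeval (fun i => (z i).eval x) :=
    algHom_ext fun i => by simp [Polynomial.coe_aeval_eq_eval]
  have h := DFunLike.congr_fun this F
  simpa [Polynomial.coe_aeval_eq_eval, MvPolynomial.coe_aeval_eq_eval] using h

namespace IsCubicPair

variable {P₀ P₁ Q₀ Q₁ : ℂ[X]} (h : IsCubicPair P₀ P₁ Q₀ Q₁)
include h

lemma swap : IsCubicPair Q₀ Q₁ P₀ P₁ :=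
  ⟨h.coprime_right, h.coprime_left, h.natDegree_right, h.natDegree_left, h.natDegree_right_le,
    h.natDegree_left_le, by rw [Set.pair_comm]; exact h.adjoin_eq_top⟩

lemma ne_zero : P₀ ≠ 0 := by
  rintro rfl
  have h1 := h.coprime_left
  rw [isCoprime_zero_left] at h1
  have := Polynomial.natDegree_eq_zero_of_isUnit h1
  have := h.natDegree_left
  omega

lemma natDegree_sub (α : ℂ) : (P₁ - 𝐂 α * P₀).natDegree = 3 := by
  rw [Polynomial.natDegree_sub_eq_left_of_natDegree_lt, h.natDegree_left]
  have h1 := Polynomial.natDegree_C_mul_le α P₀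
  have h2 := h.natDegree_left_le
  have h3 := h.natDegree_left
  omega

lemma sub_ne_zero (α : ℂ) : P₁ - 𝐂 α * P₀ ≠ 0 := by
  intro h0
  have := h.natDegree_sub α
  rw [h0] at this
  simp at this

lemma eval_left_ne_zero {α x : ℂ} (hx : (P₁ - 𝐂 α * P₀).eval x = 0) : P₀.eval x ≠ 0 := by
  intro h0
  simp [h0] at hx
  exact eval_ne_zero_of_isCoprime h.coprime_left h0 hx

lemma toRat_sub (α : ℂ) : toRat P₁ / toRat P₀ - algebraMap ℂ RatField α =
    toRat (P₁ - 𝐂 α * P₀) / toRat P₀ := by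
  have := toRat_ne_zero h.ne_zero
  rw [map_sub, map_mul, toRat_C]
  field_simp

/-- A common zero x would be mapped to the point (α, β), which would then lie on the cubic. -/
lemma no_common_root {α β : ℂ} {F : CoordRing} (hF : F.IsHomogeneous 3)
    (hF0 : aeval ![P₀ * Q₀, P₀ * Q₁, P₁ * Q₀, P₁ * Q₁] F = (0 : ℂ[X]))
    (hαβ : eval (segrePoint α β) F ≠ 0) {x : ℂ} (hx : (P₁ - 𝐂 α * P₀).eval x = 0) :
    (Q₁ - 𝐂 β * Q₀).eval x ≠ 0 := by
  intro hx'
  have h1 := h.eval_left_ne_zero hx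
  have h2 := h.swap.eval_left_ne_zero hx'
  have h3 := congrArg (Polynomial.eval x) hF0
  rw [aeval_polynomial_eq_eval, Polynomial.eval_zero] at h3
  have h4 : P₁.eval x = α * P₀.eval x := by simpa [sub_eq_zero] using hx
  have h5 : Q₁.eval x = β * Q₀.eval x := by simpa [sub_eq_zero] using hx'
  have h6 : (fun i => (![P₀ * Q₀, P₀ * Q₁, P₁ * Q₀, P₁ * Q₁] i).eval x) =
      fun i => (P₀.eval x * Q₀.eval x) * segrePoint α β i := by
    ext i
    fin_cases i <;> simp [segrePoint, h4, h5] <;> ring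
  rw [h6] at h3
  have h7 := aeval_mul_of_isHomogeneous hF (P₀.eval x * Q₀.eval x) (segrePoint α β)
  change eval _ F = _ * eval _ F at h7
  rw [h7] at h3
  exact (mul_ne_zero (pow_ne_zero 3 (mul_ne_zero h1 h2)) hαβ) h3

/-- No cancellation occurs in (p - α)(q - β') / ((p - α')(q - β)), which therefore has degree
exactly 6. The mixed pairs of factors are coprime because the curve avoids (α, β) and (α', β'). -/
lemma isCoprime {α α' β β' : ℂ} (hα : α ≠ α') (hβ : β ≠ β') {F : CoordRing} (hF : F.IsHomogeneous 3)
    (hF0 : aeval ![P₀ * Q₀, P₀ * Q₁, P₁ * Q₀, P₁ * Q₁] F = (0 : ℂ[X]))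
    (h1 : eval (segrePoint α β) F ≠ 0) (h2 : eval (segrePoint α' β') F ≠ 0) :
    IsCoprime ((P₁ - 𝐂 α * P₀) * (Q₁ - 𝐂 β' * Q₀)) ((P₁ - 𝐂 α' * P₀) * (Q₁ - 𝐂 β * Q₀)) := by
  have key : ∀ {P₀ P₁ Q₀ Q₁ : ℂ[X]}, IsCubicPair P₀ P₁ Q₀ Q₁ → ∀ {α α' : ℂ}, α ≠ α' →
      IsCoprime (P₁ - 𝐂 α * P₀) (P₁ - 𝐂 α' * P₀) := by
    intro P₀ P₁ Q₀ Q₁ h α α' hα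
    refine isCoprime_of_no_common_root fun x hx hx' => ?_
    have h3 := h.eval_left_ne_zero hx
    simp only [Polynomial.eval_sub, Polynomial.eval_mul, Polynomial.eval_C] at hx hx'
    exact mul_ne_zero (_root_.sub_ne_zero.2 hα) h3 (by linear_combination hx' - hx)
  refine IsCoprime.mul_left (IsCoprime.mul_right (key h hα) ?_)
    (IsCoprime.mul_right ?_ (key h.swap hβ.symm))
  · exact isCoprime_of_no_common_root fun x hx => h.no_common_root hF hF0 h1 hx
  · exact (isCoprime_of_no_common_root fun x hx => h.no_common_root hF hF0 h2 hx).symm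

end IsCubicPair

lemma IntermediateField.adjoin_eq_top_of_subset {L : Type*} [Field L] [Algebra ℂ L]
    (K : IntermediateField ℂ L) {S : Set L} (h : adjoin ℂ S = ⊤) {a : L}
    (hS : S ⊆ (adjoin K {a} : Set L)) : adjoin K {a} = ⊤ := by
  rw [eq_top_iff]
  intro z _
  have hz : z ∈ adjoin ℂ S := by rw [h]; trivial
  have hle : adjoin ℂ S ≤ (adjoin K {a}).restrictScalars ℂ := by
    rw [adjoin_le_iff]
    exact hS
  exact hle hz

lemma coneHom_comp_changeCoords {L : Type} [Field L] [Algebra ℂ L] (ζ : Fin 4 → L)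
    {M N : Matrix (Fin 4) (Fin 4) ℂ} (hMN : M * N = 1) (f : CoordRing) :
    coneHom ζ (changeCoords M N hMN f) =
      coneHom (fun k => ∑ j, algebraMap ℂ L (M k j) * ζ j) f := by
  have : (coneHom ζ).comp (changeCoords M N hMN).toAlgHom =
      coneHom (fun k => ∑ j, algebraMap ℂ L (M k j) * ζ j) := by
    refine algHom_ext fun k => ?_
    change coneHom ζ (changeCoords M N hMN (X k)) = _
    rw [changeCoords_X, map_sum, coneHom, coneHom, aeval_X, map_sum, Finset.sum_mul]
    refine sum_congr rfl fun j _ => ?_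
    rw [map_smul, aeval_X, map_mul, mul_assoc, Algebra.smul_def]
    rfl
  exact DFunLike.congr_fun this f

lemma changeCoords_moebius_segre {α α' β β' : ℂ} (hα : α ≠ α') (hβ : β ≠ β') :
    changeCoords _ _ (moebius_mul_inverse α α' β β' hα hβ) segre =
      ((α - α') * (β - β')) • segre := by
  rw [segre, map_sub, map_mul, map_mul]
  simp only [changeCoords_X, moebiusMatrix, Fin.sum_univ_four, MvPolynomial.smul_eq_C_mul]
  simp
  ring

lemma eval_changeCoords_symm {M N : Matrix (Fin 4) (Fin 4) ℂ} (hMN : M * N = 1) (F : CoordRing)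
    (v : Fin 4 → ℂ) :
    eval v ((changeCoords M N hMN).symm F) = eval (fun k => ∑ j, N k j * v j) F := by
  have : (aeval v : CoordRing →ₐ[ℂ] ℂ).comp (changeCoords M N hMN).symm.toAlgHom =
      aeval (fun k => ∑ j, N k j * v j) := by
    refine algHom_ext fun k => ?_
    change aeval v ((changeCoords M N hMN).symm (X k)) = _
    rw [changeCoords_symm_X, map_sum, aeval_X]
    simp
  exact DFunLike.congr_fun this F

open IntegralCurve in
/-- A cubic containing the image of a cubic pair, and not containing the quadric, cuts out on the
quadric a canonically embedded rational curve. -/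
theorem IsCubicPair.exists_integralCurve {P₀ P₁ Q₀ Q₁ : ℂ[X]}
    (h : IsCubicPair P₀ P₁ Q₀ Q₁) {Φ : CoordRing ≃ₐ[ℂ] CoordRing} (hΦ : PreservesDegree Φ)
    {F : CoordRing} (hF : F.IsHomogeneous 3)
    (hF0 : aeval ![P₀ * Q₀, P₀ * Q₁, P₁ * Q₀, P₁ * Q₁] F = (0 : ℂ[X])) {y : ℂ}
    (hy : eval (segrePoint y y) F ≠ 0) :
    ∃ C : IntegralCurve, (∀ f, f ∈ C.ideal ↔
        coneHom (segrePoint (toRat P₁ / toRat P₀) (toRat Q₁ / toRat Q₀)) (Φ.symm f) = 0) ∧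
      C.ideal = span {Φ segre, Φ F} ∧ C.IsCanonicallyEmbedded ∧ C.IsRational := by
  obtain ⟨α, α', β, β', hα, hβ, hαβ, hαβ'⟩ := exists_two_points hy
  set p := toRat P₁ / toRat P₀ with hp
  set q := toRat Q₁ / toRat Q₀ with hq
  have hP₀ := toRat_ne_zero h.ne_zero
  have hQ₀ := toRat_ne_zero h.swap.ne_zero
  let ι := algebraMap ℂ RatField
  have hιC : ∀ c, ι c = RatFunc.C c := fun c => rfl
  have hιinj : Injective ι := ι.injective
  -- New parameters on both factors turn (α, β) and (α', β') into the coordinate points of X₃ and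
  -- X₀; the transformed cubic then contains both cubes.
  set Ψ := changeCoords _ _ (moebius_mul_inverse α α' β β' hα hβ) with hΨ
  have hΨd : PreservesDegree Ψ := changeCoords_preservesDegree _ _ _
  set A₀ := p - ι α with hA₀
  set A₁ := p - ι α' with hA₁
  set B₀ := q - ι β with hB₀
  set B₁ := q - ι β' with hB₁
  have hA : ∀ a, p - ι a ≠ 0 := fun a => by
    rw [h.toRat_sub]; exact div_ne_zero (toRat_ne_zero (h.sub_ne_zero _)) hP₀
  have hB : ∀ b, q - ι b ≠ 0 := fun b => by
    rw [h.swap.toRat_sub]; exact div_ne_zero (toRat_ne_zero (h.swap.sub_ne_zero _)) hQ₀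
  have hA₁n : A₁ ≠ 0 := hA _
  have hB₀n : B₀ ≠ 0 := hB _
  set ζ := segrePoint p q with hζ
  have hcone : ∀ f, coneHom ζ (Ψ f) = coneHom ![A₀ * B₀, A₀ * B₁, A₁ * B₀, A₁ * B₁] f := by
    intro f
    rw [hΨ, coneHom_comp_changeCoords]
    congr 2
    ext1 k
    fin_cases k <;>
      simp [moebiusMatrix, Fin.sum_univ_four, hζ, segrePoint, hA₀, hA₁, hB₀, hB₁, hιC] <;> ring
  have hFcone : coneHom ζ F = 0 := by
    rw [coneHom_of_isHomogeneous ζ hF]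
    have h2 : aeval (fun i => toRat (![P₀ * Q₀, P₀ * Q₁, P₁ * Q₀, P₁ * Q₁] i)) F = 0 :=
      (MvPolynomial.aeval_algebraMap_apply (A := ℂ[X]) (B := RatField) _ F).trans (by
        rw [hF0, map_zero])
    have h3 : (fun i => toRat (![P₀ * Q₀, P₀ * Q₁, P₁ * Q₀, P₁ * Q₁] i)) =
        fun i => (toRat P₀ * toRat Q₀) * ζ i := by
      ext1 i
      fin_cases i <;> simp [hζ, segrePoint, hp, hq] <;> field_simp
    rw [h3, aeval_mul_of_isHomogeneous hF] at h2
    rcases mul_eq_zero.1 h2 with h4 | h4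
    · exact absurd h4 (pow_ne_zero 3 (mul_ne_zero hP₀ hQ₀))
    · rw [h4, map_zero, zero_mul]
  let I : Ideal CoordRing := RingHom.ker ((coneHom ζ).comp Φ.symm.toAlgHom)
  have hI : ∀ f, f ∈ I ↔ coneHom ζ (Φ.symm f) = 0 := fun f => Iff.rfl
  have hIprime : I.IsPrime := RingHom.ker_isPrime _
  let π : CoordRing →ₐ[ℂ] CoordRing ⧸ I := (Ideal.Quotient.mkₐ ℂ I).comp (Ψ.trans Φ).toAlgHom
  have hπ : ∀ f, π f = 0 ↔ coneHom ![A₀ * B₀, A₀ * B₁, A₁ * B₀, A₁ * B₁] f = 0 := by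
    intro f
    have : π f = Ideal.Quotient.mk I (Φ (Ψ f)) := rfl
    rw [this, Ideal.Quotient.eq_zero_iff_mem, hI, AlgEquiv.symm_apply_apply, hcone]
  set N : ℂ[X] := (P₁ - 𝐂 α * P₀) * (Q₁ - 𝐂 β' * Q₀) with hN
  set D : ℂ[X] := (P₁ - 𝐂 α' * P₀) * (Q₁ - 𝐂 β * Q₀) with hD
  have hND : IsCoprime N D := h.isCoprime hα hβ hF hF0 hαβ hαβ'
  -- The ratio of the two middle coordinates. Its degree 6 is the degree of the curve, so the
  -- projection to these coordinates has no base point.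
  set w := A₀ * B₁ / (A₁ * B₀) with hw
  have hwND : w = toRat N / toRat D := by
    rw [hw, hA₀, hA₁, hB₀, hB₁, h.toRat_sub, h.toRat_sub, h.swap.toRat_sub, h.swap.toRat_sub, hN,
      hD, map_mul, map_mul]
    have h1 := toRat_ne_zero (h.sub_ne_zero α')
    have h2 := toRat_ne_zero (h.swap.sub_ne_zero β)
    field_simp
  have hN0 : N ≠ 0 := mul_ne_zero (h.sub_ne_zero _) (h.swap.sub_ne_zero _)
  have hD0 : D ≠ 0 := mul_ne_zero (h.sub_ne_zero _) (h.swap.sub_ne_zero _)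
  have hNdeg : N.natDegree = 6 := by
    rw [hN, Polynomial.natDegree_mul (h.sub_ne_zero _) (h.swap.sub_ne_zero _), h.natDegree_sub,
      h.swap.natDegree_sub]
  have hDdeg : D.natDegree = 6 := by
    rw [hD, Polynomial.natDegree_mul (h.sub_ne_zero _) (h.swap.sub_ne_zero _), h.natDegree_sub,
      h.swap.natDegree_sub]
  have hrank : finrank (adjoin ℂ {w}) RatField = 6 := by
    rw [hwND, finrank_adjoin_div hND hN0 hD0, hNdeg, hDdeg, max_self]
  have htr : Transcendental ℂ w := by
    intro halg
    have := IntermediateField.adjoin.finiteDimensional halg.isIntegral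
    have : FiniteDimensional (adjoin ℂ {w}) RatField := Module.finite_of_finrank_pos (by omega)
    have := FiniteDimensional.trans ℂ (adjoin ℂ {w}) RatField
    exact RatFunc.transcendental_X (K := ℂ) (Algebra.IsAlgebraic.isAlgebraic _)
  -- A₀/A₁ is a fractional linear function of p, so it gives back p; the quotient of w by it is
  -- B₁/B₀, which gives back q.
  have hgen : adjoin (adjoin ℂ {w}) {A₀ / A₁} = ⊤ := by
    refine IntermediateField.adjoin_eq_top_of_subset _ h.adjoin_eq_top ?_
    set E := adjoin (adjoin ℂ {w}) {A₀ / A₁} with hE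
    have hwE : w ∈ E :=
      E.algebraMap_mem ⟨w, IntermediateField.mem_adjoin_simple_self ℂ w⟩
    have haE : A₀ / A₁ ∈ E := IntermediateField.mem_adjoin_simple_self _ _
    have hCE : ∀ c : ℂ, ι c ∈ E := fun c =>
      E.algebraMap_mem (algebraMap ℂ (adjoin ℂ {w}) c)
    have hbE : B₁ / B₀ ∈ E := by
      have h1 : B₁ / B₀ = w / (A₀ / A₁) := by rw [hw]; field_simp [show A₀ ≠ 0 from hA α]
      rw [h1]; exact div_mem hwE haE
    have hrec : ∀ {z : RatField} {a b : ℂ}, a ≠ b → z - ι b ≠ 0 → (z - ι a) / (z - ι b) ∈ E →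
        z ∈ E := by
      intro z a b hab hzb hz
      have hne : (z - ι a) / (z - ι b) - 1 ≠ 0 := by
        intro h0
        rw [sub_eq_zero, div_eq_one_iff_eq hzb] at h0
        exact hab (hιinj (by linear_combination -h0))
      have h1 : z = (ι b * ((z - ι a) / (z - ι b)) - ι a) / ((z - ι a) / (z - ι b) - 1) := by
        rw [eq_div_iff hne]
        field_simp
        ring
      rw [h1]
      exact div_mem (sub_mem (mul_mem (hCE _) hz) (hCE _)) (sub_mem hz (one_mem _))
    rintro z (rfl | rfl)
    · exact hrec hα hA₁n haE
    · exact hrec hβ.symm hB₀n hbE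
  have hindet : ((α' - α) * (β' - β))⁻¹ ≠ 0 :=
    inv_ne_zero (mul_ne_zero (_root_.sub_ne_zero.2 hα.symm) (_root_.sub_ne_zero.2 hβ.symm))
  have hsymmF : (Ψ.symm F).IsHomogeneous 3 := (hΨd.symm 3 F).2 hF
  have hcoef : ∀ (i : Fin 4) (a b : ℂ) (_ : ∀ k, moebiusInverse α α' β β' k i =
      ((α' - α) * (β' - β))⁻¹ * segrePoint a b k), eval (segrePoint a b) F ≠ 0 →
      coeff (single i 3) (Ψ.symm F) ≠ 0 := by
    intro i a b hk hab
    rw [← eval_single_eq_coeff hsymmF, hΨ, eval_changeCoords_symm]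
    have h1 : (fun k => ∑ j, moebiusInverse α α' β β' k j * (Pi.single i 1 : Fin 4 → ℂ) j) =
        fun k => ((α' - α) * (β' - β))⁻¹ * segrePoint a b k := by
      ext1 k
      rw [Finset.sum_eq_single i (fun j _ hj => by rw [Pi.single_eq_of_ne hj, mul_zero])
        (fun hi => absurd (mem_univ i) hi), Pi.single_eq_same, mul_one, hk]
    rw [h1]
    have h7 := aeval_mul_of_isHomogeneous hF ((α' - α) * (β' - β))⁻¹ (segrePoint a b)
    change eval _ F = _ * eval _ F at h7
    rw [h7]
    exact mul_ne_zero (pow_ne_zero _ hindet) hab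
  have hnc : IsNormalCubic π (Ψ.symm F) := by
    refine ⟨?_, ?_, hsymmF, ?_, ?_, ?_, ?_⟩
    · exact Ideal.Quotient.mk_surjective.comp (Ψ.trans Φ).surjective
    · rw [hπ]
      simp [coneHom, segre]
      ring
    · rw [hπ, ← hcone, apply_symm_apply, hFcone]
    · refine hcoef 0 α' β' (fun k => ?_) hαβ'
      fin_cases k <;> simp [moebiusInverse, segrePoint]
    · refine hcoef 3 α β (fun k => ?_) hαβ
      fin_cases k <;> simp [moebiusInverse, segrePoint]
    · intro r hr
      exact cubicComb_injective_of_finrank (hA _) hA₁n hB₀n (hB _) hw rfl htr hrank hgen ((hπ _).1 hr)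
  let C : IntegralCurve :=
    { ideal := I
      isPrime := hIprime
      isHomogeneous := by
        intro f hf d
        rw [hI, coneHom_eq_zero] at hf ⊢
        intro e
        rw [← hΦ.symm.homogeneousComponent, homogeneousComponent_of_mem (homogeneousComponent_isHomogeneous d _)]
        split_ifs
        · exact hf _
        · simp
      dim_eq := hnc.ringKrullDim_eq }
  refine ⟨C, hI, ?_, ?_, ?_⟩
  · apply le_antisymm
    · intro f hf
      have h1 : π (Ψ.symm (Φ.symm f)) = 0 := by
        rw [hπ, ← hcone, apply_symm_apply]
        exact hf
      rw [hnc.eq_zero_iff] at h1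
      have h2 := Ideal.mem_map_of_mem (Ψ.trans Φ : CoordRing →+* CoordRing) h1
      rw [Ideal.map_span, Set.image_pair] at h2
      have h3 : ∀ x, (Ψ.trans Φ : CoordRing →+* CoordRing) x = Φ (Ψ x) := fun x => rfl
      rw [h3, h3, h3, apply_symm_apply, apply_symm_apply, apply_symm_apply, hΨ,
        changeCoords_moebius_segre hα hβ, map_smul] at h2
      refine Ideal.span_le.2 ?_ h2
      rintro _ (rfl | rfl)
      · exact Submodule.smul_of_tower_mem _ _ (subset_span (by simp))
      · exact subset_span (by simp)
    · rw [Ideal.span_le]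
      rintro _ (rfl | rfl)
      · change _ ∈ I
        rw [hI, AlgEquiv.symm_apply_apply, hζ]
        simp [coneHom, segre, segrePoint]
        ring
      · change _ ∈ I
        rw [hI, AlgEquiv.symm_apply_apply, hFcone]
  · exact C.isCanonicallyEmbedded_of_isNormalCubic (hΨd.trans hΦ) hnc
  · refine C.isRational_of_coneHom hΦ hI rfl ?_
    rw [eq_top_iff, ← h.adjoin_eq_top, adjoin_le_iff]
    rintro _ (rfl | rfl)
    · exact subset_adjoin _ _ ⟨2, rfl⟩
    · exact subset_adjoin _ _ ⟨1, rfl⟩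

/-! ### Pairs of cubic functions in barycentric form -/

section Nodal

/-- The polynomial `∑ ρᵢ ∏_{j ≠ i} (x - tⱼ)`. -/
def nodalComb (t ρ : Fin 5 → ℂ) : ℂ[X] :=
  ∑ i, 𝐂 (ρ i) * nodal (Finset.univ.erase i) t

variable {t : Fin 5 → ℂ}

/-- Multiplication by x replaces ρᵢ by ρᵢtᵢ up to a multiple of the nodal polynomial. Iterated, it
reads off the top coefficients of the combination as moments of ρ. -/
lemma X_mul_nodalComb (ρ : Fin 5 → ℂ) : 𝐗 * nodalComb t ρ = 𝐂 (∑ i, ρ i) * nodal univ t +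
      nodalComb t (fun i => ρ i * t i) := by
  rw [nodalComb, nodalComb, map_sum, Finset.sum_mul, mul_sum, ← sum_add_distrib]
  refine sum_congr rfl fun i _ => ?_
  rw [Lagrange.nodal_eq_mul_nodal_erase (mem_univ i), map_mul]
  ring

lemma natDegree_nodalComb_le (ρ : Fin 5 → ℂ) : (nodalComb t ρ).natDegree ≤ 4 := by
  refine Polynomial.natDegree_sum_le_of_forall_le _ _ fun i _ => ?_
  refine (Polynomial.natDegree_C_mul_le _ _).trans ?_
  rw [Lagrange.natDegree_nodal]
  simp

lemma coeff_four_nodalComb (ρ : Fin 5 → ℂ) : (nodalComb t ρ).coeff 4 = ∑ i, ρ i := by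
  rw [nodalComb, Polynomial.finsetSum_coeff]
  refine sum_congr rfl fun i _ => ?_
  have h1 := (Lagrange.nodal_monic (s := Finset.univ.erase i) (v := t)).coeff_natDegree
  rw [Lagrange.natDegree_nodal] at h1
  have h2 : (Finset.univ.erase i).card = 4 := by simp
  rw [h2] at h1
  rw [Polynomial.coeff_C_mul, h1, mul_one]

lemma X_mul_nodalComb_of_sum_eq_zero {ρ : Fin 5 → ℂ} (h : ∑ i, ρ i = 0) :
    𝐗 * nodalComb t ρ = nodalComb t (fun i => ρ i * t i) := by
  rw [X_mul_nodalComb, h, map_zero, zero_mul, zero_add]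

lemma coeff_three_nodalComb {ρ : Fin 5 → ℂ} (h : ∑ i, ρ i = 0) :
    (nodalComb t ρ).coeff 3 = ∑ i, ρ i * t i := by
  rw [← coeff_four_nodalComb (t := t), ← X_mul_nodalComb_of_sum_eq_zero h, Polynomial.coeff_X_mul]

lemma coeff_two_nodalComb {ρ : Fin 5 → ℂ} (h : ∑ i, ρ i = 0) (h' : ∑ i, ρ i * t i = 0) :
    (nodalComb t ρ).coeff 2 = ∑ i, ρ i * t i * t i := by
  rw [← coeff_three_nodalComb h', ← X_mul_nodalComb_of_sum_eq_zero h, Polynomial.coeff_X_mul]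

lemma natDegree_nodalComb_le_three {ρ : Fin 5 → ℂ} (h : ∑ i, ρ i = 0) :
    (nodalComb t ρ).natDegree ≤ 3 := by
  rw [Polynomial.natDegree_le_iff_coeff_eq_zero]
  intro k hk
  rcases Nat.lt_or_ge 4 k with h4 | h4
  · exact coeff_eq_zero_of_natDegree_lt ((natDegree_nodalComb_le ρ).trans_lt h4)
  · obtain rfl : k = 4 := by omega
    rw [coeff_four_nodalComb, h]

lemma natDegree_nodalComb_le_two {ρ : Fin 5 → ℂ} (h : ∑ i, ρ i = 0) (h' : ∑ i, ρ i * t i = 0) :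
    (nodalComb t ρ).natDegree ≤ 2 := by
  rw [Polynomial.natDegree_le_iff_coeff_eq_zero]
  intro k hk
  rcases Nat.lt_or_ge 3 k with h4 | h4
  · exact coeff_eq_zero_of_natDegree_lt ((natDegree_nodalComb_le_three h).trans_lt h4)
  · obtain rfl : k = 3 := by omega
    rw [coeff_three_nodalComb h, h']

lemma eval_nodalComb (ρ : Fin 5 → ℂ) (i : Fin 5) :
    (nodalComb t ρ).eval (t i) = ρ i * (nodal (Finset.univ.erase i) t).eval (t i) := by
  rw [nodalComb, Polynomial.eval_finsetSum, Finset.sum_eq_single i]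
  · simp
  · intro j _ hj
    rw [Polynomial.eval_mul, Lagrange.eval_nodal_at_node (by simp [hj.symm]), mul_zero]
  · simp

lemma eval_nodal_erase_ne_zero (ht : Injective t) (i : Fin 5) :
    (nodal (Finset.univ.erase i) t).eval (t i) ≠ 0 :=
  Lagrange.eval_nodal_not_at_node fun j hj => ht.ne (Finset.ne_of_mem_erase hj).symm

/-- A polynomial of degree at most five that vanishes at the nodes. -/
lemma eq_C_mul_nodal (ht : Injective t) {D : ℂ[X]} (hD : D.natDegree ≤ 5)
    (h : ∀ i, D.eval (t i) = 0) :
    D = 𝐂 (D.coeff 5) * nodal univ t := by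
  refine Polynomial.eq_of_degree_sub_lt_of_eval_index_eq (s := univ) (v := t) ht.injOn ?_ ?_
  · rw [Polynomial.degree_lt_iff_coeff_zero]
    intro m hm
    simp only [Finset.card_univ, Fintype.card_fin] at hm
    have hn : (nodal univ t).natDegree = 5 := by simp [Lagrange.natDegree_nodal]
    rcases hm.lt_or_eq with h5 | rfl
    · rw [Polynomial.coeff_sub, Polynomial.coeff_C_mul,
        coeff_eq_zero_of_natDegree_lt (hD.trans_lt h5),
        coeff_eq_zero_of_natDegree_lt (hn.le.trans_lt h5)]
      simp
    · have h1 := (Lagrange.nodal_monic (s := univ) (v := t)).coeff_natDegree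
      rw [hn] at h1
      rw [Polynomial.coeff_sub, Polynomial.coeff_C_mul, h1, mul_one, sub_self]
  · intro i _
    rw [h, Polynomial.eval_mul, Lagrange.eval_nodal_at_node (mem_univ i), mul_zero]

end Nodal

/-- Barycentric data of two functions of degree three with a common pole, taking the values `ηᵢ` at
the nodes `tᵢ`. -/
structure IsNodalPair (η t r s : Fin 5 → ℂ) : Prop where
  values_injective : Injective η
  nodes_injective : Injective t
  left_ne_zero : ∀ i, r i ≠ 0
  right_ne_zero : ∀ i, s i ≠ 0
  -- The vanishing moments say that P₀, Q₀ have degree at most 2 and P₁, Q₁ degree at most 3; the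
  -- last three conditions say that the poles at infinity and the degree 5 of P₀Q₁ - P₁Q₀ are
  -- attained.
  left_sum : ∑ i, r i = 0
  right_sum : ∑ i, s i = 0
  left_sum_node : ∑ i, r i * t i = 0
  right_sum_node : ∑ i, s i * t i = 0
  left_sum_value : ∑ i, r i * η i = 0
  right_sum_value : ∑ i, s i * η i = 0
  left_lead : ∑ i, r i * η i * t i ≠ 0
  right_lead : ∑ i, s i * η i * t i ≠ 0
  det_ne_zero : (∑ i, r i * t i * t i) * (∑ i, s i * η i * t i) -
    (∑ i, r i * η i * t i) * (∑ i, s i * t i * t i) ≠ 0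

namespace IsNodalPair

variable {η t r s : Fin 5 → ℂ} (h : IsNodalPair η t r s)
include h

lemma swap : IsNodalPair η t s r := by
  obtain ⟨h1, h2, h3, h4, h5, h6, h7, h8, h9, h10, h11, h12, h13⟩ := h
  refine ⟨h1, h2, h4, h3, h6, h5, h8, h7, h10, h9, h12, h11, ?_⟩
  contrapose! h13
  linear_combination -h13

local notation "P₀" => nodalComb t r
local notation "P₁" => nodalComb t (fun i => r i * η i)
local notation "Q₀" => nodalComb t s
local notation "Q₁" => nodalComb t (fun i => s i * η i)

lemma natDegree_left_le : (P₀).natDegree ≤ 2 := natDegree_nodalComb_le_two h.left_sum h.left_sum_node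

lemma coeff_left : (P₁).coeff 3 ≠ 0 := by
  rw [coeff_three_nodalComb h.left_sum_value]; exact h.left_lead

lemma natDegree_left : (P₁).natDegree = 3 :=
  le_antisymm (natDegree_nodalComb_le_three h.left_sum_value)
    (Polynomial.le_natDegree_of_ne_zero h.coeff_left)

lemma eval_left_ne_zero (i : Fin 5) : (P₀).eval (t i) ≠ 0 := by
  rw [eval_nodalComb]
  exact mul_ne_zero (h.left_ne_zero i) (eval_nodal_erase_ne_zero h.nodes_injective i)

omit h in
lemma eval_left (i : Fin 5) : (P₁).eval (t i) = η i * (P₀).eval (t i) := by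
  rw [eval_nodalComb, eval_nodalComb]; ring

/-- The determinant has degree at most 5 and vanishes at the five nodes, where both functions equal
ηᵢ. Its coefficient of x⁵ is the quantity assumed nonzero in `det_ne_zero`. -/
lemma det_eq : ∃ c : ℂ, c ≠ 0 ∧ P₀ * Q₁ - P₁ * Q₀ = 𝐂 c * nodal univ t := by
  have hdeg : ∀ {f g : ℂ[X]}, f.natDegree ≤ 2 → g.natDegree = 3 → (f * g).natDegree ≤ 5 :=
    fun hf hg => Polynomial.natDegree_mul_le.trans (by omega)
  refine ⟨_, ?_, eq_C_mul_nodal h.nodes_injective ?_ fun i => ?_⟩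
  · have h1 := coeff_mul_add_eq_of_natDegree_le h.natDegree_left_le h.swap.natDegree_left.le
    have h2 := coeff_mul_add_eq_of_natDegree_le h.natDegree_left.le h.swap.natDegree_left_le
    rw [Polynomial.coeff_sub, h1, h2, coeff_two_nodalComb h.left_sum h.left_sum_node,
      coeff_three_nodalComb h.right_sum_value, coeff_three_nodalComb h.left_sum_value,
      coeff_two_nodalComb h.right_sum h.right_sum_node]
    exact h.det_ne_zero
  · refine (Polynomial.natDegree_sub_le _ _).trans (max_le ?_ ?_)
    · exact hdeg h.natDegree_left_le h.swap.natDegree_left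
    · rw [mul_comm]; exact hdeg h.swap.natDegree_left_le h.natDegree_left
  · rw [Polynomial.eval_sub, Polynomial.eval_mul, Polynomial.eval_mul, eval_left, eval_left]
    ring

lemma det_polynomial_ne_zero : P₀ * Q₁ - P₁ * Q₀ ≠ 0 := by
  obtain ⟨c, hc, h1⟩ := h.det_eq
  rw [h1]
  exact mul_ne_zero (Polynomial.C_ne_zero.2 hc) Lagrange.nodal_ne_zero

lemma exists_node {x : ℂ} (hx : (P₀ * Q₁ - P₁ * Q₀).eval x = 0) : ∃ i, x = t i := by
  obtain ⟨c, hc, h1⟩ := h.det_eq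
  rw [h1, Polynomial.eval_mul, Polynomial.eval_C, Lagrange.eval_nodal, mul_eq_zero,
    Finset.prod_eq_zero_iff] at hx
  obtain ⟨i, -, hi⟩ := hx.resolve_left hc
  exact ⟨i, sub_eq_zero.1 hi⟩

/-- A common zero of P₀ and P₁ is a zero of the determinant, hence a node, but P₀ does not vanish at
the nodes. -/
lemma isCoprime_left : IsCoprime P₀ P₁ := by
  refine isCoprime_of_no_common_root fun x hx hx' => ?_
  obtain ⟨i, rfl⟩ := h.exists_node (x := x) (by simp [hx, hx'])
  exact h.eval_left_ne_zero i hx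

lemma left_ne : P₀ ≠ 0 := fun h0 => h.eval_left_ne_zero 0 (by rw [h0, Polynomial.eval_zero])

lemma left_ne' : P₁ ≠ 0 := fun h0 => h.coeff_left (by rw [h0, Polynomial.coeff_zero])

lemma isCoprime_sub {y : ℂ} (hy : ∀ i, y ≠ η i) : IsCoprime (P₁ - 𝐂 y * P₀) (Q₁ - 𝐂 y * Q₀) := by
  refine isCoprime_of_no_common_root fun x hx hx' => ?_
  simp only [Polynomial.eval_sub, Polynomial.eval_mul, Polynomial.eval_C] at hx hx'
  obtain ⟨i, rfl⟩ := h.exists_node (x := x) (by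
    simp only [Polynomial.eval_sub, Polynomial.eval_mul]
    linear_combination (P₀).eval x * hx' - (Q₀).eval x * hx)
  rw [eval_left, ← sub_mul] at hx
  exact (mul_ne_zero (sub_ne_zero.2 (hy i).symm) (h.eval_left_ne_zero i)) hx

/-- The values at the nodes exclude an affine relation between the two functions. -/
lemma not_affine (a b : ℂ) : Q₁ * P₀ ≠ 𝐂 a * (P₁ * Q₀) + 𝐂 b * (P₀ * Q₀) := by
  intro h0
  have h1 : ∀ i, η i * (1 - a) = b := by
    intro i
    have h2 := congrArg (Polynomial.eval (t i)) h0
    simp only [Polynomial.eval_add, Polynomial.eval_mul, Polynomial.eval_C, eval_left] at h2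
    have h3 := mul_ne_zero (h.eval_left_ne_zero i) (h.swap.eval_left_ne_zero i)
    have h4 : (η i * (1 - a) - b) * ((P₀).eval (t i) * (Q₀).eval (t i)) = 0 := by
      linear_combination h2
    rcases mul_eq_zero.1 h4 with h5 | h5
    · exact sub_eq_zero.1 h5
    · exact absurd h5 h3
  have ha : a = 1 := by
    by_contra hne
    have h2 : η 0 = η 1 := mul_right_cancel₀ (sub_ne_zero.2 (Ne.symm hne))
      ((h1 0).trans (h1 1).symm)
    exact absurd (h.values_injective h2) (by decide)
  have hb : b = 0 := by rw [← h1 0, ha]; ring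
  refine h.det_polynomial_ne_zero ?_
  rw [ha, hb, map_one, map_zero] at h0
  linear_combination h0

lemma finrank_adjoin_left : finrank (adjoin ℂ {toRat P₁ / toRat P₀}) RatField = 3 := by
  rw [finrank_adjoin_div h.isCoprime_left.symm h.left_ne' h.left_ne, h.natDegree_left]
  have := h.natDegree_left_le
  omega

/-- The two functions generate the field of rational functions. -/
lemma adjoin_eq_top : adjoin ℂ {toRat P₁ / toRat P₀, toRat Q₁ / toRat Q₀} = ⊤ := by
  set p := toRat P₁ / toRat P₀ with hp
  set q := toRat Q₁ / toRat Q₀ with hq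
  set M := adjoin ℂ {p, q} with hM
  have hpM : p ∈ M := subset_adjoin _ _ (by simp)
  have hqM : q ∈ M := subset_adjoin _ _ (by simp)
  have hP₀ := toRat_ne_zero h.left_ne
  have hQ₀ := toRat_ne_zero h.swap.left_ne
  have hle : adjoin ℂ {p} ≤ M :=
    IntermediateField.adjoin.mono _ _ _ (by simp)
  have hfin : FiniteDimensional (adjoin ℂ {p}) RatField :=
    Module.finite_of_finrank_pos (by rw [h.finrank_adjoin_left]; norm_num)
  -- ℂ(p, q) lies between ℂ(p) and ℂ(t), an extension of prime degree 3.
  have hdvd : finrank M RatField ∣ 3 := by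
    rw [← h.finrank_adjoin_left]
    exact IntermediateField.finrank_dvd_of_le_left hle
  rcases (Nat.dvd_prime Nat.prime_three).1 hdvd with h1 | h3
  · exact IntermediateField.finrank_eq_one_iff_eq_top.1 h1
  exfalso
  let p' : M := ⟨p, hpM⟩
  let q' : M := ⟨q, hqM⟩
  let m : ℂ[X] → Polynomial M := Polynomial.map (algebraMap ℂ M)
  have haeval : ∀ f : ℂ[X], Polynomial.aeval (RatFunc.X : RatField) (m f) = toRat f := by
    intro f
    rw [Polynomial.aeval_map_algebraMap, RatFunc.aeval_X_left_eq_algebraMap]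
  set a := (P₁).coeff 3 with ha
  set b := (Q₁).coeff 3 with hb
  have ha0 : a ≠ 0 := h.coeff_left
  have hb0 : b ≠ 0 := h.swap.coeff_left
  -- If t had degree 3 over M, then P₁ - pP₀ and Q₁ - qQ₀ would both be multiples of its minimal
  -- polynomial. With leading coefficients equalized, their difference G has degree below 3 and root
  -- t, so it is zero.
  set G : Polynomial M := 𝐂 (algebraMap ℂ M b) * (m P₁ - 𝐂 p' * m P₀) -
    𝐂 (algebraMap ℂ M a) * (m Q₁ - 𝐂 q' * m Q₀) with hG
  have hGcoeff : ∀ k, G.coeff k = algebraMap ℂ M b *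
      (algebraMap ℂ M ((P₁).coeff k) - p' * algebraMap ℂ M ((P₀).coeff k)) -
      algebraMap ℂ M a *
      (algebraMap ℂ M ((Q₁).coeff k) - q' * algebraMap ℂ M ((Q₀).coeff k)) := by
    intro k
    simp only [hG, m, Polynomial.coeff_sub, Polynomial.coeff_C_mul, Polynomial.coeff_map]
  have hGdeg : G.natDegree < 3 := by
    have hz : ∀ k, 3 ≤ k → G.coeff k = 0 := by
      intro k hk
      have e1 : (P₀).coeff k = 0 := coeff_eq_zero_of_natDegree_lt
        (h.natDegree_left_le.trans_lt (by omega))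
      have e2 : (Q₀).coeff k = 0 := coeff_eq_zero_of_natDegree_lt
        (h.swap.natDegree_left_le.trans_lt (by omega))
      rw [hGcoeff, e1, e2]
      rcases hk.lt_or_eq with hk | rfl
      · have e3 : (P₁).coeff k = 0 := coeff_eq_zero_of_natDegree_lt
          (h.natDegree_left.le.trans_lt hk)
        have e4 : (Q₁).coeff k = 0 := coeff_eq_zero_of_natDegree_lt
          (h.swap.natDegree_left.le.trans_lt hk)
        rw [e3, e4]; simp
      · rw [← ha, ← hb]; simp [mul_comm]
    have : G.natDegree ≤ 2 := by
      rw [Polynomial.natDegree_le_iff_coeff_eq_zero]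
      exact fun k hk => hz k (by omega)
    omega
  have hGeval : Polynomial.aeval (RatFunc.X : RatField) G = 0 := by
    simp only [hG, map_sub, map_mul, haeval, Polynomial.aeval_C]
    change _ * (_ - p * _) - _ * (_ - q * _) = 0
    rw [hp, hq]
    field_simp
    ring
  have hgen : adjoin M {(RatFunc.X : RatField)} = ⊤ :=
    RatFunc.IntermediateField.adjoin_X M
  have hG0 : G = 0 := eq_zero_of_aeval_generator M hgen h3 (by norm_num) hGdeg hGeval
  -- A coefficient of G at which Q₀ does not vanish expresses q as an affine function of p, which
  -- the values at the nodes exclude.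
  obtain ⟨k, hk⟩ : ∃ k, (Q₀).coeff k ≠ 0 := by
    by_contra! hcon
    exact h.swap.left_ne (Polynomial.ext fun k => by rw [hcon k, Polynomial.coeff_zero])
  have h4 := hGcoeff k
  rw [hG0, Polynomial.coeff_zero] at h4
  have h5 := congrArg (algebraMap M RatField) h4
  simp only [map_zero, map_sub, map_mul, ← IsScalarTower.algebraMap_apply] at h5
  change 0 = _ * (_ - p * _) - _ * (_ - q * _) at h5
  simp only [← toRat_C] at h5
  rw [hp, hq] at h5
  field_simp at h5
  simp only [← map_mul, ← map_sub] at h5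
  rw [zero_mul, zero_mul, ← map_zero toRat] at h5
  have h6 := toRat_injective h5
  have he : a * (Q₀).coeff k ≠ 0 := mul_ne_zero ha0 hk
  refine h.not_affine (b * (P₀).coeff k / (a * (Q₀).coeff k))
    ((a * (Q₁).coeff k - b * (P₁).coeff k) / (a * (Q₀).coeff k)) ?_
  refine mul_left_cancel₀ (Polynomial.C_ne_zero.2 he) ?_
  rw [mul_add, ← mul_assoc (𝐂 _) (𝐂 _),
    ← mul_assoc (𝐂 _) (𝐂 _), ← map_mul, ← map_mul, mul_div_cancel₀ _ he,
    mul_div_cancel₀ _ he]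
  simp only [map_sub, map_mul]
  linear_combination -h6

lemma isCubicPair : IsCubicPair P₀ P₁ Q₀ Q₁ :=
  ⟨h.isCoprime_left, h.swap.isCoprime_left, h.natDegree_left, h.swap.natDegree_left,
    h.natDegree_left_le, h.swap.natDegree_left_le, h.adjoin_eq_top⟩

end IsNodalPair

/-! ### The cubic equation of a pair of cubic functions -/

section Bezout

variable (P₀ P₁ Q₀ Q₁ : ℂ[X])

/-- The product of the coefficient of `xᵏ` in `a₀ P₁ - a₁ P₀` and that of `xˡ` in `b₀ Q₁ - b₁ Q₀`, in
terms of the coordinates `aᵢ bⱼ`. -/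
def coeffForm (k l : ℕ) : CoordRing :=
  P₁.coeff k • (Q₁.coeff l • X 0) - P₁.coeff k • (Q₀.coeff l • X 1) -
    P₀.coeff k • (Q₁.coeff l • X 2) + P₀.coeff k • (Q₀.coeff l • X 3)

/-- A two by two minor of the matrix of coefficients of `a₀ P₁ - a₁ P₀` and `b₀ Q₁ - b₁ Q₀`. -/
def bezoutForm (k l : ℕ) : CoordRing := coeffForm P₀ P₁ Q₀ Q₁ k l - coeffForm P₀ P₁ Q₀ Q₁ l k

/-- The Bézout matrix of two cubic polynomials, in terms of the minors of their coefficients. -/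
def bezoutMatrix {R : Type*} [CommRing R] (m : ℕ → ℕ → R) : Matrix (Fin 3) (Fin 3) R :=
  !![m 3 2, m 3 1, m 3 0; m 3 1, m 3 0 + m 2 1, m 2 0; m 3 0, m 2 0, m 1 0]

/-- The resultant of `a₀ P₁ - a₁ P₀` and `b₀ Q₁ - b₁ Q₀`, a cubic form in the coordinates `aᵢ bⱼ`. -/
def bezoutCubic : CoordRing := (bezoutMatrix (bezoutForm P₀ P₁ Q₀ Q₁)).det

lemma bezoutForm_isHomogeneous (k l : ℕ) : (bezoutForm P₀ P₁ Q₀ Q₁ k l).IsHomogeneous 1 := by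
  have h : ∀ k l, coeffForm P₀ P₁ Q₀ Q₁ k l ∈ 𝓢 1 := by
    intro k l
    have hX : ∀ (a b : ℂ) (i : Fin 4), a • (b • (X i : CoordRing)) ∈ 𝓢 1 := fun a b i =>
      Submodule.smul_mem _ _ (Submodule.smul_mem _ _ (isHomogeneous_X ℂ i))
    exact add_mem (sub_mem (sub_mem (hX _ _ _) (hX _ _ _)) (hX _ _ _)) (hX _ _ _)
  exact sub_mem (h k l) (h l k)

lemma det_bezoutMatrix_isHomogeneous {m : ℕ → ℕ → CoordRing}
    (hm : ∀ k l, (m k l).IsHomogeneous 1) : (bezoutMatrix m).det.IsHomogeneous 3 := by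
  have h3 : ∀ {f g h : CoordRing}, f.IsHomogeneous 1 → g.IsHomogeneous 1 → h.IsHomogeneous 1 →
      (f * g * h).IsHomogeneous 3 := fun hf hg hh => (hf.mul hg).mul hh
  have hall : ∀ i j, (bezoutMatrix m i j).IsHomogeneous 1 := by
    intro i j
    fin_cases i <;> fin_cases j <;> first | exact (hm _ _).add (hm _ _) | exact hm _ _
  rw [Matrix.det_fin_three]
  exact (((((h3 (hall _ _) (hall _ _) (hall _ _)).sub (h3 (hall _ _) (hall _ _) (hall _ _))).sub
    (h3 (hall _ _) (hall _ _) (hall _ _))).add (h3 (hall _ _) (hall _ _) (hall _ _))).add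
    (h3 (hall _ _) (hall _ _) (hall _ _))).sub (h3 (hall _ _) (hall _ _) (hall _ _))

lemma bezoutCubic_isHomogeneous : (bezoutCubic P₀ P₁ Q₀ Q₁).IsHomogeneous 3 :=
  det_bezoutMatrix_isHomogeneous (bezoutForm_isHomogeneous P₀ P₁ Q₀ Q₁)

lemma map_bezoutCubic {A : Type*} [CommRing A] (φ : CoordRing →+* A) : φ (bezoutCubic P₀ P₁ Q₀ Q₁) =
      (bezoutMatrix fun k l => φ (bezoutForm P₀ P₁ Q₀ Q₁ k l)).det := by
  rw [bezoutCubic, RingHom.map_det]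
  congr 1
  ext i j
  fin_cases i <;> fin_cases j <;> simp [bezoutMatrix]

variable {P₀ P₁ Q₀ Q₁}

lemma sum_coeff_of_natDegree_le {f : ℂ[X]} (hf : f.natDegree ≤ 3) :
    f = 𝐂 (f.coeff 3) * 𝐗 ^ 3 + 𝐂 (f.coeff 2) * 𝐗 ^ 2 + 𝐂 (f.coeff 1) * 𝐗 + 𝐂 (f.coeff 0) := by
  conv_lhs => rw [Polynomial.as_sum_range_C_mul_X_pow' f (Nat.lt_succ_of_le hf)]
  simp [Finset.sum_range_succ]
  ring

/-- The cubic vanishes on the curve. -/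
lemma aeval_bezoutCubic (hP₀ : P₀.natDegree ≤ 3) (hP₁ : P₁.natDegree ≤ 3) (hQ₀ : Q₀.natDegree ≤ 3)
    (hQ₁ : Q₁.natDegree ≤ 3) :
    aeval ![P₀ * Q₀, P₀ * Q₁, P₁ * Q₀, P₁ * Q₁] (bezoutCubic P₀ P₁ Q₀ Q₁) = (0 : ℂ[X]) := by
  set z := ![P₀ * Q₀, P₀ * Q₁, P₁ * Q₀, P₁ * Q₁] with hz
  let α : ℕ → ℂ[X] := fun k => 𝐂 (P₁.coeff k) * P₀ - 𝐂 (P₀.coeff k) * P₁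
  let β : ℕ → ℂ[X] := fun k => 𝐂 (Q₁.coeff k) * Q₀ - 𝐂 (Q₀.coeff k) * Q₁
  have hentry : ∀ k l, aeval z (bezoutForm P₀ P₁ Q₀ Q₁ k l) = α k * β l - α l * β k := by
    intro k l
    simp only [bezoutForm, coeffForm, map_sub, map_add, map_smul, aeval_X, hz,
      Polynomial.smul_eq_C_mul, α, β]
    simp
    ring
  have hα : α 3 * 𝐗 ^ 3 + α 2 * 𝐗 ^ 2 + α 1 * 𝐗 + α 0 = 0 := by
    simp only [α]
    linear_combination P₁ * sum_coeff_of_natDegree_le hP₀ - P₀ * sum_coeff_of_natDegree_le hP₁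
  have hβ : β 3 * 𝐗 ^ 3 + β 2 * 𝐗 ^ 2 + β 1 * 𝐗 + β 0 = 0 := by
    simp only [β]
    linear_combination Q₁ * sum_coeff_of_natDegree_le hQ₀ - Q₀ * sum_coeff_of_natDegree_le hQ₁
  have h1 := map_bezoutCubic P₀ P₁ Q₀ Q₁ (aeval z : CoordRing →ₐ[ℂ] ℂ[X]).toRingHom
  change aeval z _ = _ at h1
  rw [h1]
  -- The vector (x², x, 1) is in the kernel of the Bézout matrix because x is a common root of the
  -- polynomials with coefficients α and β.
  refine Matrix.exists_mulVec_eq_zero_iff.1 ⟨![𝐗 ^ 2, 𝐗, 1], ?_, ?_⟩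
  · intro h0
    have := congrFun h0 2
    simp at this
  · have hentry' : (fun k l => (aeval z : CoordRing →ₐ[ℂ] ℂ[X]).toRingHom
        (bezoutForm P₀ P₁ Q₀ Q₁ k l)) = fun k l => α k * β l - α l * β k := by
      ext1 k; ext1 l; exact hentry k l
    rw [hentry']
    generalize α = α at *
    generalize β = β at *
    ext1 i
    fin_cases i <;> simp [bezoutMatrix, Matrix.mulVec, dotProduct, Fin.sum_univ_three]
    · linear_combination α 3 * hβ - β 3 * hα
    · linear_combination (α 3 * 𝐗 + α 2) * hβ - (β 3 * 𝐗 + β 2) * hα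
    · linear_combination (α 3 * 𝐗 ^ 2 + α 2 * 𝐗 + α 1) * hβ - (β 3 * 𝐗 ^ 2 + β 2 * 𝐗 + β 1) * hα

/-- The Bézout matrix of coprime polynomials is invertible. -/
lemma det_bezoutMatrix_ne_zero {A B : ℂ[X]} (hA : A.natDegree = 3) (hB : B.natDegree ≤ 3)
    (hAB : IsCoprime A B) :
    (bezoutMatrix fun k l => A.coeff k * B.coeff l - A.coeff l * B.coeff k).det ≠ 0 := by
  intro h0
  obtain ⟨v, hv, hv0⟩ := Matrix.exists_vecMul_eq_zero_iff.2 h0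
  have hA3 : A.coeff 3 ≠ 0 := by
    rw [← hA, Polynomial.coeff_natDegree, Polynomial.leadingCoeff_ne_zero]
    rintro rfl; simp at hA
  have hsA := sum_coeff_of_natDegree_le hA.le
  have hsB := sum_coeff_of_natDegree_le hB
  have e0 := congrArg 𝐂 (congrFun hv0 0)
  have e1 := congrArg 𝐂 (congrFun hv0 1)
  have e2 := congrArg 𝐂 (congrFun hv0 2)
  simp [bezoutMatrix, Matrix.vecMul, dotProduct, Fin.sum_univ_three] at e0 e1 e2
  generalize hα : (fun k => 𝐂 (A.coeff k)) = α
  generalize hβ : (fun k => 𝐂 (B.coeff k)) = β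
  have hα' : ∀ k, 𝐂 (A.coeff k) = α k := fun k => congrFun hα k
  have hβ' : ∀ k, 𝐂 (B.coeff k) = β k := fun k => congrFun hβ k
  -- A left kernel vector v gives U B = W A with U of degree at most 2. As A is coprime to B and has
  -- degree 3, U is zero; its coefficients are triangular in v with diagonal `A.coeff 3`.
  let U : ℂ[X] := 𝐂 (v 0) * α 3 + 𝐂 (v 1) * (α 3 * 𝐗 + α 2) +
    𝐂 (v 2) * (α 3 * 𝐗 ^ 2 + α 2 * 𝐗 + α 1)
  let W : ℂ[X] := 𝐂 (v 0) * β 3 + 𝐂 (v 1) * (β 3 * 𝐗 + β 2) +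
    𝐂 (v 2) * (β 3 * 𝐗 ^ 2 + β 2 * 𝐗 + β 1)
  have hUW : U * B = W * A := by
    simp only [hα', hβ'] at e0 e1 e2 hsA hsB
    rw [hsA, hsB]
    simp only [U, W]
    linear_combination 𝐗 ^ 2 * e0 + 𝐗 * e1 + e2
  have hU0 : U = 0 := by
    refine Polynomial.eq_zero_of_dvd_of_natDegree_lt (hAB.dvd_of_dvd_mul_right
      ⟨W, hUW.trans (mul_comm W A)⟩) ?_
    have : U.natDegree ≤ 2 := by
      simp only [U, ← hα']
      compute_degree
    omega
  have hc : ∀ k, U.coeff k = 0 := fun k => by rw [hU0, Polynomial.coeff_zero]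
  have c2 := hc 2
  have c1 := hc 1
  have c0 := hc 0
  simp [U, ← hα', Polynomial.coeff_X, Polynomial.coeff_C, hA3] at c2
  simp [U, ← hα', Polynomial.coeff_X, Polynomial.coeff_C, hA3, c2] at c1
  simp [U, ← hα', Polynomial.coeff_X, Polynomial.coeff_C, hA3, c2, c1] at c0
  exact hv (by ext i; fin_cases i <;> simp [c0, c1, c2])

lemma eval_segrePoint_bezoutCubic (x y : ℂ) : eval (segrePoint x y) (bezoutCubic P₀ P₁ Q₀ Q₁) =
      (bezoutMatrix fun k l => (P₁ - 𝐂 x * P₀).coeff k *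
        (Q₁ - 𝐂 y * Q₀).coeff l - (P₁ - 𝐂 x * P₀).coeff l *
        (Q₁ - 𝐂 y * Q₀).coeff k).det := by
  rw [map_bezoutCubic]
  congr 2
  ext1 k
  ext1 l
  simp [bezoutForm, coeffForm, segrePoint, MvPolynomial.smul_eval]
  ring

/-- Both functions have a pole at infinity: the leading coefficients of P₀ and Q₀ vanish, and with
them the first row of the Bézout matrix. -/
lemma eval_last_bezoutCubic (hP₀ : P₀.natDegree ≤ 2) (hQ₀ : Q₀.natDegree ≤ 2) :
    eval ![0, 0, 0, 1] (bezoutCubic P₀ P₁ Q₀ Q₁) = 0 := by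
  have h1 : P₀.coeff 3 = 0 := coeff_eq_zero_of_natDegree_lt (by omega)
  have h2 : Q₀.coeff 3 = 0 := coeff_eq_zero_of_natDegree_lt (by omega)
  rw [map_bezoutCubic]
  refine Matrix.det_eq_zero_of_row_eq_zero 0 fun j => ?_
  fin_cases j <;> simp [bezoutMatrix, bezoutForm, coeffForm, MvPolynomial.smul_eval, h1, h2]

end Bezout

namespace IsNodalPair

variable {η t r s : Fin 5 → ℂ} (h : IsNodalPair η t r s)
include h

/-- The cubic equation of the curve with the given barycentric data. -/
local notation "F" =>
  bezoutCubic (nodalComb t r) (nodalComb t fun i => r i * η i) (nodalComb t s)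
    (nodalComb t fun i => s i * η i)

lemma aeval_cubic : aeval ![nodalComb t r * nodalComb t s,
    nodalComb t r * nodalComb t (fun i => s i * η i),
    nodalComb t (fun i => r i * η i) * nodalComb t s,
    nodalComb t (fun i => r i * η i) * nodalComb t (fun i => s i * η i)] F = (0 : ℂ[X]) :=
  aeval_bezoutCubic (h.natDegree_left_le.trans (by norm_num)) h.natDegree_left.le
    (h.swap.natDegree_left_le.trans (by norm_num)) h.swap.natDegree_left.le

lemma eval_cubic_ne_zero {y : ℂ} (hy : ∀ i, y ≠ η i) : eval (segrePoint y y) F ≠ 0 := by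
  rw [eval_segrePoint_bezoutCubic]
  exact det_bezoutMatrix_ne_zero (h.isCubicPair.natDegree_sub y)
    (h.swap.isCubicPair.natDegree_sub y).le (h.isCoprime_sub hy)

lemma eval_cubic_eq_zero (i : Fin 5) : eval (segrePoint (η i) (η i)) F = 0 := by
  by_contra hne
  refine h.isCubicPair.no_common_root (bezoutCubic_isHomogeneous _ _ _ _) h.aeval_cubic hne
    (x := t i) ?_ ?_
  · simp only [Polynomial.eval_sub, Polynomial.eval_mul, Polynomial.eval_C, eval_left, sub_self]
  · simp only [Polynomial.eval_sub, Polynomial.eval_mul, Polynomial.eval_C, eval_left, sub_self]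

lemma eval_last_cubic : eval ![0, 0, 0, 1] F = 0 :=
  eval_last_bezoutCubic h.natDegree_left_le h.swap.natDegree_left_le

end IsNodalPair

/-! ### A parametrization of the barycentric data -/

section Weights

/-- The weights `1 / Y'(ηᵢ)` with `Y = ∏ (y - ηᵢ)`. -/
abbrev wt (η : Fin 5 → ℂ) : Fin 5 → ℂ := Lagrange.nodalWeight univ η

variable {η : Fin 5 → ℂ} (hη : Injective η)
include hη

/-- Euler's identity, the formula for the leading coefficient in Lagrange interpolation. -/
lemma sum_eval_mul_wt {f : ℂ[X]} (hf : f.natDegree ≤ 4) :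
    ∑ i, f.eval (η i) * wt η i = f.coeff 4 := by
  have h1 := Lagrange.coeff_eq_sum (s := univ) hη.injOn (P := f)
    (Polynomial.degree_lt_iff_coeff_zero _ _ |>.2 fun m hm =>
      coeff_eq_zero_of_natDegree_lt (by simp at hm; omega))
  simp only [Finset.card_univ, Fintype.card_fin] at h1
  rw [h1]
  refine sum_congr rfl fun i _ => ?_
  rw [wt, Lagrange.nodalWeight_eq_eval_nodal_erase_inv, Lagrange.eval_nodal, div_eq_mul_inv]

lemma sum_pow_mul_wt {k : ℕ} (hk : k < 4) : ∑ i, η i ^ k * wt η i = 0 := by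
  have h1 := sum_eval_mul_wt hη (f := 𝐗 ^ k) (by simp; omega)
  rw [Polynomial.coeff_X_pow, if_neg (by omega)] at h1
  simpa using h1

lemma sum_pow_four_mul_wt : ∑ i, η i ^ 4 * wt η i = 1 := by
  have h1 := sum_eval_mul_wt hη (f := 𝐗 ^ 4) (by simp)
  simpa using h1

lemma wt_ne_zero (i : Fin 5) : wt η i ≠ 0 :=
  Lagrange.nodalWeight_ne_zero hη.injOn (mem_univ i)

/-- Values whose first moments vanish are those of a polynomial of small degree. -/
lemma exists_polynomial_of_moments (v : Fin 5 → ℂ) {m : ℕ} (hm : m ≤ 4)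
    (h : ∀ k < m, ∑ i, η i ^ k * v i * wt η i = 0) :
    ∃ f : ℂ[X], f.natDegree ≤ 4 - m ∧ ∀ i, f.eval (η i) = v i := by
  set f := Lagrange.interpolate univ η v with hf
  have hev : ∀ i, f.eval (η i) = v i := fun i =>
    Lagrange.eval_interpolate_at_node v hη.injOn (mem_univ i)
  refine ⟨f, ?_, hev⟩
  induction m with
  | zero =>
    have h1 := Lagrange.degree_interpolate_lt (s := univ) v hη.injOn
    rw [Polynomial.degree_lt_iff_coeff_zero] at h1
    exact Polynomial.natDegree_le_iff_coeff_eq_zero.2 fun k hk => h1 k (by simp; omega)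
  | succ m ih =>
    have h1 := ih (by omega) fun k hk => h k (by omega)
    have h2 := sum_eval_mul_wt hη (f := 𝐗 ^ m * f)
      ((Polynomial.natDegree_mul_le).trans (by rw [Polynomial.natDegree_X_pow]; omega))
    have h3 := h m (by omega)
    simp only [Polynomial.eval_mul, Polynomial.eval_pow, Polynomial.eval_X, hev] at h2
    rw [h3, Polynomial.coeff_X_pow_mul', if_pos (by omega)] at h2
    rw [Polynomial.natDegree_le_iff_coeff_eq_zero]
    intro k hk
    rcases Nat.lt_or_ge (4 - m) k with h4 | h4
    · exact coeff_eq_zero_of_natDegree_lt (h1.trans_lt h4)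
    · obtain rfl : k = 4 - m := by omega
      exact h2.symm

end Weights

namespace CurveParam

variable (η : Fin 5 → ℂ)

/-- The moments of the weights. -/
def moment (k : ℕ) : ℂ := ∑ i, η i ^ k * wt η i

/-- A system dual to the functions `1, y, y²` for the form `∑ f(ηᵢ) g(ηᵢ) / Y'(ηᵢ)`. -/
def dual : Fin 3 → Fin 5 → ℂ :=
  ![fun i => η i ^ 4 - moment η 5 * η i ^ 3 + (moment η 5 ^ 2 - moment η 6) * η i ^ 2,
    fun i => η i ^ 3 - moment η 5 * η i ^ 2, fun i => η i ^ 2]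

variable {η} in
-- The moments of orders 2, 3, 4 are 0, 0, 1, so the pairing of 1, y, y² with y⁴, y³, y² is
-- unitriangular. The corrections by the moments 5 and 6 invert it.
lemma sum_dual (hη : Injective η) (a k : Fin 3) :
    ∑ i, η i ^ (a : ℕ) * dual η k i * wt η i = if a = k then 1 else 0 := by
  have hm : ∀ k, ∑ i, η i ^ k * wt η i = moment η k := fun k => rfl
  have h2 : moment η 2 = 0 := sum_pow_mul_wt hη (by norm_num)
  have h3 : moment η 3 = 0 := sum_pow_mul_wt hη (by norm_num)
  have h4 : moment η 4 = 1 := sum_pow_four_mul_wt hη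
  have key : ∀ (n : ℕ) (x y z : ℂ), ∑ i, η i ^ n * (x * η i ^ 4 + y * η i ^ 3 + z * η i ^ 2) *
      wt η i = x * moment η (n + 4) + y * moment η (n + 3) + z * moment η (n + 2) := by
    intro n x y z
    simp only [moment, mul_sum, ← sum_add_distrib]
    exact sum_congr rfl fun i _ => by ring
  fin_cases k
  · have : ∀ i, dual η 0 i = 1 * η i ^ 4 + (-moment η 5) * η i ^ 3 +
        (moment η 5 ^ 2 - moment η 6) * η i ^ 2 := fun i => by simp [dual]; ring
    simp only [Fin.zero_eta, this, key]
    fin_cases a <;> simp [h2, h3, h4]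
    ring
  · have : ∀ i, dual η 1 i = 0 * η i ^ 4 + 1 * η i ^ 3 + (-moment η 5) * η i ^ 2 := fun i => by
      simp [dual]; ring
    simp only [Fin.mk_one, this, key]
    fin_cases a <;> simp [h2, h3, h4]
  · have : ∀ i, dual η 2 i = 0 * η i ^ 4 + 0 * η i ^ 3 + 1 * η i ^ 2 := fun i => by simp [dual]
    simp only [Fin.reduceFinMk, this, key]
    fin_cases a <;> simp [h2, h3, h4]

variable (e : Fin 8 → ℂ)

/-- The residues of the first function. -/
def left (i : Fin 5) : ℂ := (e 0 + e 1 * η i + e 2 * η i ^ 2) * wt η i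

/-- The residues of the second function. -/
def right (i : Fin 5) : ℂ := (e 3 + e 4 * η i + e 5 * η i ^ 2) * wt η i

/-- The nodes. -/
def node (i : Fin 5) : ℂ :=
  -- Along the dual system stands e 7 times the cross product of the coefficient vectors of the
  -- residues, which is orthogonal to both. The term e 6 η is orthogonal to residues of this form in
  -- any case.
  e 7 * (e 1 * e 5 - e 2 * e 4) * dual η 0 i + e 7 * (e 2 * e 3 - e 0 * e 5) * dual η 1 i +
    e 7 * (e 0 * e 4 - e 1 * e 3) * dual η 2 i + e 6 * η i

/-- The product of the quantities that have to be nonzero. -/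
def disc : ℂ :=
  (∏ p : Fin 5 × Fin 5, if p.1 = p.2 then 1 else node η e p.1 - node η e p.2) *
    (∏ i, left η e i) * (∏ i, right η e i) * (∑ i, left η e i * η i * node η e i) *
    (∑ i, right η e i * η i * node η e i) *
    ((∑ i, left η e i * node η e i * node η e i) * (∑ i, right η e i * η i * node η e i) -
    (∑ i, left η e i * η i * node η e i) * (∑ i, right η e i * node η e i * node η e i))

variable {η} {e} (hη : Injective η)
include hη

/-- Against quadratic residues only the components along the dual system count; the multiple of η
contributes moments of order at most 3, which vanish. -/
lemma sum_quadratic_mul (a b c x y z w : ℂ) : ∑ i, (a + b * η i + c * η i ^ 2) * wt η i *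
      (x * dual η 0 i + y * dual η 1 i + z * dual η 2 i + w * η i) = a * x + b * y + c * z := by
  have h1 : ∀ i, (a + b * η i + c * η i ^ 2) * wt η i *
      (x * dual η 0 i + y * dual η 1 i + z * dual η 2 i + w * η i) =
      a * x * (η i ^ ((0 : Fin 3) : ℕ) * dual η 0 i * wt η i) +
      a * y * (η i ^ ((0 : Fin 3) : ℕ) * dual η 1 i * wt η i) +
      a * z * (η i ^ ((0 : Fin 3) : ℕ) * dual η 2 i * wt η i) +
      b * x * (η i ^ ((1 : Fin 3) : ℕ) * dual η 0 i * wt η i) +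
      b * y * (η i ^ ((1 : Fin 3) : ℕ) * dual η 1 i * wt η i) +
      b * z * (η i ^ ((1 : Fin 3) : ℕ) * dual η 2 i * wt η i) +
      c * x * (η i ^ ((2 : Fin 3) : ℕ) * dual η 0 i * wt η i) +
      c * y * (η i ^ ((2 : Fin 3) : ℕ) * dual η 1 i * wt η i) +
      c * z * (η i ^ ((2 : Fin 3) : ℕ) * dual η 2 i * wt η i) +
      w * a * (η i ^ 1 * wt η i) + w * b * (η i ^ 2 * wt η i) + w * c * (η i ^ 3 * wt η i) := by
    intro i
    simp only [Fin.val_zero, Fin.val_one, Fin.val_two]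
    ring
  simp only [h1, sum_add_distrib, ← mul_sum, sum_dual hη,
    sum_pow_mul_wt hη (show 1 < 4 by norm_num), sum_pow_mul_wt hη (show 2 < 4 by norm_num),
    sum_pow_mul_wt hη (show 3 < 4 by norm_num)]
  simp

lemma sum_quadratic (a b c : ℂ) : ∑ i, (a + b * η i + c * η i ^ 2) * wt η i = 0 := by
  have h1 : ∀ i, (a + b * η i + c * η i ^ 2) * wt η i = a * (η i ^ 0 * wt η i) +
      b * (η i ^ 1 * wt η i) + c * (η i ^ 2 * wt η i) := fun i => by ring
  simp only [h1, sum_add_distrib, ← mul_sum, sum_pow_mul_wt hη (show 0 < 4 by norm_num),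
    sum_pow_mul_wt hη (show 1 < 4 by norm_num), sum_pow_mul_wt hη (show 2 < 4 by norm_num)]
  simp

lemma sum_quadratic_value (a b c : ℂ) : ∑ i, (a + b * η i + c * η i ^ 2) * wt η i * η i = 0 := by
  have h1 : ∀ i, (a + b * η i + c * η i ^ 2) * wt η i * η i = a * (η i ^ 1 * wt η i) +
      b * (η i ^ 2 * wt η i) + c * (η i ^ 3 * wt η i) := fun i => by ring
  simp only [h1, sum_add_distrib, ← mul_sum, sum_pow_mul_wt hη (show 1 < 4 by norm_num),
    sum_pow_mul_wt hη (show 2 < 4 by norm_num), sum_pow_mul_wt hη (show 3 < 4 by norm_num)]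
  simp

/-- The linear conditions on residues and nodes hold identically in the parameters; only the open
ones remain, and `disc` is their product. -/
lemma isNodalPair_iff : IsNodalPair η (node η e) (left η e) (right η e) ↔ disc η e ≠ 0 := by
  have hinj : (∏ p : Fin 5 × Fin 5, if p.1 = p.2 then 1 else node η e p.1 - node η e p.2) ≠ 0 ↔
      Injective (node η e) := by
    rw [Finset.prod_ne_zero_iff]
    constructor
    · intro h i j hij
      by_contra hne
      have := h (i, j) (mem_univ _)
      simp [hne, hij] at this
    · rintro h ⟨i, j⟩ -
      by_cases hij : i = j
      · simp [hij]
      · simpa [hij, sub_eq_zero] using h.ne hij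
  constructor
  · intro h
    refine mul_ne_zero (mul_ne_zero (mul_ne_zero (mul_ne_zero (mul_ne_zero ?_ ?_) ?_) ?_) ?_) ?_
    · exact hinj.2 h.nodes_injective
    · exact Finset.prod_ne_zero_iff.2 fun i _ => h.left_ne_zero i
    · exact Finset.prod_ne_zero_iff.2 fun i _ => h.right_ne_zero i
    · exact h.left_lead
    · exact h.right_lead
    · exact h.det_ne_zero
  · intro h
    rw [disc] at h
    simp only [mul_ne_zero_iff] at h
    obtain ⟨⟨⟨⟨⟨h1, h2⟩, h3⟩, h4⟩, h5⟩, h6⟩ := h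
    refine ⟨hη, hinj.1 h1, fun i => Finset.prod_ne_zero_iff.1 h2 i (mem_univ i),
      fun i => Finset.prod_ne_zero_iff.1 h3 i (mem_univ i), sum_quadratic hη _ _ _,
      sum_quadratic hη _ _ _, ?_, ?_, sum_quadratic_value hη _ _ _, sum_quadratic_value hη _ _ _,
      h4, h5, h6⟩
    · simp only [left, node, sum_quadratic_mul hη]; ring
    · simp only [right, node, sum_quadratic_mul hη]; ring

end CurveParam

/-! ### Every barycentric datum is obtained from the parametrization up to an affine change -/

lemma nodalComb_comp {t t' : Fin 5 → ℂ} {α γ : ℂ} (ht : ∀ i, t i = α * t' i + γ) (ρ : Fin 5 → ℂ) :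
    (nodalComb t ρ).comp (𝐂 α * 𝐗 + 𝐂 γ) = 𝐂 (α ^ 4) * nodalComb t' ρ := by
  rw [nodalComb, nodalComb, Polynomial.sum_comp, mul_sum]
  refine sum_congr rfl fun i _ => ?_
  have h1 : (nodal (Finset.univ.erase i) t).comp (𝐂 α * 𝐗 + 𝐂 γ) =
      𝐂 (α ^ 4) * nodal (Finset.univ.erase i) t' := by
    have hcard : (Finset.univ.erase i).card = 4 := by simp
    rw [Lagrange.nodal_eq, Lagrange.nodal_eq, Polynomial.prod_comp, map_pow, ← hcard,
      ← Finset.prod_const, ← Finset.prod_mul_distrib]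
    refine Finset.prod_congr rfl fun j _ => ?_
    rw [Polynomial.sub_comp, Polynomial.X_comp, Polynomial.C_comp, ht]
    simp only [map_add, map_mul]
    ring
  rw [Polynomial.mul_comp, Polynomial.C_comp, h1]
  ring

/-- The coordinates of the point of the quadric with the two given functions as parameters. -/
abbrev segreCoords (P₀ P₁ Q₀ Q₁ : ℂ[X]) : Fin 4 → ℂ[X] :=
  ![P₀ * Q₀, P₀ * Q₁, P₁ * Q₀, P₁ * Q₁]

/-- A polynomial vanishes on the curve after a rescaling and an affine change of the parameter iff it
does so before. -/
lemma aeval_segreCoords_iff {P₀ P₁ Q₀ Q₁ P₀' P₁' Q₀' Q₁' A : ℂ[X]} {a b : ℂ} (ha : a ≠ 0)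
    (hb : b ≠ 0) (hA : A.natDegree ≠ 0) (hP₀ : P₀.comp A = 𝐂 a * P₀')
    (hP₁ : P₁.comp A = 𝐂 a * P₁') (hQ₀ : Q₀.comp A = 𝐂 b * Q₀')
    (hQ₁ : Q₁.comp A = 𝐂 b * Q₁') {f : CoordRing} {d : ℕ} (hf : f.IsHomogeneous d) :
    aeval (segreCoords P₀ P₁ Q₀ Q₁) f = (0 : ℂ[X]) ↔
      aeval (segreCoords P₀' P₁' Q₀' Q₁') f = (0 : ℂ[X]) := by
  have h1 : (aeval (segreCoords P₀ P₁ Q₀ Q₁) f : ℂ[X]).comp A =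
      𝐂 (a * b) ^ d * aeval (segreCoords P₀' P₁' Q₀' Q₁') f := by
    rw [← aeval_mul_of_isHomogeneous hf]
    have : ((Polynomial.aeval A : ℂ[X] →ₐ[ℂ] ℂ[X]).comp (aeval (segreCoords P₀ P₁ Q₀ Q₁))) =
        aeval fun i => 𝐂 (a * b) * segreCoords P₀' P₁' Q₀' Q₁' i := by
      refine algHom_ext fun i => ?_
      change (Polynomial.aeval A) (aeval (segreCoords P₀ P₁ Q₀ Q₁) (X i)) = _
      rw [aeval_X, aeval_X, ← Polynomial.comp_eq_aeval]
      fin_cases i <;> simp [hP₀, hP₁, hQ₀, hQ₁] <;> ring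
    have h2 := DFunLike.congr_fun this f
    exact (Polynomial.comp_eq_aeval).trans h2
  have h0 : (𝐂 (a * b) : ℂ[X]) ^ d ≠ 0 :=
    pow_ne_zero _ (Polynomial.C_ne_zero.2 (mul_ne_zero ha hb))
  constructor
  · intro h
    rw [h, Polynomial.zero_comp] at h1
    exact (mul_eq_zero.1 h1.symm).resolve_left h0
  · intro h
    rw [h, mul_zero, Polynomial.comp_eq_zero_iff] at h1
    rcases h1 with h1 | ⟨-, h1⟩
    · exact h1
    · rw [h1] at hA
      simp at hA

namespace IsNodalPair

variable {η t r s : Fin 5 → ℂ} (h : IsNodalPair η t r s)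
include h

lemma of_affine {t' : Fin 5 → ℂ} {α γ : ℂ} (hα : α ≠ 0) (ht : ∀ i, t i = α * t' i + γ) :
    IsNodalPair η t' r s := by
  have key : ∀ {ρ : Fin 5 → ℂ}, ∑ i, ρ i = 0 → ∑ i, ρ i * t i = α * ∑ i, ρ i * t' i := by
    intro ρ hρ
    have h1 : ∀ i, ρ i * t i = α * (ρ i * t' i) + γ * ρ i := fun i => by rw [ht]; ring
    simp only [h1, sum_add_distrib, ← mul_sum, hρ, mul_zero, add_zero]
  have key0 : ∀ {ρ : Fin 5 → ℂ}, ∑ i, ρ i = 0 → ∑ i, ρ i * t i = 0 → ∑ i, ρ i * t' i = 0 := by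
    intro ρ h1 h2
    rw [key h1] at h2
    exact (mul_eq_zero.1 h2).resolve_left hα
  have key2 : ∀ {ρ : Fin 5 → ℂ}, ∑ i, ρ i = 0 → ∑ i, ρ i * t i = 0 →
      ∑ i, ρ i * t i * t i = α ^ 2 * ∑ i, ρ i * t' i * t' i := by
    intro ρ h1 h2
    have h3 : ∀ i, ρ i * t i * t i = α * (ρ i * t' i * t i) + γ * (ρ i * t i) := fun i => by
      rw [ht i]; ring
    simp only [h3, sum_add_distrib, ← mul_sum, h2, mul_zero, add_zero]
    rw [key (key0 h1 h2)]
    ring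
  refine ⟨h.values_injective, fun i j hij => h.nodes_injective (by rw [ht, ht, hij]),
    h.left_ne_zero, h.right_ne_zero, h.left_sum, h.right_sum, key0 h.left_sum h.left_sum_node,
    key0 h.right_sum h.right_sum_node, h.left_sum_value, h.right_sum_value, ?_, ?_, ?_⟩
  · intro h0; exact h.left_lead (by rw [key h.left_sum_value, h0, mul_zero])
  · intro h0; exact h.right_lead (by rw [key h.right_sum_value, h0, mul_zero])
  · intro h0
    refine h.det_ne_zero ?_
    rw [key h.left_sum_value, key h.right_sum_value, key2 h.left_sum h.left_sum_node,
      key2 h.right_sum h.right_sum_node]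
    linear_combination α ^ 3 * h0

-- The two vanishing moments lower the degree of the polynomial interpolating ρᵢ divided by the
-- weights from 4 to 2.
omit h in
lemma exists_quadratic (hη : Injective η) {ρ : Fin 5 → ℂ} (h1 : ∑ i, ρ i = 0)
    (h2 : ∑ i, ρ i * η i = 0) :
    ∃ a b c : ℂ, ∀ i, ρ i = (a + b * η i + c * η i ^ 2) * wt η i := by
  have hw := wt_ne_zero hη
  obtain ⟨f, hf, hfe⟩ := exists_polynomial_of_moments hη (fun i => ρ i / wt η i) (m := 2)
    (by norm_num) (by
      intro k hk
      have h3 : ∀ i, η i ^ k * (ρ i / wt η i) * wt η i = ρ i * η i ^ k := fun i => by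
        have := hw i
        field_simp
      simp only [h3]
      interval_cases k <;> simpa using by assumption)
  refine ⟨f.coeff 0, f.coeff 1, f.coeff 2, fun i => ?_⟩
  have h3 := hfe i
  rw [Polynomial.eval_eq_sum_range' (n := 3) (by omega)] at h3
  simp only [Finset.sum_range_succ, Finset.sum_range_zero] at h3
  rw [eq_div_iff (hw i)] at h3
  rw [← h3]
  ring

/-- Barycentric data come from the parametrization. -/
lemma exists_param : ∃ (e : Fin 8 → ℂ) (α γ : ℂ), α ≠ 0 ∧ CurveParam.left η e = r ∧
    CurveParam.right η e = s ∧ ∀ i, t i = α * CurveParam.node η e i + γ := by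
  have hη := h.values_injective
  have hw := wt_ne_zero hη
  obtain ⟨f0, f1, f2, hf⟩ := exists_quadratic hη h.left_sum h.left_sum_value
  obtain ⟨g0, g1, g2, hg⟩ := exists_quadratic hη h.right_sum h.right_sum_value
  -- The first three moments of the nodes. Subtracting the corresponding dual combination leaves the
  -- values of a polynomial in η of degree at most 1, whose constant term becomes the translation.
  let a : Fin 3 → ℂ := fun k => ∑ i, η i ^ (k : ℕ) * t i * wt η i
  obtain ⟨p, hp, hpe⟩ := exists_polynomial_of_moments hη
    (fun i => t i - ∑ k, a k * CurveParam.dual η k i) (m := 3) (by norm_num) (by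
      intro m hm
      have h1 : ∀ i, η i ^ m * (t i - ∑ k, a k * CurveParam.dual η k i) * wt η i =
          η i ^ m * t i * wt η i - ∑ k, a k * (η i ^ m * CurveParam.dual η k i * wt η i) := by
        intro i
        rw [mul_sub, sub_mul, mul_sum, Finset.sum_mul]
        congr 1
        exact sum_congr rfl fun k _ => by ring
      simp only [h1]
      rw [Finset.sum_sub_distrib, Finset.sum_comm]
      simp only [← mul_sum]
      have h2 := fun k => CurveParam.sum_dual hη ⟨m, hm⟩ k
      simp only at h2
      simp only [h2]
      simp [a])
  have ht : ∀ i, t i = a 0 * CurveParam.dual η 0 i + a 1 * CurveParam.dual η 1 i +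
      a 2 * CurveParam.dual η 2 i + p.coeff 1 * η i + p.coeff 0 := by
    intro i
    have h1 := hpe i
    rw [Polynomial.eval_eq_sum_range' (n := 2) (by omega)] at h1
    simp only [Finset.sum_range_succ, Finset.sum_range_zero, Fin.sum_univ_three] at h1
    linear_combination -h1
  have horth : ∀ {ρ : Fin 5 → ℂ} {x y z : ℂ}, (∀ i, ρ i = (x + y * η i + z * η i ^ 2) * wt η i) →
      ∑ i, ρ i * t i = 0 → x * a 0 + y * a 1 + z * a 2 = 0 := by
    intro ρ x y z hρ h0
    rw [← h0]
    simp only [a, mul_sum, ← sum_add_distrib]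
    refine sum_congr rfl fun i _ => ?_
    rw [hρ]
    simp
    ring
  have o1 := horth hf h.left_sum_node
  have o2 := horth hg h.right_sum_node
  set c0 := f1 * g2 - f2 * g1 with hc0
  set c1 := f2 * g0 - f0 * g2 with hc1
  set c2 := f0 * g1 - f1 * g0 with hc2
  -- Both a and the cross product c are orthogonal to the coefficient vectors of r and s, so a × c =
  -- 0.
  have hpar : (a 1 * c2 = a 2 * c1) ∧ (a 2 * c0 = a 0 * c2) ∧ (a 0 * c1 = a 1 * c0) := by
    refine ⟨?_, ?_, ?_⟩
    · linear_combination f0 * o2 - g0 * o1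
    · linear_combination f1 * o2 - g1 * o1
    · linear_combination f2 * o2 - g2 * o1
  obtain ⟨p1, p2, p3⟩ := hpar
  -- With zero cross product r and s would be proportional, and the determinant of the nodal pair
  -- would vanish.
  have hc : c0 ≠ 0 ∨ c1 ≠ 0 ∨ c2 ≠ 0 := by
    by_contra! hcon
    obtain ⟨z0, z1, z2⟩ := hcon
    have hsym : ∀ i j, r i * s j = r j * s i := by
      intro i j
      rw [hf, hf, hg, hg]
      linear_combination wt η i * wt η j * ((η i * η j ^ 2 - η i ^ 2 * η j) * z0 +
        (η i ^ 2 - η j ^ 2) * z1 + (η j - η i) * z2)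
    obtain ⟨l, hs⟩ : ∃ l, ∀ i, s i = l * r i := ⟨s 0 / r 0, fun i => by
      have := h.left_ne_zero 0
      field_simp
      linear_combination hsym 0 i⟩
    refine h.det_ne_zero ?_
    simp only [hs, mul_assoc, ← mul_sum]
    ring
  obtain ⟨α, h0, h1, h2⟩ : ∃ α, a 0 = α * c0 ∧ a 1 = α * c1 ∧ a 2 = α * c2 := by
    rcases hc with hc | hc | hc
    · refine ⟨a 0 / c0, ?_, ?_, ?_⟩ <;> field_simp
      · linear_combination -p3
      · linear_combination p2
    · refine ⟨a 1 / c1, ?_, ?_, ?_⟩ <;> field_simp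
      · linear_combination p3
      · linear_combination -p1
    · refine ⟨a 2 / c2, ?_, ?_, ?_⟩ <;> field_simp
      · linear_combination -p2
      · linear_combination p1
  -- With α = 0 the nodes would be an affine function of η, and the two products in the determinant
  -- would coincide.
  have hα : α ≠ 0 := by
    rintro rfl
    rw [zero_mul] at h0 h1 h2
    replace ht : ∀ i, t i = p.coeff 1 * η i + p.coeff 0 := fun i => by rw [ht i, h0, h1, h2]; ring
    have key : ∀ {ρ τ : Fin 5 → ℂ}, ∑ i, ρ i = 0 → (∀ i, τ i = p.coeff 1 * η i + p.coeff 0) →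
        ∑ i, ρ i * τ i = p.coeff 1 * ∑ i, ρ i * η i := by
      intro ρ τ hρ hτ
      have h1 : ∀ i, ρ i * τ i = p.coeff 1 * (ρ i * η i) + p.coeff 0 * ρ i := fun i => by
        rw [hτ]; ring
      rw [sum_congr rfl fun i _ => h1 i, sum_add_distrib, ← mul_sum,
        ← mul_sum, hρ, mul_zero, add_zero]
    have key2 : ∀ ρ : Fin 5 → ℂ, ∑ i, ρ i * t i * η i = ∑ i, ρ i * η i * t i := fun ρ =>
      sum_congr rfl fun i _ => by ring
    refine h.det_ne_zero ?_
    rw [key h.left_sum_node ht, key h.right_sum_node ht, key2, key2]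
    ring
  refine ⟨![f0, f1, f2, g0, g1, g2, p.coeff 1 / α, 1], α, p.coeff 0, hα, ?_, ?_, ?_⟩
  · ext i; rw [hf]; rfl
  · ext i; rw [hg]; rfl
  · intro i
    rw [ht, h0, h1, h2]
    have : CurveParam.node η ![f0, f1, f2, g0, g1, g2, p.coeff 1 / α, 1] i =
      1 * c0 * CurveParam.dual η 0 i + 1 * c1 * CurveParam.dual η 1 i +
        1 * c2 * CurveParam.dual η 2 i +
        p.coeff 1 / α * η i := rfl
    rw [this]
    field_simp

end IsNodalPair

/-! ### Parametrized curves on the quadric -/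

namespace IntegralCurve

lemma ext_of_ideal {C C' : IntegralCurve} (h : C.ideal = C'.ideal) : C = C' := by
  cases C; cases C'; congr

lemma mem_ideal_iff (C : IntegralCurve) {f : CoordRing} :
    f ∈ C.ideal ↔ ∀ d, homogeneousComponent d f ∈ C.ideal := by
  refine ⟨fun h => C.isHomogeneous f h, fun h => ?_⟩
  rw [← sum_homogeneousComponent f]
  exact sum_mem fun d _ => h d

/-- In the coordinates `Φ`, the curve is the image of the given functions. -/
def IsParametrizedBy (C : IntegralCurve) (Φ : CoordRing ≃ₐ[ℂ] CoordRing)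
    (P₀ P₁ Q₀ Q₁ : ℂ[X]) : Prop :=
  ∀ (d : ℕ) (f : CoordRing), f.IsHomogeneous d →
    (Φ f ∈ C.ideal ↔ aeval (segreCoords P₀ P₁ Q₀ Q₁) f = (0 : ℂ[X]))

lemma IsParametrizedBy.eq {C C' : IntegralCurve} {Φ : CoordRing ≃ₐ[ℂ] CoordRing}
    (hΦ : PreservesDegree Φ) {P₀ P₁ Q₀ Q₁ : ℂ[X]}
    (h : C.IsParametrizedBy Φ P₀ P₁ Q₀ Q₁) (h' : C'.IsParametrizedBy Φ P₀ P₁ Q₀ Q₁) : C = C' := by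
  refine ext_of_ideal (Ideal.ext fun f => ?_)
  rw [mem_ideal_iff, mem_ideal_iff]
  refine forall_congr' fun d => ?_
  have hd := (hΦ.symm d _).2 (homogeneousComponent_isHomogeneous d f)
  have h1 := h d _ hd
  have h2 := h' d _ hd
  rw [apply_symm_apply] at h1 h2
  rw [h1, h2]

end IntegralCurve

lemma aeval_segrePoint_iff {P₀ P₁ Q₀ Q₁ : ℂ[X]} (hP : P₀ ≠ 0) (hQ : Q₀ ≠ 0)
    {f : CoordRing} {d : ℕ} (hf : f.IsHomogeneous d) :
    aeval (segrePoint (toRat P₁ / toRat P₀) (toRat Q₁ / toRat Q₀)) f = 0 ↔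
      aeval (segreCoords P₀ P₁ Q₀ Q₁) f = (0 : ℂ[X]) := by
  have hP' := toRat_ne_zero hP
  have hQ' := toRat_ne_zero hQ
  have h1 : aeval (fun i => algebraMap ℂ[X] RatField (segreCoords P₀ P₁ Q₀ Q₁ i)) f =
      toRat (aeval (segreCoords P₀ P₁ Q₀ Q₁) f) :=
    MvPolynomial.aeval_algebraMap_apply (A := ℂ[X]) (B := RatField) _ f
  have h2 : (fun i => algebraMap ℂ[X] RatField (segreCoords P₀ P₁ Q₀ Q₁ i)) = fun i =>
      (toRat P₀ * toRat Q₀) * segrePoint (toRat P₁ / toRat P₀) (toRat Q₁ / toRat Q₀) i := by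
    ext1 i
    fin_cases i <;> simp [segrePoint] <;> field_simp
  rw [h2, aeval_mul_of_isHomogeneous hf] at h1
  rw [← map_eq_zero_iff _ toRat_injective, ← h1, mul_eq_zero,
    or_iff_right (pow_ne_zero _ (mul_ne_zero hP' hQ'))]

/-- The curve with given barycentric data. -/
theorem IsNodalPair.exists_integralCurve {η t r s : Fin 5 → ℂ} (h : IsNodalPair η t r s)
    {Φ : CoordRing ≃ₐ[ℂ] CoordRing} (hΦ : PreservesDegree Φ) :
    ∃ C : IntegralCurve, C.IsParametrizedBy Φ (nodalComb t r) (nodalComb t fun i => r i * η i)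
        (nodalComb t s) (nodalComb t fun i => s i * η i) ∧
      C.ideal = span {Φ segre, Φ (bezoutCubic (nodalComb t r) (nodalComb t fun i => r i * η i)
        (nodalComb t s) (nodalComb t fun i => s i * η i))} ∧
      C.IsCanonicallyEmbedded ∧ C.IsRational := by
  obtain ⟨y, hy⟩ := Infinite.exists_notMem_finset (Finset.univ.image η)
  obtain ⟨C, h1, h2, h3, h4⟩ := h.isCubicPair.exists_integralCurve hΦ
    (bezoutCubic_isHomogeneous _ _ _ _) h.aeval_cubic
    (h.eval_cubic_ne_zero (y := y) fun i hi => hy (by simp [hi]))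
  refine ⟨C, fun d f hf => ?_, h2, h3, h4⟩
  rw [h1, AlgEquiv.symm_apply_apply, coneHom_of_isHomogeneous _ hf,
    ← aeval_segrePoint_iff h.left_ne h.swap.left_ne hf, mul_eq_zero, Polynomial.C_eq_zero,
    or_iff_left (pow_ne_zero _ Polynomial.X_ne_zero)]

/-! ### The generic point of a rational curve on the quadric -/

/-- The functions `p, q` are the parameters of a generic point of the cone of `J`. -/
structure IsGenericPair (J : Ideal CoordRing) (p q : RatField) : Prop where
  mem_iff : ∀ (d : ℕ) (f : CoordRing), f.IsHomogeneous d → (f ∈ J ↔ aeval (segrePoint p q) f = 0)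
  adjoin_eq_top : adjoin ℂ {p, q} = ⊤

namespace IntegralCurve

/-- The function field of a rational curve furnishes a generic point. -/
lemma IsRational.exists_generic {C : IntegralCurve} (hC : C.IsRational)
    (hlin : ∀ f : CoordRing, f.IsHomogeneous 1 → f ∈ C.ideal → f = 0) :
    ∃ g : Fin 4 → RatField, g 0 = 1 ∧ adjoin ℂ (Set.range g) = ⊤ ∧
      ∀ (d : ℕ) (f : CoordRing), f.IsHomogeneous d → (f ∈ C.ideal ↔ aeval g f = 0) := by
  obtain ⟨ψ⟩ := hC
  let Fr := FractionRing C.Ring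
  let x : Fin 4 → Fr := fun i => algebraMap C.Ring Fr (C.toRing (X i))
  have hx : ∀ i, x i ≠ 0 := by
    intro i h0
    have h1 : C.toRing (X i) = 0 := (IsFractionRing.injective C.Ring Fr) (by rw [map_zero]; exact h0)
    exact X_ne_zero i (hlin _ (isHomogeneous_X ℂ i) (C.toRing_eq_zero.1 h1))
  have hmem : ∀ i j, x i / x j ∈ C.functionField := fun i j =>
    subset_adjoin _ _ ⟨i, j, rfl⟩
  let a : Fin 4 → C.functionField := fun i => ⟨x i / x 0, hmem i 0⟩
  have ha : ∀ i, ((a i : C.functionField) : Fr) = (x 0)⁻¹ * x i := fun i => by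
    change x i / x 0 = _
    rw [div_eq_inv_mul]
  refine ⟨fun i => ψ (a i), ?_, ?_, ?_⟩
  · have : a 0 = 1 := Subtype.ext (div_self (hx 0))
    exact (congrArg ψ this).trans (map_one ψ)
  · have h1 : adjoin ℂ (Set.range a) = ⊤ := by
      apply IntermediateField.map_injective C.functionField.val
      rw [IntermediateField.adjoin_map]
      have h2 : (⊤ : IntermediateField ℂ C.functionField).map C.functionField.val =
          C.functionField := by
        rw [← AlgHom.fieldRange_eq_map, IntermediateField.fieldRange_val]
      rw [h2]
      apply le_antisymm
      · rw [adjoin_le_iff]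
        rintro _ ⟨y, -, rfl⟩
        exact y.2
      · conv_lhs => rw [functionField]
        rw [adjoin_le_iff]
        rintro _ ⟨i, j, rfl⟩
        have h3 : ∀ i, x i / x 0 ∈ adjoin ℂ (C.functionField.val '' Set.range a) := fun i =>
          subset_adjoin _ _ ⟨a i, ⟨i, rfl⟩, rfl⟩
        have h4 := div_mem (h3 i) (h3 j)
        rwa [div_div_div_cancel_right₀ (hx 0)] at h4
    have h2 := congrArg (IntermediateField.map ψ.toAlgHom) h1
    rw [IntermediateField.adjoin_map, ← Set.range_comp, ← AlgHom.fieldRange_eq_map] at h2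
    refine Eq.trans ?_ (h2.trans ?_)
    · rfl
    · rw [AlgHom.fieldRange_eq_top]
      exact ψ.surjective
  · intro d f hf
    have e1 : ψ.toAlgHom.comp (aeval a) = aeval fun i => ψ (a i) :=
      algHom_ext fun i => by rw [AlgHom.comp_apply, aeval_X, aeval_X]; rfl
    have e2 : C.functionField.val.comp (aeval a) = aeval fun i => (x 0)⁻¹ * x i :=
      algHom_ext fun i => by simp [ha]
    have e3 : (IsScalarTower.toAlgHom ℂ C.Ring Fr).comp C.toRingₐ = aeval x :=
      algHom_ext fun i => by rw [aeval_X]; rfl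
    have h1 : ψ (aeval a f) = aeval (fun i => ψ (a i)) f := DFunLike.congr_fun e1 f
    have h2 : ((aeval a f : C.functionField) : Fr) = aeval (fun i => (x 0)⁻¹ * x i) f :=
      DFunLike.congr_fun e2 f
    have h3 : algebraMap C.Ring Fr (C.toRing f) = aeval x f := DFunLike.congr_fun e3 f
    rw [aeval_mul_of_isHomogeneous hf, ← h3] at h2
    rw [← h1, map_eq_zero_iff _ ψ.injective, ← C.toRing_eq_zero,
      ← map_eq_zero_iff _ (IsFractionRing.injective C.Ring Fr)]
    rw [← ZeroMemClass.coe_eq_zero (S' := C.functionField), h2, mul_eq_zero,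
      or_iff_right (pow_ne_zero _ (inv_ne_zero (hx 0)))]

/-- In coordinates in which the curve lies on the Segre quadric, the generic point is given by a pair
of generators of the field of rational functions. -/
lemma IsRational.exists_isGenericPair {C : IntegralCurve} (hC : C.IsRational)
    (hlin : ∀ f : CoordRing, f.IsHomogeneous 1 → f ∈ C.ideal → f = 0)
    {Φ : CoordRing ≃ₐ[ℂ] CoordRing} (hΦ : PreservesDegree Φ) (hseg : Φ segre ∈ C.ideal) :
    ∃ p q, IsGenericPair (C.ideal.comap Φ) p q := by
  obtain ⟨g, hg0, hgtop, hg⟩ := hC.exists_generic hlin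
  set z : Fin 4 → RatField := fun k => aeval g (Φ (X k)) with hz
  have hzg : ∀ f, aeval g (Φ f) = aeval z f := by
    have : (aeval g).comp Φ.toAlgHom = aeval z := algHom_ext fun k => by rw [aeval_X]; rfl
    exact fun f => DFunLike.congr_fun this f
  have hmem : ∀ (d : ℕ) (f : CoordRing), f.IsHomogeneous d →
      (f ∈ C.ideal.comap Φ ↔ aeval z f = 0) := by
    intro d f hf
    rw [Ideal.mem_comap, ← hzg]
    exact hg d _ ((hΦ d f).2 hf)
  have hz0 : z 0 ≠ 0 := by
    intro h0
    have h1 := hlin _ ((hΦ 1 _).2 (isHomogeneous_X ℂ 0))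
      ((hg 1 _ ((hΦ 1 _).2 (isHomogeneous_X ℂ 0))).2 h0)
    exact X_ne_zero (R := ℂ) (0 : Fin 4) ((map_eq_zero_iff _ Φ.injective).1 h1)
  have hs : z 0 * z 3 = z 1 * z 2 := by
    have h1 := (hg 2 _ ((hΦ 2 _).2 (((isHomogeneous_X ℂ 0).mul (isHomogeneous_X ℂ 3)).sub
      ((isHomogeneous_X ℂ 1).mul (isHomogeneous_X ℂ 2))))).1 hseg
    rw [hzg] at h1
    simpa [sub_eq_zero] using h1
  have hzp : ∀ k, z k = z 0 * segrePoint (z 2 / z 0) (z 1 / z 0) k := by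
    intro k
    fin_cases k <;> simp [segrePoint] <;> field_simp
    linear_combination hs
  refine ⟨z 2 / z 0, z 1 / z 0, fun d f hf => ?_, ?_⟩
  · have h4 : aeval z f = aeval (fun k => z 0 * segrePoint (z 2 / z 0) (z 1 / z 0) k) f :=
      congrArg (fun w => aeval w f) (funext hzp)
    rw [hmem d f hf, h4, aeval_mul_of_isHomogeneous hf, mul_eq_zero,
      or_iff_right (pow_ne_zero _ hz0)]
  · set E := adjoin ℂ {z 2 / z 0, z 1 / z 0} with hE
    have h2 : z 2 / z 0 ∈ E := subset_adjoin _ _ (by simp)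
    have h1 : z 1 / z 0 ∈ E := subset_adjoin _ _ (by simp)
    have hseg : ∀ k, segrePoint (z 2 / z 0) (z 1 / z 0) k ∈ E := by
      intro k
      fin_cases k
      · exact one_mem E
      · exact h1
      · exact h2
      · exact mul_mem h2 h1
    have hgE : ∀ i, g i / z 0 ∈ E := by
      intro i
      obtain ⟨c, hc⟩ := exists_eq_sum_X ((hΦ.symm 1 _).2 (isHomogeneous_X ℂ i))
      have h3 := hzg (Φ.symm (X i))
      rw [apply_symm_apply, aeval_X, hc, map_sum] at h3
      rw [h3, Finset.sum_div]
      refine sum_mem fun k _ => ?_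
      rw [map_smul, aeval_X, hzp k, smul_div_assoc, mul_div_cancel_left₀ _ hz0]
      exact IntermediateField.smul_mem _ (hseg k)
    rw [eq_top_iff, ← hgtop, adjoin_le_iff]
    rintro _ ⟨i, rfl⟩
    have h3 := div_mem (hgE i) (hgE 0)
    rwa [div_div_div_cancel_right₀ hz0, hg0, div_one] at h3

end IntegralCurve

/-! ### Degrees of the parameters -/

/-- The monomial in the coordinates that restricts to `pⁱ qʲ`. -/
lemma exists_monomial (i j : Fin 4) : ∃ m : CoordRing, m.IsHomogeneous 3 ∧
    ∀ p q : RatField, aeval (segrePoint p q) m = p ^ (i : ℕ) * q ^ (j : ℕ) := by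
  have h3 : ∀ a b c d : ℕ, a + b + c + d = 3 →
      (X 0 ^ a * X 1 ^ b * X 2 ^ c * X 3 ^ d : CoordRing).IsHomogeneous 3 := by
    intro a b c d h
    have h1 := ((((isHomogeneous_X_pow (R := ℂ) (0 : Fin 4) a).mul (isHomogeneous_X_pow 1 b)).mul
      (isHomogeneous_X_pow 2 c)).mul (isHomogeneous_X_pow 3 d))
    rwa [h] at h1
  have hi := i.2
  have hj := j.2
  rcases le_total (i : ℕ) j with hij | hij
  · obtain ⟨k, hk⟩ := Nat.exists_eq_add_of_le hij
    refine ⟨_, h3 (3 - j) k 0 i (by omega), fun p q => ?_⟩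
    simp [segrePoint, hk]
    ring
  · obtain ⟨k, hk⟩ := Nat.exists_eq_add_of_le hij
    refine ⟨_, h3 (3 - i) 0 k j (by omega), fun p q => ?_⟩
    simp [segrePoint, hk]
    ring

/-- The sixteen functions pⁱqʲ with i, j ≤ 3 are restrictions of cubic monomials, so they inherit
the relation between sixteen cubic forms. -/
lemma IsGenericPair.exists_relation {J : Ideal CoordRing} {p q : RatField}
    (h : IsGenericPair J p q) (hJ : ∀ m : Fin 16 → CoordRing, (∀ i, (m i).IsHomogeneous 3) →
      ∃ c : Fin 16 → ℂ, c ≠ 0 ∧ ∑ i, c i • m i ∈ J) :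
    ∃ c : Fin 4 → Fin 4 → ℂ, c ≠ 0 ∧
      ∑ i, ∑ j, algebraMap ℂ RatField (c i j) * (p ^ (i : ℕ) * q ^ (j : ℕ)) = 0 := by
  choose m hm hme using exists_monomial
  let φ : Fin 4 × Fin 4 ≃ Fin 16 := finProdFinEquiv
  obtain ⟨c, hc, h0⟩ := hJ (fun k => m (φ.symm k).1 (φ.symm k).2) fun k => hm _ _
  refine ⟨fun i j => c (φ (i, j)), ?_, ?_⟩
  · intro hz
    refine hc (funext fun k => ?_)
    have := congrFun (congrFun hz (φ.symm k).1) (φ.symm k).2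
    simpa using this
  · have hhom : (∑ k, c k • m (φ.symm k).1 (φ.symm k).2) ∈ 𝓢 3 :=
      sum_mem fun k _ => Submodule.smul_mem _ _ (hm _ _)
    have h1 := (h.mem_iff 3 _ hhom).1 h0
    rw [map_sum, ← φ.sum_comp, Fintype.sum_prod_type] at h1
    rw [← h1]
    refine sum_congr rfl fun i _ => sum_congr rfl fun j _ => ?_
    rw [Equiv.symm_apply_apply, map_smul, hme, Algebra.smul_def]

/-- The relation is an equation of degree at most 3 for q over ℂ(p); it is nontrivial because p is
transcendental. Since q generates ℂ(t) over ℂ(p), it bounds the degree. -/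
lemma finrank_adjoin_le_three {p q : RatField} (hp : Transcendental ℂ p)
    (hgen : adjoin ℂ {p, q} = ⊤) {c : Fin 4 → Fin 4 → ℂ} (hc : c ≠ 0)
    (h : ∑ i, ∑ j, algebraMap ℂ RatField (c i j) * (p ^ (i : ℕ) * q ^ (j : ℕ)) = 0) :
    finrank (adjoin ℂ {p}) RatField ≤ 3 := by
  by_contra! hlt
  set K := adjoin ℂ {p} with hK
  have hpK : p ∈ K := IntermediateField.mem_adjoin_simple_self ℂ p
  let p' : K := ⟨p, hpK⟩
  have hq : adjoin K {q} = ⊤ := by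
    refine IntermediateField.adjoin_eq_top_of_subset K hgen ?_
    rintro _ (rfl | rfl)
    · exact (adjoin K {q}).algebraMap_mem p'
    · exact IntermediateField.mem_adjoin_simple_self K _
  let G : Polynomial K := ∑ j : Fin 4,
    𝐂 (∑ i : Fin 4, algebraMap ℂ K (c i j) * p' ^ (i : ℕ)) * 𝐗 ^ (j : ℕ)
  have hGdeg : G.natDegree ≤ 3 := by
    refine Polynomial.natDegree_sum_le_of_forall_le _ _ fun j _ => ?_
    exact (Polynomial.natDegree_C_mul_X_pow_le _ _).trans (by omega)
  have hG0 : Polynomial.aeval q G = 0 := by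
    rw [← h, map_sum, Finset.sum_comm]
    refine sum_congr rfl fun j _ => ?_
    rw [map_mul, Polynomial.aeval_C, map_pow, Polynomial.aeval_X, map_sum, Finset.sum_mul]
    refine sum_congr rfl fun i _ => ?_
    rw [map_mul, map_pow, ← IsScalarTower.algebraMap_apply, mul_assoc]
    rfl
  have hG := eq_zero_of_aeval_generator K hq rfl (by omega) (lt_of_le_of_lt hGdeg hlt) hG0
  refine hc (funext fun i => funext fun j => ?_)
  have h1 : G.coeff j = ∑ i : Fin 4, algebraMap ℂ K (c i j) * p' ^ (i : ℕ) := by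
    simp only [G, Polynomial.finsetSum_coeff, Polynomial.coeff_C_mul_X_pow]
    rw [Finset.sum_eq_single j]
    · simp
    · intro k _ hk
      rw [if_neg]
      exact fun h => hk (Fin.ext h.symm)
    · simp
  rw [hG, Polynomial.coeff_zero] at h1
  have h2 : Polynomial.aeval p (∑ i : Fin 4, 𝐂 (c i j) * 𝐗 ^ (i : ℕ) : ℂ[X]) = 0 := by
    have := congrArg (algebraMap K RatField) h1
    rw [map_zero, map_sum] at this
    rw [map_sum, this]
    refine sum_congr rfl fun i _ => ?_
    rw [map_mul, map_pow, map_mul, map_pow, Polynomial.aeval_C, Polynomial.aeval_X,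
      ← IsScalarTower.algebraMap_apply]
    rfl
  have h3 : (∑ i : Fin 4, 𝐂 (c i j) * 𝐗 ^ (i : ℕ) : ℂ[X]) = 0 := by
    by_contra hne
    exact hp ⟨_, hne, h2⟩
  have h4 := congrArg (fun f => Polynomial.coeff f i) h3
  simp only [Polynomial.finsetSum_coeff, Polynomial.coeff_C_mul_X_pow, Polynomial.coeff_zero] at h4
  rw [Finset.sum_eq_single i] at h4
  · simpa using h4
  · intro k _ hk
    rw [if_neg]
    exact fun h => hk (Fin.ext h.symm)
  · simp

/-! ### Places of the field of rational functions -/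

/-- Dehomogenized polynomials come from forms. -/
lemma exists_homogenization (k : Fin 4) (G : CoordRing) : ∃ (N : ℕ) (F : CoordRing),
    F.IsHomogeneous N ∧ ∀ {K : Type} [Field K] [Algebra ℂ K] (z : Fin 4 → K), z k ≠ 0 →
      aeval z F = z k ^ N * aeval (fun i => z i / z k) G := by
  induction G using MvPolynomial.induction_on with
  | C a => exact ⟨0, C a, isHomogeneous_C _ _, fun z _ => by simp⟩
  | add G₁ G₂ h₁ h₂ =>
    obtain ⟨N₁, F₁, hF₁, e₁⟩ := h₁
    obtain ⟨N₂, F₂, hF₂, e₂⟩ := h₂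
    refine ⟨N₁ + N₂, F₁ * X k ^ N₂ + F₂ * X k ^ N₁, ?_, fun z hz => ?_⟩
    · refine (hF₁.mul (isHomogeneous_X_pow k N₂)).add ?_
      rw [add_comm]
      exact hF₂.mul (isHomogeneous_X_pow k N₁)
    · simp only [map_add, map_mul, map_pow, aeval_X, e₁ z hz, e₂ z hz]
      ring
  | mul_X G i h =>
    obtain ⟨N, F, hF, e⟩ := h
    refine ⟨N + 1, F * X i, hF.mul (isHomogeneous_X ℂ i), fun z hz => ?_⟩
    simp only [map_mul, aeval_X, e z hz]
    field_simp
    ring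

/-- A point of the curve is the centre of a place of its function field. -/
lemma IsGenericPair.exists_place {J : Ideal CoordRing} {p q : RatField} (h : IsGenericPair J p q)
    {w : Fin 4 → ℂ} (hw : ∀ f ∈ J, eval w f = 0) {k : Fin 4} (hwk : w k ≠ 0)
    (hk : segrePoint p q k ≠ 0) :
    ∃ V : ValuationSubring RatField, (∀ c, algebraMap ℂ RatField c ∈ V) ∧
      ∀ i, segrePoint p q i / segrePoint p q k - algebraMap ℂ RatField (w i / w k) ∈ V.nonunits := by
  let u : Fin 4 → RatField := fun i => segrePoint p q i / segrePoint p q k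
  let w' : Fin 4 → ℂ := fun i => w i / w k
  let A : Subalgebra ℂ RatField := (aeval u : CoordRing →ₐ[ℂ] RatField).range
  let θ : CoordRing →ₐ[ℂ] A := (aeval u : CoordRing →ₐ[ℂ] RatField).rangeRestrict
  have hθ : Function.Surjective θ := AlgHom.rangeRestrict_surjective _
  let 𝔪 : Ideal CoordRing := RingHom.ker (eval w')
  -- A polynomial that vanishes at the generic point vanishes at the given point, because its
  -- homogenization lies in J.
  have hker : ∀ G : CoordRing, aeval u G = 0 → eval w' G = 0 := by
    intro G hG
    obtain ⟨N, F, hF, hFe⟩ := exists_homogenization k G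
    have h1 := hFe (segrePoint p q) hk
    rw [hG, mul_zero] at h1
    have h2 := hw F ((h.mem_iff N F hF).2 h1)
    have h3 := hFe w hwk
    change eval w F = _ * eval w' G at h3
    rw [h2] at h3
    exact (mul_eq_zero.1 h3.symm).resolve_left (pow_ne_zero _ hwk)
  have hne : 𝔪.map θ ≠ ⊤ := by
    intro htop
    rw [Ideal.eq_top_iff_one, Ideal.mem_map_iff_of_surjective θ hθ] at htop
    obtain ⟨G, hG, hG1⟩ := htop
    have h1 : aeval u (G - 1) = 0 := by
      have := congrArg Subtype.val hG1
      rw [map_sub, map_one, sub_eq_zero]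
      exact this
    have h2 := hker _ h1
    have h3 : eval w' G = 0 := hG
    rw [map_sub, h3, map_one] at h2
    norm_num at h2
  -- The ideal of the point is proper in the affine coordinate ring, so some valuation ring of the
  -- function field has its elements as nonunits.
  obtain ⟨V, hAV, hV⟩ := Ideal.image_subset_nonunits_valuationSubring
    (A := A.toSubring) (𝔪.map θ) hne
  refine ⟨V, fun c => hAV (A.algebraMap_mem c), fun i => ?_⟩
  refine hV ⟨θ (X i - C (w' i)), Ideal.mem_map_of_mem θ ?_, ?_⟩
  · change eval w' _ = 0
    simp
  · change aeval u (X i - C (w' i)) = _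
    simp [u, w']

section Place

variable {V : ValuationSubring RatField} (hV : ∀ c, algebraMap ℂ RatField c ∈ V)
include hV

lemma valuation_const {c : ℂ} (hc : c ≠ 0) : V.valuation (algebraMap ℂ RatField c) = 1 := by
  have h1 := (V.valuation_le_one_iff _).2 (hV c)
  have h2 := (V.valuation_le_one_iff _).2 (hV c⁻¹)
  have h3 : V.valuation (algebraMap ℂ RatField c) * V.valuation (algebraMap ℂ RatField c⁻¹) = 1 := by
    rw [← map_mul, ← map_mul, mul_inv_cancel₀ hc, map_one, map_one]
  refine le_antisymm h1 ?_
  rw [← h3]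
  exact mul_le_of_le_one_right' h2

/-- At a place outside the affine line, the valuation of a polynomial is determined by its degree. -/
lemma valuation_toRat (hX : toRat 𝐗 ∉ V) {f : ℂ[X]} (hf : f ≠ 0) :
    V.valuation (toRat f) = V.valuation (toRat 𝐗) ^ f.natDegree := by
  have hX1 : 1 < V.valuation (toRat 𝐗) := by
    rw [← V.valuation_le_one_iff] at hX
    exact not_le.1 hX
  induction hn : f.natDegree generalizing f with
  | zero =>
    rw [Polynomial.eq_C_of_natDegree_eq_zero hn, toRat_C, pow_zero]
    refine valuation_const hV fun h0 => hf ?_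
    rw [Polynomial.eq_C_of_natDegree_eq_zero hn, h0, map_zero]
  | succ n ih =>
    have hd : f.divX.natDegree = n := by rw [Polynomial.natDegree_divX_eq_natDegree_tsub_one, hn]; rfl
    have hd0 : f.divX ≠ 0 := by
      intro h0
      have := Polynomial.divX_mul_X_add f
      rw [h0, zero_mul, zero_add] at this
      rw [← this, Polynomial.natDegree_C] at hn
      omega
    have h1 := ih hd0 hd
    have h2 : V.valuation (toRat (f.divX * 𝐗)) = V.valuation (toRat 𝐗) ^ (n + 1) := by
      rw [map_mul, map_mul, h1, pow_succ]
    rw [← Polynomial.divX_mul_X_add f, map_add, Valuation.map_add_eq_of_lt_left, h2]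
    rw [h2, toRat_C]
    exact ((V.valuation_le_one_iff _).2 (hV _)).trans_lt (one_lt_pow₀ hX1 (by omega))

lemma toRat_mem (hX : toRat 𝐗 ∈ V) (f : ℂ[X]) : toRat f ∈ V := by
  induction f using Polynomial.induction_on' with
  | add f g hf hg => rw [map_add]; exact V.add_mem _ _ hf hg
  | monomial n a =>
    rw [← Polynomial.C_mul_X_pow_eq_monomial, map_mul, map_pow, toRat_C]
    exact V.mul_mem _ _ (hV a) (pow_mem hX n)

/-- A nontrivial place on the affine line is centred at a point. -/
lemma exists_centre (hX : toRat 𝐗 ∈ V) {a : RatField} (ha : a ≠ 0) (haV : a ∈ V.nonunits) :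
    ∃ τ : ℂ, ∀ f : ℂ[X], toRat f ∈ V.nonunits ↔ f.eval τ = 0 := by
  have hle : ∀ f, V.valuation (toRat f) ≤ 1 := fun f => (V.valuation_le_one_iff _).2 (toRat_mem hV hX f)
  -- If all nonzero polynomials were units, the nonzero nonunit a could not exist. A polynomial that
  -- is a nonunit then has a linear factor that is one.
  obtain ⟨f, hf0, hf⟩ : ∃ f : ℂ[X], f ≠ 0 ∧ V.valuation (toRat f) < 1 := by
    by_contra! hcon
    have h1 : ∀ f : ℂ[X], f ≠ 0 → V.valuation (toRat f) = 1 := fun f hf =>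
      le_antisymm (hle f) (hcon f hf)
    rw [ValuationSubring.mem_nonunits_iff, ← RatFunc.num_div_denom a, map_div₀,
      h1 _ (RatFunc.num_ne_zero ha), h1 _ (RatFunc.denom_ne_zero a)] at haV
    simp at haV
  obtain ⟨τ, hτ⟩ : ∃ τ : ℂ, V.valuation (toRat (𝐗 - 𝐂 τ)) < 1 := by
    by_contra! hcon
    have h1 : ∀ τ, V.valuation (toRat (𝐗 - 𝐂 τ)) = 1 := fun τ =>
      le_antisymm (hle _) (hcon τ)
    have h2 := (IsAlgClosed.splits f).eq_prod_roots
    rw [h2, map_mul, map_mul, toRat_C, valuation_const hV (Polynomial.leadingCoeff_ne_zero.2 hf0),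
      one_mul, map_multiset_prod, map_multiset_prod, Multiset.map_map, Multiset.map_map] at hf
    refine hf.ne (Multiset.prod_eq_one fun x hx => ?_)
    obtain ⟨σ, -, rfl⟩ := Multiset.mem_map.1 hx
    exact h1 σ
  refine ⟨τ, fun g => ?_⟩
  rw [ValuationSubring.mem_nonunits_iff]
  have h1 : g = (𝐗 - 𝐂 τ) * (g /ₘ (𝐗 - 𝐂 τ)) + 𝐂 (g.eval τ) := by
    conv_lhs => rw [← Polynomial.modByMonic_add_div g (𝐗 - 𝐂 τ),
      Polynomial.modByMonic_X_sub_C_eq_C_eval, add_comm]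
  have h2 : V.valuation (toRat ((𝐗 - 𝐂 τ) * (g /ₘ (𝐗 - 𝐂 τ)))) < 1 := by
    rw [map_mul, map_mul]
    exact mul_lt_one_of_lt_of_le hτ (hle _)
  constructor
  · intro hg
    by_contra hne
    rw [h1, map_add, toRat_C, Valuation.map_add_eq_of_lt_right, valuation_const hV hne] at hg
    · exact lt_irrefl _ hg
    · rwa [valuation_const hV hne]
  · intro hg
    rw [h1, hg, map_zero, add_zero]
    exact h2

end Place

/-! ### Canonical curves have barycentric data -/

lemma transcendental_of_not_const {p : RatField} (hp : ∀ c : ℂ, p ≠ algebraMap ℂ RatField c) :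
    Transcendental ℂ p :=
  RatFunc.transcendental_of_ne_C p (by rintro ⟨c, hc⟩; exact hp c hc)

lemma exists_fraction {p : RatField} (hp : Transcendental ℂ p)
    (h : finrank (adjoin ℂ {p}) RatField ≤ 3) :
    ∃ P₀ P₁ : ℂ[X], p = toRat P₁ / toRat P₀ ∧ IsCoprime P₀ P₁ ∧ P₀ ≠ 0 ∧ P₁ ≠ 0 ∧
      P₀.natDegree ≤ 3 ∧ P₁.natDegree ≤ 3 := by
  have hp0 : p ≠ 0 := by rintro rfl; exact hp isAlgebraic_zero
  have h1 := RatFunc.num_ne_zero hp0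
  have h2 := RatFunc.denom_ne_zero p
  have h3 := RatFunc.isCoprime_num_denom p
  have h4 : p = toRat p.num / toRat p.denom := (RatFunc.num_div_denom p).symm
  rw [h4, finrank_adjoin_div h3 h1 h2] at h
  exact ⟨p.denom, p.num, h4, h3.symm, h2, h1, (le_max_right _ _).trans h, (le_max_left _ _).trans h⟩

/-- Transport of a generic point under an automorphism of the function field. -/
lemma IsGenericPair.map {J : Ideal CoordRing} {p q : RatField} (h : IsGenericPair J p q)
    (σ : RatField ≃ₐ[ℂ] RatField) : IsGenericPair J (σ p) (σ q) := by
  refine ⟨fun d f hf => ?_, ?_⟩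
  · have : σ.toAlgHom.comp (aeval (segrePoint p q)) = aeval (segrePoint (σ p) (σ q)) := by
      refine algHom_ext fun i => ?_
      rw [AlgHom.comp_apply, aeval_X, aeval_X]
      change σ _ = _
      fin_cases i <;> simp [segrePoint]
    have h1 : σ (aeval (segrePoint p q) f) = aeval (segrePoint (σ p) (σ q)) f :=
      DFunLike.congr_fun this f
    rw [h.mem_iff d f hf, ← h1, map_eq_zero_iff _ σ.injective]
  · have h1 := congrArg (IntermediateField.map σ.toAlgHom) h.adjoin_eq_top
    rw [IntermediateField.adjoin_map, ← AlgHom.fieldRange_eq_map, AlgHom.fieldRange_eq_top.2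
      σ.surjective, Set.image_pair] at h1
    exact h1

/-- An automorphism of the field of rational functions moving a point to infinity. -/
lemma exists_inversion (τ : ℂ) : ∃ σ : RatField ≃ₐ[ℂ] RatField,
    σ (toRat 𝐗) = (toRat (𝐗 - 𝐂 τ))⁻¹ := by
  set x : RatField := (toRat (𝐗 - 𝐂 τ))⁻¹ with hx
  have hx0 : toRat (𝐗 - 𝐂 τ) ≠ 0 := toRat_ne_zero (Polynomial.X_sub_C_ne_zero τ)
  have hX : (RatFunc.X : RatField) = x⁻¹ + algebraMap ℂ RatField τ := by
    rw [hx, inv_inv, map_sub, toRat_C, sub_add_cancel, RatFunc.algebraMap_X]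
  have hE : RatFunc.X ∈ adjoin ℂ {x} := by
    rw [hX]
    exact add_mem (inv_mem (IntermediateField.mem_adjoin_simple_self ℂ x))
      ((adjoin ℂ {x}).algebraMap_mem τ)
  have htop : adjoin ℂ {x} = ⊤ := by
    rw [eq_top_iff, ← RatFunc.adjoin_X, adjoin_le_iff]
    rintro _ rfl
    exact hE
  have htr : Transcendental ℂ x := by
    refine transcendental_of_not_const fun c hc => ?_
    have h1 : (RatFunc.X : RatField) = algebraMap ℂ RatField (c⁻¹ + τ) := by
      rw [hX, hc, map_add, map_inv₀]
    have h2 : Transcendental ℂ (RatFunc.X : RatField) := RatFunc.transcendental_X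
    exact h2 (h1 ▸ isAlgebraic_algebraMap _)
  refine ⟨(RatFunc.algEquivOfTranscendental x htr).trans
    ((IntermediateField.equivOfEq htop).trans IntermediateField.topEquiv), ?_⟩
  change ((RatFunc.algEquivOfTranscendental x htr (toRat 𝐗) : adjoin ℂ {x}) : RatField) = x
  rw [RatFunc.algEquivOfTranscendental_algebraMap]
  simp

/-- The pull-back of a place under an automorphism. -/
lemma exists_comap_place (V : ValuationSubring RatField) (σ : RatField ≃ₐ[ℂ] RatField) :
    ∃ V' : ValuationSubring RatField, (∀ x, x ∈ V' ↔ σ x ∈ V) ∧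
      ∀ x, x ∈ V'.nonunits ↔ σ x ∈ V.nonunits := by
  refine ⟨V.comap σ.toAlgHom.toRingHom, fun x => Iff.rfl, fun x => ?_⟩
  rw [ValuationSubring.mem_nonunits_iff_or, ValuationSubring.mem_nonunits_iff_or,
    map_eq_zero_iff _ σ.injective, ← map_inv₀]
  rfl

/-- The first function in a generic pair has degree at most three and is not constant. -/
structure IsCubicGenericPair (J : Ideal CoordRing) (p q : RatField) : Prop
    extends IsGenericPair J p q where
  left : Transcendental ℂ p
  right : Transcendental ℂ q
  ne : p ≠ q
  left_le : finrank (adjoin ℂ {p}) RatField ≤ 3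
  right_le : finrank (adjoin ℂ {q}) RatField ≤ 3

/-- A constant p or q, or an equality p = q, would put the curve into a plane. The bounds on the
degrees come from one relation, read in both variables. -/
lemma IsGenericPair.isCubicGenericPair {J : Ideal CoordRing} {p q : RatField}
    (h : IsGenericPair J p q) (hlin : ∀ f : CoordRing, f.IsHomogeneous 1 → f ∈ J → f = 0)
    (hJ : ∀ m : Fin 16 → CoordRing, (∀ i, (m i).IsHomogeneous 3) →
      ∃ c : Fin 16 → ℂ, c ≠ 0 ∧ ∑ i, c i • m i ∈ J) : IsCubicGenericPair J p q := by
  have hlin' : ∀ b : Fin 4 → ℂ, ∑ i, b i • segrePoint p q i = 0 → b = 0 := by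
    intro b hb
    have h1 : (∑ i, b i • X i : CoordRing) ∈ J := by
      rw [h.mem_iff 1 _ (isHomogeneous_sum_X b), map_sum, ← hb]
      exact sum_congr rfl fun i _ => by rw [map_smul, aeval_X]
    have h2 := hlin _ (isHomogeneous_sum_X b) h1
    ext i
    have h3 := congrArg (eval (Pi.single i 1)) h2
    simpa [MvPolynomial.smul_eval, Pi.single_apply] using h3
  have hp : Transcendental ℂ p := transcendental_of_not_const fun c hc => by
    have := hlin' ![-c, 0, 1, 0] (by simp [Fin.sum_univ_four, segrePoint, hc, Algebra.smul_def])
    have := congrFun this 2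
    simp at this
  have hq : Transcendental ℂ q := transcendental_of_not_const fun c hc => by
    have := hlin' ![-c, 1, 0, 0] (by simp [Fin.sum_univ_four, segrePoint, hc, Algebra.smul_def])
    have := congrFun this 1
    simp at this
  obtain ⟨c, hc, hrel⟩ := h.exists_relation hJ
  refine { h with left := hp, right := hq, ne := ?_, left_le := ?_, right_le := ?_ }
  · rintro rfl
    have := hlin' ![0, 1, -1, 0] (by simp [Fin.sum_univ_four, segrePoint])
    have := congrFun this 1
    simp at this
  · exact finrank_adjoin_le_three hp h.adjoin_eq_top hc hrel
  · refine finrank_adjoin_le_three (c := fun i j => c j i) hq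
      (by rw [Set.pair_comm]; exact h.adjoin_eq_top) ?_ ?_
    · intro h0
      exact hc (funext fun i => funext fun j => congrFun (congrFun h0 j) i)
    · rw [Finset.sum_comm, ← hrel]
      exact sum_congr rfl fun i _ => sum_congr rfl fun j _ => by ring

lemma IsCubicGenericPair.map {J : Ideal CoordRing} {p q : RatField}
    (h : IsCubicGenericPair J p q) (σ : RatField ≃ₐ[ℂ] RatField)
    (hlin : ∀ f : CoordRing, f.IsHomogeneous 1 → f ∈ J → f = 0)
    (hJ : ∀ m : Fin 16 → CoordRing, (∀ i, (m i).IsHomogeneous 3) →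
      ∃ c : Fin 16 → ℂ, c ≠ 0 ∧ ∑ i, c i • m i ∈ J) : IsCubicGenericPair J (σ p) (σ q) :=
  (h.toIsGenericPair.map σ).isCubicGenericPair hlin hJ

lemma mul_mem_nonunits {V : ValuationSubring RatField} {a b : RatField} (ha : a ∈ V.nonunits)
    (hb : b ∈ V) : a * b ∈ V.nonunits := by
  rw [ValuationSubring.mem_nonunits_iff] at ha ⊢
  rw [map_mul]
  exact mul_lt_one_of_lt_of_le ha ((V.valuation_le_one_iff _).2 hb)

lemma mem_of_mem_nonunits {V : ValuationSubring RatField} {a : RatField} (ha : a ∈ V.nonunits) :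
    a ∈ V := (V.valuation_le_one_iff _).1 ((V.mem_nonunits_iff.1 ha).le)

lemma Transcendental.ne_zero' {p : RatField} (hp : Transcendental ℂ p) : p ≠ 0 := by
  rintro rfl; exact hp isAlgebraic_zero

/-- After an automorphism of the function field both functions have a pole at infinity. -/
lemma IsCubicGenericPair.exists_pole {J : Ideal CoordRing} {p q : RatField}
    (h : IsCubicGenericPair J p q) (hlin : ∀ f : CoordRing, f.IsHomogeneous 1 → f ∈ J → f = 0)
    (hJ : ∀ m : Fin 16 → CoordRing, (∀ i, (m i).IsHomogeneous 3) →
      ∃ c : Fin 16 → ℂ, c ≠ 0 ∧ ∑ i, c i • m i ∈ J)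
    (hpt : ∀ f ∈ J, eval ![0, 0, 0, 1] f = 0) :
    ∃ p q, IsCubicGenericPair J p q ∧ ∃ V : ValuationSubring RatField,
      (∀ c, algebraMap ℂ RatField c ∈ V) ∧ toRat 𝐗 ∉ V ∧ p⁻¹ ∈ V.nonunits ∧
      q⁻¹ ∈ V.nonunits := by
  have hp := h.left.ne_zero'
  have hq := h.right.ne_zero'
  obtain ⟨V, hV, hVp⟩ := h.exists_place hpt (k := 3) (by simp)
    (by simp [segrePoint, hp, hq])
  have h1 : p⁻¹ ∈ V.nonunits := by
    have := hVp 1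
    have e : segrePoint p q 1 / segrePoint p q 3 - algebraMap ℂ RatField
        ((![0, 0, 0, 1] : Fin 4 → ℂ) 1 / (![0, 0, 0, 1] : Fin 4 → ℂ) 3) = p⁻¹ := by
      simp [segrePoint]; field_simp
    rwa [e] at this
  have h2 : q⁻¹ ∈ V.nonunits := by
    have := hVp 2
    have e : segrePoint p q 2 / segrePoint p q 3 - algebraMap ℂ RatField
        ((![0, 0, 0, 1] : Fin 4 → ℂ) 2 / (![0, 0, 0, 1] : Fin 4 → ℂ) 3) = q⁻¹ := by
      simp [segrePoint]; field_simp
    rwa [e] at this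
  -- If the place is centred at a finite point τ, the substitution of 1/(t - τ) for t moves it to
  -- infinity.
  by_cases hX : toRat 𝐗 ∈ V
  · obtain ⟨τ, hτ⟩ := exists_centre hV hX (inv_ne_zero hp) h1
    obtain ⟨σ, hσ⟩ := exists_inversion τ
    obtain ⟨V', hV', hV'n⟩ := exists_comap_place V σ
    refine ⟨σ.symm p, σ.symm q, h.map σ.symm hlin hJ, V', fun c => ?_, ?_, ?_, ?_⟩
    · rw [hV', AlgEquiv.commutes]; exact hV c
    · rw [hV', hσ]
      have h3 := (hτ (𝐗 - 𝐂 τ)).2 (by simp)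
      rw [ValuationSubring.mem_nonunits_iff_or] at h3
      exact h3.resolve_left (toRat_ne_zero (Polynomial.X_sub_C_ne_zero τ))
    · rw [hV'n, map_inv₀, apply_symm_apply]; exact h1
    · rw [hV'n, map_inv₀, apply_symm_apply]; exact h2
  · exact ⟨p, q, h, V, hV, hX, h1, h2⟩

lemma natDegree_lt_of_pole {V : ValuationSubring RatField}
    (hV : ∀ c, algebraMap ℂ RatField c ∈ V) (hX : toRat 𝐗 ∉ V) {P₀ P₁ : ℂ[X]}
    (h₀ : P₀ ≠ 0) (h₁ : P₁ ≠ 0) (h : (toRat P₁ / toRat P₀)⁻¹ ∈ V.nonunits) :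
    P₀.natDegree < P₁.natDegree := by
  rw [ValuationSubring.mem_nonunits_iff, inv_div, map_div₀, valuation_toRat hV hX h₀,
    valuation_toRat hV hX h₁] at h
  rw [← V.valuation_le_one_iff, not_le] at hX
  rw [div_lt_one₀ (pow_pos (zero_lt_one.trans hX) _)] at h
  exact (pow_lt_pow_iff_right₀ hX).1 h

lemma eval_eq_of_place {V : ValuationSubring RatField} {P₀ P₁ : ℂ[X]} (h₀ : P₀ ≠ 0) {η τ : ℂ}
    (hX : ∀ f, toRat f ∈ V) (hτ : ∀ f : ℂ[X], toRat f ∈ V.nonunits ↔ f.eval τ = 0)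
    (h : toRat P₁ / toRat P₀ - algebraMap ℂ RatField η ∈ V.nonunits) :
    P₁.eval τ = η * P₀.eval τ := by
  have h1 := mul_mem_nonunits h (hX P₀)
  have h2 : (toRat P₁ / toRat P₀ - algebraMap ℂ RatField η) * toRat P₀ = toRat (P₁ - 𝐂 η * P₀) := by
    have := toRat_ne_zero h₀
    rw [map_sub, map_mul, toRat_C]
    field_simp
  rw [h2, hτ] at h1
  simpa [sub_eq_zero] using h1

/-- A pair of functions with a pole at infinity and common values at the nodes is barycentric. -/
lemma exists_isNodalPair {η t : Fin 5 → ℂ} (hη : Injective η) {P₀ P₁ Q₀ Q₁ : ℂ[X]}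
    (hP : IsCoprime P₀ P₁) (hQ : IsCoprime Q₀ Q₁) (hP₁ : P₁.natDegree ≤ 3) (hQ₁ : Q₁.natDegree ≤ 3)
    (hP₀ : P₀.natDegree < P₁.natDegree) (hQ₀ : Q₀.natDegree < Q₁.natDegree)
    (hPt : ∀ i, P₁.eval (t i) = η i * P₀.eval (t i)) (hQt : ∀ i, Q₁.eval (t i) = η i * Q₀.eval (t i))
    (hne : P₀ * Q₁ - P₁ * Q₀ ≠ 0) :
    ∃ r s, IsNodalPair η t r s ∧ P₀ = nodalComb t r ∧ P₁ = nodalComb t (fun i => r i * η i) ∧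
      Q₀ = nodalComb t s ∧ Q₁ = nodalComb t (fun i => s i * η i) := by
  have hP0t : ∀ i, P₀.eval (t i) ≠ 0 := fun i h0 =>
    eval_ne_zero_of_isCoprime hP h0 (by rw [hPt, h0, mul_zero])
  have hQ0t : ∀ i, Q₀.eval (t i) ≠ 0 := fun i h0 =>
    eval_ne_zero_of_isCoprime hQ h0 (by rw [hQt, h0, mul_zero])
  have ht : Injective t := by
    intro i j hij
    have h1 := hPt i
    rw [hij, hPt j] at h1
    exact hη (mul_right_cancel₀ (hP0t j) h1).symm
  have hw := eval_nodal_erase_ne_zero ht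
  have hnodal : ∀ {f : ℂ[X]} {ρ : Fin 5 → ℂ}, f.natDegree ≤ 3 →
      (∀ i, f.eval (t i) = ρ i * (nodal (Finset.univ.erase i) t).eval (t i)) →
      f = nodalComb t ρ := by
    intro f ρ hf hρ
    have hlt : ∀ {g : ℂ[X]}, g.natDegree ≤ 4 → g.degree < (univ : Finset (Fin 5)).card := fun hg =>
      Polynomial.degree_lt_iff_coeff_zero _ _ |>.2 fun m hm =>
        coeff_eq_zero_of_natDegree_lt (by simp at hm; omega)
    refine Polynomial.eq_of_degrees_lt_of_eval_index_eq univ ht.injOn (hlt (hf.trans (by omega)))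
      (hlt (natDegree_nodalComb_le ρ)) fun i _ => ?_
    rw [hρ, eval_nodalComb]
  -- The barycentric coefficients of interpolation at the five nodes; all four polynomials have
  -- degree below 5 and are recovered from their values.
  let r : Fin 5 → ℂ := fun i => P₀.eval (t i) / (nodal (Finset.univ.erase i) t).eval (t i)
  let s : Fin 5 → ℂ := fun i => Q₀.eval (t i) / (nodal (Finset.univ.erase i) t).eval (t i)
  have e1 : P₀ = nodalComb t r := hnodal (by omega) fun i => (div_mul_cancel₀ _ (hw i)).symm
  have e2 : Q₀ = nodalComb t s := hnodal (by omega) fun i => (div_mul_cancel₀ _ (hw i)).symm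
  have e3 : P₁ = nodalComb t (fun i => r i * η i) := hnodal hP₁ fun i => by
    rw [hPt, mul_right_comm, div_mul_cancel₀ _ (hw i), mul_comm]
  have e4 : Q₁ = nodalComb t (fun i => s i * η i) := hnodal hQ₁ fun i => by
    rw [hQt, mul_right_comm, div_mul_cancel₀ _ (hw i), mul_comm]
  have hz : ∀ {f : ℂ[X]} {m k : ℕ}, f.natDegree ≤ m → m < k → f.coeff k = 0 := fun h1 h2 =>
    coeff_eq_zero_of_natDegree_lt (h1.trans_lt h2)
  have s1 : ∑ i, r i = 0 := by
    rw [← coeff_four_nodalComb (t := t), ← e1]; exact hz (m := 2) (by omega) (by omega)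
  have s2 : ∑ i, s i = 0 := by
    rw [← coeff_four_nodalComb (t := t), ← e2]; exact hz (m := 2) (by omega) (by omega)
  have s3 : ∑ i, r i * η i = 0 := by
    rw [← coeff_four_nodalComb (t := t), ← e3]; exact hz hP₁ (by omega)
  have s4 : ∑ i, s i * η i = 0 := by
    rw [← coeff_four_nodalComb (t := t), ← e4]; exact hz hQ₁ (by omega)
  have s5 : ∑ i, r i * t i = 0 := by
    rw [← coeff_three_nodalComb s1, ← e1]; exact hz (m := 2) (by omega) (by omega)
  have s6 : ∑ i, s i * t i = 0 := by
    rw [← coeff_three_nodalComb s2, ← e2]; exact hz (m := 2) (by omega) (by omega)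
  -- The determinant has degree at most 5 and five zeros at the nodes, so it would be zero if its
  -- coefficient of x⁵ were.
  have hdet : P₀.coeff 2 * Q₁.coeff 3 - P₁.coeff 3 * Q₀.coeff 2 ≠ 0 := by
    have h1 : (P₀ * Q₁ - P₁ * Q₀).natDegree ≤ 5 := by
      refine (Polynomial.natDegree_sub_le _ _).trans (max_le ?_ ?_) <;>
        exact Polynomial.natDegree_mul_le.trans (by omega)
    have h2 := eq_C_mul_nodal ht h1 fun i => by
      rw [Polynomial.eval_sub, Polynomial.eval_mul, Polynomial.eval_mul, hPt, hQt]; ring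
    rw [Polynomial.coeff_sub, coeff_mul_add_eq_of_natDegree_le (df := 2) (dg := 3) (by omega) hQ₁,
      coeff_mul_add_eq_of_natDegree_le (df := 3) (dg := 2) hP₁ (by omega)] at h2
    intro h0
    rw [h0, map_zero, zero_mul] at h2
    exact hne h2
  -- If g had degree below 3, then f would have degree below 2, and the determinant would be zero.
  have hlead : ∀ {f g f' g' : ℂ[X]}, g.natDegree ≤ 3 → f.natDegree < g.natDegree →
      f.coeff 2 * g'.coeff 3 - g.coeff 3 * f'.coeff 2 ≠ 0 → g.coeff 3 ≠ 0 := by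
    intro f g f' g' h1 h2 h3 h0
    have h4 : g.natDegree ≤ 2 := by
      by_contra hlt
      have : g.natDegree = 3 := by omega
      rw [← this, Polynomial.coeff_natDegree, Polynomial.leadingCoeff_eq_zero] at h0
      rw [h0] at this
      simp at this
    rw [h0, hz (f := f) (m := 1) (by omega) (by omega)] at h3
    simp at h3
  refine ⟨r, s, ⟨hη, ht, fun i => div_ne_zero (hP0t i) (hw i), fun i => div_ne_zero (hQ0t i) (hw i),
    s1, s2, s5, s6, s3, s4, ?_, ?_, ?_⟩, e1, e3, e2, e4⟩
  · rw [← coeff_three_nodalComb s3, ← e3]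
    exact hlead hP₁ hP₀ hdet
  · rw [← coeff_three_nodalComb s4, ← e4]
    refine hlead hQ₁ hQ₀ (f' := P₀) (g' := P₁) ?_
    contrapose! hdet
    linear_combination -hdet
  · rw [← coeff_three_nodalComb s3, ← coeff_three_nodalComb s4, ← coeff_two_nodalComb s1 s5,
      ← coeff_two_nodalComb s2 s6, ← e1, ← e2, ← e3, ← e4]
    exact hdet

/-- A generic pair whose curve contains the six points comes from barycentric data. -/
lemma IsGenericPair.exists_nodal {J : Ideal CoordRing} {p q : RatField} (h : IsGenericPair J p q)
    (hlin : ∀ f : CoordRing, f.IsHomogeneous 1 → f ∈ J → f = 0)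
    (hJ : ∀ m : Fin 16 → CoordRing, (∀ i, (m i).IsHomogeneous 3) →
      ∃ c : Fin 16 → ℂ, c ≠ 0 ∧ ∑ i, c i • m i ∈ J)
    (hpt : ∀ f ∈ J, eval ![0, 0, 0, 1] f = 0) {η : Fin 5 → ℂ} (hη : Injective η)
    (hη' : ∀ i, ∀ f ∈ J, eval (segrePoint (η i) (η i)) f = 0) :
    ∃ t r s, IsNodalPair η t r s ∧ ∀ (d : ℕ) (f : CoordRing), f.IsHomogeneous d →
      (f ∈ J ↔ aeval (segreCoords (nodalComb t r) (nodalComb t fun i => r i * η i) (nodalComb t s)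
        (nodalComb t fun i => s i * η i)) f = (0 : ℂ[X])) := by
  obtain ⟨p, q, h, V, hV, hX, hVp, hVq⟩ :=
    (h.isCubicGenericPair hlin hJ).exists_pole hlin hJ hpt
  obtain ⟨P₀, P₁, hp, hPc, hP₀, hP₁, -, hP₁d⟩ := exists_fraction h.left h.left_le
  obtain ⟨Q₀, Q₁, hq, hQc, hQ₀, hQ₁, -, hQ₁d⟩ := exists_fraction h.right h.right_le
  have hPd := natDegree_lt_of_pole hV hX hP₀ hP₁ (hp ▸ hVp)
  have hQd := natDegree_lt_of_pole hV hX hQ₀ hQ₁ (hq ▸ hVq)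
  have hnode : ∀ i, ∃ τ, P₁.eval τ = η i * P₀.eval τ ∧ Q₁.eval τ = η i * Q₀.eval τ := by
    intro i
    obtain ⟨V', hV', hV'p⟩ := h.exists_place (hη' i) (k := 0) (by simp [segrePoint])
      (by simp [segrePoint])
    have h1 : q - algebraMap ℂ RatField (η i) ∈ V'.nonunits := by simpa [segrePoint] using hV'p 1
    have h2 : p - algebraMap ℂ RatField (η i) ∈ V'.nonunits := by simpa [segrePoint] using hV'p 2
    -- The place lies at a finite parameter: p is finite there, whereas it has a pole at infinity by
    -- the comparison of degrees.
    have hX' : toRat 𝐗 ∈ V' := by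
      by_contra hX'
      have h3 : p ∈ V' := by
        have := V'.add_mem _ _ (mem_of_mem_nonunits h2) (hV' (η i))
        rwa [sub_add_cancel] at this
      rw [hp, ← V'.valuation_le_one_iff, map_div₀, valuation_toRat hV' hX' hP₀,
        valuation_toRat hV' hX' hP₁] at h3
      rw [← V'.valuation_le_one_iff, not_le] at hX'
      rw [div_le_one₀ (pow_pos (zero_lt_one.trans hX') _), pow_le_pow_iff_right₀ hX'] at h3
      omega
    obtain ⟨τ, hτ⟩ := exists_centre hV' hX'
      (sub_ne_zero.2 fun h0 => h.left (by rw [h0]; exact isAlgebraic_algebraMap _)) h2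
    exact ⟨τ, eval_eq_of_place hP₀ (toRat_mem hV' hX') hτ (hp ▸ h2),
      eval_eq_of_place hQ₀ (toRat_mem hV' hX') hτ (hq ▸ h1)⟩
  choose t ht using hnode
  obtain ⟨r, s, hrs, e1, e2, e3, e4⟩ := exists_isNodalPair hη hPc hQc hP₁d hQ₁d hPd hQd
    (fun i => (ht i).1) (fun i => (ht i).2) (by
      intro h0
      refine h.ne ?_
      rw [hp, hq, div_eq_div_iff (toRat_ne_zero hP₀) (toRat_ne_zero hQ₀), ← map_mul, ← map_mul]
      congr 1
      linear_combination -h0)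
  refine ⟨t, r, s, hrs, fun d f hf => ?_⟩
  rw [← e1, ← e2, ← e3, ← e4, h.mem_iff d f hf, hp, hq, aeval_segrePoint_iff hP₀ hQ₀ hf]

/-! ### The parametrized family of canonical curves -/

/-- The canonically embedded rational curves on the quadric `Φ segre` through six given points of the
diagonal conic. -/
def segreCurves (Φ : CoordRing ≃ₐ[ℂ] CoordRing) (η : Fin 5 → ℂ) : Set IntegralCurve :=
  {C | C.IsCanonicallyEmbedded ∧ C.IsRational ∧
    (∀ f ∈ C.ideal, eval ![0, 0, 0, 1] (Φ.symm f) = 0) ∧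
    (∀ i, ∀ f ∈ C.ideal, eval (segrePoint (η i) (η i)) (Φ.symm f) = 0) ∧ Φ segre ∈ C.ideal}

/-- The curve has the given barycentric data. -/
def IntegralCurve.IsNodal (C : IntegralCurve) (Φ : CoordRing ≃ₐ[ℂ] CoordRing)
    (η t r s : Fin 5 → ℂ) : Prop :=
  C.IsParametrizedBy Φ (nodalComb t r) (nodalComb t fun i => r i * η i) (nodalComb t s)
    (nodalComb t fun i => s i * η i)

lemma nodalComb_smul (t ρ : Fin 5 → ℂ) (a : ℂ) :
    nodalComb t (fun i => a * ρ i) = 𝐂 a * nodalComb t ρ := by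
  rw [nodalComb, nodalComb, mul_sum]
  exact sum_congr rfl fun i _ => by rw [map_mul, mul_assoc]

/-- Rescaling the residues and an affine change of the parameter do not change the curve. -/
lemma IntegralCurve.isNodal_iff {C : IntegralCurve} {Φ : CoordRing ≃ₐ[ℂ] CoordRing}
    {η t r s t' r' s' : Fin 5 → ℂ} {a b α γ : ℂ} (ha : a ≠ 0) (hb : b ≠ 0) (hα : α ≠ 0)
    (ht : ∀ i, t i = α * t' i + γ) (hr : ∀ i, r i = a * r' i) (hs : ∀ i, s i = b * s' i) :
    C.IsNodal Φ η t r s ↔ C.IsNodal Φ η t' r' s' := by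
  have key : ∀ {ρ ρ' : Fin 5 → ℂ} {c : ℂ}, (∀ i, ρ i = c * ρ' i) →
      (nodalComb t ρ).comp (𝐂 α * 𝐗 + 𝐂 γ) = 𝐂 (α ^ 4 * c) * nodalComb t' ρ' := by
    intro ρ ρ' c h
    rw [nodalComb_comp ht, show ρ = fun i => c * ρ' i from funext h, nodalComb_smul, map_mul,
      mul_assoc]
  refine forall_congr' fun d => forall_congr' fun f => forall_congr' fun hf => ?_
  rw [aeval_segreCoords_iff (mul_ne_zero (pow_ne_zero 4 hα) ha) (mul_ne_zero (pow_ne_zero 4 hα) hb)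
    (by rw [Polynomial.natDegree_linear hα]; norm_num) (key hr)
    (key (ρ' := fun i => r' i * η i) fun i => by rw [hr, mul_assoc]) (key hs)
    (key (ρ' := fun i => s' i * η i) fun i => by rw [hs, mul_assoc]) hf]

lemma IsNodalPair.of_smul {η t r s r' s' : Fin 5 → ℂ} (h : IsNodalPair η t r s) {a b : ℂ}
    (hr : ∀ i, r i = a * r' i) (hs : ∀ i, s i = b * s' i) : IsNodalPair η t r' s' := by
  have ha : a ≠ 0 := fun h0 => h.left_ne_zero 0 (by rw [hr, h0, zero_mul])
  have hb : b ≠ 0 := fun h0 => h.right_ne_zero 0 (by rw [hs, h0, zero_mul])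
  obtain ⟨h1, h2, h3, h4, h5, h6, h7, h8, h9, h10, h11, h12, h13⟩ := h
  simp only [hr, hs, mul_assoc, ← mul_sum] at h3 h4 h5 h6 h7 h8 h9 h10 h11 h12 h13
  refine ⟨h1, h2, fun i => right_ne_zero_of_mul (h3 i), fun i => right_ne_zero_of_mul (h4 i),
    (mul_eq_zero.1 h5).resolve_left ha, (mul_eq_zero.1 h6).resolve_left hb,
    (mul_eq_zero.1 h7).resolve_left ha, (mul_eq_zero.1 h8).resolve_left hb,
    (mul_eq_zero.1 h9).resolve_left ha, (mul_eq_zero.1 h10).resolve_left hb, ?_, ?_, ?_⟩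
  · simp only [mul_assoc]; exact right_ne_zero_of_mul h11
  · simp only [mul_assoc]; exact right_ne_zero_of_mul h12
  · intro h0
    simp only [mul_assoc] at h0
    exact h13 (by linear_combination a * b * h0)

/-! ### The curves belonging to the parameters -/

namespace CurveParam

variable (η : Fin 5 → ℂ)

/-- The cubic equation of the curve with parameters `e`. -/
def cubic (e : Fin 8 → ℂ) : CoordRing :=
  bezoutCubic (nodalComb (node η e) (left η e)) (nodalComb (node η e) fun i => left η e i * η i)
    (nodalComb (node η e) (right η e)) (nodalComb (node η e) fun i => right η e i * η i)

/-- The parameters given by the zeros of the two quadratic polynomials. -/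
def slice (u : Fin 5 → ℂ) : Fin 8 → ℂ :=
  ![u 1 * u 2, -(u 1 + u 2), 1, u 3 * u 4, -(u 3 + u 4), 1, 1, u 0]

variable {η} {Φ : CoordRing ≃ₐ[ℂ] CoordRing} (hΦ : PreservesDegree Φ) (hη : Injective η)
include hΦ hη

lemma exists_curve {e : Fin 8 → ℂ} (he : disc η e ≠ 0) : ∃ C ∈ segreCurves Φ η,
    C.IsNodal Φ η (node η e) (left η e) (right η e) ∧ C.ideal = span {Φ segre, Φ (cubic η e)} := by
  have h := (isNodalPair_iff hη).2 he
  obtain ⟨C, h1, h2, h3, h4⟩ := h.exists_integralCurve hΦ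
  have key : ∀ w : Fin 4 → ℂ, eval w segre = 0 → eval w (cubic η e) = 0 →
      ∀ f ∈ C.ideal, eval w (Φ.symm f) = 0 := by
    intro w hw hw' f hf
    rw [h2] at hf
    have hle : span {Φ segre, Φ (cubic η e)} ≤
        RingHom.ker ((eval w).comp (Φ.symm : CoordRing →+* CoordRing)) := by
      rw [Ideal.span_le]
      rintro _ (rfl | rfl)
      · change eval w (Φ.symm (Φ segre)) = 0
        rwa [AlgEquiv.symm_apply_apply]
      · change eval w (Φ.symm (Φ (cubic η e))) = 0
        rwa [AlgEquiv.symm_apply_apply]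
    exact hle hf
  refine ⟨C, ⟨h3, h4, key _ (by simp [segre]) h.eval_last_cubic,
    fun i => key _ (by simp [segre, segrePoint]) (h.eval_cubic_eq_zero i), ?_⟩, h1, h2⟩
  rw [h2]
  exact subset_span (by simp)

/-- Surjectivity of the parametrization. The generic point yields barycentric data, these come from
parameters up to an affine change of t, and such a change does not affect the curve. -/
lemma exists_param_of_mem {C : IntegralCurve} (hC : C ∈ segreCurves Φ η) :
    ∃ e, disc η e ≠ 0 ∧ C.IsNodal Φ η (node η e) (left η e) (right η e) := by
  obtain ⟨hcan, hrat, hpt, hη', hseg⟩ := hC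
  obtain ⟨p, q, hpq⟩ := hrat.exists_isGenericPair (fun f => hcan.linear_notMem) hΦ hseg
  obtain ⟨t, r, s, hn, hmem⟩ := hpq.exists_nodal (fun f hf hf0 => by
      have := hcan.linear_notMem ((hΦ 1 f).2 hf) hf0
      rwa [map_eq_zero_iff _ Φ.injective] at this)
    (fun m hm => by
      obtain ⟨c, hc, h0⟩ := hcan.exists_cubic (fun i => Φ (m i)) fun i => (hΦ 3 _).2 (hm i)
      refine ⟨c, hc, ?_⟩
      rw [Ideal.mem_comap, map_sum]
      simpa only [map_smul] using h0)
    (fun f hf => by simpa using hpt _ hf) hη (fun i f hf => by simpa using hη' i _ hf)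
  obtain ⟨e, α, γ, hα, rfl, rfl, ht⟩ := hn.exists_param
  refine ⟨e, (isNodalPair_iff hη).1 (hn.of_affine hα ht), ?_⟩
  rw [← C.isNodal_iff one_ne_zero one_ne_zero hα ht (fun i => (one_mul _).symm)
    fun i => (one_mul _).symm]
  exact hmem

omit hΦ in
/-- A general curve of the family has parameters in the slice. -/
lemma exists_slice {e : Fin 8 → ℂ} (he : disc η e ≠ 0) (h2 : e 2 ≠ 0) (h5 : e 5 ≠ 0)
    (h6 : e 6 ≠ 0) : ∃ u, disc η (slice u) ≠ 0 ∧ ∀ C : IntegralCurve,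
      C.IsNodal Φ η (node η e) (left η e) (right η e) ↔
        C.IsNodal Φ η (node η (slice u)) (left η (slice u)) (right η (slice u)) := by
  have hquad : ∀ a b c : ℂ, c ≠ 0 → ∃ x y, a = c * (x * y) ∧ b = c * -(x + y) := by
    intro a b c hc
    obtain ⟨z, hz⟩ := IsAlgClosed.exists_pow_nat_eq (b ^ 2 - 4 * a * c) (show 0 < 2 by norm_num)
    refine ⟨(-b + z) / (2 * c), (-b - z) / (2 * c), ?_, ?_⟩
    · field_simp
      linear_combination hz
    · field_simp
      ring
  obtain ⟨x₁, x₂, e0, e1⟩ := hquad (e 0) (e 1) _ h2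
  obtain ⟨x₃, x₄, e3, e4⟩ := hquad (e 3) (e 4) _ h5
  -- The residues are divided by e 2 and e 5 to make the quadratic polynomials monic, and the nodes
  -- by e 6; this turns the coefficient e 7 of the cross product into e 7 e 2 e 5 / e 6.
  set u : Fin 5 → ℂ := ![e 7 * e 2 * e 5 / e 6, x₁, x₂, x₃, x₄] with hu
  have hl : ∀ i, left η e i = e 2 * left η (slice u) i := fun i => by
    simp only [left, slice, hu, e0, e1]
    simp
    ring
  have hr : ∀ i, right η e i = e 5 * right η (slice u) i := fun i => by
    simp only [right, slice, hu, e3, e4]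
    simp
    ring
  have ht : ∀ i, node η e i = e 6 * node η (slice u) i + 0 := fun i => by
    simp only [node, slice, hu, e0, e1, e3, e4]
    simp
    field_simp
  refine ⟨u, ?_, fun C => C.isNodal_iff h2 h5 h6 ht hl hr⟩
  rw [← isNodalPair_iff hη]
  exact (((isNodalPair_iff hη).2 he).of_smul hl hr).of_affine h6 ht

end CurveParam

/-! ### Polynomial families -/

/-- A family of elements of an algebra that depends polynomially on parameters. -/
def IsPolyFamily {n : ℕ} {M : Type} [CommRing M] [Algebra ℂ M] (f : (Fin n → ℂ) → M) : Prop :=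
  ∃ p : MvPolynomial (Fin n) M, ∀ u, f u = eval (fun i => algebraMap ℂ M (u i)) p

namespace IsPolyFamily

variable {n : ℕ} {M : Type} [CommRing M] [Algebra ℂ M] {f g : (Fin n → ℂ) → M}

lemma const (m : M) : IsPolyFamily (fun _ : Fin n → ℂ => m) := ⟨C m, fun u => by simp⟩

lemma coord (i : Fin n) : IsPolyFamily (fun u : Fin n → ℂ => u i) := ⟨X i, fun u => by simp⟩

lemma add (hf : IsPolyFamily f) (hg : IsPolyFamily g) : IsPolyFamily (fun u => f u + g u) := by
  obtain ⟨p, hp⟩ := hf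
  obtain ⟨q, hq⟩ := hg
  exact ⟨p + q, fun u => by simp only [hp, hq, map_add]⟩

lemma mul (hf : IsPolyFamily f) (hg : IsPolyFamily g) : IsPolyFamily (fun u => f u * g u) := by
  obtain ⟨p, hp⟩ := hf
  obtain ⟨q, hq⟩ := hg
  exact ⟨p * q, fun u => by simp only [hp, hq, map_mul]⟩

lemma sub (hf : IsPolyFamily f) (hg : IsPolyFamily g) : IsPolyFamily (fun u => f u - g u) := by
  obtain ⟨p, hp⟩ := hf
  obtain ⟨q, hq⟩ := hg
  exact ⟨p - q, fun u => by simp only [hp, hq, map_sub]⟩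

lemma neg (hf : IsPolyFamily f) : IsPolyFamily (fun u => -f u) := by
  obtain ⟨p, hp⟩ := hf
  exact ⟨-p, fun u => by simp only [hp, map_neg]⟩

lemma pow (hf : IsPolyFamily f) (k : ℕ) : IsPolyFamily (fun u => f u ^ k) := by
  obtain ⟨p, hp⟩ := hf
  exact ⟨p ^ k, fun u => by simp only [hp, map_pow]⟩

lemma sum {ι : Type} {s : Finset ι} {f : ι → (Fin n → ℂ) → M} (h : ∀ i ∈ s, IsPolyFamily (f i)) :
    IsPolyFamily (fun u => ∑ i ∈ s, f i u) := by
  classical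
  induction s using Finset.induction_on with
  | empty => simpa using const 0
  | insert a s ha ih =>
    simp only [Finset.sum_insert ha]
    exact (h a (by simp)).add (ih fun i hi => h i (by simp [hi]))

lemma prod {ι : Type} {s : Finset ι} {f : ι → (Fin n → ℂ) → M} (h : ∀ i ∈ s, IsPolyFamily (f i)) :
    IsPolyFamily (fun u => ∏ i ∈ s, f i u) := by
  classical
  induction s using Finset.induction_on with
  | empty => simpa using const 1
  | insert a s ha ih =>
    simp only [Finset.prod_insert ha]
    exact (h a (by simp)).mul (ih fun i hi => h i (by simp [hi]))

lemma ofId {f : (Fin n → ℂ) → ℂ} (hf : IsPolyFamily f) :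
    IsPolyFamily (fun u => Algebra.ofId ℂ M (f u)) := by
  obtain ⟨p, hp⟩ := hf
  refine ⟨p.map (Algebra.ofId ℂ M : ℂ →+* M), fun u => ?_⟩
  change Algebra.ofId ℂ M (f u) = _
  rw [hp, MvPolynomial.eval_map]
  exact MvPolynomial.eval₂_comp_left (Algebra.ofId ℂ M : ℂ →+* M) (RingHom.id ℂ) u p

lemma smul {f : (Fin n → ℂ) → ℂ} (hf : IsPolyFamily f) (hg : IsPolyFamily g) : IsPolyFamily (fun u => f u • g u) := by
  simp only [Algebra.smul_def]
  exact hf.ofId.mul hg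

/-- A linear function of a polynomial family is a polynomial family. -/
lemma linear {M' : Type} [CommRing M'] [Algebra ℂ M'] (hf : IsPolyFamily f) (l : M →ₗ[ℂ] M') :
    IsPolyFamily (fun u => l (f u)) := by
  obtain ⟨p, hp⟩ := hf
  have : (fun u => l (f u)) = fun u => ∑ m ∈ p.support, (∏ i, u i ^ m i) • l (p.coeff m) := by
    funext u
    rw [hp, MvPolynomial.eval_eq', map_sum]
    refine sum_congr rfl fun m _ => ?_
    simp only [← map_pow, ← map_prod]
    rw [mul_comm, ← Algebra.smul_def, map_smul]
  rw [this]
  exact sum fun m _ => .smul (prod fun i _ => (coord i).pow _) (const _)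

lemma evalPolynomial {f : (Fin n → ℂ) → ℂ[X]} {x : (Fin n → ℂ) → ℂ} (hf : IsPolyFamily f)
    (hx : IsPolyFamily x) : IsPolyFamily (fun u => (f u).eval (x u)) := by
  obtain ⟨p, hp⟩ := hf
  have : (fun u => (f u).eval (x u)) = fun u => ∑ m ∈ p.support,
      (∑ k ∈ (p.coeff m).support, (p.coeff m).coeff k * x u ^ k) * ∏ i, u i ^ m i := by
    funext u
    rw [hp, MvPolynomial.eval_eq', Polynomial.eval_finsetSum]
    refine sum_congr rfl fun m _ => ?_
    rw [Polynomial.eval_mul, Polynomial.eval_prod, Polynomial.eval_eq_sum, Polynomial.sum_def]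
    simp [Polynomial.algebraMap_eq]
  rw [this]
  exact sum fun m _ => (sum fun k _ => (const _).mul (hx.pow _)).mul (prod fun i _ => (coord i).pow _)

lemma det_bezoutMatrix {m : (Fin n → ℂ) → ℕ → ℕ → M}
    (h : ∀ k l, IsPolyFamily (fun u => m u k l)) : IsPolyFamily (fun u => (bezoutMatrix (m u)).det) := by
  simp only [bezoutMatrix, Matrix.det_fin_three, Matrix.of_apply, Matrix.cons_val', Matrix.cons_val_zero,
    Matrix.cons_val_one, Matrix.cons_val, Matrix.cons_val_fin_one]
  repeat first
    | exact h _ _ | apply IsPolyFamily.add | apply IsPolyFamily.sub | apply IsPolyFamily.mul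

lemma bezoutCubic {P₀ P₁ Q₀ Q₁ : (Fin n → ℂ) → ℂ[X]} (hP₀ : IsPolyFamily P₀)
    (hP₁ : IsPolyFamily P₁) (hQ₀ : IsPolyFamily Q₀) (hQ₁ : IsPolyFamily Q₁) :
    IsPolyFamily (fun u => bezoutCubic (P₀ u) (P₁ u) (Q₀ u) (Q₁ u)) := by
  have hX : ∀ (i : Fin 4) {f g : (Fin n → ℂ) → ℂ[X]} (k l : ℕ), IsPolyFamily f →
      IsPolyFamily g → IsPolyFamily (fun u => ((f u).coeff k * (g u).coeff l) • (X i : CoordRing)) :=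
    fun i f g k l hf hg => .smul ((hf.linear (Polynomial.lcoeff ℂ k)).mul
      (hg.linear (Polynomial.lcoeff ℂ l))) (.const _)
  have hform : ∀ k l, IsPolyFamily (fun u => coeffForm (P₀ u) (P₁ u) (Q₀ u) (Q₁ u) k l) := fun k l => by
    simp only [coeffForm, smul_smul]
    exact (((hX 0 k l hP₁ hQ₁).sub (hX 1 k l hP₁ hQ₀)).sub (hX 2 k l hP₀ hQ₁)).add
      (hX 3 k l hP₀ hQ₀)
  exact det_bezoutMatrix fun k l => (hform k l).sub (hform l k)

lemma comp {k : ℕ} {f : (Fin n → ℂ) → ℂ} (hf : IsPolyFamily f) {g : (Fin k → ℂ) → Fin n → ℂ}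
    (hg : ∀ i, IsPolyFamily (fun u => g u i)) : IsPolyFamily (fun u => f (g u)) := by
  obtain ⟨p, hp⟩ := hf
  have : (fun u => f (g u)) = fun u => ∑ m ∈ p.support, p.coeff m * ∏ i, g u i ^ m i := by
    funext u
    rw [hp, MvPolynomial.eval_eq']
    rfl
  rw [this]
  exact sum fun m _ => (const _).mul (prod fun i _ => (hg i).pow _)

/-- The product of polynomials that do not vanish identically does not vanish identically. -/
lemma exists_ne_zero_of_mul {f g : (Fin n → ℂ) → ℂ} (hf : IsPolyFamily f) (hg : IsPolyFamily g)
    (hf0 : ∃ u, f u ≠ 0) (hg0 : ∃ u, g u ≠ 0) : ∃ u, f u * g u ≠ 0 := by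
  obtain ⟨p, hp⟩ := hf
  obtain ⟨q, hq⟩ := hg
  by_contra! hcon
  have h1 : p * q = 0 := MvPolynomial.funext fun u => by
    rw [map_mul, map_zero, ← hcon u, hp, hq]; rfl
  rcases mul_eq_zero.1 h1 with rfl | rfl
  · obtain ⟨u, hu⟩ := hf0
    exact hu (by rw [hp, map_zero])
  · obtain ⟨u, hu⟩ := hg0
    exact hu (by rw [hq, map_zero])

lemma exists_ne_zero_of_prod {ι : Type} {s : Finset ι} {f : ι → (Fin n → ℂ) → ℂ}
    (hf : ∀ i ∈ s, IsPolyFamily (f i)) (h : ∀ i ∈ s, ∃ u, f i u ≠ 0) : ∃ u, ∏ i ∈ s, f i u ≠ 0 := by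
  classical
  induction s using Finset.induction_on with
  | empty => exact ⟨0, by simp⟩
  | insert a s ha ih =>
    simp only [Finset.prod_insert ha]
    exact exists_ne_zero_of_mul (hf a (by simp)) (prod fun i hi => hf i (by simp [hi]))
      (h a (by simp)) (ih (fun i hi => hf i (by simp [hi])) fun i hi => h i (by simp [hi]))

/-- A polynomial that vanishes wherever another one does not vanishes everywhere. -/
lemma eq_zero_of_forall {f g : (Fin n → ℂ) → ℂ} (hf : IsPolyFamily f) (hg : IsPolyFamily g)
    (hg0 : ∃ u, g u ≠ 0) (h : ∀ u, g u ≠ 0 → f u = 0) (u : Fin n → ℂ) : f u = 0 := by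
  by_contra hne
  obtain ⟨v, hv⟩ := exists_ne_zero_of_mul hf hg ⟨u, hne⟩ hg0
  exact left_ne_zero_of_mul hv (h v (right_ne_zero_of_mul hv))

end IsPolyFamily

/-! ### Polynomial dependence of the curves on the parameters -/

namespace CurveParam

variable (η : Fin 5 → ℂ)

lemma isPoly_left (i : Fin 5) : IsPolyFamily (fun e => left η e i) :=
  (((IsPolyFamily.coord 0).add ((IsPolyFamily.coord 1).mul (.const _))).add
    ((IsPolyFamily.coord 2).mul (.const _))).mul (.const _)

lemma isPoly_right (i : Fin 5) : IsPolyFamily (fun e => right η e i) :=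
  (((IsPolyFamily.coord 3).add ((IsPolyFamily.coord 4).mul (.const _))).add
    ((IsPolyFamily.coord 5).mul (.const _))).mul (.const _)

lemma isPoly_node (i : Fin 5) : IsPolyFamily (fun e => node η e i) :=
  ((((((IsPolyFamily.coord 7).mul (((IsPolyFamily.coord 1).mul (.coord 5)).sub
    ((IsPolyFamily.coord 2).mul (.coord 4)))).mul (.const _)).add
    (((IsPolyFamily.coord 7).mul (((IsPolyFamily.coord 2).mul (.coord 3)).sub
    ((IsPolyFamily.coord 0).mul (.coord 5)))).mul (.const _))).add
    (((IsPolyFamily.coord 7).mul (((IsPolyFamily.coord 0).mul (.coord 4)).sub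
    ((IsPolyFamily.coord 1).mul (.coord 3)))).mul (.const _))).add ((IsPolyFamily.coord 6).mul (.const _)))

lemma isPoly_node_sub (p : Fin 5 × Fin 5) :
    IsPolyFamily (fun e => if p.1 = p.2 then 1 else node η e p.1 - node η e p.2) := by
  split_ifs
  · exact .const 1
  · exact (isPoly_node η _).sub (isPoly_node η _)

/-- The determinant occurring in `disc`. -/
def det (e : Fin 8 → ℂ) : ℂ :=
  (∑ i, left η e i * node η e i * node η e i) * (∑ i, right η e i * η i * node η e i) -
    (∑ i, left η e i * η i * node η e i) * (∑ i, right η e i * node η e i * node η e i)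

lemma isPoly_det : IsPolyFamily (det η) :=
  ((IsPolyFamily.sum fun i _ => ((isPoly_left η i).mul (isPoly_node η i)).mul (isPoly_node η i)).mul
    (.sum fun i _ => ((isPoly_right η i).mul (.const _)).mul (isPoly_node η i))).sub
    ((IsPolyFamily.sum fun i _ => ((isPoly_left η i).mul (.const _)).mul (isPoly_node η i)).mul
    (.sum fun i _ => ((isPoly_right η i).mul (isPoly_node η i)).mul (isPoly_node η i)))

lemma isPoly_disc : IsPolyFamily (disc η) :=
  (((((IsPolyFamily.prod fun p _ => isPoly_node_sub η p).mul (.prod fun i _ => isPoly_left η i)).mul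
    (.prod fun i _ => isPoly_right η i)).mul
    (.sum fun i _ => ((isPoly_left η i).mul (.const _)).mul (isPoly_node η i))).mul
    (.sum fun i _ => ((isPoly_right η i).mul (.const _)).mul (isPoly_node η i))).mul
    (isPoly_det η)

lemma isPoly_nodalComb {ρ : (Fin 8 → ℂ) → Fin 5 → ℂ} (h : ∀ i, IsPolyFamily (fun e => ρ e i)) :
    IsPolyFamily (fun e => nodalComb (node η e) (ρ e)) :=
  .sum fun i _ => (IsPolyFamily.ofId (M := ℂ[X]) (h i)).mul
    (.prod fun j _ => (IsPolyFamily.const 𝐗).sub (IsPolyFamily.ofId (M := ℂ[X]) (isPoly_node η j)))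

lemma isPoly_cubic : IsPolyFamily (cubic η) :=
  IsPolyFamily.bezoutCubic (isPoly_nodalComb η (isPoly_left η))
    (isPoly_nodalComb η (ρ := fun e i => left η e i * η i) fun i => (isPoly_left η i).mul (.const _))
    (isPoly_nodalComb η (isPoly_right η))
    (isPoly_nodalComb η (ρ := fun e i => right η e i * η i) fun i => (isPoly_right η i).mul (.const _))

lemma isPoly_slice (k : Fin 8) : IsPolyFamily (fun u => slice u k) := by
  fin_cases k
  · exact (IsPolyFamily.coord 1).mul (.coord 2)
  · exact ((IsPolyFamily.coord 1).add (.coord 2)).neg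
  · exact .const 1
  · exact (IsPolyFamily.coord 3).mul (.coord 4)
  · exact ((IsPolyFamily.coord 3).add (.coord 4)).neg
  · exact .const 1
  · exact .const 1
  · exact .coord 0

end CurveParam

/-! ### Slopes of a curve at the points of the diagonal conic -/

lemma derivative_aeval (z : Fin 4 → ℂ[X]) (f : CoordRing) : derivative (aeval z f) =
      ∑ k, aeval z (pderiv k f) * derivative (z k) := by
  induction f using MvPolynomial.induction_on with
  | C a => simp [Polynomial.algebraMap_eq]
  | add p q hp hq => simp only [map_add, hp, hq, add_mul, sum_add_distrib]
  | mul_X p i hp =>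
    have h1 : ∀ k : Fin 4, aeval z (pderiv k (p * X i)) * derivative (z k) =
        aeval z p * (aeval z (pderiv k (X i : CoordRing)) * derivative (z k)) +
          z i * (aeval z (pderiv k p) * derivative (z k)) := by
      intro k
      rw [Derivation.leibniz, smul_eq_mul, smul_eq_mul, map_add, map_mul, map_mul, aeval_X]
      ring
    simp_rw [h1]
    rw [sum_add_distrib, ← mul_sum, ← mul_sum, ← hp, Finset.sum_eq_single i,
      pderiv_X_self, map_one, one_mul, map_mul, aeval_X, Polynomial.derivative_mul]
    · ring
    · intro k _ hk
      rw [pderiv_X_of_ne hk.symm, map_zero, zero_mul]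
    · simp

lemma eval_aeval_polynomial (z : Fin 4 → ℂ[X]) (f : CoordRing) (x : ℂ) :
    (aeval z f).eval x = eval (fun k => (z k).eval x) f := by
  rw [aeval_def, ← Polynomial.coe_evalRingHom, hom_eval₂]
  congr 1
  ext
  simp

lemma degree_eq {m : Fin 4 →₀ ℕ} {d : ℕ} (h : Finsupp.weight 1 m = d) :
    m 0 + m 1 + m 2 + m 3 = d := by
  simpa [Finsupp.weight_apply, Finsupp.sum_fintype, Fin.sum_univ_four] using h

/-- The restriction of a form of degree three to the diagonal. -/
lemma natDegree_diagonal_le {f : CoordRing} (hf : f.IsHomogeneous 3)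
    (h0 : eval ![0, 0, 0, 1] f = 0) :
    (aeval (segrePoint (𝐗 : ℂ[X]) 𝐗) f).natDegree ≤ 5 := by
  rw [aeval_def, eval₂_eq']
  refine Polynomial.natDegree_sum_le_of_forall_le _ _ fun m hm => ?_
  have hdeg : m 0 + m 1 + m 2 + m 3 = 3 := degree_eq (hf (mem_support_iff.1 hm))
  -- Only X₃³ restricts to the sixth power on the diagonal, and its coefficient is the value of the
  -- form at (0, 0, 0, 1).
  have h3 : m 3 ≠ 3 := by
    intro h3
    rw [eval_eq', Finset.sum_eq_single m] at h0
    · have h012 : m 0 = 0 ∧ m 1 = 0 ∧ m 2 = 0 := by omega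
      simp [Fin.prod_univ_four, h012, h3] at h0
      exact mem_support_iff.1 hm h0
    · intro m' hm' hne
      have hdeg' : m' 0 + m' 1 + m' 2 + m' 3 = 3 := degree_eq (hf (mem_support_iff.1 hm'))
      rw [Fin.prod_univ_four]
      by_cases h : m' 0 = 0 ∧ m' 1 = 0 ∧ m' 2 = 0
      · refine absurd ?_ hne
        ext k
        fin_cases k <;> simp <;> omega
      · simp
        tauto
    · exact fun h => absurd hm h
  refine (Polynomial.natDegree_C_mul_le _ _).trans ?_
  rw [Fin.prod_univ_four]
  simp only [segrePoint, Matrix.cons_val_zero, Matrix.cons_val_one, Matrix.cons_val, one_pow, one_mul,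
    ← sq, ← pow_mul, ← pow_add, Polynomial.natDegree_X_pow]
  omega

/-- The derivative, along the first ruling, at a point of the diagonal. -/
def diagSlope (y : ℂ) : CoordRing →ₗ[ℂ] ℂ :=
  (aeval (segrePoint y y)).toLinearMap ∘ₗ (pderiv 2 : Derivation ℂ CoordRing CoordRing).toLinearMap +
    y • (aeval (segrePoint y y)).toLinearMap ∘ₗ
      (pderiv 3 : Derivation ℂ CoordRing CoordRing).toLinearMap

lemma diagSlope_apply (y : ℂ) (f : CoordRing) :
    diagSlope y f = eval (segrePoint y y) (pderiv 2 f) + y * eval (segrePoint y y) (pderiv 3 f) := rfl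

/-- The ruling is contained in the quadric, so the slope depends only on the restriction of a form
to the quadric. -/
lemma diagSlope_segre_mul (y : ℂ) (f : CoordRing) : diagSlope y (segre * f) = 0 := by
  simp [diagSlope_apply, segre, segrePoint, Derivation.leibniz, pderiv_X]
  ring

namespace IsNodalPair

variable {η t r s : Fin 5 → ℂ} (h : IsNodalPair η t r s)
include h

local notation "P₀" => nodalComb t r
local notation "P₁" => nodalComb t (fun i => r i * η i)
local notation "Q₀" => nodalComb t s
local notation "Q₁" => nodalComb t (fun i => s i * η i)
local notation "F" => bezoutCubic P₀ P₁ Q₀ Q₁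

lemma det_eq_sub : P₀ * Q₁ - P₁ * Q₀ = 𝐂 ((∑ i, r i * t i * t i) * (∑ i, s i * η i * t i) -
    (∑ i, r i * η i * t i) * (∑ i, s i * t i * t i)) * nodal univ t := by
  obtain ⟨c, -, hc⟩ := h.det_eq
  have h1 := coeff_mul_add_eq_of_natDegree_le h.natDegree_left_le h.swap.natDegree_left.le
  have h2 := coeff_mul_add_eq_of_natDegree_le h.natDegree_left.le h.swap.natDegree_left_le
  have h3 := (Lagrange.nodal_monic (s := univ) (v := t)).coeff_natDegree
  rw [Lagrange.natDegree_nodal, Finset.card_univ, Fintype.card_fin] at h3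
  have h4 := congrArg (fun f => f.coeff 5) hc
  simp only [Polynomial.coeff_sub, Polynomial.coeff_C_mul, h3, mul_one] at h4
  rw [hc, ← h4]
  congr 2
  rw [← coeff_two_nodalComb h.left_sum h.left_sum_node, ← coeff_three_nodalComb h.right_sum_value,
    ← coeff_three_nodalComb h.left_sum_value, ← coeff_two_nodalComb h.right_sum h.right_sum_node]
  exact congrArg₂ (· - ·) h1 h2

/-- The slope of the curve at a node. -/
lemma diagSlope_mul (i : Fin 5) (y : ℂ) :
    diagSlope (η i) F * ((∑ i, r i * t i * t i) * (∑ i, s i * η i * t i) -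
      (∑ i, r i * η i * t i) * (∑ i, s i * t i * t i)) * (nodal univ η).eval y *
        wt η i = eval (segrePoint y y) F *
      (r i * (derivative (Q₁ - 𝐂 (η i) * Q₀)).eval (t i)) := by
  set D := (∑ i, r i * t i * t i) * (∑ i, s i * η i * t i) -
      (∑ i, r i * η i * t i) * (∑ i, s i * t i * t i) with hD
  have hF : (F).IsHomogeneous 3 := bezoutCubic_isHomogeneous _ _ _ _
  have hdiag : ∀ x : ℂ, (aeval (segrePoint (𝐗 : ℂ[X]) 𝐗) F).eval x = eval (segrePoint x x) F := by
    intro x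
    rw [eval_aeval_polynomial]
    congr 2
    ext k
    fin_cases k <;> simp [segrePoint]
  -- On the diagonal the cubic has degree at most 5 and the zeros ηᵢ, so it is c ∏ (y - ηᵢ). The
  -- auxiliary value at y serves to eliminate c.
  have hG := eq_C_mul_nodal h.values_injective (natDegree_diagonal_le hF h.eval_last_cubic)
    fun i => by rw [hdiag, h.eval_cubic_eq_zero]
  set c := (aeval (segrePoint (𝐗 : ℂ[X]) 𝐗) F).coeff 5
  set T := (nodal (Finset.univ.erase i) t).eval (t i) with hT
  have hT0 : T ≠ 0 := eval_nodal_erase_ne_zero h.nodes_injective i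
  set W := (nodal (Finset.univ.erase i) η).eval (η i) with hW
  have hW0 : W ≠ 0 := eval_nodal_erase_ne_zero h.values_injective i
  have hwt : wt η i = W⁻¹ := Lagrange.nodalWeight_eq_eval_nodal_erase_inv
  have e1 : eval (segrePoint y y) F = c * (nodal univ η).eval y := by
    rw [← hdiag, hG, Polynomial.eval_mul, Polynomial.eval_C]
  -- Four linear relations at the node: the derivative of the cubic along the diagonal (e2) and
  -- along the curve (e3), the derivative of the determinant identity (e4), and Euler's relation
  -- (e5). Eliminating the derivative along the second ruling leaves the slope.
  have e2 := congrArg (fun f => (derivative f).eval (η i)) hG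
  simp only [derivative_aeval, Polynomial.derivative_mul, Polynomial.derivative_C, zero_mul, zero_add,
    Polynomial.eval_mul, Polynomial.eval_C, Polynomial.eval_finsetSum,
    Lagrange.eval_nodal_derivative_eval_node_eq (mem_univ i), ← hW] at e2
  have e3 := congrArg (fun f => (derivative f).eval (t i)) h.aeval_cubic
  simp only [derivative_aeval, Polynomial.eval_mul, Polynomial.eval_finsetSum,
    Polynomial.derivative_zero, Polynomial.eval_zero] at e3
  have e4 := congrArg (fun f => (derivative f).eval (t i)) h.det_eq_sub
  simp only [← hD, Polynomial.derivative_sub, Polynomial.derivative_mul, Polynomial.derivative_C,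
    zero_mul, zero_add, Polynomial.eval_mul, Polynomial.eval_C, Polynomial.eval_sub,
    Polynomial.eval_add, Lagrange.eval_nodal_derivative_eval_node_eq (mem_univ i), ← hT] at e4
  have e5 := congrArg (eval (segrePoint (η i) (η i))) hF.sum_X_mul_pderiv
  rw [map_nsmul, h.eval_cubic_eq_zero, smul_zero, map_sum] at e5
  have hpt : (fun k => (![P₀ * Q₀, P₀ * Q₁, P₁ * Q₀, P₁ * Q₁] k).eval (t i)) =
      ((P₀).eval (t i) * (Q₀).eval (t i)) • segrePoint (η i) (η i) := by
    ext k
    fin_cases k <;> simp [segrePoint, eval_left] <;> ring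
  have hpt' : (fun k => (segrePoint (𝐗 : ℂ[X]) 𝐗 k).eval (η i)) = segrePoint (η i) (η i) := by
    ext k
    fin_cases k <;> simp [segrePoint]
  simp only [eval_aeval_polynomial, hpt, eval_smul_of_isHomogeneous hF.pderiv] at e3
  simp only [eval_aeval_polynomial, hpt'] at e2
  simp only [Fin.sum_univ_four, segrePoint, Matrix.cons_val_zero, Matrix.cons_val_one, Matrix.cons_val,
    Polynomial.derivative_mul, Polynomial.derivative_X, Polynomial.derivative_one, Polynomial.eval_add,
    Polynomial.eval_mul, Polynomial.eval_X, Polynomial.eval_one, Polynomial.eval_zero, eval_left,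
    map_mul, eval_X] at e2 e3 e5
  rw [diagSlope_apply, e1, hwt]
  simp only [segrePoint]
  rw [eval_left, eval_left] at e4
  have ha : (P₀).eval (t i) = r i * T := eval_nodalComb r i
  have ha0 := h.eval_left_ne_zero i
  have hb0 := h.swap.eval_left_ne_zero i
  simp only [Polynomial.derivative_sub, Polynomial.derivative_mul, Polynomial.derivative_C, zero_mul,
    zero_add, Polynomial.eval_mul, Polynomial.eval_C, Polynomial.eval_sub]
  generalize (derivative P₀).eval (t i) = a' at *
  generalize (derivative P₁).eval (t i) = α at *
  generalize (derivative Q₀).eval (t i) = b' at *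
  generalize (derivative Q₁).eval (t i) = β at *
  generalize (P₀).eval (t i) = a at *
  generalize (Q₀).eval (t i) = b at *
  generalize eval ![1, η i, η i, η i * η i] (pderiv 0 F) = F0 at *
  generalize eval ![1, η i, η i, η i * η i] (pderiv 1 F) = F1 at *
  generalize eval ![1, η i, η i, η i * η i] (pderiv 2 F) = F2 at *
  generalize eval ![1, η i, η i, η i * η i] (pderiv 3 F) = F3 at *
  generalize (nodal univ η).eval y = Yy at *
  have e6 : b * (α - η i * a') * (F2 + η i * F3) + a * (β - η i * b') * (F1 + η i * F3) = 0 := by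
    have h0 : (a * b) ^ 2 ≠ 0 := pow_ne_zero 2 (mul_ne_zero ha0 hb0)
    refine (mul_eq_zero.1 ?_).resolve_left h0
    have e3' := e3
    norm_num at e3'
    linear_combination e3' - (a * b) ^ 2 * (a' * b + a * b') * e5
  have e7 : (F2 + η i * F3) * D * T = r i * T * (β - η i * b') * (c * W) := by
    linear_combination -e6 - (F2 + η i * F3) * e4 + a * (β - η i * b') * e2 +
      (β - η i * b') * (c * W) * ha
  field_simp
  have e8 : (F2 + η i * F3) * D = r i * (β - η i * b') * (c * W) :=
    mul_right_cancel₀ hT0 (by linear_combination e7)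
  linear_combination Yy * e8

end IsNodalPair

namespace CurveParam

variable (η : Fin 5 → ℂ)

/-- The numerator of the slope at a node. -/
def slopeNum (i : Fin 5) (e : Fin 8 → ℂ) : ℂ :=
  left η e i * (derivative (nodalComb (node η e) (fun i => right η e i * η i) -
    𝐂 (η i) * nodalComb (node η e) (right η e))).eval (node η e i)

lemma isPoly_slopeNum (i : Fin 5) : IsPolyFamily (slopeNum η i) :=
  (isPoly_left η i).mul (.evalPolynomial (.linear ((isPoly_nodalComb η
    (ρ := fun e i => right η e i * η i) fun i => (isPoly_right η i).mul (.const _)).sub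
      ((IsPolyFamily.const _).mul (isPoly_nodalComb η (isPoly_right η)))) derivative)
        (isPoly_node η i))

variable {η}

/-- The degenerate member: for tᵢ = ηᵢ both functions become the parameter x itself. The determinant
vanishes there, and it is the denominator of the slopes. -/
lemma node_of_eq_zero {e : Fin 8 → ℂ} (h7 : e 7 = 0) (h6 : e 6 = 1) : node η e = η := by
  ext i
  simp [node, h7, h6]

lemma det_of_eq_zero {e : Fin 8 → ℂ} (h7 : e 7 = 0) (h6 : e 6 = 1) : det η e = 0 := by
  rw [det, node_of_eq_zero h7 h6]
  ring

lemma left_slice (u : Fin 5 → ℂ) (i : Fin 5) :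
    left η (slice u) i = (η i - u 1) * (η i - u 2) * wt η i := by
  change (u 1 * u 2 + -(u 1 + u 2) * η i + 1 * η i ^ 2) * wt η i = _
  ring

lemma right_slice (u : Fin 5 → ℂ) (i : Fin 5) :
    right η (slice u) i = (η i - u 3) * (η i - u 4) * wt η i := by
  change (u 3 * u 4 + -(u 3 + u 4) * η i + 1 * η i ^ 2) * wt η i = _
  ring

variable (hη : Injective η)
include hη

/-- In the degenerate case Q₁ = x Q₀, so Q₁ - ηᵢQ₀ has derivative Q₀(ηᵢ) at ηᵢ. The numerator is the
value at ηᵢ of the monic polynomial with the roots u₁, …, u₄, times the weight. -/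
lemma slopeNum_slice_of_eq_zero (i : Fin 5) {u : Fin 5 → ℂ} (hu : u 0 = 0) :
    slopeNum η i (slice u) = (η i - u 1) * (η i - u 2) * ((η i - u 3) * (η i - u 4)) * wt η i := by
  have hwt : wt η i = ((nodal (Finset.univ.erase i) η).eval (η i))⁻¹ :=
    Lagrange.nodalWeight_eq_eval_nodal_erase_inv
  have hsum : ∑ i, right η (slice u) i = 0 := sum_quadratic hη _ _ _
  rw [slopeNum, node_of_eq_zero (by simp [slice, hu]) (by simp [slice]),
    ← X_mul_nodalComb_of_sum_eq_zero hsum, ← sub_mul]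
  simp only [Polynomial.derivative_mul, Polynomial.derivative_sub, Polynomial.derivative_X,
    Polynomial.derivative_C, sub_zero, one_mul, Polynomial.eval_add, Polynomial.eval_mul,
    Polynomial.eval_sub, Polynomial.eval_X, Polynomial.eval_C, sub_self, zero_mul, add_zero,
    eval_nodalComb, left_slice, right_slice, hwt]
  field_simp [eval_nodal_erase_ne_zero hη i]

lemma diagSlope_cubic {e : Fin 8 → ℂ} (he : disc η e ≠ 0) (i : Fin 5) (y : ℂ) :
    diagSlope (η i) (cubic η e) * (det η e * ((nodal univ η).eval y * wt η i)) =
      eval (segrePoint y y) (cubic η e) * slopeNum η i e := by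
  rw [← mul_assoc, ← mul_assoc]
  exact ((isNodalPair_iff hη).2 he).diagSlope_mul i y

lemma exists_det_slice_ne_zero : ∃ u, det η (slice u) ≠ 0 := by
  by_contra! hcon
  have s1 : ∑ i, η i ^ 4 * wt η i = 1 := sum_pow_four_mul_wt hη
  have s2 : ∑ i, η i ^ 2 * wt η i = 0 := sum_pow_mul_wt hη (by norm_num)
  have s3 : ∑ i, η i ^ 3 * wt η i = 0 := sum_pow_mul_wt hη (by norm_num)
  have s4 : ∑ i, η i ^ 1 * dual η 1 i * wt η i = 1 := sum_dual hη 1 1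
  have key : ∀ x : ℂ, x * (-1 + x ^ 2 * ∑ i, η i ^ 2 * dual η 1 i ^ 2 * wt η i +
      x * ∑ i, dual η 1 i ^ 2 * wt η i - x ^ 2 * ((∑ i, η i ^ 3 * dual η 1 i * wt η i) *
        ∑ i, dual η 1 i ^ 2 * wt η i)) = 0 := by
    intro x
    -- The test curves have residues belonging to y² and y² - 1. Their determinant is x times a
    -- polynomial of degree at most 2 with constant term -1, which cannot vanish at 1, -1 and 2.
    have h := hcon ![x, 0, 0, 1, -1]
    have hn : ∀ i, node η (slice ![x, 0, 0, 1, -1]) i = η i - x * dual η 1 i := fun i => by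
      simp [node, slice]; ring
    have hl : ∀ i, left η (slice ![x, 0, 0, 1, -1]) i = η i ^ 2 * wt η i := fun i => by
      rw [left_slice]; simp; ring_nf; simp
    have hr : ∀ i, right η (slice ![x, 0, 0, 1, -1]) i = (η i ^ 2 - 1) * wt η i := fun i => by
      rw [right_slice]; simp; ring_nf; simp
    simp only [det, hl, hr, hn] at h
    have e1 : ∑ i, η i ^ 2 * wt η i * (η i - x * dual η 1 i) * (η i - x * dual η 1 i) =
        ∑ i, η i ^ 4 * wt η i - 2 * x * ∑ i, η i ^ 3 * dual η 1 i * wt η i +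
          x ^ 2 * ∑ i, η i ^ 2 * dual η 1 i ^ 2 * wt η i := by
      simp only [Fin.sum_univ_five]; ring
    have e2 : ∑ i, (η i ^ 2 - 1) * wt η i * η i * (η i - x * dual η 1 i) =
        ∑ i, η i ^ 4 * wt η i - ∑ i, η i ^ 2 * wt η i - x * ∑ i, η i ^ 3 * dual η 1 i * wt η i +
          x * ∑ i, η i ^ 1 * dual η 1 i * wt η i := by
      simp only [Fin.sum_univ_five]; ring
    have e3 : ∑ i, η i ^ 2 * wt η i * η i * (η i - x * dual η 1 i) =
        ∑ i, η i ^ 4 * wt η i - x * ∑ i, η i ^ 3 * dual η 1 i * wt η i := by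
      simp only [Fin.sum_univ_five]; ring
    have e4 : ∑ i, (η i ^ 2 - 1) * wt η i * (η i - x * dual η 1 i) * (η i - x * dual η 1 i) =
        ∑ i, η i ^ 4 * wt η i - 2 * x * ∑ i, η i ^ 3 * dual η 1 i * wt η i +
          x ^ 2 * ∑ i, η i ^ 2 * dual η 1 i ^ 2 * wt η i - ∑ i, η i ^ 2 * wt η i +
          2 * x * ∑ i, η i ^ 1 * dual η 1 i * wt η i - x ^ 2 * ∑ i, dual η 1 i ^ 2 * wt η i := by
      simp only [Fin.sum_univ_five]; ring
    rw [e1, e2, e3, e4, s1, s2, s4] at h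
    linear_combination h
  have k1 := key 1
  have k2 := key (-1)
  have k3 := key 2
  have : (3 : ℂ) = 0 := by linear_combination k3 / 2 - 3 * k1 + k2
  norm_num at this

/-- A product of nonzero polynomials is nonzero, so the factors are tested separately: differences
of nodes and leading coefficients at u = 0, the residue at ηᵢ with all roots equal to ηᵢ + 1, and
the determinant by the preceding lemma. -/
lemma exists_disc_slice_ne_zero : ∃ u, disc η (slice u) ≠ 0 := by
  have hp : ∀ {f : (Fin 8 → ℂ) → ℂ}, IsPolyFamily f → IsPolyFamily (fun u => f (slice u)) :=
    fun hf => hf.comp isPoly_slice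
  have hnode : node η (slice 0) = η := node_of_eq_zero (by simp [slice]) (by simp [slice])
  have hlead : ∑ i, η i ^ 4 * wt η i ≠ 0 := by rw [sum_pow_four_mul_wt hη]; exact one_ne_zero
  unfold disc
  refine IsPolyFamily.exists_ne_zero_of_mul (hp (((((IsPolyFamily.prod fun p _ =>
    isPoly_node_sub η p).mul (.prod fun i _ => isPoly_left η i)).mul (.prod fun i _ =>
      isPoly_right η i)).mul (.sum fun i _ => ((isPoly_left η i).mul (.const _)).mul
      (isPoly_node η i))).mul (.sum fun i _ => ((isPoly_right η i).mul (.const _)).mul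
      (isPoly_node η i)))) (hp (isPoly_det η)) ?_ (exists_det_slice_ne_zero hη)
  refine IsPolyFamily.exists_ne_zero_of_mul (hp ((((IsPolyFamily.prod fun p _ =>
    isPoly_node_sub η p).mul (.prod fun i _ => isPoly_left η i)).mul (.prod fun i _ =>
      isPoly_right η i)).mul (.sum fun i _ => ((isPoly_left η i).mul (.const _)).mul
      (isPoly_node η i)))) (hp (.sum fun i _ => ((isPoly_right η i).mul (.const _)).mul
      (isPoly_node η i))) ?_ ⟨0, ?_⟩
  · refine IsPolyFamily.exists_ne_zero_of_mul (hp (((IsPolyFamily.prod fun p _ =>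
      isPoly_node_sub η p).mul (.prod fun i _ => isPoly_left η i)).mul (.prod fun i _ =>
        isPoly_right η i))) (hp (.sum fun i _ => ((isPoly_left η i).mul (.const _)).mul
        (isPoly_node η i))) ?_ ⟨0, ?_⟩
    · refine IsPolyFamily.exists_ne_zero_of_mul (hp ((IsPolyFamily.prod fun p _ =>
        isPoly_node_sub η p).mul (.prod fun i _ => isPoly_left η i))) (hp (.prod fun i _ =>
          isPoly_right η i)) (IsPolyFamily.exists_ne_zero_of_mul (hp (IsPolyFamily.prod fun p _ =>
        isPoly_node_sub η p)) (hp (.prod fun i _ => isPoly_left η i)) ⟨0, ?_⟩ ?_) ?_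
      · refine Finset.prod_ne_zero_iff.2 fun p _ => ?_
        split_ifs with h
        · exact one_ne_zero
        · rw [hnode]
          exact sub_ne_zero.2 (hη.ne h)
      · refine IsPolyFamily.exists_ne_zero_of_prod (fun i _ => hp (isPoly_left η i)) fun i _ =>
          ⟨fun _ => η i + 1, ?_⟩
        rw [left_slice]
        simpa using wt_ne_zero hη i
      · refine IsPolyFamily.exists_ne_zero_of_prod (fun i _ => hp (isPoly_right η i)) fun i _ =>
          ⟨fun _ => η i + 1, ?_⟩
        rw [right_slice]
        simpa using wt_ne_zero hη i
    · rw [hnode]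
      convert hlead using 2 with i
      rw [left_slice]
      simp
      ring
  · rw [hnode]
    convert hlead using 2 with i
    rw [right_slice]
    simp
    ring

end CurveParam

/-! ### Zariski topologies -/

section Zariski

variable {V W : Type} [AddCommGroup V] [Module ℂ V] [AddCommGroup W] [Module ℂ W]

/-- The value of a polynomial in the linear functionals at a vector. -/
abbrev evalAt (v : V) : MvPolynomial (Dual ℂ V) ℂ →+* ℂ := eval fun φ => φ v

lemma isOpen_zariski_ne (P : MvPolynomial (Dual ℂ V) ℂ) :
    IsOpen[zariskiTopology V] {v | evalAt v P ≠ 0} :=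
  TopologicalSpace.isOpen_generateFrom_of_mem ⟨P, rfl⟩

/-- The nonvanishing sets of single polynomials are closed under finite intersection, so they form a
basis and not only a subbasis. -/
lemma exists_evalAt_ne_zero {U : Set V} (hU : IsOpen[zariskiTopology V] U) {v : V} (hv : v ∈ U) :
    ∃ P : MvPolynomial (Dual ℂ V) ℂ, evalAt v P ≠ 0 ∧ ∀ w, evalAt w P ≠ 0 → w ∈ U := by
  induction hU with
  | basic s hs =>
    obtain ⟨P, rfl⟩ := hs
    exact ⟨P, hv, fun w hw => hw⟩
  | univ => exact ⟨1, by simp, fun _ _ => trivial⟩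
  | inter s t _ _ hs ht =>
    obtain ⟨P, h1, h2⟩ := hs hv.1
    obtain ⟨Q, h3, h4⟩ := ht hv.2
    refine ⟨P * Q, by rw [map_mul]; exact mul_ne_zero h1 h3, fun w hw => ?_⟩
    rw [map_mul] at hw
    exact ⟨h2 w (left_ne_zero_of_mul hw), h4 w (right_ne_zero_of_mul hw)⟩
  | sUnion S _ ih =>
    obtain ⟨s, hs, hvs⟩ := hv
    obtain ⟨P, h1, h2⟩ := ih s hs hvs
    exact ⟨P, h1, fun w hw => ⟨s, hs, h2 w hw⟩⟩

lemma continuous_zariski {f : V → W} (h : ∀ φ : Dual ℂ W,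
    ∃ p : MvPolynomial (Dual ℂ V) ℂ, ∀ v, φ (f v) = evalAt v p) :
    Continuous[zariskiTopology V, zariskiTopology W] f := by
  choose p hp using h
  let _ := zariskiTopology V
  refine continuous_generateFrom_iff.2 ?_
  rintro _ ⟨P, rfl⟩
  have h2 : f ⁻¹' {x | eval (fun φ : Dual ℂ W => φ x) P ≠ 0} = {v | evalAt v (bind₁ p P) ≠ 0} := by
    ext v
    have h1 : evalAt v (bind₁ p P) = eval (fun φ => φ (f v)) P := by
      simp only [evalAt, hp]
      exact eval₂Hom_bind₁ (RingHom.id ℂ) _ p P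
    simp only [Set.mem_preimage, Set.mem_ofPred_eq, h1]
  rw [h2]
  exact isOpen_zariski_ne _

lemma continuous_zariski_affine (l : V →ₗ[ℂ] W) (w : W) :
    Continuous[zariskiTopology V, zariskiTopology W] fun v => l v + w :=
  continuous_zariski fun φ => ⟨X (φ ∘ₗ l) + C (φ w), fun v => by simp⟩

/-- Clearing the denominators in a polynomial expression in fractions `h s / c`. -/
lemma exists_clear_denominators {σ T : Type} [CommRing T] [Algebra ℂ T] (h : σ → T) (c : T)
    (P : MvPolynomial σ ℂ) : ∃ (N : ℕ) (Q : T), ∀ (K : Type) [Field K] [Algebra ℂ K]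
      (ev : T →ₐ[ℂ] K), ev c ≠ 0 → ev Q = ev c ^ N * aeval (fun s => ev (h s) / ev c) P := by
  induction P using MvPolynomial.induction_on with
  | C a => exact ⟨0, algebraMap ℂ T a, fun K _ _ ev _ => by simp⟩
  | add p q hp hq =>
    obtain ⟨N, Q, h1⟩ := hp
    obtain ⟨N', Q', h2⟩ := hq
    refine ⟨N + N', Q * c ^ N' + Q' * c ^ N, fun K _ _ ev hc => ?_⟩
    rw [map_add, map_add, map_mul, map_mul, map_pow, map_pow, h1 K ev hc, h2 K ev hc]
    ring
  | mul_X p s hp =>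
    obtain ⟨N, Q, h1⟩ := hp
    refine ⟨N + 1, Q * h s, fun K _ _ ev hc => ?_⟩
    rw [map_mul, map_mul, h1 K ev hc, aeval_X]
    field_simp
    ring

lemma isOpen_grassmann_iff {O : Set (Submodule ℂ V)} : IsOpen[grassmannTopology V] O ↔
    ∀ r : ℕ, ∃ O' : Set (Fin r → V), IsOpen[zariskiTopology (Fin r → V)] O' ∧
      ∀ v, LinearIndependent ℂ v → (v ∈ O' ↔ Submodule.span ℂ (Set.range v) ∈ O) := by
  rw [grassmannTopology, isOpen_iSup_iff]
  refine forall_congr' fun r => ?_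
  rw [isOpen_coinduced]
  refine (@isOpen_induced_iff _ _ (zariskiTopology _) _ _).trans (exists_congr fun O' => and_congr_right fun _ => ?_)
  rw [Set.ext_iff]
  exact ⟨fun h v hv => h ⟨v, hv⟩, fun h v => h v.1 v.2⟩

/-- The subspaces that meet a given open set form an open set. -/
lemma isOpen_grassmann_inter {Ω : Set V} (hΩ : IsOpen[zariskiTopology V] Ω) :
    IsOpen[grassmannTopology V] {L | ∃ w ∈ L, w ∈ Ω} := by
  refine isOpen_grassmann_iff.2 fun r => ⟨⋃ a : Fin r → ℂ, (fun v => ∑ i, a i • v i) ⁻¹' Ω, ?_, ?_⟩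
  · refine @isOpen_iUnion _ _ (zariskiTopology (Fin r → V)) _ fun a => ?_
    have := continuous_zariski_affine (V := Fin r → V) (∑ i, a i • proj i) (0 : V)
    simp only [LinearMap.sum_apply, LinearMap.smul_apply, LinearMap.proj_apply, add_zero] at this
    exact @IsOpen.preimage _ _ (zariskiTopology _) (zariskiTopology _) _ this _ hΩ
  · intro v _
    simp only [Set.mem_iUnion, Set.mem_preimage, Set.mem_ofPred_eq]
    constructor
    · rintro ⟨a, ha⟩
      exact ⟨_, Submodule.sum_mem _ fun i _ => Submodule.smul_mem _ _
        (Submodule.subset_span ⟨i, rfl⟩), ha⟩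
    · rintro ⟨w, hw, h⟩
      obtain ⟨a, rfl⟩ := (Submodule.mem_span_range_iff_exists_fun ℂ).1 hw
      exact ⟨a, h⟩

/-- The span of an injective linear image, depending linearly on a parameter, is a continuous
function of the parameter. -/
lemma isOpen_span_range {B : Type} [AddCommGroup B] [Module ℂ B] [Module.Finite ℂ W]
    (l₀ : B →ₗ[ℂ] W) (l : V →ₗ[ℂ] B →ₗ[ℂ] W) {O : Set (Submodule ℂ W)}
    (hO : IsOpen[grassmannTopology W] O) : ∃ O' : Set V, IsOpen[zariskiTopology V] O' ∧
      ∀ v, Injective (l₀ + l v) → (v ∈ O' ↔ range (l₀ + l v) ∈ O) := by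
  by_cases hinj : ∃ v, Injective (l₀ + l v)
  swap
  · exact ⟨∅, @isOpen_empty _ (zariskiTopology V), fun v hv => absurd ⟨v, hv⟩ hinj⟩
  have : Module.Finite ℂ B := Module.Finite.of_injective _ hinj.choose_spec
  set b := Module.finBasis ℂ B
  obtain ⟨O', h1, h2⟩ := isOpen_grassmann_iff.1 hO (finrank ℂ B)
  have hcont := continuous_zariski_affine (V := V) (W := Fin (finrank ℂ B) → W)
    (LinearMap.pi fun i => (LinearMap.applyₗ (b i)) ∘ₗ l) (fun i => l₀ (b i))
  refine ⟨_, @IsOpen.preimage _ _ (zariskiTopology _) (zariskiTopology _) _ hcont _ h1,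
    fun v hv => ?_⟩
  have h3 : (LinearMap.pi fun i => (LinearMap.applyₗ (b i)) ∘ₗ l) v + (fun i => l₀ (b i)) =
      (l₀ + l v) ∘ b := by
    ext i
    simp [add_comm]
  rw [Set.mem_preimage, h3, h2 _ (b.linearIndependent.map' _ (LinearMap.ker_eq_bot.2 hv)),
    Set.range_comp, ← Submodule.map_span, b.span_eq, Submodule.map_top]

end Zariski

/-! ### Coordinates on spaces of complete intersection curves -/

/-- The factor a' is the component of a of degree d - k, or zero if d < k. Quantifying over w
expresses this degree without subtraction. -/
lemma exists_homogeneousComponent_mul {S : CoordRing} {k : ℕ} (hS : S.IsHomogeneous k) (a : CoordRing)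
    (d : ℕ) : ∃ a', homogeneousComponent d (S * a) = S * a' ∧
      ∀ w : CoordRing, w.IsHomogeneous k → (w * a').IsHomogeneous d := by
  have key : ∀ i, homogeneousComponent d (S * homogeneousComponent i a) =
      if i + k = d then S * homogeneousComponent i a else 0 := by
    intro i
    have h1 := hS.mul (homogeneousComponent_isHomogeneous i a)
    rw [homogeneousComponent_of_mem ((mem_homogeneousSubmodule _ _).2 h1)]
    simp only [add_comm k i, eq_comm]
  refine ⟨∑ i ∈ Finset.range (a.totalDegree + 1), if i + k = d then homogeneousComponent i a else 0,
    ?_, fun w hw => ?_⟩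
  · conv_lhs => rw [← sum_homogeneousComponent a, mul_sum, map_sum]
    rw [mul_sum]
    refine sum_congr rfl fun i _ => ?_
    rw [key]
    split_ifs <;> simp
  · rw [mul_sum]
    refine IsHomogeneous.sum _ _ _ fun i _ => ?_
    split_ifs with h
    · rw [← h, add_comm]
      exact hw.mul (homogeneousComponent_isHomogeneous i a)
    · rw [mul_zero]
      exact isHomogeneous_zero _ _ _

/-- The pieces of given degree of the ideals generated by a fixed prime form and a varying cubic
form are the images of injective linear maps depending linearly on the cubic form. -/
lemma exists_frame {S : CoordRing} {k : ℕ} (hS : S.IsHomogeneous k) (hp : Prime S) (d : ℕ) :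
    ∃ (B : Type) (_ : AddCommGroup B) (_ : Module ℂ B) (l₀ : B →ₗ[ℂ] 𝓢 d)
      (l : 𝓢 3 →ₗ[ℂ] B →ₗ[ℂ] 𝓢 d),
      ∀ w : 𝓢 3, ¬ S ∣ (w : CoordRing) → Injective (l₀ + l w) ∧
        ∀ f, f ∈ range (l₀ + l w) ↔ (f : CoordRing) ∈ span {S, (w : CoordRing)} := by
  set Vd := 𝓢 d
  set A : Submodule ℂ CoordRing := Vd.comap (LinearMap.mulLeft ℂ S) with hA
  set B : Submodule ℂ CoordRing := ⨅ w : 𝓢 3, Vd.comap (LinearMap.mulLeft ℂ (w : CoordRing)) with hB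
  have hmemB : ∀ {b}, b ∈ B ↔ ∀ w : 𝓢 3, (w : CoordRing) * b ∈ Vd := by
    simp [hB, Submodule.mem_iInf]
  set M : Submodule ℂ B := ((span {S}).restrictScalars ℂ).comap B.subtype with hM
  have hmemM : ∀ {b : B}, b ∈ M ↔ S ∣ (b : CoordRing) := by simp [hM, Ideal.mem_span_singleton]
  -- The frame is (a, n) ↦ S a + w n with n in a complement of the multiples of S. It is injective
  -- because S is prime and does not divide w; multiples of S in the second factor are absorbed by
  -- the first.
  obtain ⟨N, hN⟩ := Submodule.exists_isCompl M
  refine ⟨A × N, inferInstance, inferInstance,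
    LinearMap.codRestrict Vd (LinearMap.mulLeft ℂ S ∘ₗ A.subtype ∘ₗ LinearMap.fst ℂ A N)
      fun x => x.1.2,
    LinearMap.mk₂ ℂ (fun w x => ⟨(w : CoordRing) * (x.2 : B), hmemB.1 x.2.1.2 w⟩)
      (fun w w' x => Subtype.ext (add_mul _ _ _)) (fun c w x => Subtype.ext (smul_mul_assoc _ _ _))
      (fun w x y => Subtype.ext (mul_add _ _ _)) (fun c w x => Subtype.ext (mul_smul_comm _ _ _)),
    fun w hw => ⟨?_, fun f => ⟨?_, fun hf => ?_⟩⟩⟩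
  · rw [injective_iff_map_eq_zero]
    rintro ⟨a, n⟩ h
    have h1 : S * (a : CoordRing) + w * ((n : B) : CoordRing) = 0 := congrArg Subtype.val h
    have h2 : S ∣ ((n : B) : CoordRing) := (hp.dvd_or_dvd ⟨-a, by linear_combination h1⟩).resolve_left hw
    have h3 : (n : B) = 0 := by
      have := hN.disjoint.le_bot ⟨hmemM.2 h2, n.2⟩
      simpa using this
    rw [h3] at h1
    have h4 : (a : CoordRing) = 0 := by simpa [hp.ne_zero] using h1
    exact Prod.ext (Subtype.ext h4) (Subtype.ext h3)
  · rintro ⟨⟨a, n⟩, rfl⟩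
    exact Ideal.mem_span_pair.2 ⟨a, (n : B), by
      change _ = S * (a : CoordRing) + w * ((n : B) : CoordRing)
      ring⟩
  · obtain ⟨a, b, hab⟩ := Ideal.mem_span_pair.1 hf
    obtain ⟨a', ha1, ha2⟩ := exists_homogeneousComponent_mul hS a d
    obtain ⟨b', hb1, hb2⟩ := exists_homogeneousComponent_mul
      ((mem_homogeneousSubmodule _ _).1 w.2) b d
    have h1 : (f : CoordRing) = S * a' + w * b' := by
      rw [← ha1, ← hb1, ← map_add, mul_comm S, mul_comm (w : CoordRing), hab,
        homogeneousComponent_eq_self ((mem_homogeneousSubmodule _ _).1 f.2)]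
    have hb3 : b' ∈ B := hmemB.2 fun v => hb2 v v.2
    obtain ⟨m, hm, n, hn, hmn⟩ := Submodule.mem_sup.1
      (hN.codisjoint.eq_top.symm ▸ Submodule.mem_top : (⟨b', hb3⟩ : B) ∈ M ⊔ N)
    obtain ⟨e, he⟩ := hmemM.1 hm
    have h2 : b' = S * e + n := by rw [← he]; exact (congrArg Subtype.val hmn).symm
    have h3 : a' + w * e ∈ A := by
      change S * (a' + w * e) ∈ Vd
      have h4 : S * (a' + w * e) = f - w * n := by rw [h1, h2]; ring
      rw [h4]
      exact Vd.sub_mem f.2 (hmemB.1 n.2 w)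
    refine ⟨(⟨a' + w * e, h3⟩, ⟨n, hn⟩), Subtype.ext ?_⟩
    change S * (a' + w * e) + w * (n : CoordRing) = f
    rw [h1, h2]
    ring

/-- A linear projection along the multiples of a form. -/
lemma exists_projection (S : CoordRing) (d : ℕ) : ∃ π : 𝓢 d →ₗ[ℂ] 𝓢 d,
      (∀ w, π w = 0 ↔ S ∣ (w : CoordRing)) ∧ ∀ w, S ∣ (π w - w : CoordRing) := by
  set V := 𝓢 d
  set M : Submodule ℂ V := ((span {S}).restrictScalars ℂ).comap V.subtype with hM
  have hmemM : ∀ {b : V}, b ∈ M ↔ S ∣ (b : CoordRing) := by simp [hM, Ideal.mem_span_singleton]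
  obtain ⟨N, hN⟩ := Submodule.exists_isCompl M
  have hker : ∀ w : V, N.projection M hN.symm w = 0 ↔ S ∣ (w : CoordRing) := fun w => by
    rw [Submodule.projection_apply_eq_zero_iff, hmemM]
  refine ⟨N.projection M hN.symm, hker, fun w => (hker (_ - w)).1 ?_⟩
  rw [map_sub, Submodule.projection_apply_of_mem_left _ (Submodule.projection_apply_mem _ _), sub_self]

/-- Normalized equations of curves on a fixed surface. -/
lemma exists_normalized {𝒳 : Set IntegralCurve} {S : CoordRing} {k : ℕ} (hS : S.IsHomogeneous k)
    {c : CoordRing →ₗ[ℂ] ℂ} (hc : ∀ f, c (S * f) = 0)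
    (h : ∀ C ∈ 𝒳, ∃ G : CoordRing, G.IsHomogeneous 3 ∧ c G ≠ 0 ∧ C.ideal = span {S, G}) :
    ∃ (π : 𝓢 3 →ₗ[ℂ] 𝓢 3) (Γ : 𝒳 → 𝓢 3), (∀ w, S ∣ (π w - w : CoordRing)) ∧
      (∀ C : 𝒳, ∀ G : 𝓢 3, (G : CoordRing) ∈ C.1.ideal → c G ≠ 0 → Γ C = (c G)⁻¹ • π G) ∧
      ∀ C : 𝒳, C.1.ideal = span {S, (Γ C : CoordRing)} ∧ c (Γ C : CoordRing) = 1 := by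
  set V := 𝓢 3
  obtain ⟨π, hπM, hπS⟩ := exists_projection S 3
  choose! G hG3 hG0 hGI using h
  have hGV : ∀ C : 𝒳, G C ∈ V := fun C => (mem_homogeneousSubmodule _ _).2 (hG3 C C.2)
  set Γ : 𝒳 → V := fun C => (c (G C))⁻¹ • π ⟨G C, hGV C⟩ with hΓ
  have hΓG : ∀ C : 𝒳, ∀ w : V, (w : CoordRing) ∈ C.1.ideal → c w ≠ 0 → Γ C = (c w)⁻¹ • π w := by
    intro C w hw hcw
    rw [hGI C C.2] at hw
    obtain ⟨a, b, hab⟩ := Ideal.mem_span_pair.1 hw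
    obtain ⟨a', ha1, -⟩ := exists_homogeneousComponent_mul hS a 3
    obtain ⟨b', hb1, hb2⟩ := exists_homogeneousComponent_mul (hG3 C C.2) b 3
    -- Since X₀³ b' has degree 3, b' is constant: a cubic in the ideal is a multiple of S plus a
    -- scalar multiple of G.
    have hb3 : b' = MvPolynomial.C (coeff 0 b') := by
      have h1 := HasDegree.of_isHomogeneous (hb2 (X 0 ^ 3) (isHomogeneous_X_pow 0 3))
      rw [pow_three', mul_assoc, mul_assoc] at h1
      exact (h1.of_X_mul (k := 2) 0).of_X_mul (k := 1) 0 |>.of_X_mul (k := 0) 0 |>.eq_C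
    generalize coeff 0 b' = r at hb3
    have h1 : (w : CoordRing) = S * a' + r • G C := by
      rw [smul_eq_C_mul, ← hb3, mul_comm b', ← ha1, ← hb1, ← map_add, mul_comm S, mul_comm (G C), hab,
        homogeneousComponent_eq_self ((mem_homogeneousSubmodule _ _).1 w.2)]
    have h2 : π (w - r • ⟨G C, hGV C⟩) = 0 := by
      rw [hπM]
      exact ⟨a', by rw [Submodule.coe_sub, Submodule.coe_smul, h1, add_sub_cancel_right]⟩
    rw [map_sub, map_smul, sub_eq_zero] at h2
    have h3 : c w = r * c (G C) := by rw [h1, map_add, hc, zero_add, map_smul, smul_eq_mul]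
    have h4 : r ≠ 0 := fun h => hcw (by rw [h3, h, zero_mul])
    change (c (G C))⁻¹ • π ⟨G C, hGV C⟩ = _
    rw [h2, h3, smul_smul]
    exact congrArg (· • π ⟨G C, hGV C⟩) (by field_simp)
  have hspan : ∀ C : 𝒳, C.1.ideal = span {S, (Γ C : CoordRing)} ∧ c (Γ C : CoordRing) = 1 := by
    intro C
    obtain ⟨e, he⟩ := hπS ⟨G C, hGV C⟩
    have he' : (π ⟨G C, hGV C⟩ : CoordRing) = G C + S * e := by rw [← he]; ring
    have h1 : (Γ C : CoordRing) = (c (G C))⁻¹ • (G C + S * e) := by rw [← he']; rfl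
    have h2 : G C = c (G C) • (Γ C : CoordRing) - S * e := by
      rw [h1, smul_inv_smul₀ (hG0 C C.2), add_sub_cancel_right]
    refine ⟨?_, ?_⟩
    · rw [hGI C C.2]
      apply le_antisymm
      · rw [Ideal.span_le]
        rintro _ (rfl | rfl)
        · exact subset_span (by simp)
        · rw [h2]
          refine sub_mem (Submodule.smul_of_tower_mem _ _ (subset_span (by simp)))
            (Ideal.mul_mem_right _ _ (subset_span (by simp)))
      · rw [Ideal.span_le]
        rintro _ (rfl | rfl)
        · exact subset_span (by simp)
        · rw [h1]
          exact Submodule.smul_of_tower_mem _ _ (add_mem (subset_span (by simp))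
            (Ideal.mul_mem_right _ _ (subset_span (by simp))))
    · rw [h1, map_smul, map_add, hc, add_zero, smul_eq_mul, inv_mul_cancel₀ (hG0 C C.2)]
  exact ⟨π, Γ, hπS, hΓG, hspan⟩

/-- A space of curves on a fixed quadric, cut out by cubic forms. -/
theorem exists_coordinates {𝒳 : Set IntegralCurve} {S : CoordRing} {k : ℕ} (hS : S.IsHomogeneous k)
    (hp : Prime S) {c : CoordRing →ₗ[ℂ] ℂ} (hc : ∀ f, c (S * f) = 0)
    (h : ∀ C ∈ 𝒳, ∃ G : CoordRing, G.IsHomogeneous 3 ∧ c G ≠ 0 ∧ C.ideal = span {S, G}) :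
    ∃ (π : 𝓢 3 →ₗ[ℂ] 𝓢 3) (Γ : 𝒳 → 𝓢 3), (∀ w, S ∣ (π w - w : CoordRing)) ∧
      (∀ C : 𝒳, ∀ G : 𝓢 3, (G : CoordRing) ∈ C.1.ideal → c G ≠ 0 → Γ C = (c G)⁻¹ • π G) ∧
      (instTopologicalSpaceSubtype : TopologicalSpace 𝒳) =
        TopologicalSpace.induced Γ (zariskiTopology _) := by
  set V := 𝓢 3
  obtain ⟨π, Γ, hπS, hΓG, hspan⟩ := exists_normalized hS hc h
  have hcdvd : ∀ {f : CoordRing}, S ∣ f → c f = 0 := by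
    rintro _ ⟨g, rfl⟩
    exact hc g
  refine ⟨π, Γ, hπS, hΓG, le_antisymm ?_ ?_⟩
  · rw [← continuous_iff_le_induced]
    refine continuous_generateFrom_iff.2 ?_
    rintro _ ⟨P, rfl⟩
    -- The normalized equation is a rational function of any cubic w of the ideal with c w ≠ 0.
    -- After clearing denominators, a condition on it says that the space of cubics of the curve
    -- meets an open set.
    obtain ⟨n, Q, hQ⟩ := exists_clear_denominators
      (fun φ : Dual ℂ V => (X (φ ∘ₗ π) : MvPolynomial (Dual ℂ V) ℂ))
      (X (c ∘ₗ V.subtype)) P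
    have hval : ∀ w : V, c w ≠ 0 → (evalAt w Q ≠ 0 ↔
        eval (fun φ : Dual ℂ V => φ ((c w)⁻¹ • π w)) P ≠ 0) := by
      intro w hw
      have h1 := hQ ℂ (aeval fun φ : Dual ℂ V => φ w) (by simpa using hw)
      simp only [aeval_X] at h1
      have h2 : evalAt w Q = (c w) ^ n * eval (fun φ : Dual ℂ V => φ ((c w)⁻¹ • π w)) P := by
        refine h1.trans ?_
        simp only [LinearMap.comp_apply, Submodule.subtype_apply, map_smul, smul_eq_mul, ← div_eq_inv_mul]
        rfl
      rw [h2]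
      simp [hw]
    have hO := isOpen_grassmann_inter (isOpen_zariski_ne (X (c ∘ₗ V.subtype) * Q))
    have hpre : Γ ⁻¹' {x | eval (fun φ : Dual ℂ V => φ x) P ≠ 0} =
        (fun C : 𝒳 => C.1.forms 3) ⁻¹' {L | ∃ w ∈ L, w ∈ {v : V | evalAt v
          (X (c ∘ₗ V.subtype) * Q) ≠ 0}} := by
      ext C
      simp only [Set.mem_preimage, Set.mem_ofPred_eq, map_mul, eval_X, LinearMap.comp_apply,
        Submodule.subtype_apply, mul_ne_zero_iff]
      constructor
      · intro hC
        have hmem : (Γ C : CoordRing) ∈ C.1.ideal := by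
          rw [(hspan C).1]; exact subset_span (by simp)
        have h1 : c (Γ C : CoordRing) ≠ 0 := by rw [(hspan C).2]; exact one_ne_zero
        refine ⟨Γ C, hmem, h1, (hval _ h1).2 ?_⟩
        rwa [← hΓG C _ hmem h1]
      · rintro ⟨w, hw, h1, h2⟩
        rw [hΓG C w hw h1]
        exact (hval _ h1).1 h2
    rw [hpre]
    have hcont : @Continuous _ _ _ (grassmannTopology V) (fun C : IntegralCurve => C.forms 3) :=
      continuous_iff_le_induced.2 (iInf_le _ 3)
    exact @IsOpen.preimage _ _ _ (grassmannTopology V) _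
      (@Continuous.comp _ _ _ _ _ (grassmannTopology V) _ _ hcont continuous_subtype_val) _ hO
  -- Conversely, in every degree the ideal has a frame depending linearly on the normalized cubic,
  -- so each map to a Grassmannian is continuous in it.
  · have h0 : (instTopologicalSpaceSubtype : TopologicalSpace 𝒳) = ⨅ d : ℕ,
        TopologicalSpace.induced (fun C : 𝒳 => C.1.forms d) (grassmannTopology (𝓢 d)) := by
      refine (induced_iInf (g := (Subtype.val : 𝒳 → IntegralCurve))).trans ?_
      simp only [induced_compose]
      rfl
    rw [h0]
    refine le_iInf fun d => ?_
    intro U hU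
    obtain ⟨O, hO, rfl⟩ := hU
    obtain ⟨B, _, _, l₀, l, hl⟩ := exists_frame hS hp d
    have : Module.Finite ℂ (𝓢 d) :=
      Module.Finite.iff_fg.2 (homogeneousSubmodule_fg _ _ d)
    obtain ⟨O', hO', hO''⟩ := isOpen_span_range l₀ l hO
    refine ⟨O', hO', ?_⟩
    ext C
    have hdvd : ¬ S ∣ (Γ C : CoordRing) := fun h => by
      have := (hspan C).2
      rw [hcdvd h] at this
      exact zero_ne_one this
    obtain ⟨h1, h2⟩ := hl (Γ C) hdvd
    have h3 : range (l₀ + l (Γ C)) = C.1.forms d := by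
      ext f
      rw [h2, ← (hspan C).1]
      rfl
    rw [Set.mem_preimage, Set.mem_preimage, hO'' _ h1, h3]

/-! ### Dimension of spaces with rational parametrizations -/

/-- Elements chosen from the steps of a chain of primes are algebraically independent modulo the first
one. -/
lemma aeval_notMem_of_chain {A : Type} [CommRing A] [Algebra ℂ A] (m : ℕ) :
    ∀ (p : ℕ → Ideal A) (x : ℕ → A), (∀ i ≤ m, (p i).IsPrime) → (∀ i < m, p i ≤ p (i + 1)) →
      (∀ i < m, x i ∈ p (i + 1)) → (∀ i < m, x i ∉ p i) →
      ∀ f : MvPolynomial (Fin m) ℂ, f ≠ 0 → aeval (fun i : Fin m => x i) f ∉ p 0 := by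
  induction m with
  | zero =>
    intro p x hp _ _ _ f hf hmem
    rw [eq_C_of_isEmpty f, aeval_C] at hmem
    have hc : coeff 0 f ≠ 0 := fun h => hf (by rw [eq_C_of_isEmpty f, h, map_zero])
    exact (hp 0 le_rfl).ne_top (Ideal.eq_top_of_isUnit_mem _ hmem ((isUnit_iff_ne_zero.2 hc).map _))
  | succ m ih =>
    intro p x hp hle hx hx' f hf hmem
    set φ : Polynomial (MvPolynomial (Fin m) ℂ) →+* A := Polynomial.eval₂RingHom
      (aeval fun i : Fin m => x (i + 1) : MvPolynomial (Fin m) ℂ →ₐ[ℂ] A).toRingHom (x 0) with hφ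
    have hcomp : ∀ g : MvPolynomial (Fin (m + 1)) ℂ,
        aeval (fun i : Fin (m + 1) => x i) g = φ (finSuccEquiv ℂ m g) := by
      intro g
      induction g using MvPolynomial.induction_on with
      | C a => simp [hφ, finSuccEquiv_apply]
      | add p q hp hq => simp only [map_add, hp, hq]
      | mul_X p i hp =>
        rw [map_mul, map_mul, map_mul, hp, aeval_X]
        congr 1
        refine Fin.cases ?_ (fun j => ?_) i
        · simp [hφ, finSuccEquiv_X_zero]
        · simp [hφ, finSuccEquiv_X_succ]
    rw [hcomp] at hmem
    have hF : finSuccEquiv ℂ m f ≠ 0 := (map_ne_zero_iff _ (finSuccEquiv ℂ m).injective).2 hf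
    -- A power of x 0, which is not in the prime p 0, can be cancelled. After that the constant term
    -- in the first variable is nonzero and its value lies in p 1, so induction applies.
    obtain ⟨G, hG, hG0⟩ := Polynomial.exists_eq_pow_rootMultiplicity_mul_and_not_dvd _ hF 0
    rw [map_zero, sub_zero] at hG hG0
    have hφX : φ 𝐗 = x 0 := by simp [hφ]
    have hprime := hp 0 (Nat.zero_le _)
    have h1 : φ G ∈ p 0 := by
      rw [hG, map_mul, map_pow, hφX] at hmem
      exact (hprime.mem_or_mem hmem).resolve_left fun h =>
        hx' 0 (Nat.succ_pos m) (hprime.mem_of_pow_mem _ h)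
    have h2 : aeval (fun i : Fin m => x (i + 1)) (G.coeff 0) ∈ p 1 := by
      have h3 : φ G = φ G.divX * x 0 + aeval (fun i : Fin m => x (i + 1)) (G.coeff 0) := by
        conv_lhs => rw [← Polynomial.divX_mul_X_add G, map_add, map_mul, hφX]
        simp [hφ]
      rw [← (p 1).add_mem_iff_right (Ideal.mul_mem_left _ (φ G.divX) (hx 0 (Nat.succ_pos m))), ← h3]
      exact hle 0 (Nat.succ_pos m) h1
    exact ih (fun i => p (i + 1)) (fun i => x (i + 1)) (fun i hi => hp _ (by omega))
      (fun i hi => hle _ (by omega)) (fun i hi => hx _ (by omega)) (fun i hi => hx' _ (by omega))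
      (G.coeff 0) (fun h => hG0 (Polynomial.X_dvd_iff.2 h)) h2

lemma le_of_algebraicIndependent {m n : ℕ} {y : Fin m → FractionRing (MvPolynomial (Fin n) ℂ)}
    (hy : AlgebraicIndependent ℂ y) : m ≤ n := by
  have h1 := hy.cardinalMk_le_trdeg
  rw [← trdeg_add_eq ℂ (MvPolynomial (Fin n) ℂ)] at h1
  have : Algebra.IsAlgebraic (MvPolynomial (Fin n) ℂ) (FractionRing (MvPolynomial (Fin n) ℂ)) :=
    IsLocalization.isAlgebraic _ (nonZeroDivisors _)
  have h2 : Algebra.trdeg (MvPolynomial (Fin n) ℂ) (FractionRing (MvPolynomial (Fin n) ℂ)) = 0 :=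
    trdeg_eq_zero
  simpa [h2] using h1

section Families

variable {𝒳 V : Type} [AddCommGroup V] [Module ℂ V] (Γ : 𝒳 → V)

/-- The polynomial functions that vanish on a set. -/
def vanishing (Z : Set 𝒳) : Ideal (MvPolynomial (Dual ℂ V) ℂ) where
  carrier := {P | ∀ x ∈ Z, evalAt (Γ x) P = 0}
  zero_mem' := fun x _ => map_zero _
  add_mem' := fun hP hQ x hx => by rw [map_add, hP x hx, hQ x hx, add_zero]
  smul_mem' := fun P Q hQ x hx => by rw [smul_eq_mul, map_mul, hQ x hx, mul_zero]

variable {Γ}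

lemma mem_vanishing {Z : Set 𝒳} {P : MvPolynomial (Dual ℂ V) ℂ} :
    P ∈ vanishing Γ Z ↔ ∀ x ∈ Z, evalAt (Γ x) P = 0 := Iff.rfl

lemma vanishing_anti {Z Z' : Set 𝒳} (h : Z ⊆ Z') : vanishing Γ Z' ≤ vanishing Γ Z :=
  fun _ hP x hx => hP x (h hx)

variable (Γ) in
/-- A set of the form of a family depending rationally on `n` parameters, in terms of functions. -/
def IsRationalFamily (Z : Set 𝒳) (n : ℕ) : Prop :=
  ∃ θ : MvPolynomial (Dual ℂ V) ℂ →ₐ[ℂ] FractionRing (MvPolynomial (Fin n) ℂ),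
    ∀ P, θ P = 0 ↔ P ∈ vanishing Γ Z

lemma IsRationalFamily.isPrime {Z : Set 𝒳} {n : ℕ} (h : IsRationalFamily Γ Z n) :
    (vanishing Γ Z).IsPrime := by
  obtain ⟨θ, hθ⟩ := h
  have : vanishing Γ Z = RingHom.ker θ := by
    ext P
    exact (hθ P).symm
  rw [this]
  exact RingHom.ker_isPrime _

/-- The functions modulo those vanishing on Z embed in a field of transcendence degree n. -/
lemma IsRationalFamily.le {Z : Set 𝒳} {n m : ℕ} (h : IsRationalFamily Γ Z n)
    {x : Fin m → MvPolynomial (Dual ℂ V) ℂ}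
    (hx : ∀ f : MvPolynomial (Fin m) ℂ, f ≠ 0 → aeval x f ∉ vanishing Γ Z) : m ≤ n := by
  obtain ⟨θ, hθ⟩ := h
  refine le_of_algebraicIndependent (y := fun i => θ (x i))
    (algebraicIndependent_iff.2 fun f hf => ?_)
  by_contra hne
  refine hx f hne ((hθ _).1 ?_)
  rw [← hf]
  exact (comp_aeval_apply (φ := θ) x f).symm ▸ rfl

/-- A family given by rational functions. -/
lemma isRationalFamily_image {n : ℕ} {κ : (Fin n → ℂ) → 𝒳} {δ c : (Fin n → ℂ) → ℂ}
    {H : Dual ℂ V → (Fin n → ℂ) → ℂ} (hδ : IsPolyFamily δ) (hδ0 : ∃ u, δ u ≠ 0)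
    (hc : IsPolyFamily c) (hc0 : ∀ u, δ u ≠ 0 → c u ≠ 0) (hH : ∀ φ, IsPolyFamily (H φ))
    (h : ∀ φ u, δ u ≠ 0 → φ (Γ (κ u)) * c u = H φ u) :
    IsRationalFamily Γ (κ '' {u | δ u ≠ 0}) n := by
  obtain ⟨c', hc'⟩ := hc
  choose H' hH' using hH
  have hcne : c' ≠ 0 := by
    rintro rfl
    obtain ⟨u, hu⟩ := hδ0
    exact hc0 u hu (by rw [hc', map_zero])
  have hcne' : algebraMap _ (FractionRing (MvPolynomial (Fin n) ℂ)) c' ≠ 0 :=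
    (map_ne_zero_iff _ (IsFractionRing.injective _ _)).2 hcne
  refine ⟨aeval fun φ => algebraMap _ (FractionRing (MvPolynomial (Fin n) ℂ)) (H' φ) /
    algebraMap _ _ c', fun P => ?_⟩
  obtain ⟨N, Q, hQ⟩ := exists_clear_denominators H' c' P
  have h1 := hQ _ (IsScalarTower.toAlgHom ℂ (MvPolynomial (Fin n) ℂ)
    (FractionRing (MvPolynomial (Fin n) ℂ))) hcne'
  have h2 : ∀ u, δ u ≠ 0 → (eval u Q = 0 ↔ evalAt (Γ (κ u)) P = 0) := by
    intro u hu
    have hcu : eval u c' ≠ 0 := fun h0 => hc0 u hu ((hc' u).trans h0)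
    have h3 := hQ ℂ (aeval u) hcu
    have h4 : (fun φ => (aeval u) (H' φ) / (aeval u) c') = fun φ : Dual ℂ V => φ (Γ (κ u)) := by
      funext φ
      refine (div_eq_iff hcu).2 ?_
      have h5 := h φ u hu
      rw [hc', hH'] at h5
      exact h5.symm
    rw [h4] at h3
    have h6 : eval u Q = eval u c' ^ N * evalAt (Γ (κ u)) P := h3
    rw [h6]
    simp [hcu]
  have h7 : (aeval (fun φ => algebraMap _ (FractionRing (MvPolynomial (Fin n) ℂ)) (H' φ) /
      algebraMap _ _ c') P = 0) ↔ Q = 0 := by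
    rw [← map_eq_zero_iff _ (IsFractionRing.injective (MvPolynomial (Fin n) ℂ)
      (FractionRing (MvPolynomial (Fin n) ℂ)))]
    refine Iff.trans ?_ (Eq.congr_left h1).symm
    exact ⟨fun h0 => mul_eq_zero_of_right _ h0, fun h0 => (mul_eq_zero.1 h0).resolve_left
      (pow_ne_zero N hcne')⟩
  rw [h7, mem_vanishing, Set.forall_mem_image]
  constructor
  · rintro rfl u hu
    exact (h2 u hu).1 (map_zero _)
  · intro hP
    refine MvPolynomial.funext fun u => ?_
    rw [map_zero]
    exact IsPolyFamily.eq_zero_of_forall (f := fun u => eval u Q) ⟨Q, fun u => rfl⟩ hδ hδ0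
      (fun u hu => (h2 u hu).2 (hP hu)) u

variable [TopologicalSpace 𝒳] (hΓ : ‹TopologicalSpace 𝒳› = TopologicalSpace.induced Γ (zariskiTopology V))
include hΓ

lemma isOpen_evalAt_ne_zero (P : MvPolynomial (Dual ℂ V) ℂ) : IsOpen {x | evalAt (Γ x) P ≠ 0} := by
  rw [hΓ]
  exact ⟨_, isOpen_zariski_ne P, rfl⟩

lemma exists_evalAt_ne_zero_of_isOpen {U : Set 𝒳} (hU : IsOpen U) {x : 𝒳} (hx : x ∈ U) :
    ∃ P : MvPolynomial (Dual ℂ V) ℂ, evalAt (Γ x) P ≠ 0 ∧ ∀ y, evalAt (Γ y) P ≠ 0 → y ∈ U := by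
  rw [hΓ] at hU
  obtain ⟨O, hO, rfl⟩ := hU
  obtain ⟨P, h1, h2⟩ := exists_evalAt_ne_zero hO hx
  exact ⟨P, h1, fun y hy => h2 _ hy⟩

lemma mem_closure_iff_vanishing {Z : Set 𝒳} {x : 𝒳} :
    x ∈ closure Z ↔ ∀ P ∈ vanishing Γ Z, evalAt (Γ x) P = 0 := by
  rw [mem_closure_iff]
  constructor
  · intro h P hP
    by_contra hne
    obtain ⟨y, hy, hyZ⟩ := h _ (isOpen_evalAt_ne_zero hΓ P) hne
    exact hy (hP y hyZ)
  · intro h U hU hx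
    obtain ⟨P, h1, h2⟩ := exists_evalAt_ne_zero_of_isOpen hΓ hU hx
    by_contra hcon
    exact h1 (h P fun y hy => by_contra fun hne => hcon ⟨y, h2 y hne, hy⟩)

lemma closure_subset_of_vanishing {Z Z' : Set 𝒳} (h : vanishing Γ Z' ≤ vanishing Γ Z) :
    closure Z ⊆ closure Z' := fun _ hx =>
  (mem_closure_iff_vanishing hΓ).2 fun P hP => (mem_closure_iff_vanishing hΓ).1 hx P (h hP)

lemma isPrime_vanishing_iff {Z : Set 𝒳} : (vanishing Γ Z).IsPrime ↔ IsIrreducible Z := by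
  constructor
  · intro h
    refine ⟨?_, fun U U' hU hU' ⟨x, hxZ, hx⟩ ⟨y, hyZ, hy⟩ => ?_⟩
    · by_contra hne
      rw [Set.not_nonempty_iff_eq_empty] at hne
      exact h.ne_top ((Ideal.eq_top_iff_one _).2 fun x hx => by simp [hne] at hx)
    · obtain ⟨P, h1, h2⟩ := exists_evalAt_ne_zero_of_isOpen hΓ hU hx
      obtain ⟨Q, h3, h4⟩ := exists_evalAt_ne_zero_of_isOpen hΓ hU' hy
      have h5 : P * Q ∉ vanishing Γ Z := fun hPQ => (h.mem_or_mem hPQ).elim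
        (fun hP => h1 (hP x hxZ)) fun hQ => h3 (hQ y hyZ)
      rw [mem_vanishing] at h5
      push Not at h5
      obtain ⟨z, hz, hne⟩ := h5
      rw [map_mul] at hne
      exact ⟨z, hz, h2 z (left_ne_zero_of_mul hne), h4 z (right_ne_zero_of_mul hne)⟩
  · intro h
    refine ⟨fun htop => ?_, fun {P Q} hPQ => ?_⟩
    · obtain ⟨x, hx⟩ := h.nonempty
      have := (Ideal.eq_top_iff_one _).1 htop x hx
      simp at this
    · by_contra! hcon
      obtain ⟨hP, hQ⟩ := hcon
      rw [mem_vanishing] at hP hQ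
      push Not at hP hQ
      obtain ⟨x, hx, hxP⟩ := hP
      obtain ⟨y, hy, hyQ⟩ := hQ
      obtain ⟨z, hz, hzP, hzQ⟩ := h.isPreirreducible _ _ (isOpen_evalAt_ne_zero hΓ P) (isOpen_evalAt_ne_zero hΓ Q)
        ⟨x, hx, hxP⟩ ⟨y, hy, hyQ⟩
      have := hPQ z hz
      rw [map_mul] at this
      exact (mul_ne_zero hzP hzQ) this

/-- A chain of irreducible closed sets gives a chain of prime vanishing ideals; elements chosen from
its steps are algebraically independent functions on the whole space. -/
lemma topologicalKrullDim_le {n : ℕ} (h : IsRationalFamily Γ Set.univ n) :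
    topologicalKrullDim 𝒳 ≤ n := by
  refine iSup_le fun s => ?_
  set m := s.length with hm
  -- The chain is read from its largest member downwards, so that the vanishing ideals increase.
  set Z : ℕ → TopologicalSpace.IrreducibleCloseds 𝒳 := fun i => s ⟨m - i, by omega⟩ with hZ
  set p : ℕ → Ideal (MvPolynomial (Dual ℂ V) ℂ) := fun i => vanishing Γ (Z i : Set 𝒳) with hp
  have hlt : ∀ i < m, Z (i + 1) < Z i := fun i hi => s.strictMono (by
    rw [Fin.lt_def]; change m - (i + 1) < m - i; omega)
  have hstep : ∀ i < m, ∃ x, x ∈ p (i + 1) ∧ x ∉ p i := by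
    intro i hi
    by_contra! hcon
    have h1 := closure_subset_of_vanishing hΓ (Z := (Z i : Set 𝒳)) (Z' := (Z (i + 1) : Set 𝒳)) hcon
    rw [(Z i).isClosed.closure_eq, (Z (i + 1)).isClosed.closure_eq] at h1
    exact (hlt i hi).not_ge h1
  choose! x hx hx' using hstep
  have h2 := aeval_notMem_of_chain m p x
    (fun i _ => (isPrime_vanishing_iff hΓ).2 (Z i).isIrreducible)
    (fun i hi => vanishing_anti (hlt i hi).le) hx hx'
  have h3 := h.le (x := fun i : Fin m => x i) fun f hf hmem =>
    h2 f hf (vanishing_anti (Set.subset_univ _) hmem)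
  exact_mod_cast h3

/-- The closures of the Z j form a chain of irreducible closed sets. It is strict, since j + 1
independent functions on Z (j + 1) cannot remain independent on a family with j parameters. -/
lemma le_topologicalKrullDim {n : ℕ} {Z : ℕ → Set 𝒳} (hmono : ∀ j < n, Z j ⊆ Z (j + 1))
    (hZ : ∀ j ≤ n, IsRationalFamily Γ (Z j) j)
    (hx : ∀ j < n, ∃ x : Fin (j + 1) → MvPolynomial (Dual ℂ V) ℂ,
      ∀ f : MvPolynomial (Fin (j + 1)) ℂ, f ≠ 0 → aeval x f ∉ vanishing Γ (Z (j + 1))) :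
    n ≤ topologicalKrullDim 𝒳 := by
  set T : Fin (n + 1) → TopologicalSpace.IrreducibleCloseds 𝒳 := fun j => ⟨closure (Z j),
    ((isPrime_vanishing_iff hΓ).1 (hZ j (by omega)).isPrime).closure, isClosed_closure⟩ with hT
  have hlt : ∀ j : Fin n, T j.castSucc < T j.succ := by
    intro j
    refine lt_of_le_not_ge (closure_mono (hmono j j.2)) fun hge => ?_
    obtain ⟨x, hx⟩ := hx j j.2
    have hle : (j : ℕ) + 1 ≤ j := (hZ j (by omega)).le (x := x) fun f hf hmem => by
      refine hx f hf fun y hy => ?_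
      exact (mem_closure_iff_vanishing hΓ).1 (hge (subset_closure hy)) _ hmem
    omega
  exact Order.le_krullDim_iff.2 ⟨⟨n, T, hlt⟩, rfl⟩

end Families

/-! ### Leading forms of algebraic relations -/

/-- If `f` vanishes on the fractions `N / D`, then some homogeneous component of `f` vanishes on `N`
wherever `D` is zero. -/
lemma exists_homogeneousComponent_eq_zero {m n : ℕ} {f : MvPolynomial (Fin m) ℂ} (hf : f ≠ 0)
    {δ D : (Fin n → ℂ) → ℂ} {N : Fin m → (Fin n → ℂ) → ℂ} (hδ : IsPolyFamily δ) (hδ0 : ∃ v, δ v ≠ 0)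
    (hD : IsPolyFamily D) (hN : ∀ i, IsPolyFamily (N i))
    (h : ∀ v, δ v ≠ 0 → ∃ k : Fin m → ℂ, eval k f = 0 ∧ ∀ i, N i v = D v * k i) :
    ∃ d, homogeneousComponent d f ≠ 0 ∧
      ∀ v, D v = 0 → eval (fun i => N i v) (homogeneousComponent d f) = 0 := by
  classical
  -- The component of highest degree is taken. After multiplication of f(N / D) = 0 by Dᵈ, all other
  -- terms contain D; the identity extends by density to the zeros of D, where only the leading form
  -- survives.
  set d := Nat.findGreatest (fun n => homogeneousComponent n f ≠ 0) f.totalDegree with hd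
  obtain ⟨n₀, hn₀, hne⟩ : ∃ n ≤ f.totalDegree, homogeneousComponent n f ≠ 0 := by
    by_contra! hcon
    refine hf ?_
    rw [← sum_homogeneousComponent f]
    exact Finset.sum_eq_zero fun i hi => hcon i (by simpa [Nat.lt_succ_iff] using hi)
  have hsum : f = ∑ i ∈ Finset.range (d + 1), homogeneousComponent i f := by
    conv_lhs => rw [← sum_homogeneousComponent f]
    refine (Finset.sum_subset (Finset.range_subset_range.2
      (Nat.succ_le_succ (Nat.findGreatest_le _))) fun i hi hi' => ?_).symm
    by_contra h0
    simp only [Finset.mem_range, Nat.lt_succ_iff, not_le] at hi hi'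
    exact Nat.findGreatest_is_greatest hi' hi h0
  have hne' := Nat.findGreatest_spec (P := fun n => homogeneousComponent n f ≠ 0) hn₀ hne
  refine ⟨d, hne', fun v hv => ?_⟩
  have hpoly : ∀ g : MvPolynomial (Fin m) ℂ, IsPolyFamily (fun v => eval (fun i => N i v) g) :=
    fun g => IsPolyFamily.comp (f := fun x => eval x g) ⟨g, fun u => rfl⟩ hN
  have key := IsPolyFamily.eq_zero_of_forall (f := fun v => ∑ i ∈ Finset.range (d + 1),
    D v ^ (d - i) * eval (fun i => N i v) (homogeneousComponent i f))
    (.sum fun i _ => (hD.pow _).mul (hpoly _)) hδ hδ0 (fun v hv => by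
      obtain ⟨k, hk, hk'⟩ := h v hv
      have h1 : (fun i => N i v) = D v • k := funext hk'
      have h2 : ∀ i ∈ Finset.range (d + 1), D v ^ (d - i) *
          eval (fun i => N i v) (homogeneousComponent i f) =
            D v ^ d * eval k (homogeneousComponent i f) := fun i hi => by
        rw [h1, eval_smul_of_isHomogeneous (homogeneousComponent_isHomogeneous i f), ← mul_assoc,
          ← pow_add, Nat.sub_add_cancel (by simpa [Nat.lt_succ_iff] using hi)]
      rw [sum_congr rfl h2, ← mul_sum, ← map_sum, ← hsum, hk, mul_zero]) v
  rw [Finset.sum_range_succ, Finset.sum_eq_zero fun i hi => ?_] at key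
  · simpa using key
  · rw [hv, zero_pow (by have := Finset.mem_range.1 hi; omega), zero_mul]

lemma exists_prod_eq {s : Multiset ℂ} {j : ℕ} (h : s.card = j) :
    ∃ r : Fin j → ℂ, ∀ φ : ℂ → ℂ, (s.map φ).prod = ∏ l, φ (r l) := by
  obtain ⟨L, rfl⟩ := Quot.exists_rep s
  obtain rfl : L.length = j := h
  exact ⟨fun l => L[l.1], fun φ => (Fin.prod_univ_fun_getElem L φ).symm⟩

/-- A form that vanishes on the values of all monic polynomials is zero. -/
lemma eq_zero_of_forall_roots {j d : ℕ} {g : MvPolynomial (Fin (j + 1)) ℂ} (hg : g.IsHomogeneous d)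
    {a c : Fin (j + 1) → ℂ} (ha : Injective a) (hc : ∀ i, c i ≠ 0)
    (h : ∀ r : Fin j → ℂ, eval (fun i => (∏ l, (a i - r l)) * c i) g = 0) : g = 0 := by
  -- Homogeneity allows any nonzero leading coefficient, and density then any polynomial of degree
  -- at most j. By interpolation at j + 1 points its values are arbitrary.
  have key := fun b : Fin (j + 1) → ℂ => IsPolyFamily.eq_zero_of_forall
    (f := fun b : Fin (j + 1) → ℂ => eval (fun i => (∑ k : Fin (j + 1), b k * a i ^ (k : ℕ)) * c i) g)
    (g := fun b => b (Fin.last j))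
    (IsPolyFamily.comp (f := fun x => eval x g) ⟨g, fun u => rfl⟩ fun i =>
      (IsPolyFamily.sum fun k _ => (IsPolyFamily.coord k).mul (.const _)).mul (.const _)) (.coord _)
    ⟨1, one_ne_zero⟩ (fun b hb => by
      set P : ℂ[X] := ∑ k : Fin (j + 1), 𝐂 (b k) * 𝐗 ^ (k : ℕ) with hP
      have hcoeff : P.coeff j = b (Fin.last j) := by
        rw [hP, Polynomial.finsetSum_coeff, Finset.sum_eq_single (Fin.last j)]
        · simp
        · intro k _ hk
          have hne : j ≠ k := fun h0 => hk (Fin.ext h0.symm)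
          simp [Polynomial.coeff_X_pow, hne]
        · simp
      have hdeg : P.natDegree = j := le_antisymm
        (Polynomial.natDegree_sum_le_of_forall_le _ _ fun k _ =>
          (Polynomial.natDegree_C_mul_X_pow_le _ _).trans (Nat.lt_succ_iff.1 k.2))
        (Polynomial.le_natDegree_of_ne_zero (by rw [hcoeff]; exact hb))
      have hs := IsAlgClosed.splits P
      obtain ⟨r, hr⟩ := exists_prod_eq (show P.roots.card = j by rw [← hs.natDegree_eq_card_roots, hdeg])
      have hval : ∀ x, P.eval x = b (Fin.last j) * ∏ l, (x - r l) := by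
        intro x
        rw [hs.eval_eq_prod_roots, Polynomial.leadingCoeff, hdeg, hcoeff, hr]
      have h1 : (fun i => (∑ k : Fin (j + 1), b k * a i ^ (k : ℕ)) * c i) = b (Fin.last j) •
          fun i => (∏ l : Fin j, (a i - r l)) * c i := by
        funext i
        rw [Pi.smul_apply, smul_eq_mul, ← mul_assoc, ← hval]
        simp [hP, Polynomial.eval_finsetSum]
      rw [h1, eval_smul_of_isHomogeneous hg, h, mul_zero]) b
  refine MvPolynomial.funext fun x => ?_
  set P := Lagrange.interpolate univ a (fun i => x i / c i) with hP
  have hdeg := Lagrange.degree_interpolate_lt (s := univ) (v := a) (fun i => x i / c i) ha.injOn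
  rw [Finset.card_univ, Fintype.card_fin, ← hP] at hdeg
  have h1 := key fun k => P.coeff k
  have h2 : (fun i => (∑ k : Fin (j + 1), P.coeff k * a i ^ (k : ℕ)) * c i) = x := by
    funext i
    have h3 := Lagrange.eval_interpolate_at_node (fun i => x i / c i) ha.injOn (mem_univ i)
    rw [← hP, Polynomial.eval_eq_sum_range' (Nat.lt_succ_of_le
      (Polynomial.natDegree_le_iff_coeff_eq_zero.2 fun k hk => Polynomial.coeff_eq_zero_of_degree_lt
        (hdeg.trans_le (by exact_mod_cast hk)))), ← Fin.sum_univ_eq_sum_range (fun k => P.coeff k * a i ^ k)] at h3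
    rw [h3, div_mul_cancel₀ _ (hc i)]
  rw [map_zero, ← h1, h2]

/-! ### The dimension of the space of curves -/

/-- The form is linear in X₃ with coprime coefficients X₀ and -X₁X₂, hence irreducible. -/
lemma prime_segre : Prime segre := by
  rw [← UniqueFactorizationMonoid.irreducible_iff_prime]
  have h1 : segre = X 0 * X 3 + -(X 1 * X 2) := by rw [segre]; ring
  have hX : ∀ i j : Fin 4, i ≠ j → ¬ (X i : CoordRing) ∣ X j := fun i j hij h =>
    hij (X_dvd_X.1 h)
  have hp : Prime (X 0 : CoordRing) := X_prime
  rw [h1]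
  refine irreducible_mul_X_add _ _ 3 (X_ne_zero 0) (by simp [vars_X]) ?_ ?_
  · rw [vars_neg]
    intro h
    rcases Finset.mem_union.1 (vars_mul _ _ h) with h | h <;> simp [vars_X] at h
  · rw [hp.irreducible.isRelPrime_iff_not_dvd, dvd_neg]
    exact fun h => (hp.dvd_or_dvd h).elim (hX 0 1 (by decide)) (hX 0 2 (by decide))

lemma evalAt_aeval_X {V : Type} [AddCommGroup V] [Module ℂ V] {m : ℕ} (l : Fin m → Dual ℂ V)
    (v : V) (f : MvPolynomial (Fin m) ℂ) :
    evalAt v (aeval (fun i => X (l i)) f) = eval (fun i => l i v) f := by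
  induction f using MvPolynomial.induction_on with
  | C a => simp
  | add p q hp hq => simp only [map_add, hp, hq]
  | mul_X p i hp => simp only [map_mul, hp, aeval_X, eval_X]

/-- A polynomial function that vanishes on a nonempty open part of a rational family vanishes on the
whole family. -/
lemma vanishing_image_le {𝒳 V : Type} [AddCommGroup V] [Module ℂ V] {Γ : 𝒳 → V} {n : ℕ}
    {κ : (Fin n → ℂ) → 𝒳} {δ δ' c : (Fin n → ℂ) → ℂ} {H : Dual ℂ V → (Fin n → ℂ) → ℂ}
    (hδ : IsPolyFamily δ) (hδ' : IsPolyFamily δ') (hδ0 : ∃ u, δ' u * δ u ≠ 0) (hc : IsPolyFamily c)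
    (hc0 : ∀ u, δ u ≠ 0 → c u ≠ 0) (hH : ∀ φ, IsPolyFamily (H φ))
    (h : ∀ φ u, δ u ≠ 0 → φ (Γ (κ u)) * c u = H φ u) :
    vanishing Γ (κ '' {u | δ' u * δ u ≠ 0}) ≤ vanishing Γ (κ '' {u | δ u ≠ 0}) := by
  intro P hP
  obtain ⟨c', hc'⟩ := hc
  choose H' hH' using hH
  obtain ⟨N, Q, hQ⟩ := exists_clear_denominators H' c' P
  have h2 : ∀ u, δ u ≠ 0 → eval u Q = c u ^ N * evalAt (Γ (κ u)) P := by
    intro u hu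
    have hcu : eval u c' ≠ 0 := fun h0 => hc0 u hu ((hc' u).trans h0)
    have h4 : (fun φ => (aeval u) (H' φ) / (aeval u) c') = fun φ : Dual ℂ V => φ (Γ (κ u)) := by
      funext φ
      refine (div_eq_iff hcu).2 ?_
      have h5 := h φ u hu
      rw [hc', hH'] at h5
      exact h5.symm
    have h3 := hQ ℂ (aeval u) hcu
    rw [h4] at h3
    rw [hc']
    exact h3
  have h3 := IsPolyFamily.eq_zero_of_forall (f := fun u => eval u Q) ⟨Q, fun u => rfl⟩ (hδ'.mul hδ) hδ0
    fun u hu => by rw [h2 u (right_ne_zero_of_mul hu), hP _ ⟨u, hu, rfl⟩, mul_zero]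
  rw [mem_vanishing, Set.forall_mem_image]
  intro u hu
  have h4 := h3 u
  rw [h2 u hu] at h4
  exact (mul_eq_zero.1 h4).resolve_left (pow_ne_zero N (hc0 u hu))

namespace CurveParam

/-- The first `j` coordinates vary, the others are fixed. -/
def extend (u₀ : Fin 5 → ℂ) (j : ℕ) (v : Fin j → ℂ) : Fin 5 → ℂ :=
  fun i => if h : (i : ℕ) < j then v ⟨i, h⟩ else u₀ i

lemma isPoly_extend (u₀ : Fin 5 → ℂ) (j : ℕ) (i : Fin 5) : IsPolyFamily (fun v => extend u₀ j v i) := by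
  unfold extend
  split_ifs
  · exact .coord _
  · exact .const _

lemma extend_self (u₀ : Fin 5 → ℂ) (j : ℕ) : extend u₀ j (fun i => if h : (i : ℕ) < 5 then u₀ ⟨i, h⟩
    else 0) = u₀ := by
  funext i
  simp [extend]

lemma extend_succ (u₀ : Fin 5 → ℂ) (j : ℕ) (v : Fin j → ℂ) :
    extend u₀ (j + 1) (fun i => if h : (i : ℕ) < 5 then extend u₀ j v ⟨i, h⟩ else 0) =
      extend u₀ j v := by
  funext i
  by_cases h : (i : ℕ) < j
  · simp [extend, h, h.le]
  · simp [extend, h]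

/-- With u₀ set to 0, the first j roots are the free values r and the others stay fixed; the product
over all roots splits accordingly. -/
lemma prod_extend (u₀ : Fin 5 → ℂ) {j : ℕ} (hj : j < 5) (r : Fin j → ℂ) (x : ℂ) :
    ∏ k : Fin 4, (x - extend u₀ (j + 1) (Fin.cons 0 r) k.succ) =
      (∏ k, (x - r k)) * ∏ k : Fin 4, if (k : ℕ) < j then 1 else x - u₀ k.succ := by
  have hr : ∀ k (hk : k < j), (Fin.cons 0 r : Fin (j + 1) → ℂ) ⟨k + 1, by omega⟩ = r ⟨k, hk⟩ :=
    fun k hk => Fin.cons_succ (α := fun _ => ℂ) 0 r ⟨k, hk⟩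
  have hcons : ∀ k : Fin 4, extend u₀ (j + 1) (Fin.cons 0 r) k.succ =
      if h : (k : ℕ) < j then r ⟨k, h⟩ else u₀ k.succ := by
    intro k
    by_cases hk : (k : ℕ) < j
    · simp [extend, hk, hr k hk]
    · simp [extend, hk]
  simp only [hcons]
  clear hcons hr
  interval_cases j <;> simp [Fin.prod_univ_succ, mul_assoc]

variable {η : Fin 5 → ℂ} {Φ : CoordRing ≃ₐ[ℂ] CoordRing} (hΦ : PreservesDegree Φ) (hη : Injective η)
include hΦ hη

/-- Coordinates on the space of curves, and their values on the parametrized family. -/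
lemma exists_family : ∃ (Γ : segreCurves Φ η → 𝓢 3) (κ : (Fin 8 → ℂ) → segreCurves Φ η)
    (num : Dual ℂ (𝓢 3) → (Fin 8 → ℂ) → ℂ)
    (den : (Fin 8 → ℂ) → ℂ) (l : Fin 5 → Dual ℂ (𝓢 3)) (a : ℂ),
    (instTopologicalSpaceSubtype : TopologicalSpace (segreCurves Φ η)) =
      TopologicalSpace.induced Γ (zariskiTopology _) ∧
    (∀ φ, IsPolyFamily (num φ)) ∧ IsPolyFamily den ∧ (∀ e, disc η e ≠ 0 → den e ≠ 0) ∧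
    (∀ φ e, disc η e ≠ 0 → φ (Γ (κ e)) * den e = num φ e) ∧
    (∀ C, ∃ e, disc η e ≠ 0 ∧ κ e = C) ∧
    (∀ e, disc η e ≠ 0 → e 2 ≠ 0 → e 5 ≠ 0 → e 6 ≠ 0 →
      ∃ u, disc η (slice u) ≠ 0 ∧ κ e = κ (slice u)) ∧ a ≠ 0 ∧
    ∀ i e, disc η e ≠ 0 → slopeNum η i e * a * (wt η i)⁻¹ = det η e * l i (Γ (κ e)) := by
  -- The value at the point (y, y) of the diagonal, away from the ηᵢ, is the normalizing functional:
  -- it vanishes on multiples of the quadric and on none of the cubics of the family.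
  obtain ⟨y, hy⟩ := (Set.finite_range η).infinite_compl.nonempty
  have hy' : ∀ i, y ≠ η i := fun i h => hy ⟨i, h.symm⟩
  set S := Φ segre with hS
  have hS2 : S.IsHomogeneous 2 := (hΦ 2 segre).2 (by
    rw [segre]
    exact ((isHomogeneous_X ℂ 0).mul (isHomogeneous_X ℂ 3)).sub
      ((isHomogeneous_X ℂ 1).mul (isHomogeneous_X ℂ 2)))
  have hSp : Prime S := (MulEquiv.prime_iff Φ.toMulEquiv).2 prime_segre
  set c : CoordRing →ₗ[ℂ] ℂ := (aeval (segrePoint y y)).toLinearMap ∘ₗ Φ.symm.toLinearMap with hc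
  have hcΦ : ∀ f, c (Φ f) = eval (segrePoint y y) f := fun f => by
    change eval _ (Φ.symm (Φ f)) = _
    rw [AlgEquiv.symm_apply_apply]
  have hcS : ∀ f, c (S * f) = 0 := fun f => by
    obtain ⟨g, rfl⟩ := Φ.surjective f
    rw [hS, ← map_mul, hcΦ, map_mul]
    simp [segre, segrePoint]
  have hcubic : ∀ e, (Φ (cubic η e)).IsHomogeneous 3 := fun e =>
    (hΦ 3 _).2 (bezoutCubic_isHomogeneous _ _ _ _)
  have hccubic : ∀ e, disc η e ≠ 0 → c (Φ (cubic η e)) ≠ 0 := fun e he => by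
    rw [hcΦ]
    exact ((isNodalPair_iff hη).2 he).eval_cubic_ne_zero hy'
  obtain ⟨u₀, hu₀⟩ := exists_disc_slice_ne_zero hη
  have : Nonempty IntegralCurve := ⟨(exists_curve hΦ hη hu₀).choose⟩
  choose! κ' hκ1 hκ2 hκ3 using fun (e : Fin 8 → ℂ) (he : disc η e ≠ 0) => exists_curve hΦ hη he
  have hmem : ∀ C ∈ segreCurves Φ η, ∃ e, disc η e ≠ 0 ∧ κ' e = C := fun C hC => by
    obtain ⟨e, he, h1⟩ := exists_param_of_mem hΦ hη hC
    exact ⟨e, he, (hκ2 e he).eq hΦ h1⟩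
  obtain ⟨π, Γ, hπ, hΓ, htop⟩ := exists_coordinates (𝒳 := segreCurves Φ η) hS2 hSp hcS (fun C hC => by
    obtain ⟨e, he, rfl⟩ := hmem C hC
    exact ⟨Φ (cubic η e), hcubic e, hccubic e he, hκ3 e he⟩)
  classical
  -- Where `disc` vanishes the value is a fixed arbitrary member of the family.
  set κ : (Fin 8 → ℂ) → segreCurves Φ η := fun e =>
    if he : disc η e ≠ 0 then ⟨κ' e, hκ1 e he⟩ else ⟨κ' (slice u₀), hκ1 _ hu₀⟩ with hκ
  have hκ' : ∀ e, disc η e ≠ 0 → (κ e).1 = κ' e := fun e he => by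
    rw [hκ]
    simp only [dif_pos he]
  have hΓκ : ∀ e, disc η e ≠ 0 → Γ (κ e) = (c (Φ (cubic η e)))⁻¹ • π ⟨Φ (cubic η e), hcubic e⟩ :=
    fun e he => hΓ (κ e) ⟨Φ (cubic η e), hcubic e⟩ (by
      rw [hκ' e he, hκ3 e he]
      exact subset_span (by simp)) (hccubic e he)
  set toV : CoordRing →ₗ[ℂ] 𝓢 3 :=
    LinearMap.codRestrict (𝓢 3) (homogeneousComponent 3) fun f => homogeneousComponent_mem _ _ with htoV
  have htoV' : ∀ e, toV (Φ (cubic η e)) = ⟨Φ (cubic η e), hcubic e⟩ := fun e =>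
    Subtype.ext (homogeneousComponent_eq_self (hcubic e))
  set l : Fin 5 → Dual ℂ (𝓢 3) := fun i =>
    diagSlope (η i) ∘ₗ Φ.symm.toLinearMap ∘ₗ (𝓢 3).subtype with hl
  have hlπ : ∀ i (f : CoordRing) (hf : (Φ f).IsHomogeneous 3), l i (π ⟨Φ f, hf⟩) = diagSlope (η i) f := by
    intro i f hf
    obtain ⟨g, hg⟩ := hπ ⟨Φ f, hf⟩
    have h1 : Φ.symm (π ⟨Φ f, hf⟩ : CoordRing) = f + segre * Φ.symm g := by
      rw [AlgEquiv.symm_apply_eq, map_add, map_mul, apply_symm_apply, ← hS, ← hg]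
      exact (add_sub_cancel _ _).symm
    change diagSlope (η i) (Φ.symm (π ⟨Φ f, hf⟩ : CoordRing)) = _
    rw [h1, map_add, diagSlope_segre_mul, add_zero]
  have hY : (nodal univ η).eval y ≠ 0 :=
    Lagrange.eval_nodal_not_at_node fun i _ => hy' i
  refine ⟨Γ, κ, fun φ e => φ (π (toV (Φ (cubic η e)))), fun e => c (Φ (cubic η e)), l,
    ((nodal univ η).eval y)⁻¹, htop,
    fun φ => (isPoly_cubic η).linear (φ ∘ₗ π ∘ₗ toV ∘ₗ Φ.toLinearMap),
    (isPoly_cubic η).linear (c ∘ₗ Φ.toLinearMap), hccubic, fun φ e he => ?_, fun C => ?_,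
    fun e he h2 h5 h6 => ?_, inv_ne_zero hY, fun i e he => ?_⟩
  · change φ (Γ (κ e)) * c (Φ (cubic η e)) = φ (π (toV (Φ (cubic η e))))
    rw [hΓκ e he, htoV', map_smul, smul_eq_mul, mul_comm, mul_inv_cancel_left₀ (hccubic e he)]
  · obtain ⟨e, he, h1⟩ := hmem C C.2
    exact ⟨e, he, Subtype.ext ((hκ' e he).trans h1)⟩
  · obtain ⟨u, hu, h1⟩ := exists_slice (Φ := Φ) hη he h2 h5 h6
    refine ⟨u, hu, Subtype.ext ?_⟩
    rw [hκ' e he, hκ' _ hu]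
    exact ((h1 _).1 (hκ2 e he)).eq hΦ (hκ2 _ hu)
  · have h1 := diagSlope_cubic hη he i y
    have hw := wt_ne_zero hη i
    have h2 := hccubic e he
    rw [hΓκ e he, map_smul, hlπ, smul_eq_mul]
    rw [hcΦ] at h2 ⊢
    field_simp
    linear_combination -h1

/-- The slice with all five parameters has the same vanishing ideal as the whole space, which gives
irreducibility and the bound 5. The subfamilies Z j, in which the first j parameters vary, form the
chain for the lower bound, and the slopes at the first j + 1 points are independent on Z (j + 1). -/
theorem krullDim_segreCurves : topologicalKrullDim (segreCurves Φ η) = 5 ∧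
    IrreducibleSpace (segreCurves Φ η) := by
  obtain ⟨Γ, κ, num, den, l, a, htop, hnum, hden, hden0, hval, hsurj, hslice, ha, hslope⟩ :=
    exists_family hΦ hη
  obtain ⟨u₀, hu₀⟩ := exists_disc_slice_ne_zero hη
  have hfam : ∀ {n : ℕ} (g : (Fin n → ℂ) → Fin 8 → ℂ), (∀ k, IsPolyFamily (fun v => g v k)) →
      (∃ v, disc η (g v) ≠ 0) →
      IsRationalFamily Γ ((fun v => κ (g v)) '' {v | disc η (g v) ≠ 0}) n := fun g hg h0 =>
    isRationalFamily_image (δ := fun v => disc η (g v)) (c := fun v => den (g v))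
      (H := fun φ v => num φ (g v)) ((isPoly_disc η).comp hg) h0 (hden.comp hg)
      (fun v hv => hden0 _ hv) (fun φ => (hnum φ).comp hg) fun φ v hv => hval φ _ hv
  have hext : ∀ j k, IsPolyFamily (fun v => slice (extend u₀ j v) k) := fun j k =>
    (isPoly_slice k).comp (isPoly_extend u₀ j)
  have hne : ∀ j, ∃ v, disc η (slice (extend u₀ j v)) ≠ 0 := fun j =>
    ⟨_, by rw [extend_self]; exact hu₀⟩
  set Z : ℕ → Set (segreCurves Φ η) := fun j => (fun v => κ (slice (extend u₀ j v))) ''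
    {v | disc η (slice (extend u₀ j v)) ≠ 0} with hZ
  have hZfam : ∀ j, IsRationalFamily Γ (Z j) j := fun j => hfam _ (hext j) (hne j)
  have hZ5 : ∀ u, disc η (slice u) ≠ 0 → κ (slice u) ∈ Z 5 := fun u hu => by
    have h1 : extend u₀ 5 u = u := by
      funext i
      simp [extend]
    exact ⟨u, by rw [Set.mem_ofPred_eq, h1]; exact hu, by simp only [h1]⟩
  -- Curves with e 2, e 5, e 6 nonzero lie in the slice, and a function vanishing on them vanishes
  -- on all curves.
  have huniv : vanishing Γ Set.univ = vanishing Γ (Z 5) := by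
    refine le_antisymm (vanishing_anti (Set.subset_univ _)) fun P hP => ?_
    have h1 := vanishing_image_le (Γ := Γ) (κ := κ) (δ := disc η) (δ' := fun e => e 2 * e 5 * e 6)
      (isPoly_disc η) (((IsPolyFamily.coord 2).mul (.coord 5)).mul (.coord 6))
      ⟨slice u₀, mul_ne_zero (by simp [slice]) hu₀⟩ hden hden0 hnum hval
    have h2 : P ∈ vanishing Γ (κ '' {e | e 2 * e 5 * e 6 * disc η e ≠ 0}) := by
      rw [mem_vanishing, Set.forall_mem_image]
      intro e he
      obtain ⟨u, hu, h3⟩ := hslice e (right_ne_zero_of_mul he)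
        (left_ne_zero_of_mul (left_ne_zero_of_mul (left_ne_zero_of_mul he)))
        (right_ne_zero_of_mul (left_ne_zero_of_mul (left_ne_zero_of_mul he)))
        (right_ne_zero_of_mul (left_ne_zero_of_mul he))
      rw [h3]
      exact hP _ (hZ5 u hu)
    intro C _
    obtain ⟨e, he, rfl⟩ := hsurj C
    exact h1 h2 _ ⟨e, he, rfl⟩
  have huniv' : IsRationalFamily Γ Set.univ 5 := by
    have := hZfam 5
    rw [IsRationalFamily, ← huniv] at this
    exact this
  refine ⟨le_antisymm (topologicalKrullDim_le htop huniv') ?_, ?_⟩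
  · refine le_topologicalKrullDim (n := 5) htop (Z := Z) (fun j _ => ?_) (fun j _ => hZfam j)
      fun j hj => ⟨fun i => X (l (Fin.castLE (by omega) i)), fun f hf hmem => ?_⟩
    · rintro _ ⟨v, hv, rfl⟩
      refine ⟨_, ?_, congrArg (fun u => κ (slice u)) (extend_succ u₀ j v)⟩
      rw [Set.mem_ofPred_eq, extend_succ]
      exact hv
    · set ι : Fin (j + 1) → Fin 5 := Fin.castLE (by omega) with hι
      have hιj : Injective ι := Fin.castLE_injective _
      -- The slopes are fractions with the common denominator `det`. A relation between them leaves
      -- a nonzero leading form that vanishes on the numerators where u₀ = 0, that is, on the values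
      -- of monic polynomials with j free roots.
      obtain ⟨d, hd, hd'⟩ := exists_homogeneousComponent_eq_zero hf
        (δ := fun v => disc η (slice (extend u₀ (j + 1) v)))
        (D := fun v => det η (slice (extend u₀ (j + 1) v)))
        (N := fun i v => slopeNum η (ι i) (slice (extend u₀ (j + 1) v)) * a * (wt η (ι i))⁻¹)
        ((isPoly_disc η).comp (hext _)) (hne _) ((isPoly_det η).comp (hext _))
        (fun i => (((isPoly_slopeNum η (ι i)).comp (hext _)).mul (.const _)).mul (.const _))
        (fun v hv => ⟨fun i => l (ι i) (Γ (κ (slice (extend u₀ (j + 1) v)))), by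
          have h1 := hmem _ ⟨v, hv, rfl⟩
          rwa [evalAt_aeval_X] at h1, fun i => hslope (ι i) _ hv⟩)
      refine hd (eq_zero_of_forall_roots (homogeneousComponent_isHomogeneous d f) (hη.comp hιj)
        (c := fun i => (∏ k : Fin 4, if (k : ℕ) < j then 1 else η (ι i) - u₀ k.succ) * a)
        (fun i => mul_ne_zero (Finset.prod_ne_zero_iff.2 fun k _ => ?_) ha) fun r => ?_)
      · have hn := (isNodalPair_iff hη).2 hu₀
        have hl := hn.left_ne_zero (ι i)
        have hr := hn.right_ne_zero (ι i)
        rw [left_slice] at hl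
        rw [right_slice] at hr
        split_ifs
        · exact one_ne_zero
        · fin_cases k
          · exact left_ne_zero_of_mul (left_ne_zero_of_mul hl)
          · exact right_ne_zero_of_mul (left_ne_zero_of_mul hl)
          · exact left_ne_zero_of_mul (left_ne_zero_of_mul hr)
          · exact right_ne_zero_of_mul (left_ne_zero_of_mul hr)
      · have h0 : extend u₀ (j + 1) (Fin.cons 0 r) 0 = 0 := by simp [extend]
        have h1 := hd' (Fin.cons 0 r) (det_of_eq_zero (by simp [slice, h0]) (by simp [slice]))
        rw [← h1]
        congr 2
        funext i
        rw [slopeNum_slice_of_eq_zero hη _ h0]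
        have h2 := prod_extend u₀ hj r (η (ι i))
        rw [Fin.prod_univ_four] at h2
        simp only [Fin.succ_zero_eq_one, Fin.succ_one_eq_two, Fin.reduceSucc] at h2
        have hw := wt_ne_zero hη (ι i)
        field_simp
        simp only [Function.comp_apply]
        linear_combination (-1) * h2
  · have h1 := (isPrime_vanishing_iff htop).1 huniv'.isPrime
    have : PreirreducibleSpace (segreCurves Φ η) := ⟨h1.isPreirreducible⟩
    exact { toNonempty := h1.nonempty.to_type }

end CurveParam

/-! ### Normal form of a smooth quadric through six points of a plane -/

/-- The polarization of a quadratic form. -/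
lemma exists_bilinForm {q : CoordRing} (hq : q.IsHomogeneous 2) :
    ∃ B : LinearMap.BilinForm ℂ (Fin 4 → ℂ), (∀ v w, B v w = B w v) ∧
      (∀ v, B v v = 2 * eval v q) ∧ ∀ v i, B v (Pi.single i 1) = eval v (pderiv i q) := by
  set A : Matrix (Fin 4) (Fin 4) ℂ := fun i j => eval 0 (pderiv j (pderiv i q)) with hA
  have hsymm : ∀ i j, A i j = A j i := by
    intro i j
    have : ⁅pderiv i, pderiv j⁆ = (0 : Derivation ℂ CoordRing CoordRing) :=
      MvPolynomial.derivation_ext fun k => by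
        rw [Derivation.commutator_apply, pderiv_X, pderiv_X]
        simp [Pi.single_apply, apply_ite (pderiv i), apply_ite (pderiv j)]
    have h := DFunLike.congr_fun this q
    rw [Derivation.commutator_apply, Derivation.zero_apply, sub_eq_zero] at h
    simp only [hA, h]
  have h1 : ∀ v i, eval v (pderiv i q) = ∑ j, v j * A i j := by
    intro v i
    have h2 : (pderiv i q).IsHomogeneous 1 := hq.pderiv
    have h3 := congrArg (eval v) h2.sum_X_mul_pderiv
    simp only [map_sum, map_mul, eval_X, one_smul] at h3
    rw [← h3]
    refine sum_congr rfl fun j _ => ?_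
    have h4 : (pderiv j (pderiv i q)).totalDegree = 0 :=
      (h2.pderiv (i := j)).totalDegree_le.antisymm (Nat.zero_le _)
    rw [hA, totalDegree_eq_zero_iff_eq_C.1 h4]
    simp [constantCoeff_eq]
  have h5 : ∀ v w, Matrix.toBilin' A v w = ∑ i, w i * eval v (pderiv i q) := by
    intro v w
    rw [Matrix.toBilin'_apply, Finset.sum_comm]
    refine sum_congr rfl fun i _ => ?_
    rw [h1, mul_sum]
    exact sum_congr rfl fun j _ => by rw [hsymm j i]; ring
  refine ⟨Matrix.toBilin' A, fun v w => ?_, fun v => ?_, fun v i => ?_⟩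
  · rw [Matrix.toBilin'_apply, Matrix.toBilin'_apply, Finset.sum_comm]
    exact sum_congr rfl fun i _ => sum_congr rfl fun j _ => by rw [hsymm j i]; ring
  · have := congrArg (eval v) hq.sum_X_mul_pderiv
    simp only [map_sum, map_mul, eval_X, nsmul_eq_mul, map_natCast] at this
    rw [h5, this, Nat.cast_ofNat]
  · rw [h5]
    simp [Pi.single_apply]

/-- A nonzero vector of the radical is a point of the quadric at which all partial derivatives
vanish. -/
lemma IsSmoothQuadric.nondegenerate {q : CoordRing} (hq : IsSmoothQuadric q)
    {B : LinearMap.BilinForm ℂ (Fin 4 → ℂ)} (hB : ∀ v w, B v w = B w v)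
    (hBq : ∀ v, B v v = 2 * eval v q)
    (hBd : ∀ v i, B v (Pi.single i 1) = eval v (pderiv i q)) : B.Nondegenerate := by
  have h8 : ∀ v, (∀ w, B v w = 0) → v = 0 := by
    intro v hv
    by_contra hne
    obtain ⟨a, ha⟩ := Projectivization.exists_smul_eq_mk_rep ℂ v hne
    have hz : eval v q = 0 := by simpa [hBq] using hv v
    obtain ⟨i, hi⟩ := hq.smooth (Projectivization.mk ℂ v hne) (by
      rw [VanishesAt, ← ha, Units.smul_def, eval_smul_of_isHomogeneous hq.isHomogeneous, hz, mul_zero])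
    refine hi ?_
    rw [VanishesAt, ← ha, Units.smul_def, eval_smul_of_isHomogeneous hq.isHomogeneous.pderiv,
      ← hBd, hv, mul_zero]
  exact ⟨h8, fun v hv => h8 v fun w => (hB v w).trans (hv w)⟩

/-- The determinant of three vectors. -/
def det3 (u v w : Fin 3 → ℂ) : ℂ := Matrix.det (Matrix.of ![u, v, w])

lemma det3_eq (u v w : Fin 3 → ℂ) : det3 u v w = u 0 * v 1 * w 2 - u 0 * v 2 * w 1 -
    u 1 * v 0 * w 2 + u 1 * v 2 * w 0 + u 2 * v 0 * w 1 - u 2 * v 1 * w 0 := by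
  rw [det3, Matrix.det_fin_three]
  rfl

lemma det3_smul (u v w z : Fin 3 → ℂ) :
    det3 u v w • z = det3 z v w • u + det3 u z w • v + det3 u v z • w := by
  ext i
  fin_cases i <;> simp [det3_eq] <;> ring

lemma det3_eq_zero_of_smul {u v w : Fin 3 → ℂ} {a b : ℂ} (ha : a ≠ 0) (h : a • u = b • v) :
    det3 u v w = 0 := by
  rw [← inv_smul_smul₀ ha u, h]
  simp only [det3_eq, Pi.smul_apply, smul_eq_mul]
  ring

/-- No three of the vectors are dependent. -/
def IsGeneral (u : Fin 6 → Fin 3 → ℂ) : Prop :=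
  ∀ i j k, i ≠ j → i ≠ k → j ≠ k → det3 (u i) (u j) (u k) ≠ 0

section

variable {u : Fin 6 → Fin 3 → ℂ} (hu : IsGeneral u) {B : LinearMap.BilinForm ℂ (Fin 3 → ℂ)}
  (hB : ∀ v w, B v w = B w v) (h0 : ∀ i, B (u i) (u i) = 0)
include hu hB h0

/-- Orthogonality of uᵢ and uⱼ puts their line into the conic, and the other points would have to
lie on a residual line. In terms of the form, two further points give two linear equations for its
values at (uᵢ, uₖ) and (uⱼ, uₖ), with nonzero determinant. -/
lemma IsGeneral.bilin_eq_zero {i j k l m : Fin 6} (hij : i ≠ j) (hik : i ≠ k) (hil : i ≠ l)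
    (him : i ≠ m) (hjk : j ≠ k) (hjl : j ≠ l) (hjm : j ≠ m) (hkl : k ≠ l) (hkm : k ≠ m)
    (hlm : l ≠ m) (h : B (u i) (u j) = 0) : B (u i) (u k) = 0 := by
  have key : ∀ l, i ≠ l → j ≠ l → det3 (u l) (u j) (u k) * B (u i) (u k) +
      det3 (u i) (u l) (u k) * B (u j) (u k) = 0 := by
    intro l hil hjl
    have h1 := det3_smul (u i) (u j) (u k) (u l)
    have h2 : B (det3 (u i) (u j) (u k) • u l) (det3 (u i) (u j) (u k) • u l) = 0 := by simp [h0]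
    rw [h1] at h2
    simp only [map_add, map_smul, LinearMap.add_apply, LinearMap.smul_apply, smul_eq_mul, h0, h,
      hB (u j) (u i), hB (u k) (u i), hB (u k) (u j)] at h2
    have h3 := hu i j l hij hil hjl
    refine (mul_eq_zero.1 ?_).resolve_left (mul_ne_zero two_ne_zero h3)
    linear_combination h2
  have h1 := key l hil hjl
  have h2 := key m him hjm
  have h3 := mul_ne_zero (hu i j k hij hik hjk) (hu l m k hlm hkl.symm hkm.symm)
  refine (mul_eq_zero.1 ?_).resolve_left h3
  have h4 : det3 (u i) (u j) (u k) * det3 (u l) (u m) (u k) =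
      det3 (u l) (u j) (u k) * det3 (u i) (u m) (u k) -
      det3 (u m) (u j) (u k) * det3 (u i) (u l) (u k) := by
    simp only [det3_eq]
    ring
  rw [h4]
  linear_combination det3 (u i) (u m) (u k) * h1 - det3 (u i) (u l) (u k) * h2

lemma IsGeneral.eq_zero_of_bilin_eq_zero (h : B (u 0) (u 1) = 0 ∨ B (u 0) (u 2) = 0 ∨
    B (u 1) (u 2) = 0) : ∀ v w, B v w = 0 := by
  have H := fun i j k l m => hu.bilin_eq_zero hB h0 (i := i) (j := j) (k := k) (l := l) (m := m)
  have h3 : B (u 0) (u 1) = 0 ∧ B (u 0) (u 2) = 0 ∧ B (u 1) (u 2) = 0 := by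
    have a1 : B (u 0) (u 1) = 0 → B (u 0) (u 2) = 0 := by apply H 0 1 2 3 4 <;> decide
    have a2 : B (u 0) (u 2) = 0 → B (u 1) (u 2) = 0 := by
      rw [hB, hB (u 1)]
      apply H 2 0 1 3 4 <;> decide
    have a3 : B (u 1) (u 2) = 0 → B (u 0) (u 1) = 0 := by
      rw [hB (u 0)]
      apply H 1 2 0 3 4 <;> decide
    tauto
  have hd := hu 0 1 2 (by decide) (by decide) (by decide)
  intro v w
  have h4 : B (det3 (u 0) (u 1) (u 2) • v) (det3 (u 0) (u 1) (u 2) • w) = 0 := by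
    rw [det3_smul, det3_smul _ _ _ w]
    simp [h0, h3, hB (u 1) (u 0), hB (u 2) (u 0), hB (u 2) (u 1)]
  simpa [hd] using h4

end

/-- A smooth quadric through six general points of a plane, in suitable coordinates. -/
lemma IsGeneral.exists_coordinates {u : Fin 6 → Fin 3 → ℂ} (hu : IsGeneral u)
    {ι : (Fin 3 → ℂ) →ₗ[ℂ] Fin 4 → ℂ} (hι : Injective ι) {q : CoordRing}
    (hq : IsSmoothQuadric q) (h0 : ∀ i, eval (ι (u i)) q = 0) :
    ∃ (N : Matrix (Fin 4) (Fin 4) ℂ) (η : Fin 5 → ℂ) (κ : ℂ), IsUnit N.det ∧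
      Injective η ∧ κ ≠ 0 ∧ (∀ v, eval (N.mulVec v) q = κ * eval v segre) ∧
      (∃ a : ℂ, a ≠ 0 ∧ ι (u 0) = a • N.mulVec ![0, 0, 0, 1]) ∧
      ∀ i, ∃ a : ℂ, a ≠ 0 ∧ ι (u i.succ) = a • N.mulVec (segrePoint (η i) (η i)) := by
  obtain ⟨B, hB, hBq, hBd⟩ := exists_bilinForm hq.isHomogeneous
  have hnd := hq.nondegenerate hB hBq hBd
  set B' : LinearMap.BilinForm ℂ (Fin 3 → ℂ) := B.compl₁₂ ι ι with hB'
  have hB's : ∀ v w, B' v w = B' w v := fun v w => hB _ _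
  have h0' : ∀ i, B' (u i) (u i) = 0 := fun i => by
    change B (ι (u i)) (ι (u i)) = 0
    rw [hBq, h0, mul_zero]
  have hrank : finrank ℂ (range ι) = 3 := by
    rw [LinearMap.finrank_range_of_inj hι, Module.finrank_fin_fun]
  have horth : finrank ℂ (B.orthogonal (range ι)) = 1 := by
    rw [LinearMap.BilinForm.finrank_orthogonal hnd, hrank, Module.finrank_fin_fun]
  have hB0 : ¬ ∀ v w, B' v w = 0 := by
    intro h
    have : range ι ≤ B.orthogonal (range ι) := by
      rintro _ ⟨v, rfl⟩ _ ⟨w, rfl⟩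
      exact h w v
    have := Submodule.finrank_mono this
    omega
  have hne : B' (u 0) (u 1) ≠ 0 ∧ B' (u 0) (u 2) ≠ 0 ∧ B' (u 1) (u 2) ≠ 0 := by
    have := fun h => hB0 (hu.eq_zero_of_bilin_eq_zero hB's h0' h)
    tauto
  obtain ⟨hp, hr, hs⟩ := hne
  set p := B' (u 0) (u 1) with hp'
  set r := B' (u 0) (u 2) with hr'
  set s := B' (u 1) (u 2) with hs'
  have hd := hu 0 1 2 (by decide) (by decide) (by decide)
  obtain ⟨n, hn, hn0⟩ := Submodule.exists_mem_ne_zero_of_ne_bot (p := B.orthogonal (range ι))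
    (fun h => by rw [h, finrank_bot] at horth; omega)
  have hnι : ∀ v, B (ι v) n = 0 := fun v => hn _ ⟨v, rfl⟩
  -- An isotropic normal vector would lie in the plane and in the radical of B'. But the values of
  -- B' on u₀, u₁, u₂ form an invertible matrix, as p, r, s are nonzero.
  have hnn : B n n ≠ 0 := by
    intro h
    have h1 : range ι = LinearMap.ker (B n) := by
      refine Submodule.eq_of_le_of_finrank_le ?_ ?_
      · rintro _ ⟨v, rfl⟩
        rw [LinearMap.mem_ker, hB, hnι]
      · have h2 := (B n).finrank_range_add_finrank_ker
        have h3 : range (B n) ≠ ⊥ := fun h => hn0 (hnd.1 n fun w => by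
          rw [LinearMap.range_eq_bot.1 h, LinearMap.zero_apply])
        have h4 := Submodule.one_le_finrank_iff.2 h3
        rw [Module.finrank_fin_fun] at h2
        omega
    have h2 : n ∈ range ι := by rw [h1]; exact h
    obtain ⟨v, rfl⟩ := h2
    have h3 : ∀ w, B' v w = 0 := fun w => (hB _ _).trans (hnι w)
    have h4 := det3_smul (u 0) (u 1) (u 2) v
    have h5 : ∀ w, B' (det3 (u 0) (u 1) (u 2) • v) w = 0 := fun w => by simp [h3]
    rw [h4] at h5
    have e0 := h5 (u 0)
    have e1 := h5 (u 1)
    have e2 := h5 (u 2)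
    simp only [map_add, map_smul, LinearMap.add_apply, LinearMap.smul_apply, smul_eq_mul, h0',
      hB's (u 1) (u 0), hB's (u 2) (u 0), hB's (u 2) (u 1), ← hp', ← hr', ← hs'] at e0 e1 e2
    set a := det3 v (u 1) (u 2)
    set b := det3 (u 0) v (u 2)
    set c := det3 (u 0) (u 1) v
    have hc : c = 0 := by
      refine (mul_eq_zero.1 ?_).resolve_left (mul_ne_zero two_ne_zero (mul_ne_zero hr hs))
      linear_combination s * e0 + r * e1 - p * e2
    have hb : b = 0 := by simpa [hc, hp] using e0
    have ha : a = 0 := by simpa [hc, hp] using e1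
    rw [ha, hb, hc] at h4
    simp only [zero_smul, add_zero] at h4
    exact hn0 (by rw [(smul_eq_zero.1 h4).resolve_left hd, map_zero])
  obtain ⟨μ, hμ⟩ := IsAlgClosed.exists_pow_nat_eq (1 / (r * s)) (n := 2) two_pos
  obtain ⟨ν, hν⟩ := IsAlgClosed.exists_pow_nat_eq (2 * p / B n n) (n := 2) two_pos
  have hμ0 : μ ≠ 0 := by
    rintro rfl
    rw [zero_pow two_ne_zero] at hμ
    exact one_div_ne_zero (mul_ne_zero hr hs) hμ.symm
  -- The vector is orthogonal to u₀ and u₁; μ and ν are chosen so that m₀ and νn have squares -2p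
  -- and 2p. In the basis u₁, (m₀ + νn)/2, (m₀ - νn)/2, u₀ the quadric is p(X₀X₃ - X₁X₂) and the
  -- plane is X₁ = X₂.
  set m₀ : Fin 3 → ℂ := μ • (p • u 2 - s • u 0 - r • u 1) with hm₀
  clear_value m₀
  have b0m : B' (u 0) m₀ = 0 := by
    simp only [hm₀, map_sub, map_smul, smul_eq_mul, h0', ← hp', ← hr']; ring
  have b1m : B' (u 1) m₀ = 0 := by
    simp only [hm₀, map_sub, map_smul, smul_eq_mul, h0', hB's (u 1) (u 0), ← hp', ← hs']; ring
  have bmm : B' m₀ m₀ = -2 * p := by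
    have h1 : B' m₀ m₀ = -2 * p * (r * s * μ ^ 2) := by
      simp only [hm₀, map_sub, map_smul, LinearMap.sub_apply, LinearMap.smul_apply, smul_eq_mul,
        h0', hB's (u 1) (u 0), hB's (u 2) (u 0), hB's (u 2) (u 1), ← hp', ← hr', ← hs']
      ring
    rw [h1, hμ]
    field_simp
  have bnn : B (ν • n) (ν • n) = 2 * p := by
    simp only [map_smul, LinearMap.smul_apply, smul_eq_mul]
    rw [← mul_assoc, ← sq, hν]
    field_simp
  set N : Matrix (Fin 4) (Fin 4) ℂ := Matrix.of fun i =>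
    ![ι (u 1) i, (ι m₀ i + ν * n i) / 2, (ι m₀ i - ν * n i) / 2, ι (u 0) i] with hN
  have hNv : ∀ v, N.mulVec v = ι (v 0 • u 1 + v 3 • u 0 + ((v 1 + v 2) / 2) • m₀) +
      ((v 1 - v 2) / 2) • (ν • n) := by
    intro v
    ext i
    simp only [hN, Matrix.mulVec, dotProduct, Fin.sum_univ_four, Matrix.of_apply, map_add, map_smul,
      Pi.add_apply, Pi.smul_apply, smul_eq_mul, Matrix.cons_val]
    ring
  have hBN : ∀ v w, B (N.mulVec v) (N.mulVec w) =
      p * (v 0 * w 3 + v 3 * w 0 - v 1 * w 2 - v 2 * w 1) := by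
    intro v w
    rw [hNv, hNv]
    have b' : ∀ x y, B (ι x) (ι y) = B' x y := fun _ _ => rfl
    have e1 : ∀ x, B (ι x) (ν • n) = 0 := fun x => by rw [map_smul, hnι, smul_zero]
    have e2 : ∀ x, B (ν • n) (ι x) = 0 := fun x => (hB _ _).trans (e1 x)
    generalize ν • n = n' at bnn e1 e2 ⊢
    rw [map_add, map_add, LinearMap.add_apply, LinearMap.add_apply, map_smul (B _), map_smul (B _), e1,
      map_smul B, LinearMap.smul_apply, LinearMap.smul_apply, e2, bnn, b']
    simp only [map_add, map_smul, LinearMap.add_apply, LinearMap.smul_apply, smul_eq_mul, h0', b0m,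
      b1m, bmm, hB's m₀ (u 0), hB's m₀ (u 1), hB's (u 1) (u 0), ← hp']
    ring
  have hNinj : ∀ v, N.mulVec v = 0 → v = 0 := by
    intro v hv
    have key := fun w => hBN v w
    simp only [hv, map_zero, LinearMap.zero_apply, zero_eq_mul, hp, false_or] at key
    ext i
    fin_cases i
    · simpa using key (Pi.single 3 1)
    · simpa using key (Pi.single 2 1)
    · simpa using key (Pi.single 1 1)
    · simpa using key (Pi.single 0 1)
  have hpt : ∀ i : Fin 5, ∃ a η : ℂ, a ≠ 0 ∧ ι (u i.succ) = a • N.mulVec (segrePoint η η) := by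
    intro i
    have h1 : ∃ x z w : ℂ, u i.succ = x • u 1 + z • u 0 + w • m₀ := by
      have h2 := det3_smul (u 0) (u 1) (u 2) (u i.succ)
      set a := det3 (u i.succ) (u 1) (u 2)
      set b := det3 (u 0) (u i.succ) (u 2)
      set c := det3 (u 0) (u 1) (u i.succ)
      set d := det3 (u 0) (u 1) (u 2)
      refine ⟨d⁻¹ * (b + c * r / p), d⁻¹ * (a + c * s / p), d⁻¹ * (c / (p * μ)), ?_⟩
      rw [← inv_smul_smul₀ hd (u i.succ), h2, hm₀]
      ext k
      simp only [Pi.add_apply, Pi.smul_apply, Pi.sub_apply, smul_eq_mul]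
      field_simp
      ring
    obtain ⟨x, z, w, h1⟩ := h1
    have h2 : x * z = w ^ 2 := by
      have h3 := h0' i.succ
      rw [h1] at h3
      simp only [map_add, map_smul, LinearMap.add_apply, LinearMap.smul_apply, smul_eq_mul, h0', b0m,
        b1m, bmm, hB's m₀ (u 0), hB's m₀ (u 1), hB's (u 1) (u 0), ← hp'] at h3
      refine mul_left_cancel₀ (mul_ne_zero two_ne_zero hp) ?_
      linear_combination h3
    have hx : x ≠ 0 := by
      rintro rfl
      obtain rfl : w = 0 := by simpa using h2.symm
      obtain ⟨k, hk⟩ : ∃ k : Fin 6, k ≠ 0 ∧ k ≠ i.succ :=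
        (by decide : ∀ i : Fin 5, ∃ k : Fin 6, k ≠ 0 ∧ k ≠ i.succ) i
      refine hu 0 i.succ k (Fin.succ_ne_zero i).symm hk.1.symm hk.2.symm ?_
      rw [h1]
      simp [det3_eq]
      ring
    refine ⟨x, w / x, hx, ?_⟩
    rw [hNv, h1]
    have hz : z = x * (w / x * (w / x)) := by field_simp; linear_combination h2
    have hw : w = x * (w / x) := by field_simp
    simp only [segrePoint, Matrix.cons_val, sub_self, zero_div, zero_smul, add_zero, one_smul,
      add_self_div_two]
    rw [← map_smul, smul_add, smul_add, smul_smul, smul_smul, ← hz, ← hw]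
  choose a η ha hη using hpt
  refine ⟨N, η, p, ?_, ?_, hp, ?_, ⟨1, one_ne_zero, ?_⟩, fun i => ⟨a i, ha i, hη i⟩⟩
  · refine isUnit_iff_ne_zero.2 fun h => ?_
    obtain ⟨v, hv, hv'⟩ := Matrix.exists_mulVec_eq_zero_iff.2 h
    exact hv (hNinj v hv')
  · intro i j hij
    by_contra hne
    obtain ⟨k, hk⟩ : ∃ k : Fin 6, k ≠ i.succ ∧ k ≠ j.succ :=
      (by decide : ∀ i j : Fin 5, ∃ k : Fin 6, k ≠ i.succ ∧ k ≠ j.succ) i j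
    have h1 : a j • u i.succ = a i • u j.succ := by
      apply hι
      rw [map_smul, map_smul, hη, hη, hij, smul_comm]
    refine hu i.succ j.succ k (fun h => hne (Fin.succ_injective _ h)) hk.1.symm hk.2.symm ?_
    exact det3_eq_zero_of_smul (ha j) h1
  · intro v
    have h1 := hBq (N.mulVec v)
    rw [hBN] at h1
    refine mul_left_cancel₀ (two_ne_zero (α := ℂ)) ?_
    rw [← h1]
    simp [segre]
    ring
  · rw [hNv]
    simp

/-! ### Deformation of six points of a conic to a general position -/

lemma exists_det3_ne_zero {u v : Fin 3 → ℂ} (hu : u ≠ 0) (h : ∀ a : ℂ, v ≠ a • u) :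
    ∃ w, det3 u v w ≠ 0 := by
  by_contra! h0
  have e0 := h0 ![1, 0, 0]
  have e1 := h0 ![0, 1, 0]
  have e2 := h0 ![0, 0, 1]
  simp [det3_eq] at e0 e1 e2
  obtain ⟨k, hk⟩ := Function.ne_iff.1 hu
  refine h (v k / u k) ?_
  have hk' : u k ≠ 0 := hk
  ext i
  rw [Pi.smul_apply, smul_eq_mul, div_mul_eq_mul_div, eq_div_iff hk']
  fin_cases i <;> fin_cases k <;> simp <;> grind

/-- A conic with three collinear points is a pair of lines. -/
lemma exists_basis_of_det3_eq_zero {B : LinearMap.BilinForm ℂ (Fin 3 → ℂ)}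
    (hB : ∀ v w, B v w = B w v) {u v w : Fin 3 → ℂ} (hu : B u u = 0) (hv : B v v = 0)
    (hw : B w w = 0) (huv : ∃ z, det3 u v z ≠ 0) (hwu : ∃ z, det3 w u z ≠ 0)
    (hwv : ∃ z, det3 w v z ≠ 0) (h : det3 u v w = 0) (hne : ∃ z, B z z ≠ 0) :
    ∃ e₀ e₁ e₂, det3 e₀ e₁ e₂ ≠ 0 ∧ ∀ x y z : ℂ,
      B (x • e₀ + y • e₁ + z • e₂) (x • e₀ + y • e₁ + z • e₂) = 0 → x * y = 0 := by
  obtain ⟨z₀, hz₀⟩ := huv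
  obtain ⟨t, ht⟩ := hne
  -- The third point is a combination of u and v with both coefficients nonzero, so its isotropy
  -- makes u and v orthogonal.
  have huv : B u v = 0 := by
    have h1 := det3_smul u v z₀ w
    rw [h, zero_smul, add_zero] at h1
    have h2 : B (det3 u v z₀ • w) (det3 u v z₀ • w) = 0 := by simp [hw]
    have ha : det3 w v z₀ ≠ 0 := fun ha => by
      obtain ⟨z, hz⟩ := hwv
      rw [ha, zero_smul, zero_add] at h1
      exact hz (det3_eq_zero_of_smul hz₀ h1)
    have hb : det3 u w z₀ ≠ 0 := fun hb => by
      obtain ⟨z, hz⟩ := hwu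
      rw [hb, zero_smul, add_zero] at h1
      exact hz (det3_eq_zero_of_smul hz₀ h1)
    rw [h1] at h2
    simp only [map_add, map_smul, LinearMap.add_apply, LinearMap.smul_apply, smul_eq_mul, hu, hv,
      hB v u] at h2
    refine (mul_eq_zero.1 ?_).resolve_left (mul_ne_zero two_ne_zero (mul_ne_zero ha hb))
    linear_combination h2
  have hd : det3 u v t ≠ 0 := by
    intro hd
    have h1 := det3_smul u v z₀ t
    rw [hd, zero_smul, add_zero] at h1
    have h2 : B (det3 u v z₀ • t) (det3 u v z₀ • t) = 0 := by
      rw [h1]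
      simp [hu, hv, huv, hB v u]
    simp [hz₀, ht] at h2
  -- Subtracting multiples of u from t and v leaves the form 2 B(u, t) x y. If t is orthogonal to
  -- both u and v, the conic is a double line.
  have key : ∀ u v : Fin 3 → ℂ, B u u = 0 → B v v = 0 → B u v = 0 → det3 u v t ≠ 0 → B u t ≠ 0 →
      ∃ e₀ e₁ e₂, det3 e₀ e₁ e₂ ≠ 0 ∧ ∀ x y z : ℂ,
      B (x • e₀ + y • e₁ + z • e₂) (x • e₀ + y • e₁ + z • e₂) = 0 → x * y = 0 := by
    intro u v hu hv huv hd h1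
    obtain ⟨k, hk⟩ : ∃ k, 2 * k * B u t = B t t := ⟨B t t / (2 * B u t), by field_simp⟩
    obtain ⟨l, hl⟩ : ∃ l, l * B u t = B v t := ⟨B v t / B u t, by field_simp⟩
    refine ⟨t - k • u, u, v - l • u, ?_, fun x y z h => ?_⟩
    · convert hd using 1
      simp only [det3_eq, Pi.sub_apply, Pi.smul_apply, smul_eq_mul]
      ring
    · simp only [map_add, map_sub, map_smul, LinearMap.add_apply, LinearMap.sub_apply,
        LinearMap.smul_apply, smul_eq_mul, hu, hv, huv, hB v u, hB t u, hB t v] at h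
      refine (mul_eq_zero.1 ?_).resolve_left (mul_ne_zero two_ne_zero h1)
      linear_combination h + x ^ 2 * hk + 2 * x * z * hl
  by_cases h1 : B u t = 0
  · by_cases h2 : B v t = 0
    · refine ⟨t, u, v, ?_, fun x y z h => ?_⟩
      · convert hd using 1
        simp only [det3_eq]
        ring
      · simp [hu, hv, huv, hB v u, hB t u, hB t v, h1, h2, ht] at h
        rw [h, zero_mul]
    · refine key v u hv hu (by rw [hB, huv]) (fun h => hd ?_) h2
      rw [det3_eq] at h ⊢
      linear_combination -h
  · exact key u v hu hv huv hd h1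

/-- Coordinates in which a reducible conic is contained in the union of two lines. -/
lemma exists_linearEquiv_of_basis {B : LinearMap.BilinForm ℂ (Fin 3 → ℂ)} {e₀ e₁ e₂ : Fin 3 → ℂ}
    (he : det3 e₀ e₁ e₂ ≠ 0) (h : ∀ x y z : ℂ,
      B (x • e₀ + y • e₁ + z • e₂) (x • e₀ + y • e₁ + z • e₂) = 0 → x * y = 0) :
    ∃ (T : (Fin 3 → ℂ) ≃ₗ[ℂ] Fin 3 → ℂ) (δ : ℂ), δ ≠ 0 ∧
      (∀ x y z, det3 (T x) (T y) (T z) = δ * det3 x y z) ∧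
      ∀ v, B v v = 0 → T.symm v 0 * T.symm v 1 = 0 := by
  set T : (Fin 3 → ℂ) →ₗ[ℂ] Fin 3 → ℂ := (proj 0).smulRight e₀ +
    (proj 1).smulRight e₁ + (proj 2).smulRight e₂ with hT
  have hTx : ∀ x, T x = x 0 • e₀ + x 1 • e₁ + x 2 • e₂ := fun x => rfl
  have hinj : Injective T := by
    refine (injective_iff_map_eq_zero T).2 fun x hx => ?_
    have h0 : ∀ k, x 0 * e₀ k + x 1 * e₁ k + x 2 * e₂ k = 0 := fun k => congrFun (hTx x ▸ hx) k
    have c0 := h0 0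
    have c1 := h0 1
    have c2 := h0 2
    rw [det3_eq] at he
    ext k
    refine (mul_eq_zero.1 ?_).resolve_left he
    fin_cases k
    · simp only [Fin.zero_eta]
      linear_combination (e₁ 1 * e₂ 2 - e₁ 2 * e₂ 1) * c0 - (e₁ 0 * e₂ 2 - e₁ 2 * e₂ 0) * c1 +
        (e₁ 0 * e₂ 1 - e₁ 1 * e₂ 0) * c2
    · simp only [Fin.mk_one]
      linear_combination -(e₀ 1 * e₂ 2 - e₀ 2 * e₂ 1) * c0 + (e₀ 0 * e₂ 2 - e₀ 2 * e₂ 0) * c1 -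
        (e₀ 0 * e₂ 1 - e₀ 1 * e₂ 0) * c2
    · simp only [Fin.reduceFinMk]
      linear_combination (e₀ 1 * e₁ 2 - e₀ 2 * e₁ 1) * c0 - (e₀ 0 * e₁ 2 - e₀ 2 * e₁ 0) * c1 +
        (e₀ 0 * e₁ 1 - e₀ 1 * e₁ 0) * c2
  refine ⟨LinearEquiv.ofInjectiveEndo T hinj, det3 e₀ e₁ e₂, he, fun x y z => ?_, fun v hv => ?_⟩
  · simp only [LinearEquiv.coe_ofInjectiveEndo, hTx, det3_eq, Pi.add_apply, Pi.smul_apply, smul_eq_mul]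
    ring
  · obtain ⟨x, rfl⟩ := (LinearEquiv.ofInjectiveEndo T hinj).surjective v
    rw [LinearEquiv.symm_apply_apply]
    rw [LinearEquiv.coe_ofInjectiveEndo, hTx] at hv
    exact h _ _ _ hv

/-- No three points of a smooth conic are collinear. -/
lemma det3_ne_zero_of_conic {s : ℂ} (hs : s ≠ 0) {c : Fin 3 → Fin 3 → ℂ}
    (hc : ∀ i, c i 0 * c i 1 = s ^ 2 * c i 2 ^ 2)
    (hij : ∀ i j, i ≠ j → ∃ z, det3 (c i) (c j) z ≠ 0) : det3 (c 0) (c 1) (c 2) ≠ 0 := by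
  -- The smooth conic contains no line, so distinct points of it are not conjugate.
  have key : ∀ i j, i ≠ j → c i 0 * c j 1 + c j 0 * c i 1 - 2 * s ^ 2 * c i 2 * c j 2 ≠ 0 := by
    intro i j hne h
    obtain ⟨z, hz⟩ := hij i j hne
    have h1 := hc i
    have h2 := hc j
    have m1 : c i 0 * c j 1 - c j 0 * c i 1 = 0 := by
      refine pow_eq_zero_iff two_ne_zero |>.1 ?_
      linear_combination (c i 0 * c j 1 + c j 0 * c i 1 + 2 * s ^ 2 * c i 2 * c j 2) * h -
        4 * c j 0 * c j 1 * h1 - 4 * s ^ 2 * c i 2 ^ 2 * h2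
    have m2 : c i 0 * c j 2 - c j 0 * c i 2 = 0 := by
      refine pow_eq_zero_iff two_ne_zero |>.1 (mul_left_cancel₀ (pow_ne_zero 2 hs) ?_)
      linear_combination c i 0 * c j 0 * h - c i 0 ^ 2 * h2 - c j 0 ^ 2 * h1
    have m3 : c i 1 * c j 2 - c j 1 * c i 2 = 0 := by
      refine pow_eq_zero_iff two_ne_zero |>.1 (mul_left_cancel₀ (pow_ne_zero 2 hs) ?_)
      linear_combination c i 1 * c j 1 * h - c i 1 ^ 2 * h2 - c j 1 ^ 2 * h1
    refine hz ?_
    rw [det3_eq]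
    linear_combination z 2 * m1 - z 1 * m2 + z 0 * m3
  intro h0
  have g := hc
  -- The Gram determinant of three vectors is a multiple of the square of their determinant; for
  -- points of the conic it reduces to twice the product of the three mutual pairings.
  have h1 : 2 * s ^ 2 * det3 (c 0) (c 1) (c 2) ^ 2 =
      2 * (c 0 0 * c 1 1 + c 1 0 * c 0 1 - 2 * s ^ 2 * c 0 2 * c 1 2) *
        (c 0 0 * c 2 1 + c 2 0 * c 0 1 - 2 * s ^ 2 * c 0 2 * c 2 2) *
        (c 1 0 * c 2 1 + c 2 0 * c 1 1 - 2 * s ^ 2 * c 1 2 * c 2 2) +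
      8 * (c 0 0 * c 0 1 - s ^ 2 * c 0 2 ^ 2) * (c 1 0 * c 1 1 - s ^ 2 * c 1 2 ^ 2) *
        (c 2 0 * c 2 1 - s ^ 2 * c 2 2 ^ 2) -
      2 * (c 0 0 * c 0 1 - s ^ 2 * c 0 2 ^ 2) *
        (c 1 0 * c 2 1 + c 2 0 * c 1 1 - 2 * s ^ 2 * c 1 2 * c 2 2) ^ 2 -
      2 * (c 1 0 * c 1 1 - s ^ 2 * c 1 2 ^ 2) *
        (c 0 0 * c 2 1 + c 2 0 * c 0 1 - 2 * s ^ 2 * c 0 2 * c 2 2) ^ 2 -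
      2 * (c 2 0 * c 2 1 - s ^ 2 * c 2 2 ^ 2) *
        (c 0 0 * c 1 1 + c 1 0 * c 0 1 - 2 * s ^ 2 * c 0 2 * c 1 2) ^ 2 := by
    rw [det3_eq]
    ring
  simp only [h0, hc, sub_self] at h1
  have := mul_ne_zero (mul_ne_zero (key 0 1 (by decide)) (key 0 2 (by decide))) (key 1 2 (by decide))
  refine this ?_
  linear_combination (-1 / 2) * h1

/-- Deformation of a point of the line pair `xy = 0` to a point of the conic `xy = s²z²`. -/
lemma exists_deformation {c : Fin 3 → ℂ} (hc : c 0 * c 1 = 0) : ∃ a b : Fin 3 → ℂ, ∀ s : ℂ,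
    (c + s • a + s ^ 2 • b) 0 * (c + s • a + s ^ 2 • b) 1 =
      s ^ 2 * (c + s • a + s ^ 2 • b) 2 ^ 2 := by
  by_cases h0 : c 0 = 0
  · by_cases h1 : c 1 = 0
    · refine ⟨![c 2, c 2, 0], 0, fun s => ?_⟩
      simp only [Pi.add_apply, Pi.smul_apply, smul_eq_mul, h0, h1, Matrix.cons_val, Pi.zero_apply]
      ring
    · refine ⟨0, ![c 2 ^ 2 / c 1, 0, 0], fun s => ?_⟩
      simp [h0]
      field_simp
  · have h1 : c 1 = 0 := (mul_eq_zero.1 hc).resolve_left h0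
    refine ⟨0, ![0, c 2 ^ 2 / c 0, 0], fun s => ?_⟩
    simp [h1]
    field_simp

/-! ### The curves through six general points -/

lemma IntegralCurve.contains_iff {C : IntegralCurve} {p : P3} {a : ℂ} {w : Fin 4 → ℂ} (ha : a ≠ 0)
    (h : p.rep = a • w) : C.Contains p ↔ ∀ f ∈ C.ideal, eval w f = 0 := by
  have hw : w ≠ 0 := by
    rintro rfl
    exact p.rep_nonzero (by rw [h, smul_zero])
  have : p = Projectivization.mk ℂ w hw := by
    rw [← p.mk_rep, Projectivization.mk_eq_mk_iff']
    exact ⟨a, h.symm⟩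
  rw [this, contains_mk]

/-- The curves through six general points of a plane form a standard family. -/
lemma exists_curvesThrough_eq {y : Fin 6 → P3} {q : CoordRing} (hq : IsSmoothQuadric q)
    (hy : ∀ i, VanishesAt q (y i)) {u : Fin 6 → Fin 3 → ℂ} (hu : IsGeneral u)
    {ι : (Fin 3 → ℂ) →ₗ[ℂ] Fin 4 → ℂ} (hι : Injective ι) (hιu : ∀ i, ι (u i) = (y i).rep) :
    ∃ (Φ : CoordRing ≃ₐ[ℂ] CoordRing) (η : Fin 5 → ℂ), PreservesDegree Φ ∧ Injective η ∧
      curvesThrough y q = segreCurves Φ η := by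
  obtain ⟨N, η, κ, hN, hη, hκ, hseg, ⟨a₀, ha₀, h0⟩, h1⟩ :=
    hu.exists_coordinates hι hq fun i => by rw [hιu]; exact hy i
  choose a ha h1 using h1
  rw [hιu] at h0
  simp only [hιu] at h1
  have hMN : N⁻¹ * N = 1 := Matrix.nonsing_inv_mul N hN
  have hev : ∀ F v, eval v ((changeCoords N⁻¹ N hMN).symm F) = eval (N.mulVec v) F :=
    fun F v => eval_changeCoords_symm hMN F v
  have hqΦ : q = κ • changeCoords N⁻¹ N hMN segre := by
    have : (changeCoords N⁻¹ N hMN).symm q = κ • segre := by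
      refine MvPolynomial.funext fun v => ?_
      rw [hev, hseg, smul_eval]
    rw [← map_smul, ← this, apply_symm_apply]
  refine ⟨changeCoords N⁻¹ N hMN, η, changeCoords_preservesDegree _ _ _, hη, ?_⟩
  ext K
  simp only [curvesThrough, segreCurves, Set.mem_ofPred_eq, hev, Fin.forall_fin_succ (n := 5),
    IntegralCurve.contains_iff ha₀ h0, fun i => IntegralCurve.contains_iff (C := K) (ha i) (h1 i),
    and_assoc]
  have : q ∈ K.ideal ↔ changeCoords N⁻¹ N hMN segre ∈ K.ideal := by
    rw [hqΦ, smul_eq_C_mul]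
    exact Ideal.unit_mul_mem_iff_mem _ ((isUnit_iff_ne_zero.2 hκ).map C)
  rw [this]

lemma topologicalKrullDim_curvesThrough {y : Fin 6 → P3} {q : CoordRing}
    {Φ : CoordRing ≃ₐ[ℂ] CoordRing} {η : Fin 5 → ℂ} (hΦ : PreservesDegree Φ)
    (hη : Injective η) (h : curvesThrough y q = segreCurves Φ η) :
    topologicalKrullDim (curvesThrough y q) = 5 ∧ ∃! Z : Set (curvesThrough y q),
      Z ∈ irreducibleComponents (curvesThrough y q) ∧ topologicalKrullDim Z = 5 := by
  rw [h]
  obtain ⟨h1, h2⟩ := CurveParam.krullDim_segreCurves hΦ hη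
  refine ⟨h1, Set.univ, ⟨?_, ?_⟩, fun Z hZ => ?_⟩
  · rw [irreducibleComponents_eq_singleton]
    rfl
  · rw [← h1]
    exact (Homeomorph.Set.univ _).isHomeomorph.topologicalKrullDim_eq _
  · have := hZ.1
    rwa [irreducibleComponents_eq_singleton] at this

/-! ### General sextuples -/

lemma det3_smul_smul (a b c : ℂ) (u v w : Fin 3 → ℂ) :
    det3 (a • u) (b • v) (c • w) = a * b * c * det3 u v w := by
  simp only [det3_eq, Pi.smul_apply, smul_eq_mul]
  ring

lemma isGeneral_smul_iff {a : Fin 6 → ℂ} (ha : ∀ i, a i ≠ 0) {u : Fin 6 → Fin 3 → ℂ} :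
    IsGeneral (fun i => a i • u i) ↔ IsGeneral u := by
  simp only [IsGeneral, det3_smul_smul, mul_ne_zero_iff, ne_eq, ha, not_false_eq_true, true_and]

lemma isGeneral_mk_iff (π : (Fin 4 → ℂ) →ₗ[ℂ] Fin 3 → ℂ) {v : Fin 6 → Fin 4 → ℂ}
    (hv : ∀ i, v i ≠ 0) : IsGeneral (fun i => π (Projectivization.mk ℂ (v i) (hv i)).rep) ↔
      IsGeneral fun i => π (v i) := by
  choose a ha using fun i => Projectivization.exists_smul_eq_mk_rep ℂ (v i) (hv i)
  simp only [← ha, Units.smul_def, map_smul]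
  exact isGeneral_smul_iff fun i => (a i).ne_zero

lemma isOpen_isGeneral (π : (Fin 4 → ℂ) →ₗ[ℂ] Fin 3 → ℂ) :
    IsOpen[zariskiTuples 6] {y : Fin 6 → P3 | IsGeneral fun i => π (y i).rep} := by
  refine isOpen_coinduced.2 ((@isOpen_induced_iff _ _ (zariskiTopology _) _ _).2
    ⟨{v | IsGeneral fun i => π (v i)}, ?_, ?_⟩)
  · let l : Fin 6 → Fin 3 → Dual ℂ (Fin 6 → Fin 4 → ℂ) := fun i k =>
      proj k ∘ₗ π ∘ₗ proj i
    let D : Fin 6 → Fin 6 → Fin 6 → MvPolynomial (Dual ℂ (Fin 6 → Fin 4 → ℂ)) ℂ :=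
      fun i j k => X (l i 0) * X (l j 1) * X (l k 2) - X (l i 0) * X (l j 2) * X (l k 1) -
        X (l i 1) * X (l j 0) * X (l k 2) + X (l i 1) * X (l j 2) * X (l k 0) +
        X (l i 2) * X (l j 0) * X (l k 1) - X (l i 2) * X (l j 1) * X (l k 0)
    have hD : ∀ v i j k, evalAt v (D i j k) = det3 (π (v i)) (π (v j)) (π (v k)) := by
      intro v i j k
      simp [D, l, det3_eq, evalAt]
    convert isOpen_zariski_ne (∏ i, ∏ j, ∏ k, if i ≠ j ∧ i ≠ k ∧ j ≠ k then D i j k else 1) using 1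
    ext v
    simp only [Set.mem_ofPred_eq, map_prod, Finset.prod_ne_zero_iff, mem_univ, true_implies,
      apply_ite (evalAt v), hD, map_one, IsGeneral]
    refine forall_congr' fun i => forall_congr' fun j => forall_congr' fun k => ?_
    split_ifs with h
    · exact ⟨fun h' => h' h.1 h.2.1 h.2.2, fun h' _ _ _ => h'⟩
    · exact ⟨fun _ => one_ne_zero, fun _ h1 h2 h3 => absurd ⟨h1, h2, h3⟩ h⟩
  · ext v
    exact (isGeneral_mk_iff π v.2).symm

lemma IsPolyFamily.evalAt {n : ℕ} {V : Type} [AddCommGroup V] [Module ℂ V] {v : (Fin n → ℂ) → V}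
    (h : ∀ φ : Dual ℂ V, IsPolyFamily fun u => φ (v u))
    (P : MvPolynomial (Dual ℂ V) ℂ) : IsPolyFamily fun u => evalAt (v u) P := by
  induction P using MvPolynomial.induction_on with
  | C a => simpa using IsPolyFamily.const a
  | add p q hp hq => simpa only [map_add] using hp.add hq
  | mul_X p φ hp => simpa only [map_mul, eval_X] using hp.mul (h φ)

lemma exists_linearForm (φ : Dual ℂ (Fin 4 → ℂ)) :
    ∃ f : CoordRing, f.IsHomogeneous 1 ∧ ∀ v, eval v f = φ v := by
  refine ⟨∑ i, C (φ (Pi.single i 1)) * X i, IsHomogeneous.sum _ _ _ fun i _ => ?_, fun v => ?_⟩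
  · simpa using (isHomogeneous_C (Fin 4) _).mul (isHomogeneous_X ℂ i)
  · rw [LinearMap.pi_apply_eq_sum_univ φ v]
    simp only [map_sum, map_mul, eval_C, eval_X, smul_eq_mul]
    refine sum_congr rfl fun i _ => ?_
    rw [mul_comm]
    congr 2
    ext j
    simp [Pi.single_apply, eq_comm]

section

variable {ι : (Fin 3 → ℂ) →ₗ[ℂ] Fin 4 → ℂ} {π : (Fin 4 → ℂ) →ₗ[ℂ] Fin 3 → ℂ} (hπ : ∀ x, π (ι x) = x)
include hπ

/-- Points of the conic `xy = s²z²` in general position. -/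
lemma mk_mem_sextuplesOnConic (T : (Fin 3 → ℂ) ≃ₗ[ℂ] Fin 3 → ℂ) {s : ℂ}
    {c : Fin 6 → Fin 3 → ℂ} (hc : ∀ i, c i 0 * c i 1 = s ^ 2 * c i 2 ^ 2)
    (hv : ∀ i, ι (T (c i)) ≠ 0) (hgen : IsGeneral fun i => T (c i)) :
    (fun i => Projectivization.mk ℂ _ (hv i)) ∈ sextuplesOnConic (range ι) := by
  refine ⟨fun i j hij => ?_, fun i => ?_, ?_⟩
  · by_contra hne
    obtain ⟨k, hk⟩ := (by decide : ∀ i j : Fin 6, ∃ k : Fin 6, k ≠ i ∧ k ≠ j) i j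
    obtain ⟨a, ha⟩ := (Projectivization.mk_eq_mk_iff' ℂ _ _ _ _).1 hij
    refine hgen i j k hne hk.1.symm hk.2.symm (det3_eq_zero_of_smul one_ne_zero (b := a) ?_)
    rw [← hπ (a • _), map_smul, ha, hπ, one_smul]
  · rw [Projectivization.submodule_mk, Submodule.span_singleton_le_iff_mem]
    exact ⟨_, rfl⟩
  · choose f hf hfv using fun k : Fin 3 =>
      exists_linearForm (proj k ∘ₗ T.symm.toLinearMap ∘ₗ π)
    have hfv' : ∀ k x, eval (ι (T x)) (f k) = x k := fun k x => by simp [hfv, hπ]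
    have hg : (f 0 * f 1 - C (s ^ 2) * f 2 ^ 2).IsHomogeneous 2 := by
      refine ((hf 0).mul (hf 1)).sub ?_
      have h2 : (f 2 ^ 2).IsHomogeneous 2 := (hf 2).pow 2
      have h3 := (isHomogeneous_C (Fin 4) (s ^ 2)).mul h2
      rwa [zero_add] at h3
    have hgv : ∀ x, eval (ι (T x)) (f 0 * f 1 - C (s ^ 2) * f 2 ^ 2) = x 0 * x 1 - s ^ 2 * x 2 ^ 2 :=
      fun x => by simp only [map_sub, map_mul, map_pow, eval_C, hfv']
    generalize f 0 * f 1 - C (s ^ 2) * f 2 ^ 2 = g at hg hgv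
    refine ⟨g, hg, ⟨ι (T ![1, 1, 0]), ⟨_, rfl⟩, ?_⟩, fun i => ?_⟩
    · simp [hgv]
    · obtain ⟨a, ha⟩ := Projectivization.exists_smul_eq_mk_rep ℂ _ (hv i)
      rw [VanishesAt, ← ha, Units.smul_def, eval_smul_of_isHomogeneous hg]
      rw [hgv, hc, sub_self, mul_zero]

/-- Three collinear points put the conic into the pair of lines xy = 0. Each point moves along a
path to a point of xy = s²z², and for suitable s near the start, in the Zariski sense, the six
points are distinct points of a smooth conic. -/
lemma sextuplesOnConic_subset_closure : sextuplesOnConic (range ι) ⊆ @closure _ (zariskiTuples 6)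
      ({y : Fin 6 → P3 | IsGeneral fun i => π (y i).rep} ∩ sextuplesOnConic (range ι)) := by
  intro y hy
  by_cases hgen : IsGeneral fun i => π (y i).rep
  · exact @subset_closure _ (zariskiTuples 6) _ _ ⟨hgen, hy⟩
  obtain ⟨hinj, hle, g, hg, ⟨w, ⟨w, rfl⟩, hw⟩, hgy⟩ := hy
  set u : Fin 6 → Fin 3 → ℂ := fun i => π (y i).rep with hu
  have hιu : ∀ i, ι (u i) = (y i).rep := by
    intro i
    have h1 : (y i).rep ∈ range ι := by
      refine hle i ?_
      rw [Projectivization.submodule_eq]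
      exact Submodule.mem_span_singleton_self _
    obtain ⟨x, hx⟩ := h1
    change ι (π _) = _
    rw [← hx, hπ]
  have hu0 : ∀ i, u i ≠ 0 := fun i h => (y i).rep_nonzero (by rw [← hιu, h, map_zero])
  have hpair : ∀ i j, i ≠ j → ∃ z, det3 (u i) (u j) z ≠ 0 := by
    intro i j hij
    refine exists_det3_ne_zero (hu0 i) fun a ha => hij (hinj ?_)
    rw [← (y i).mk_rep, ← (y j).mk_rep, eq_comm, Projectivization.mk_eq_mk_iff']
    exact ⟨a, by rw [← hιu, ← hιu, ha, map_smul]⟩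
  obtain ⟨B, hB, hBg, -⟩ := exists_bilinForm hg
  have hB' : ∀ v w, B.compl₁₂ ι ι v w = B.compl₁₂ ι ι w v := fun v w => hB _ _
  have hBu : ∀ i, B.compl₁₂ ι ι (u i) (u i) = 0 := fun i => by
    rw [LinearMap.compl₁₂_apply, hBg, hιu]
    exact mul_eq_zero_of_right _ (hgy i)
  obtain ⟨T, δ, hδ, hT, hTB⟩ : ∃ (T : (Fin 3 → ℂ) ≃ₗ[ℂ] Fin 3 → ℂ) (δ : ℂ), δ ≠ 0 ∧
      (∀ x y z, det3 (T x) (T y) (T z) = δ * det3 x y z) ∧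
      ∀ v, B.compl₁₂ ι ι v v = 0 → T.symm v 0 * T.symm v 1 = 0 := by
    simp only [IsGeneral, not_forall, not_not] at hgen
    obtain ⟨i, j, k, hij, hik, hjk, h⟩ := hgen
    obtain ⟨e₀, e₁, e₂, he, h⟩ := exists_basis_of_det3_eq_zero hB' (hBu i) (hBu j) (hBu k)
      (hpair i j hij) (hpair k i hik.symm) (hpair k j hjk.symm) h ⟨w, by
        rw [LinearMap.compl₁₂_apply, hBg]
        exact mul_ne_zero two_ne_zero hw⟩
    exact exists_linearEquiv_of_basis he h
  choose a b hab using fun i => exists_deformation (hTB (u i) (hBu i))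
  set c : ℂ → Fin 6 → Fin 3 → ℂ := fun s i => T.symm (u i) + s • a i + s ^ 2 • b i with hc
  have hTc : ∀ s i, T (c s i) = u i + s • T (a i) + s ^ 2 • T (b i) := fun s i => by
    simp only [hc, map_add, map_smul, LinearEquiv.apply_symm_apply]
  refine (@mem_closure_iff _ (zariskiTuples 6) _ _).2 fun O hO hyO => ?_
  obtain ⟨O', hO', hO⟩ := (@isOpen_induced_iff _ _ (zariskiTopology _) _ _).1
    (isOpen_coinduced.1 hO)
  have hmem : ∀ v : Fin 6 → Fin 4 → ℂ, ∀ hv : ∀ i, v i ≠ 0, v ∈ O' ↔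
      (fun i => Projectivization.mk ℂ (v i) (hv i)) ∈ O := fun v hv => Set.ext_iff.1 hO ⟨v, hv⟩
  have hyO' : (fun i => (y i).rep) ∈ O' := by
    refine (hmem _ fun i => (y i).rep_nonzero).2 ?_
    simpa only [Projectivization.mk_rep] using hyO
  obtain ⟨P, hP, hPO⟩ := exists_evalAt_ne_zero hO' hyO'
  choose! z hz using hpair
  have hpath : ∀ (L : (Fin 6 → Fin 3 → ℂ) →ₗ[ℂ] ℂ),
      IsPolyFamily fun σ : Fin 1 → ℂ => L fun i => T (c (σ 0) i) := by
    intro L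
    have : ∀ s, (fun i => T (c s i)) = u + s • (fun i => T (a i)) + s ^ 2 • fun i => T (b i) :=
      fun s => funext fun i => hTc s i
    simp only [this, map_add, map_smul, smul_eq_mul]
    exact ((IsPolyFamily.const _).add ((IsPolyFamily.coord 0).mul (.const _))).add
      (((IsPolyFamily.coord 0).pow 2).mul (.const _))
  have hpathc : ∀ i k, IsPolyFamily fun σ : Fin 1 → ℂ => T (c (σ 0) i) k := fun i k =>
    hpath (proj k ∘ₗ proj i)
  have hc0 : ∀ i, T (c 0 i) = u i := fun i => by simp [hTc]
  have hF1 : IsPolyFamily fun σ : Fin 1 → ℂ => evalAt (fun i => ι (T (c (σ 0) i))) P :=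
    IsPolyFamily.evalAt (fun φ => hpath (φ ∘ₗ LinearMap.pi fun i => ι ∘ₗ proj i)) P
  have hF2 : ∀ p ∈ (univ : Finset (Fin 6 × Fin 6)), IsPolyFamily fun σ : Fin 1 → ℂ =>
      if p.1 = p.2 then 1 else det3 (T (c (σ 0) p.1)) (T (c (σ 0) p.2)) (z p.1 p.2) := by
    intro p _
    split_ifs
    · exact .const 1
    · simp only [det3_eq]
      have h1 := hpathc p.1
      have h2 := hpathc p.2
      repeat first
        | exact h1 _ | exact h2 _ | exact .const _ | apply IsPolyFamily.add
        | apply IsPolyFamily.sub | apply IsPolyFamily.mul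
  have hF2' : ∀ p ∈ (univ : Finset (Fin 6 × Fin 6)), ∃ σ : Fin 1 → ℂ,
      (if p.1 = p.2 then 1 else det3 (T (c (σ 0) p.1)) (T (c (σ 0) p.2)) (z p.1 p.2)) ≠ 0 := by
    intro p _
    refine ⟨0, ?_⟩
    split_ifs with h
    · exact one_ne_zero
    · simpa only [Pi.zero_apply, hc0] using hz _ _ h
  -- Nonvanishing of P keeps the sextuple in the open set, that of s makes the conic smooth, and the
  -- determinants with fixed z keep the points distinct. The first and the last hold at s = 0, so
  -- the product is a nonzero polynomial in s.
  obtain ⟨σ, hσ⟩ := IsPolyFamily.exists_ne_zero_of_mul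
    (hF1.mul (IsPolyFamily.coord 0)) (IsPolyFamily.prod hF2)
    (IsPolyFamily.exists_ne_zero_of_mul hF1 (IsPolyFamily.coord 0)
      ⟨0, by simpa only [Pi.zero_apply, hc0, hιu] using hP⟩ ⟨1, one_ne_zero⟩)
    (IsPolyFamily.exists_ne_zero_of_prod hF2 hF2')
  rw [mul_ne_zero_iff, mul_ne_zero_iff, Finset.prod_ne_zero_iff] at hσ
  obtain ⟨⟨hσ1, hσ0⟩, hσ2⟩ := hσ
  generalize σ 0 = s at hσ1 hσ0 hσ2
  have hpair' : ∀ i j, i ≠ j → det3 (T (c s i)) (T (c s j)) (z i j) ≠ 0 := fun i j hij => by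
    simpa [hij] using hσ2 (i, j) (mem_univ _)
  have hgen' : IsGeneral fun i => T (c s i) := by
    intro i j k hij hik hjk
    change det3 (T (c s i)) (T (c s j)) (T (c s k)) ≠ 0
    rw [hT]
    refine mul_ne_zero hδ (det3_ne_zero_of_conic hσ0 (c := fun l => c s (![i, j, k] l))
      (fun l => hab _ s) fun l m hlm => ⟨T.symm (z (![i, j, k] l) (![i, j, k] m)), fun h => ?_⟩)
    refine hpair' (![i, j, k] l) (![i, j, k] m) ?_ ?_
    · fin_cases l <;> fin_cases m <;> first
        | exact absurd rfl hlm | exact hij | exact hik | exact hjk | exact hij.symm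
        | exact hik.symm | exact hjk.symm
    · rw [← T.apply_symm_apply (z _ _), hT, h, mul_zero]
  have hv : ∀ i, ι (T (c s i)) ≠ 0 := by
    intro i hi
    obtain ⟨j, hj⟩ := (by decide : ∀ i : Fin 6, ∃ j : Fin 6, i ≠ j) i
    refine hpair' i j hj ?_
    rw [← hπ (T (c s i)), hi, map_zero]
    simp [det3_eq]
  refine ⟨_, (hmem _ hv).1 (hPO _ hσ1), ?_, mk_mem_sextuplesOnConic hπ T (fun i => hab i s) hv hgen'⟩
  exact (isGeneral_mk_iff π hv).2 (by simpa only [hπ] using hgen')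

end

end

theorem mainTheorem10 (H : Submodule ℂ (Fin 4 → ℂ)) (hH : Module.finrank ℂ H = 3) :
    ∃ U : Set (Fin 6 → P3), IsOpen[zariskiTuples 6] U ∧
      sextuplesOnConic H ⊆ @closure _ (zariskiTuples 6) (U ∩ sextuplesOnConic H) ∧
      ∀ y ∈ U ∩ sextuplesOnConic H, ∀ q : CoordRing, IsSmoothQuadric q →
        (∀ i, VanishesAt q (y i)) →
        topologicalKrullDim (curvesThrough y q) = 5 ∧
        ∃! Z : Set (curvesThrough y q),
          Z ∈ irreducibleComponents (curvesThrough y q) ∧ topologicalKrullDim Z = 5 := by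
  -- Coordinates on the plane: ι embeds ℂ³ onto H, and its left inverse π, defined on all of ℂ⁴,
  -- lets general position be stated as an open condition on arbitrary sextuples.
  set e := (Module.finBasisOfFinrankEq ℂ H hH).equivFun
  obtain ⟨π, hπ⟩ := (H.subtype ∘ₗ e.symm.toLinearMap).exists_leftInverse_of_injective
    (LinearMap.ker_eq_bot.2 (H.injective_subtype.comp e.symm.injective))
  obtain ⟨ι, hι⟩ : ∃ ι, ι = H.subtype ∘ₗ e.symm.toLinearMap := ⟨_, rfl⟩
  rw [← hι] at hπ
  have hπ' : ∀ x, π (ι x) = x := fun x => DFunLike.congr_fun hπ x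
  have hrange : LinearMap.range ι = H := by
    rw [hι, LinearMap.range_comp, LinearEquiv.range, Submodule.map_top, Submodule.range_subtype]
  refine ⟨_, isOpen_isGeneral π, hrange ▸ sextuplesOnConic_subset_closure hπ', ?_⟩
  rintro y ⟨hy, -, hyH, -⟩ q hq hqy
  obtain ⟨Φ, η, hΦ, hη, h⟩ := exists_curvesThrough_eq hq hqy hy
    (ι := ι) (Function.LeftInverse.injective hπ') fun i => by
      have h1 : (y i).rep ∈ LinearMap.range ι := by
        rw [hrange]
        refine hyH i ?_
        rw [Projectivization.submodule_eq]
        exact Submodule.mem_span_singleton_self _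
      obtain ⟨x, hx⟩ := h1
      rw [← hx, hπ']
  exact topologicalKrullDim_curvesThrough hΦ hη h
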